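/- **Setting.** Let $d\ge 2$, $T>0$, $\mathbb T^d=\mathbb R^d/\mathbb Z^d$; functions on $\mathbb T^d$ are identified with $\mathbb Z^d$-periodic functions on $\mathbb R^d$. Let $\varphi\in C_c^\infty(\mathbb R^d;\mathbb R)$ be a mollifier with $\int\varphi=1$, $\varphi\ge 0$, $\varphi(-h)=\varphi(h)$, $\varphi(h)=0$ for $|h|\ge 1$ and $\varphi(h)>0$ for $|h|\le \frac12$, and put $\varphi_r(h)=r^{-d}\varphi(h/r)$, $(f*k)(x)=\int_{\mathbb R^d}f(x-h)k(h)\,dh$ (convolution is in $x$ only). Let $u\in BV(\mathbb T^d;\mathbb R^d)$ be divergence-free, with $\|\nabla u\|_{L^1}$ denoting the total variation of the measure $\nabla u=(\partial_iu_j)_{ij}$ with respect to the Euclidean ($l^2$) norm $|\cdot|$ of matrices. Let $\rho\in L^\infty_tL^\infty_x$ be a weak solution of $\partial_t\rho+\nabla\cdot(u\rho)=0$ on $\mathbb T^d\times[0,T]$ with initial datum $\rho_0\in L^\infty$ and weak trace $\rho_T\in L^\infty$ at time $T$. Let $\phi_T\in W^{1,\infty}(\mathbb T^d)$ with $\|\phi_T\|_{W^{1,\infty}}=\|\phi_T\|_{L^\infty}+\|\nabla\phi_T\|_{L^\infty}\le1$,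 and let $\phi\in L^\infty_tL^\infty_x$ be a weak solution of the same equation with $\phi(\cdot,T)=\phi_T$, weak trace $\phi_0\in L^\infty$ at time $0$, and $\|\phi\|_{L^\infty_tL^\infty_x}\le\|\phi_T\|_{L^\infty}$. Put $\|\rho_0\|_{W^{-1,1}}=\sup\{\int_{\mathbb T^d}\rho_0\psi\,dx:\ \|\psi\|_{W^{1,\infty}}\le1\}$. **Parameters and terms.** Let $\Lambda,\delta,\delta',\epsilon,\epsilon'>0$ with $\delta\le\epsilon e^{-\Lambda}$. Let $v=u*\varphi_{\epsilon'}$ and $M=\frac{\nabla v*\varphi_{4\epsilon}}{|\nabla v*\varphi_{4\epsilon}|}$ (and $M=0$ where the denominator vanishes). For a matrix $A$ put $\varphi^{\Lambda,A}(h)=\frac1\Lambda\int_0^\Lambda\varphi(\exp(-\lambda A^{\top})h)\,d\lambda$ and $\varphi^{\Lambda,A}_\delta(h)=\delta^{-d}\varphi^{\Lambda,A}(h/\delta)$, and write $h\cdot A\cdot w=\sum_{i,j}h_iA_{ij}w_j$. Define $$I_1=\int_{\mathbb T^d}\int_{\mathbb R^d}\rho_T(x)\big(\phi_T-\phi_T*\varphi_\delta^{\Lambda,M(z)}\big)(x)\,\varphi_\epsilon(z-x)\,dz\,dx,$$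 $$I_2=\int_{\mathbb T^d}\int_{\mathbb R^d}\rho_0(x)\big(\phi_0*\varphi_\delta^{\Lambda,M(z)}\big)(x)\,\varphi_\epsilon(z-x)\,dz\,dx,$$ $$I_3'=-\int_0^T\!\!\int_{\mathbb T^d}\int_{\mathbb R^d}\rho(x,t)\big(\phi*\varphi_{\delta'}*\varphi_\delta^{\Lambda,M(z)}\big)(x,t)\;u(x)\cdot\nabla\varphi_\epsilon(z-x)\,dz\,dx\,dt,$$ $$R_1=-\int_0^T\!\!\int_{\mathbb T^d}\int_{\mathbb R^d}\rho(x,t)\big((\phi-\phi*\varphi_{\delta'})*\varphi_\delta^{\Lambda,M(z)}\big)(x,t)\;u(x)\cdot\nabla\varphi_\epsilon(z-x)\,dz\,dx\,dt,$$ $$I_4'=\int_0^T\!\!\int_{\mathbb T^d}\int_{\mathbb R^d}\int_{\mathbb R^d}\rho(x,t)\phi(x-\delta h,t)\Big(\int_0^1h\cdot\big(\nabla v(x-s\delta h)-|\nabla v(x-s\delta h)|M(z)\big)\cdot\nabla\varphi^{\Lambda,M(z)}(h)\,ds\Big)\varphi_\epsilon(z-x)\,dh\,dz\,dx\,dt,$$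 $$I_5'=\int_0^T\!\!\int_{\mathbb T^d}\int_{\mathbb R^d}\int_{\mathbb R^d}\rho(x,t)\phi(x-\delta h,t)\Big(\int_0^1|\nabla v(x-s\delta h)|\;h\cdot M(z)\cdot\nabla\varphi^{\Lambda,M(z)}(h)\,ds\Big)\varphi_\epsilon(z-x)\,dh\,dz\,dx\,dt,$$ $$R_2=\int_0^T\!\!\int_{\mathbb T^d}\int_{\mathbb R^d}\rho(x,t)\Big(\int_{\mathbb R^d}\phi(x-h,t)\big((u-v)(x)-(u-v)(x-h)\big)\cdot\nabla\varphi_\delta^{\Lambda,M(z)}(h)\,dh\Big)\varphi_\epsilon(z-x)\,dz\,dx\,dt.$$ **Proposition.** There is a constant $C>0$ depending only on $d$ and $\varphi$ such that, for all data as above, $$\int_{\mathbb T^d}\rho_T\phi_T\,dx=I_1+I_2+I_3'+I_4'+I_5'+R_1+R_2,$$ with the bounds $$|I_1|\le C\,\delta e^{(d+1)\Lambda}\|\rho\|_{L^\infty_tL^\infty_x},\qquad |I_2|\le C\Big(1+\frac{e^\Lambda}{\delta}+\frac1\epsilon\Big)\|\rho_0\|_{W^{-1,1}},$$ $$|I_3'|\le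 C\,T^{\frac{d-1}d}\frac{e^{d\Lambda}}{\epsilon}\|\rho\|_{L^\infty_tL^\infty_x}\Big(\|\nabla u\|_{L^1}+\Big|\int_{\mathbb T^d}u\,dx\Big|\Big)\Big(\|\phi*\varphi_{\delta'}\|^2_{L^2_tL^2_x}-\|\phi*\varphi_{\delta'}*\varphi_{2\delta e^\Lambda}\|^2_{L^2_tL^2_x}\Big)^{\frac1d},$$ $$|I_4'|\le C\,Te^{2\Lambda}\|\rho\|_{L^\infty_tL^\infty_x}\|\nabla u\|_{L^1}^{\frac12}\Big(\|\nabla u*\varphi_{\epsilon'}\|_{L^1}-\|\nabla u*\varphi_{\epsilon'}*\varphi_{4\epsilon}\|_{L^1}\Big)^{\frac12},$$ $$|I_5'|\le C\,\frac T\Lambda\|\rho\|_{L^\infty_tL^\infty_x}\|\nabla u\|_{L^1},$$ $$|R_1|\le C\,T\frac{\delta'e^{(d+1)\Lambda}}{\epsilon\delta}\|\rho\|_{L^\infty_tL^\infty_x}\Big(\|\nabla u\|_{L^1}+\Big|\int_{\mathbb T^d}u\,dx\Big|\Big),\qquad |R_2|\le C\,T\frac{\epsilon'e^{(d+1)\Lambda}}{\delta}\|\rho\|_{L^\infty_tL^\infty_x}\|\nabla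 u\|_{L^1}.$$ In particular, if $u$ has zero mean, the factor $\|\nabla u\|_{L^1}+|\int u|$ in the bounds on $I_3'$ and $R_1$ is just $\|\nabla u\|_{L^1}$. -/

import Mathlib

open MeasureTheory
open scoped ContDiff

noncomputable section

/-- Euclidean space `ℝ^d`. Functions on the torus `𝕋^d = ℝ^d / ℤ^d` are `ℤ^d`-periodic functions
on it, and integrals over `𝕋^d` are integrals over the unit cell. -/
abbrev Euc (d : ℕ) : Type := EuclideanSpace ℝ (Fin d)

/-- The unit cell `[0,1)^d`. -/
def cell (d : ℕ) : Set (Euc d) := {x | ∀ i, x i ∈ Set.Ico (0 : ℝ) 1}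

/-- Lebesgue measure on the torus. -/
def torusMeasure (d : ℕ) : Measure (Euc d) := volume.restrict (cell d)

/-- Lebesgue measure on `𝕋^d × [0,T]`. -/
def spaceTimeMeasure (d : ℕ) (T : ℝ) : Measure (Euc d × ℝ) :=
  (torusMeasure d).prod (volume.restrict (Set.Icc 0 T))

def IsPeriodic {d : ℕ} {F : Type*} (f : Euc d → F) : Prop :=
  ∀ (x : Euc d) (i : Fin d), f (x + EuclideanSpace.single i 1) = f x

/-- Smooth functions on the torus. -/
def IsTestFunction {d : ℕ} (ψ : Euc d → ℝ) : Prop := ContDiff ℝ ∞ ψ ∧ IsPeriodic ψ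

/-- Smooth functions of `(x, t)`, periodic in `x`. -/
def IsSpaceTimeTestFunction {d : ℕ} (ψ : Euc d → ℝ → ℝ) : Prop :=
  ContDiff ℝ ∞ (Function.uncurry ψ) ∧ ∀ t, IsPeriodic (fun x => ψ x t)

/-- `f ∈ L^∞(𝕋^d)`. -/
def IsBoundedOnTorus {d : ℕ} (f : Euc d → ℝ) : Prop :=
  IsPeriodic f ∧ MemLp f ⊤ (torusMeasure d)

/-- `f ∈ L_t^∞ L_x^∞` on `𝕋^d × [0,T]`. -/
def IsBoundedOnSpaceTime {d : ℕ} (T : ℝ) (f : Euc d → ℝ → ℝ) : Prop :=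
  (∀ t, IsPeriodic (fun x => f x t)) ∧ MemLp (Function.uncurry f) ⊤ (spaceTimeMeasure d T)

/-- The norm of `L^∞(𝕋^d)`. -/
def supNormTorus {d : ℕ} {F : Type*} [NormedAddCommGroup F] (f : Euc d → F) : ℝ :=
  (eLpNorm f ⊤ (torusMeasure d)).toReal

/-- The norm of `L_t^∞ L_x^∞` on `𝕋^d × [0,T]`. -/
def supNormSpaceTime {d : ℕ} (T : ℝ) (f : Euc d → ℝ → ℝ) : ℝ :=
  (eLpNorm (Function.uncurry f) ⊤ (spaceTimeMeasure d T)).toReal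

/-- `g` is the weak gradient of `f` on the torus. -/
def HasWeakGradient {d : ℕ} (f : Euc d → ℝ) (g : Euc d → Euc d) : Prop :=
  ∀ ψ : Euc d → ℝ, IsTestFunction ψ → ∀ i : Fin d,
    ∫ x in cell d, f x * gradient ψ x i = - ∫ x in cell d, g x i * ψ x

/-- The closed unit ball of `W^{1,∞}(𝕋^d)`, with the norm `‖f‖_{L^∞} + ‖∇f‖_{L^∞}`. -/
def unitBallW1Inf (d : ℕ) : Set (Euc d → ℝ) :=
  {f | IsBoundedOnTorus f ∧ ∃ g : Euc d → Euc d, MemLp g ⊤ (torusMeasure d) ∧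
    HasWeakGradient f g ∧ supNormTorus f + supNormTorus g ≤ 1}

/-- The norm of `W^{-1,1}`, dual to `W^{1,∞}`. -/
def negSobolevNorm {d : ℕ} (f : Euc d → ℝ) : ℝ :=
  sSup {s | ∃ ψ ∈ unitBallW1Inf d, s = ∫ x in cell d, f x * ψ x}

/-- The Euclidean (`l²`) norm of a matrix. -/
def frob {d : ℕ} (A : Matrix (Fin d) (Fin d) ℝ) : ℝ := √(∑ i, ∑ j, A i j ^ 2)

/-- The gradient matrix `(∇u)_{ij} = ∂_i u_j` of a differentiable vector field. -/
def gradMatrix {d : ℕ} (u : Euc d → Euc d) (x : Euc d) : Matrix (Fin d) (Fin d) ℝ :=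
  Matrix.of fun i j => fderiv ℝ u x (EuclideanSpace.single i 1) j

/-- The numbers `∫ u_j ∂_i Ψ_{ij}` for smooth matrix fields `Ψ` on the torus with `|Ψ| ≤ 1`. -/
def variationSet {d : ℕ} (u : Euc d → Euc d) : Set ℝ :=
  {s | ∃ Ψ : Euc d → Matrix (Fin d) (Fin d) ℝ,
    (∀ i j, IsTestFunction (fun x => Ψ x i j)) ∧ (∀ x, frob (Ψ x) ≤ 1) ∧
    s = ∫ x in cell d, ∑ i, ∑ j, u x j * gradient (fun y => Ψ y i j) x i}

/-- `u ∈ BV(𝕋^d; ℝ^d)`. -/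
def IsBV {d : ℕ} (u : Euc d → Euc d) : Prop :=
  IsPeriodic u ∧ Integrable u (torusMeasure d) ∧ BddAbove (variationSet u)

/-- `‖∇u‖_{L^1}` for `u ∈ BV`, that is, the total variation of the measure `∇u` on the torus. -/
def totalVariation {d : ℕ} (u : Euc d → Euc d) : ℝ := sSup (variationSet u)

/-- `∇ · u = 0` in the sense of distributions on the torus. -/
def IsDivFree {d : ℕ} (u : Euc d → Euc d) : Prop :=
  ∀ ψ : Euc d → ℝ, IsTestFunction ψ → ∫ x in cell d, inner ℝ (u x) (gradient ψ x) = 0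

/-- `ρ ∈ L_t^∞ L_x^∞` is a weak solution of `∂ρ/∂t + ∇ · (u ρ) = 0` on `𝕋^d × [0,T]` with weak
traces `ρ₀` at time `0` and `ρT` at time `T`. -/
def IsWeakSolution {d : ℕ} (u : Euc d → Euc d) (T : ℝ) (ρ : Euc d → ℝ → ℝ)
    (ρ₀ ρT : Euc d → ℝ) : Prop :=
  IsBoundedOnSpaceTime T ρ ∧ IsBoundedOnTorus ρ₀ ∧ IsBoundedOnTorus ρT ∧
  ∀ ψ : Euc d → ℝ → ℝ, IsSpaceTimeTestFunction ψ →
    ∫ t in (0 : ℝ)..T, ∫ x in cell d,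
        ρ x t * (deriv (fun s => ψ x s) t + inner ℝ (u x) (gradient (fun y => ψ y t) x))
      = (∫ x in cell d, ρT x * ψ x T) - ∫ x in cell d, ρ₀ x * ψ x 0

/-- The admissible mollifiers. -/
structure IsMollifier {d : ℕ} (η : Euc d → ℝ) : Prop where
  smooth : ContDiff ℝ ∞ η
  integral_eq_one : ∫ h, η h = 1
  nonneg : ∀ h, 0 ≤ η h
  even : ∀ h, η (-h) = η h
  eq_zero : ∀ h, 1 ≤ ‖h‖ → η h = 0
  pos : ∀ h, ‖h‖ ≤ 1 / 2 → 0 < η h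

/-- The rescaling `η_r(h) = r^{-d} η(h / r)`. -/
def rescale {d : ℕ} (η : Euc d → ℝ) (r : ℝ) (h : Euc d) : ℝ := (r ^ d)⁻¹ * η (r⁻¹ • h)

/-- `(f * k)(x) = ∫_{ℝ^d} k(h) f(x - h) dh`. -/
def mollify {d : ℕ} {F : Type*} [NormedAddCommGroup F] [NormedSpace ℝ F]
    (f : Euc d → F) (k : Euc d → ℝ) : Euc d → F :=
  convolution k f (ContinuousLinearMap.lsmul ℝ ℝ) volume

/-- `‖φ‖_{L_t^2 L_x^2}^2` on `𝕋^d × [0,T]`. -/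
def sqNormL2 {d : ℕ} (T : ℝ) (φ : Euc d → ℝ → ℝ) : ℝ :=
  ∫ t in (0 : ℝ)..T, ∫ x in cell d, φ x t ^ 2

/-- The spatial mollification `(φ * k)(x, t)`. -/
def mollifySpace {d : ℕ} (φ : Euc d → ℝ → ℝ) (k : Euc d → ℝ) (x : Euc d) (t : ℝ) : ℝ :=
  mollify (fun y => φ y t) k x

/-- `‖∇v‖_{L^1(𝕋^d)}` for a smooth vector field `v`. For `v = u * k` with `k` smooth and compactly
supported, `∇v = ∇u * k`. -/
def gradNormL1 {d : ℕ} (v : Euc d → Euc d) : ℝ := ∫ x in cell d, frob (gradMatrix v x)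

/-- The anisotropic mollifier `h ↦ Λ⁻¹ ∫_0^Λ η(exp(-λ Mᵀ) h) dλ`. -/
def albertiMollifier {d : ℕ} (η : Euc d → ℝ) (Λ : ℝ) (M : Matrix (Fin d) (Fin d) ℝ)
    (h : Euc d) : ℝ :=
  Λ⁻¹ * ∫ l in (0 : ℝ)..Λ, η (WithLp.toLp 2 ((NormedSpace.exp (-(l • M.transpose))).mulVec h.ofLp))

/-- `h · A · v = ∑ h_i A_{ij} v_j`. -/
def sandwich {d : ℕ} (h : Euc d) (A : Matrix (Fin d) (Fin d) ℝ) (v : Euc d) : ℝ :=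
  ∑ i, ∑ j, h i * A i j * v j

/-- The unit part of the gradient of a smooth field, `∇v / |∇v|` (zero where `∇v = 0`). -/
def unitGradient {d : ℕ} (v : Euc d → Euc d) (x : Euc d) : Matrix (Fin d) (Fin d) ℝ :=
  (frob (gradMatrix v x))⁻¹ • gradMatrix v x

/-- The commutator `∫ f(x-h) (v(x) - v(x-h)) · ∇k(h) dh`. -/
def velocityCommutator {d : ℕ} (f : Euc d → ℝ) (v : Euc d → Euc d) (k : Euc d → ℝ) (x : Euc d) : ℝ :=
  ∫ h, f (x - h) * inner ℝ (v x - v (x - h)) (gradient k h)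

/-! The terms of the decomposition, for a matrix field `M`. -/

def termI1 {d : ℕ} (η : Euc d → ℝ) (Λ δ ε : ℝ) (M : Euc d → Matrix (Fin d) (Fin d) ℝ)
    (ρT φT : Euc d → ℝ) : ℝ :=
  ∫ x in cell d, ∫ z, ρT x * (φT x - mollify φT (rescale (albertiMollifier η Λ (M z)) δ) x)
    * rescale η ε (z - x)

def termI2 {d : ℕ} (η : Euc d → ℝ) (Λ δ ε : ℝ) (M : Euc d → Matrix (Fin d) (Fin d) ℝ)
    (ρ₀ φ₀ : Euc d → ℝ) : ℝ :=
  ∫ x in cell d, ∫ z, ρ₀ x * mollify φ₀ (rescale (albertiMollifier η Λ (M z)) δ) x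
    * rescale η ε (z - x)

/-- The localisation term
`-∫∫∫ ρ(x,t) (f * η_δ^{Λ,M(z)})(x,t) u(x) · ∇η_ε(z - x) dz dx dt`. -/
def localisationTerm {d : ℕ} (η : Euc d → ℝ) (Λ δ ε T : ℝ)
    (M : Euc d → Matrix (Fin d) (Fin d) ℝ) (u : Euc d → Euc d) (ρ f : Euc d → ℝ → ℝ) : ℝ :=
  - ∫ t in (0 : ℝ)..T, ∫ x in cell d, ∫ z,
      ρ x t * mollifySpace f (rescale (albertiMollifier η Λ (M z)) δ) x t
        * inner ℝ (u x) (gradient (rescale η ε) (z - x))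

def termI3 {d : ℕ} (η : Euc d → ℝ) (Λ δ δ' ε T : ℝ) (M : Euc d → Matrix (Fin d) (Fin d) ℝ)
    (u : Euc d → Euc d) (ρ φ : Euc d → ℝ → ℝ) : ℝ :=
  localisationTerm η Λ δ ε T M u ρ (mollifySpace φ (rescale η δ'))

def termR1 {d : ℕ} (η : Euc d → ℝ) (Λ δ δ' ε T : ℝ) (M : Euc d → Matrix (Fin d) (Fin d) ℝ)
    (u : Euc d → Euc d) (ρ φ : Euc d → ℝ → ℝ) : ℝ :=
  localisationTerm η Λ δ ε T M u ρ (fun x t => φ x t - mollifySpace φ (rescale η δ') x t)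

/-- For `v = u * η_{ε'}`. -/
def termI4 {d : ℕ} (η : Euc d → ℝ) (Λ δ ε T : ℝ) (M : Euc d → Matrix (Fin d) (Fin d) ℝ)
    (v : Euc d → Euc d) (ρ φ : Euc d → ℝ → ℝ) : ℝ :=
  ∫ t in (0 : ℝ)..T, ∫ x in cell d, ∫ z, ∫ h,
    ρ x t * φ (x - δ • h) t
      * (∫ s in (0 : ℝ)..1,
          sandwich h (gradMatrix v (x - (s * δ) • h) - frob (gradMatrix v (x - (s * δ) • h)) • M z)
            (gradient (albertiMollifier η Λ (M z)) h))
      * rescale η ε (z - x)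

/-- For `v = u * η_{ε'}`. -/
def termI5 {d : ℕ} (η : Euc d → ℝ) (Λ δ ε T : ℝ) (M : Euc d → Matrix (Fin d) (Fin d) ℝ)
    (v : Euc d → Euc d) (ρ φ : Euc d → ℝ → ℝ) : ℝ :=
  ∫ t in (0 : ℝ)..T, ∫ x in cell d, ∫ z, ∫ h,
    ρ x t * φ (x - δ • h) t
      * (∫ s in (0 : ℝ)..1, frob (gradMatrix v (x - (s * δ) • h))
          * sandwich h (M z) (gradient (albertiMollifier η Λ (M z)) h))
      * rescale η ε (z - x)

/-- For `w = u - u * η_{ε'}`. -/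
def termR2 {d : ℕ} (η : Euc d → ℝ) (Λ δ ε T : ℝ) (M : Euc d → Matrix (Fin d) (Fin d) ℝ)
    (w : Euc d → Euc d) (ρ φ : Euc d → ℝ → ℝ) : ℝ :=
  ∫ t in (0 : ℝ)..T, ∫ x in cell d, ∫ z,
    ρ x t * velocityCommutator (fun y => φ y t) w (rescale (albertiMollifier η Λ (M z)) δ) x
      * rescale η ε (z - x)

end

open scoped Pointwise

noncomputable section

/-! Fix a point z and put κ = φ_δ^{Λ,M(z)}, χ = φ_ε(z - ·). Since ρ and φ are carried by the same
field, the values of ∫ ρ χ (φ*κ) dx at times T and 0 differ by the time integral of two things: ρχ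
against the commutator ∫ φ(x-h) (u(x)-u(x-h))·∇κ(h) dh, and the flux ρ (φ*κ) u·∇χ through the
cutoff. This is `IsNiceSolution.doubling`. Integrating it over z in one cell and using ∫ φ_ε = 1
yields the identity. The endpoint at T is ∫ ρ_T φ_T minus I₁ and the endpoint at 0 is I₂. The flux
is I₃' + R₁ after splitting φ into φ*φ_{δ'} and a remainder. The commutator of u - v is R₂, and that
of v is I₄' + I₅' after writing ∇v = (∇v - |∇v|M) + |∇v|M along the segment from x to x - δh.

I₅' is the term for which the anisotropic kernel is made. The operator h·M·∇ is, up to sign, the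
derivative along the flow exp(-λMᵀ), so averaging over λ in [0, Λ] telescopes to Λ⁻¹ times a
difference of two densities (`sandwich_gradient_albertiMollifier`). Each has mass one because M is
trace-free and the flow preserves volume (`measurePreserving_flow`). Incompressibility of u enters
only through this trace condition.

I₄' is governed by a convexity defect. For |M| ≤ 1 one has |A - |A|M|² ≤ 2|A|(|A| - A:M), and M is
chosen so that the integral of |∇v(x)| - ∇v(x):M(z) against φ_{4ε}(z-x) is exactly ‖∇v‖ -
‖∇v*φ_{4ε}‖ (`lintegral_defect`). Cauchy-Schwarz gives the two square roots. The scale 4ε appears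
because the base point moves by at most δe^Λ ≤ ε, and φ_ε shifted by such a vector is dominated by a
multiple of φ_{4ε} (`IsMollifier.exists_rescale_sub_le`).

I₃' rests on a cancellation. The integral of ∇φ_ε is zero, so f*κ_z may be replaced by f*κ_z - f,
which is bounded independently of z by increments of f over the ball of radius δe^Λ. Hölder with
exponents d and d/(d-1), the embedding of BV into L^{d/(d-1)} (`exists_eLpNorm_le`), and the formula
for the L² energy lost under mollification as a weighted mean of squared increments
(`lintegral_energy`) finish it.

The remaining terms are softer. I₁ uses that φ_T is Lipschitz. I₂ uses that the localised
mollification of φ₀ lies in W^{1,∞}. R₁ moves the difference f - f*φ_{δ'} onto the Lipschitz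
function f*κ, and R₂ uses ‖u - v‖_{L¹} ≤ ε'‖∇u‖.

All of this is carried out for Borel, everywhere bounded, exactly periodic representatives
(`IsNiceSolution.exists_bounds`). The given data are only classes modulo null sets, and every term
depends only on these classes. -/

variable {d : ℕ}

/-! ### The unit cell as a fundamental domain of the integer lattice -/

/-- The standard basis of `ℝ^d`. -/
def stdBasis (d : ℕ) : Module.Basis (Fin d) ℝ (Euc d) := (EuclideanSpace.basisFun (Fin d) ℝ).toBasis

/-- The lattice `ℤ^d`. -/
abbrev intLattice (d : ℕ) : Submodule ℤ (Euc d) := Submodule.span ℤ (Set.range (stdBasis d))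

variable {d : ℕ}

lemma stdBasis_apply (i : Fin d) : stdBasis d i = EuclideanSpace.single i 1 := by
  simp [stdBasis]

lemma cell_eq_fundamentalDomain : cell d = ZSpan.fundamentalDomain (stdBasis d) := by
  ext x
  simp [cell, ZSpan.fundamentalDomain, stdBasis]

lemma isAddFundamentalDomain_cell : IsAddFundamentalDomain (intLattice d) (cell d) volume := by
  rw [cell_eq_fundamentalDomain]
  exact ZSpan.isAddFundamentalDomain _ _

instance : VAddInvariantMeasure (intLattice d) (Euc d) volume :=
  ⟨fun g _ _ => measure_preimage_add volume (g : Euc d) _⟩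

lemma measurableSet_cell : MeasurableSet (cell d) := by
  rw [cell_eq_fundamentalDomain]
  exact ZSpan.fundamentalDomain_measurableSet _

lemma volume_cell : volume (cell d) = 1 := by
  have h := (PiLp.volume_preserving_ofLp (Fin d)).measure_preimage
    (s := Set.univ.pi fun _ => Set.Ico (0 : ℝ) 1)
    (MeasurableSet.univ_pi fun _ => measurableSet_Ico).nullMeasurableSet
  rw [volume_pi_pi] at h
  simp only [Real.volume_Ico, sub_zero, ENNReal.ofReal_one, Finset.prod_const_one] at h
  rw [← h]
  congr 1
  ext x
  simp [cell]

instance : IsProbabilityMeasure (torusMeasure d) :=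
  ⟨by rw [torusMeasure, Measure.restrict_apply_univ, volume_cell]⟩

instance : IsProbabilityMeasure ((volume : Measure (Euc d)).restrict (cell d)) :=
  ⟨by rw [Measure.restrict_apply_univ, volume_cell]⟩

lemma measurable_coord (j : Fin d) : Measurable fun x : Euc d => x j :=
  (EuclideanSpace.proj (𝕜 := ℝ) j).continuous.measurable

lemma norm_le_of_mem_cell {x : Euc d} (hx : x ∈ cell d) : ‖x‖ ≤ d := by
  rw [cell_eq_fundamentalDomain, ← ZSpan.fract_eq_self] at hx
  have := ZSpan.norm_fract_le (stdBasis d) x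
  rw [hx] at this
  refine this.trans ?_
  -- The bound d is the sum of the norms of the basis vectors; the sharper √d is not needed.
  simp [stdBasis_apply]

lemma IsPeriodic.add_lattice {F : Type*} {f : Euc d → F} (hf : IsPeriodic f) {g : Euc d}
    (hg : g ∈ intLattice d) (x : Euc d) : f (x + g) = f x := by
  induction hg using Submodule.span_induction generalizing x with
  | mem y hy =>
    obtain ⟨i, rfl⟩ := hy
    rw [stdBasis_apply, hf]
  | zero => simp
  | add a b _ _ ha hb => rw [← add_assoc, hb, ha]
  | smul n a _ ha =>
    induction n using Int.induction_on generalizing x with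
    | zero => simp
    | succ n ih => rw [add_smul, ← add_assoc, one_smul, ha, ih]
    | pred n ih =>
      rw [sub_smul, one_smul, ← ih x]
      conv_rhs => rw [← sub_add_cancel ((-(n : ℤ)) • a) a, ← add_assoc, ha]

lemma IsPeriodic.vadd {F : Type*} {f : Euc d → F} (hf : IsPeriodic f) (g : intLattice d)
    (x : Euc d) : f (g +ᵥ x) = f x := by
  rw [Submodule.vadd_def, vadd_eq_add, add_comm]
  exact hf.add_lattice g.2 x

lemma isAddFundamentalDomain_vadd_cell (y : Euc d) :
    IsAddFundamentalDomain (intLattice d) (y +ᵥ cell d) volume :=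
  isAddFundamentalDomain_cell.vadd_of_comm y

lemma preimage_add_right_vadd_cell (y : Euc d) : (fun x => x + y) ⁻¹' (y +ᵥ cell d) = cell d := by
  ext x
  rw [Set.mem_preimage, Set.mem_vadd_set_iff_neg_vadd_mem, vadd_eq_add, add_comm x, neg_add_cancel_left]

/-- Translating the integrand amounts to translating the cell, and the translated cell is another
fundamental domain, over which an invariant function has the same integral. -/
lemma lintegral_cell_add {f : Euc d → ENNReal} (hf : IsPeriodic f) (y : Euc d) :
    ∫⁻ x in cell d, f (x + y) = ∫⁻ x in cell d, f x := by
  rw [isAddFundamentalDomain_cell.setLIntegral_eq (isAddFundamentalDomain_vadd_cell y) f hf.vadd,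
    ← (measurePreserving_add_right volume y).setLIntegral_comp_preimage_emb
    (measurableEmbedding_addRight y) f (y +ᵥ cell d), preimage_add_right_vadd_cell]

lemma lintegral_cell_sub {f : Euc d → ENNReal} (hf : IsPeriodic f) (y : Euc d) :
    ∫⁻ x in cell d, f (x - y) = ∫⁻ x in cell d, f x := by
  simpa [sub_eq_add_neg] using lintegral_cell_add hf (-y)

lemma integral_cell_add {F : Type*} [NormedAddCommGroup F] [NormedSpace ℝ F] {f : Euc d → F}
    (hf : IsPeriodic f) (y : Euc d) : ∫ x in cell d, f (x + y) = ∫ x in cell d, f x := by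
  rw [isAddFundamentalDomain_cell.setIntegral_eq (isAddFundamentalDomain_vadd_cell y) hf.vadd,
    ← (measurePreserving_add_right volume y).setIntegral_preimage_emb
    (measurableEmbedding_addRight y) f (y +ᵥ cell d), preimage_add_right_vadd_cell]

lemma integral_cell_sub {F : Type*} [NormedAddCommGroup F] [NormedSpace ℝ F] {f : Euc d → F}
    (hf : IsPeriodic f) (y : Euc d) : ∫ x in cell d, f (x - y) = ∫ x in cell d, f x := by
  simpa [sub_eq_add_neg] using integral_cell_add hf (-y)

lemma IsPeriodic.integrableOn_vadd_cell {F : Type*} [NormedAddCommGroup F]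
    {f : Euc d → F} (hf : IsPeriodic f) (hi : Integrable f (torusMeasure d)) (y : Euc d) :
    IntegrableOn f (y +ᵥ cell d) :=
  (isAddFundamentalDomain_cell.integrableOn_iff (isAddFundamentalDomain_vadd_cell y) hf.vadd).1 hi

/-- The exceptional set is invariant under the lattice, so it is null as soon as its trace on one
fundamental domain is. -/
lemma ae_of_ae_torus {p : Euc d → Prop} (hp : IsPeriodic p)
    (h : ∀ᵐ x ∂torusMeasure d, p x) : ∀ᵐ x, p x := by
  have hc : ∀ᵐ x, x ∈ cell d → p x := (ae_restrict_iff' measurableSet_cell).1 h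
  rw [ae_iff] at hc ⊢
  apply isAddFundamentalDomain_cell.measure_zero_of_invariant
  · intro g
    ext x
    rw [Set.mem_vadd_set_iff_neg_vadd_mem]
    simp [hp.vadd]
  · convert hc using 2
    ext x
    simp [and_comm]

/-- A point differs from its integer part by an element of the cell, so for points of norm at most r
only lattice vectors of norm at most r + d occur. -/
lemma exists_finite_cover_cell (r : ℝ) :
    ∃ s : Set (intLattice d), s.Finite ∧
      Metric.closedBall (0 : Euc d) r ⊆ ⋃ g ∈ s, (g : Euc d) +ᵥ cell d := by
  refine ⟨{g | (g : Euc d) ∈ Metric.closedBall 0 (r + d)}, ?_, ?_⟩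
  · have := ZSpan.setFinite_inter (stdBasis d) (Metric.isBounded_closedBall (x := (0 : Euc d))
      (r := r + d))
    refine Set.Finite.of_finite_image (f := Subtype.val) (this.subset ?_)
      Subtype.val_injective.injOn
    rintro _ ⟨g, hg, rfl⟩
    exact ⟨hg, g.2⟩
  · intro x hx
    have hm : x - ZSpan.floor (stdBasis d) x ∈ cell d := by
      rw [cell_eq_fundamentalDomain]
      exact ZSpan.fract_mem_fundamentalDomain _ x
    refine Set.mem_biUnion (x := ZSpan.floor (stdBasis d) x) ?_ ?_
    · have h1 := norm_le_of_mem_cell hm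
      simp only [Set.mem_ofPred_eq, mem_closedBall_zero_iff] at hx ⊢
      have h2 := norm_sub_norm_le (ZSpan.floor (stdBasis d) x : Euc d) x
      rw [norm_sub_rev] at h2
      linarith
    · rw [Set.mem_vadd_set_iff_neg_vadd_mem, vadd_eq_add, neg_add_eq_sub]
      exact hm

lemma IsPeriodic.integrableOn_closedBall {F : Type*} [NormedAddCommGroup F]
    {f : Euc d → F} (hf : IsPeriodic f) (hi : Integrable f (torusMeasure d)) (r : ℝ) :
    IntegrableOn f (Metric.closedBall 0 r) := by
  obtain ⟨s, hs, hr⟩ := exists_finite_cover_cell (d := d) r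
  refine IntegrableOn.mono_set ?_ hr
  rw [integrableOn_finite_biUnion hs]
  exact fun g _ => hf.integrableOn_vadd_cell hi _

lemma IsPeriodic.locallyIntegrable {F : Type*} [NormedAddCommGroup F]
    {f : Euc d → F} (hf : IsPeriodic f) (hi : Integrable f (torusMeasure d)) :
    LocallyIntegrable f := by
  rw [locallyIntegrable_iff]
  intro k hk
  obtain ⟨r, hr⟩ := hk.isBounded.subset_closedBall 0
  exact (hf.integrableOn_closedBall hi r).mono_set hr

/-! ### Fubini along the diagonal -/

/-- Functions of two variables that are invariant under simultaneous integer translations. -/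
def IsDiagPeriodic {F : Type*} (f : Euc d → Euc d → F) : Prop :=
  ∀ x z i, f (x + EuclideanSpace.single i 1) (z + EuclideanSpace.single i 1) = f x z

/-- In the coordinates (x, y) with z = y + x the function is periodic in x for fixed y. The cell can
then be translated by y, which makes z the variable confined to the cell; undoing the substitution
leaves x free. -/
lemma lintegral_diag {f : Euc d → Euc d → ENNReal} (hm : Measurable (Function.uncurry f))
    (hf : IsDiagPeriodic f) :
    ∫⁻ x in cell d, ∫⁻ z, f x z = ∫⁻ z in cell d, ∫⁻ x, f x z := by
  calc ∫⁻ x in cell d, ∫⁻ z, f x z = ∫⁻ x in cell d, ∫⁻ y, f x (y + x) := by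
        refine lintegral_congr fun x => ?_
        rw [lintegral_add_right_eq_self (fun z => f x z) x]
    _ = ∫⁻ y, ∫⁻ x in cell d, f x (y + x) := by
        refine lintegral_lintegral_swap (Measurable.aemeasurable ?_)
        exact hm.comp (measurable_fst.prodMk (measurable_snd.add measurable_fst))
    _ = ∫⁻ y, ∫⁻ x in cell d, f (x - y) x := by
        refine lintegral_congr fun y => ?_
        have hp : IsPeriodic (fun x => f x (y + x)) := fun x i => by
          simp only [← add_assoc]; exact hf _ _ _
        rw [← lintegral_cell_sub hp y]
        simp
    _ = ∫⁻ x in cell d, ∫⁻ y, f (x - y) x := by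
        refine lintegral_lintegral_swap (Measurable.aemeasurable ?_)
        exact hm.comp ((measurable_snd.sub measurable_fst).prodMk measurable_snd)
    _ = ∫⁻ z in cell d, ∫⁻ x, f x z := by
        refine lintegral_congr fun x => ?_
        exact lintegral_sub_left_eq_self (fun z => f z x) x

lemma integral_diag {f : Euc d → Euc d → ℝ} (hm : Measurable (Function.uncurry f))
    (hf : IsDiagPeriodic f) (hi : ∫⁻ x in cell d, ∫⁻ z, ‖f x z‖ₑ ≠ ⊤) :
    ∫ x in cell d, ∫ z, f x z = ∫ z in cell d, ∫ x, f x z := by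
  have key : ∀ {g : Euc d → Euc d → ℝ}, Measurable (Function.uncurry g) →
      (∫⁻ x in cell d, ∫⁻ z, ‖g x z‖ₑ ≠ ⊤) →
      Integrable (Function.uncurry g) ((volume.restrict (cell d)).prod volume) := by
    intro g hg hgi
    refine ⟨hg.aestronglyMeasurable, ?_⟩
    rw [HasFiniteIntegral, lintegral_prod _ hg.enorm.aemeasurable]
    exact lt_top_iff_ne_top.2 hgi
  have hep : IsDiagPeriodic (fun x z => ‖f x z‖ₑ) := fun x z i => by simp only [hf x z i]
  have hp : ∀ y, IsPeriodic (fun x => f x (y + x)) := fun y x i => by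
    simp only [← add_assoc]; exact hf _ _ _
  have m1 : Measurable (Function.uncurry fun x y => f x (y + x)) :=
    hm.comp (measurable_fst.prodMk (measurable_snd.add measurable_fst))
  have m2 : Measurable (Function.uncurry fun x y => f (x - y) x) :=
    hm.comp ((measurable_fst.sub measurable_snd).prodMk measurable_fst)
  calc ∫ x in cell d, ∫ z, f x z = ∫ x in cell d, ∫ y, f x (y + x) := by
        congr 1; ext x
        rw [integral_add_right_eq_self (fun z => f x z) x]
    _ = ∫ y, ∫ x in cell d, f x (y + x) := by
        refine integral_integral_swap (key m1 ?_)
        convert hi using 3 with x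
        exact lintegral_add_right_eq_self (fun z => ‖f x z‖ₑ) x
    _ = ∫ y, ∫ x in cell d, f (x - y) x := by
        congr 1; ext y
        rw [← integral_cell_sub (hp y) y]
        simp
    _ = ∫ x in cell d, ∫ y, f (x - y) x := by
        refine (integral_integral_swap (key m2 ?_)).symm
        -- Finiteness in the exchanged order, needed for the second use of Fubini, comes from the
        -- nonnegative version.
        rw [lintegral_diag hm.enorm hep] at hi
        convert hi using 3 with x
        exact lintegral_sub_left_eq_self (fun z => ‖f z x‖ₑ) x
    _ = ∫ z in cell d, ∫ x, f x z := by
        congr 1; ext x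
        exact integral_sub_left_eq_self (fun z => f z x) volume x

/-! ### Gradients -/

lemma inner_gradient (f : Euc d → ℝ) (x v : Euc d) :
    inner ℝ v (gradient f x) = fderiv ℝ f x v := by
  rw [real_inner_comm, gradient, InnerProductSpace.toDual_symm_apply]

lemma gradient_apply (f : Euc d → ℝ) (x : Euc d) (i : Fin d) :
    gradient f x i = fderiv ℝ f x (EuclideanSpace.single i 1) := by
  rw [← inner_gradient, EuclideanSpace.inner_single_left]
  simp

lemma norm_gradient (f : Euc d → ℝ) (x : Euc d) : ‖gradient f x‖ = ‖fderiv ℝ f x‖ := by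
  rw [gradient, LinearIsometryEquiv.norm_map]

lemma ContDiff.gradient {f : Euc d → ℝ} (hf : ContDiff ℝ ∞ f) : ContDiff ℝ ∞ (gradient f) :=
  (InnerProductSpace.toDual ℝ (Euc d)).symm.contDiff.comp (hf.fderiv_right (m := ∞) le_rfl)

lemma HasCompactSupport.gradient {f : Euc d → ℝ} (hf : HasCompactSupport f) :
    HasCompactSupport (gradient f) :=
  (hf.fderiv (𝕜 := ℝ)).comp_left (g := (InnerProductSpace.toDual ℝ (Euc d)).symm) (map_zero _)

lemma gradient_eq_of_hasFDerivAt {f : Euc d → ℝ} {x g : Euc d} {L : Euc d →L[ℝ] ℝ}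
    (h : HasFDerivAt f L x) (hL : ∀ w, L w = inner ℝ w g) : gradient f x = g := by
  refine ext_inner_left ℝ fun w => ?_
  rw [inner_gradient, h.fderiv, hL]

lemma IsPeriodic.fderiv {F : Type*} [NormedAddCommGroup F] [NormedSpace ℝ F]
    {f : Euc d → F} (hf : IsPeriodic f) : IsPeriodic (fderiv ℝ f) := fun x i => by
  rw [← fderiv_comp_add_right]
  congr 1
  funext y
  exact hf y i

lemma IsPeriodic.gradient {f : Euc d → ℝ} (hf : IsPeriodic f) : IsPeriodic (gradient f) :=
  fun x i => by rw [_root_.gradient, hf.fderiv x i, ← _root_.gradient]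

lemma IsPeriodic.gradMatrix {f : Euc d → Euc d} (hf : IsPeriodic f) : IsPeriodic (gradMatrix f) :=
  fun x i => by simp only [_root_.gradMatrix, hf.fderiv x i]

lemma integral_fderiv_eq_zero {f : Euc d → ℝ} (hf : ContDiff ℝ ∞ f) (hc : HasCompactSupport f)
    (v : Euc d) : ∫ x, fderiv ℝ f x v = 0 := by
  have hcont : Continuous fun x => fderiv ℝ f x v :=
    (hf.continuous_fderiv (by simp)).clm_apply continuous_const
  have hsupp : HasCompactSupport fun x => fderiv ℝ f x v :=
    (hc.fderiv (𝕜 := ℝ)).comp_left (g := fun L : Euc d →L[ℝ] ℝ => L v) rfl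
  have h1 : ∀ x : Euc d, HasLineDerivAt ℝ (fun _ : Euc d => (1 : ℝ)) 0 x v := fun x =>
    (hasFDerivAt_const (1 : ℝ) x).hasLineDerivAt v
  have h2 : ∀ x : Euc d, HasLineDerivAt ℝ f (fderiv ℝ f x v) x v := fun x =>
    ((hf.differentiable (by simp)) x).hasFDerivAt.hasLineDerivAt v
  have h3 := hcont.integrable_of_hasCompactSupport (μ := volume) hsupp
  have h4 := hf.continuous.integrable_of_hasCompactSupport (μ := volume) hc
  have := integral_bilinear_hasLineDerivAt_right_eq_neg_left_of_integrable (μ := volume)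
    (f := fun _ : Euc d => (1 : ℝ)) (f' := fun _ => 0) (g := f) (g' := fun x => fderiv ℝ f x v)
    (v := v) (B := ContinuousLinearMap.mul ℝ ℝ) (by simp) (by simpa using h3)
    (by simpa using h4) (fun x _ => h1 x) (fun x _ => h2 x)
  simpa using this

/-! ### Smoothness of parametric integrals -/

/-- The derivative of a parametric integral is again a parametric integral, with values in `E →L[ℝ]
F`. The induction on the order of differentiability therefore has to vary the target space.
Domination comes from compactness of the interval times a closed ball. -/
lemma contDiff_intervalIntegral_param {E : Type} [NormedAddCommGroup E] [NormedSpace ℝ E]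
    [FiniteDimensional ℝ E] {F : Type} [NormedAddCommGroup F] [NormedSpace ℝ F]
    {f : ℝ → E → F} (hf : ContDiff ℝ ∞ (Function.uncurry f)) (a b : ℝ) :
    ContDiff ℝ ∞ (fun x => ∫ t in a..b, f t x) ∧
    ∀ x, HasFDerivAt (fun x => ∫ t in a..b, f t x) (∫ t in a..b, fderiv ℝ (f t) x) x := by
  have hslice : ∀ {F : Type} [NormedAddCommGroup F] [NormedSpace ℝ F] {f : ℝ → E → F},
      ContDiff ℝ ∞ (Function.uncurry f) → ∀ t, ContDiff ℝ ∞ (f t) := fun hf t =>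
    hf.comp (contDiff_const.prodMk contDiff_id)
  have hjoint : ∀ {F : Type} [NormedAddCommGroup F] [NormedSpace ℝ F] {f : ℝ → E → F},
      ContDiff ℝ ∞ (Function.uncurry f) →
      ContDiff ℝ ∞ (Function.uncurry fun t x => fderiv ℝ (f t) x) := by
    intro F _ _ f hf
    have : (Function.uncurry fun t x => fderiv ℝ (f t) x) = fun p : ℝ × E =>
        (fderiv ℝ (Function.uncurry f) p).comp (ContinuousLinearMap.inr ℝ ℝ E) := by
      funext ⟨t, x⟩
      have h1 : HasFDerivAt (Function.uncurry f) (fderiv ℝ (Function.uncurry f) (t, x)) (t, x) :=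
        (hf.differentiable (by simp) _).hasFDerivAt
      exact (h1.comp x (hasFDerivAt_prodMk_right t x)).fderiv
    rw [this]
    exact (hf.fderiv_right (m := ∞) le_rfl).clm_comp contDiff_const
  have hderiv : ∀ {F : Type} [NormedAddCommGroup F] [NormedSpace ℝ F] {f : ℝ → E → F},
      ContDiff ℝ ∞ (Function.uncurry f) →
      ∀ x, HasFDerivAt (fun x => ∫ t in a..b, f t x) (∫ t in a..b, fderiv ℝ (f t) x) x := by
    intro F _ _ f hf x
    have hc := (hjoint hf).continuous
    obtain ⟨K, hK⟩ := ((isCompact_uIcc (a := a) (b := b)).prod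
      (isCompact_closedBall x 1)).exists_bound_of_continuousOn hc.continuousOn
    refine intervalIntegral.hasFDerivAt_integral_of_dominated_of_fderiv_le
      (s := Metric.ball x 1) (bound := fun _ => K) (F' := fun x t => fderiv ℝ (f t) x)
      (Metric.ball_mem_nhds x one_pos) ?_ ?_ ?_ ?_ ?_ ?_
    · exact Filter.Eventually.of_forall fun y =>
        (hf.continuous.comp (continuous_id.prodMk continuous_const)).aestronglyMeasurable
    · exact (hf.continuous.comp (continuous_id.prodMk continuous_const)).intervalIntegrable _ _
    · exact (hc.comp (continuous_id.prodMk continuous_const)).aestronglyMeasurable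
    · refine Filter.Eventually.of_forall fun t ht y hy => ?_
      exact hK (t, y) ⟨Set.uIoc_subset_uIcc ht, Metric.ball_subset_closedBall hy⟩
    · simp
    · refine Filter.Eventually.of_forall fun t _ y _ => ?_
      exact ((hslice hf t).differentiable (by simp) y).hasFDerivAt
  refine ⟨?_, hderiv hf⟩
  rw [contDiff_infty]
  intro n
  induction n generalizing F with
  | zero =>
    refine contDiff_zero.2 ?_
    refine intervalIntegral.continuous_parametric_intervalIntegral_of_continuous' ?_ a b
    exact hf.continuous.comp continuous_swap
  | succ n ih =>
    refine contDiff_succ_iff_hasFDerivAt.2 ⟨_, ih (hjoint hf), hderiv hf⟩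

/-! ### The linear flow generated by a matrix -/

/-- The linear map `h ↦ -Aᵀ h`. -/
def flowGen (A : Matrix (Fin d) (Fin d) ℝ) : Euc d →L[ℝ] Euc d :=
  Matrix.toEuclideanCLM (𝕜 := ℝ) (-A.transpose)

/-- The linear map `h ↦ exp (-l Aᵀ) h`. -/
def flow (A : Matrix (Fin d) (Fin d) ℝ) (l : ℝ) : Euc d →L[ℝ] Euc d :=
  NormedSpace.exp (l • flowGen A)

/-- `Matrix.toEuclideanCLM` as a linear map. -/
def toCLMₗ (d : ℕ) : Matrix (Fin d) (Fin d) ℝ →ₗ[ℝ] (Euc d →L[ℝ] Euc d) where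
  toFun := Matrix.toEuclideanCLM (n := Fin d) (𝕜 := ℝ)
  map_add' := map_add _
  map_smul' := map_smul _

lemma continuous_toEuclideanCLM :
    Continuous (Matrix.toEuclideanCLM (n := Fin d) (𝕜 := ℝ)) :=
  (toCLMₗ d).continuous_of_finiteDimensional

lemma continuous_flowGen : Continuous (flowGen (d := d)) :=
  continuous_toEuclideanCLM.comp (continuous_id.matrix_transpose.neg)

lemma toEuclideanCLM_exp (X : Matrix (Fin d) (Fin d) ℝ) :
    Matrix.toEuclideanCLM (𝕜 := ℝ) (NormedSpace.exp X) =
      NormedSpace.exp (Matrix.toEuclideanCLM (𝕜 := ℝ) X) := by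
  -- Any Banach algebra norm on matrices serves here: the exponential is compatible with every
  -- continuous ring homomorphism.
  let := Matrix.linftyOpNormedRing (n := Fin d) (α := ℝ)
  let := Matrix.linftyOpNormedAlgebra (n := Fin d) (α := ℝ) (R := ℝ)
  let : NormedAlgebra ℚ (Matrix (Fin d) (Fin d) ℝ) := NormedAlgebra.restrictScalars ℚ ℝ _
  exact NormedSpace.map_exp _ continuous_toEuclideanCLM X

lemma flow_eq_toEuclideanCLM (A : Matrix (Fin d) (Fin d) ℝ) (l : ℝ) :
    flow A l = Matrix.toEuclideanCLM (𝕜 := ℝ) (NormedSpace.exp (-(l • A.transpose))) := by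
  have : -(l • A.transpose) = l • -A.transpose := (smul_neg l A.transpose).symm
  rw [toEuclideanCLM_exp, flow, flowGen, this]
  exact congrArg _ ((toCLMₗ d).map_smul l _).symm

lemma flow_apply (A : Matrix (Fin d) (Fin d) ℝ) (l : ℝ) (h : Euc d) :
    WithLp.toLp 2 ((NormedSpace.exp (-(l • A.transpose))).mulVec h.ofLp) = flow A l h := by
  rw [flow_eq_toEuclideanCLM]
  rfl

lemma frob_nonneg (A : Matrix (Fin d) (Fin d) ℝ) : 0 ≤ frob A := Real.sqrt_nonneg _

lemma frob_sq (A : Matrix (Fin d) (Fin d) ℝ) : frob A ^ 2 = ∑ i, ∑ j, A i j ^ 2 :=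
  Real.sq_sqrt (by positivity)

lemma frob_transpose (A : Matrix (Fin d) (Fin d) ℝ) : frob A.transpose = frob A := by
  rw [frob, frob, Finset.sum_comm]
  rfl

lemma frob_neg (A : Matrix (Fin d) (Fin d) ℝ) : frob (-A) = frob A := by
  simp [frob]

lemma norm_toEuclideanCLM_le (A : Matrix (Fin d) (Fin d) ℝ) :
    ‖Matrix.toEuclideanCLM (𝕜 := ℝ) A‖ ≤ frob A := by
  refine ContinuousLinearMap.opNorm_le_bound _ (frob_nonneg A) fun x => ?_
  refine (sq_le_sq₀ (norm_nonneg _) (mul_nonneg (frob_nonneg A) (norm_nonneg x))).1 ?_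
  rw [mul_pow, frob_sq, EuclideanSpace.real_norm_sq_eq, EuclideanSpace.real_norm_sq_eq,
    Finset.sum_mul]
  refine Finset.sum_le_sum fun i _ => ?_
  exact Finset.sum_mul_sq_le_sq_mul_sq Finset.univ (fun j => A i j) (fun j => x j)

lemma norm_flowGen_le (A : Matrix (Fin d) (Fin d) ℝ) : ‖flowGen A‖ ≤ frob A := by
  refine (norm_toEuclideanCLM_le _).trans_eq ?_
  rw [frob_neg, frob_transpose]

lemma norm_exp_le_exp_norm (x : Euc d →L[ℝ] Euc d) : ‖NormedSpace.exp x‖ ≤ Real.exp ‖x‖ := by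
  rw [NormedSpace.exp_eq_tsum ℝ, Real.exp_eq_exp_ℝ]
  refine tsum_of_norm_bounded (NormedSpace.expSeries_div_hasSum_exp ‖x‖) fun n => ?_
  have h1 : ‖x ^ n‖ ≤ ‖x‖ ^ n := by
    -- The zeroth power is treated separately through ‖id‖ ≤ 1, which remains true on the zero
    -- space.
    rcases n with _ | n
    · rw [pow_zero, pow_zero]
      exact ContinuousLinearMap.norm_id_le (𝕜 := ℝ) (E := Euc d)
    · exact norm_pow_le' x n.succ_pos
  rw [norm_smul, norm_inv, div_eq_inv_mul]
  simp only [RCLike.norm_natCast]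
  gcongr

lemma norm_flow_le {A : Matrix (Fin d) (Fin d) ℝ} (hA : frob A ≤ 1) (l : ℝ) :
    ‖flow A l‖ ≤ Real.exp |l| := by
  refine (norm_exp_le_exp_norm _).trans ?_
  rw [norm_smul, Real.norm_eq_abs]
  gcongr
  exact mul_le_of_le_one_right (abs_nonneg l) ((norm_flowGen_le A).trans hA)

lemma flow_zero (A : Matrix (Fin d) (Fin d) ℝ) : flow A 0 = 1 := by
  rw [flow, zero_smul ℝ (flowGen A), NormedSpace.exp_zero]

lemma exp_add_smul {𝔸 : Type*} [NormedRing 𝔸] [NormedAlgebra ℝ 𝔸] [CompleteSpace 𝔸] (x : 𝔸)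
    (l m : ℝ) : NormedSpace.exp ((l + m) • x) = NormedSpace.exp (l • x) * NormedSpace.exp (m • x) := by
  let : NormedAlgebra ℚ 𝔸 := NormedAlgebra.restrictScalars ℚ ℝ _
  rw [add_smul, NormedSpace.exp_add_of_commute (((Commute.refl x).smul_left l).smul_right m)]

lemma flow_add (A : Matrix (Fin d) (Fin d) ℝ) (l m : ℝ) : flow A (l + m) = flow A l * flow A m := by
  exact exp_add_smul (flowGen A) l m

lemma flow_neg_flow (A : Matrix (Fin d) (Fin d) ℝ) (l : ℝ) (h : Euc d) :
    flow A (-l) (flow A l h) = h := by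
  have := flow_add A (-l) l
  rw [neg_add_cancel, flow_zero] at this
  exact (DFunLike.congr_fun this h).symm

lemma norm_le_exp_mul_norm_flow {A : Matrix (Fin d) (Fin d) ℝ} (hA : frob A ≤ 1) (l : ℝ)
    (h : Euc d) : ‖h‖ ≤ Real.exp |l| * ‖flow A l h‖ := by
  conv_lhs => rw [← flow_neg_flow A l h]
  refine ((flow A (-l)).le_opNorm _).trans ?_
  gcongr
  simpa using norm_flow_le hA (-l)

lemma hasDerivAt_flow (A : Matrix (Fin d) (Fin d) ℝ) (l : ℝ) (h : Euc d) :
    HasDerivAt (fun l => flow A l h) (flow A l (flowGen A h)) l := by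
  have := (hasDerivAt_exp_smul_const (𝕂 := ℝ) (flowGen A) l).clm_apply (hasDerivAt_const l h)
  simpa [flow] using this

lemma contDiff_flow (A : Matrix (Fin d) (Fin d) ℝ) :
    ContDiff ℝ ∞ (fun p : ℝ × Euc d => flow A p.1 p.2) := by
  have h1 : ContDiff ℝ ∞ (NormedSpace.exp : (Euc d →L[ℝ] Euc d) → _) :=
    contDiff_iff_contDiffAt.2 fun x => (NormedSpace.exp_analytic (𝕂 := ℝ) x).contDiffAt
  exact (h1.comp (contDiff_fst.smul contDiff_const)).clm_apply contDiff_snd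

lemma continuous_flow_left :
    Continuous fun p : Matrix (Fin d) (Fin d) ℝ × ℝ => flow p.1 p.2 := by
  have h1 : Continuous (NormedSpace.exp : (Euc d →L[ℝ] Euc d) → _) :=
    continuous_iff_continuousAt.2 fun x => (NormedSpace.exp_analytic (𝕂 := ℝ) x).continuousAt
  exact h1.comp (continuous_snd.smul (continuous_flowGen.comp continuous_fst))

lemma continuous_flow :
    Continuous fun p : (Matrix (Fin d) (Fin d) ℝ × Euc d) × ℝ => flow p.1.1 p.2 p.1.2 :=
  (continuous_flow_left.comp ((continuous_fst.comp continuous_fst).prodMk continuous_snd)).clm_apply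
    (continuous_snd.comp continuous_fst)

/-! ### Volume preservation by the flow of a trace-free matrix -/

/-- The determinant of a linear map of `ℝ^d`, as a function on a normed space. -/
def detCLM (L : Euc d →L[ℝ] Euc d) : ℝ := ((Matrix.toEuclideanCLM (n := Fin d) (𝕜 := ℝ)).symm L).det

lemma differentiable_detCLM : Differentiable ℝ (detCLM (d := d)) := by
  have hentry : ∀ i j, Differentiable ℝ fun L : Euc d →L[ℝ] Euc d =>
      (Matrix.toEuclideanCLM (n := Fin d) (𝕜 := ℝ)).symm L i j := fun i j => by
    let e : (Euc d →L[ℝ] Euc d) →ₗ[ℝ] ℝ :=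
      { toFun := fun L => (Matrix.toEuclideanCLM (n := Fin d) (𝕜 := ℝ)).symm L i j
        map_add' := fun L L' => by rw [map_add]; rfl
        map_smul' := fun c L => by rw [map_smul]; rfl }
    exact (LinearMap.toContinuousLinearMap e).differentiable
  have : (detCLM (d := d)) = fun L => ∑ σ : Equiv.Perm (Fin d), ((Equiv.Perm.sign σ : ℤ) : ℝ) *
      ∏ i, (Matrix.toEuclideanCLM (n := Fin d) (𝕜 := ℝ)).symm L (σ i) i := by
    funext L; rw [detCLM, Matrix.det_apply']
  rw [this]
  refine Differentiable.fun_sum fun σ _ => (differentiable_const _).mul fun L => ?_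
  refine HasFDerivAt.differentiableAt ((HasFDerivAt.finsetProd (u := Finset.univ)
    fun i _ => (hentry (σ i) i L).hasFDerivAt).congr_of_eventuallyEq ?_)
  exact Filter.Eventually.of_forall fun L => by simp

lemma detCLM_mul (L L' : Euc d →L[ℝ] Euc d) : detCLM (L * L') = detCLM L * detCLM L' := by
  rw [detCLM, map_mul, Matrix.det_mul]; rfl

/-- The determinant is multiplicative along the one-parameter group and has derivative tr(-Aᵀ) = 0
at time 0. Multiplicativity carries the vanishing derivative to every time, so the determinant keeps
its initial value 1. -/
lemma detCLM_flow {A : Matrix (Fin d) (Fin d) ℝ} (hA : A.trace = 0) (l : ℝ) :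
    detCLM (flow A l) = 1 := by
  set N : Matrix (Fin d) (Fin d) ℝ := -A.transpose with hN'
  have hN : N.trace = 0 := by simp [hN', hA]
  have hadd : ∀ s r, detCLM (flow A (s + r)) = detCLM (flow A s) * detCLM (flow A r) :=
    fun s r => by rw [flow_add, detCLM_mul]
  have hone : detCLM (1 : Euc d →L[ℝ] Euc d) = 1 := by simp [detCLM]
  have hd := (differentiable_detCLM (d := d) 1).hasFDerivAt
  have hline : HasDerivAt (fun s : ℝ => detCLM (1 + s • flowGen A))
      (fderiv ℝ detCLM 1 (flowGen A)) 0 := by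
    have h1 : HasDerivAt (fun s : ℝ => 1 + s • flowGen A) (flowGen A) 0 := by
      have := ((hasDerivAt_id (0 : ℝ)).smul_const (flowGen A)).const_add 1
      rwa [one_smul ℝ (flowGen A)] at this
    have h2 : HasFDerivAt (detCLM (d := d)) (fderiv ℝ detCLM 1) (1 + (0 : ℝ) • flowGen A) := by
      rwa [zero_smul ℝ (flowGen A), add_zero]
    exact h2.comp_hasDerivAt (0 : ℝ) h1
  have hline' : HasDerivAt (fun s : ℝ => detCLM (1 + s • flowGen A)) 0 0 := by
    have heq : ∀ s : ℝ, detCLM (1 + s • flowGen A) = (1 + s • N).det := fun s => by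
      rw [detCLM, map_add, map_one, map_smul, flowGen, StarAlgEquiv.symm_apply_apply]
    simp only [heq, Matrix.det_one_add_smul _ N, hN, zero_mul, add_zero]
    -- This is the coefficient c in det(1 + sN) = 1 + s tr N + s² c(s); only its being a polynomial
    -- in s is used.
    generalize (1 + (Polynomial.X : Polynomial ℝ) • N.map Polynomial.C).det.divX.divX = c
    have h2 := ((c.hasDerivAt 0).mul (hasDerivAt_pow 2 (0 : ℝ))).const_add 1
    simpa using h2
  have hz := hline.unique hline'
  have h0 : HasDerivAt (fun s => detCLM (flow A s)) 0 0 := by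
    have hexp : HasDerivAt (fun s : ℝ => flow A s) (flowGen A) 0 := by
      have := hasDerivAt_exp_smul_const (𝕂 := ℝ) (flowGen A) 0
      rwa [zero_smul ℝ (flowGen A), NormedSpace.exp_zero, one_mul] at this
    have h2 : HasFDerivAt (detCLM (d := d)) (fderiv ℝ detCLM 1) (flow A 0) := by
      rwa [flow_zero]
    have := h2.comp_hasDerivAt (0 : ℝ) hexp
    rwa [hz] at this
  have hder : ∀ s, HasDerivAt (fun s => detCLM (flow A s)) 0 s := fun s => by
    have h1 : HasDerivAt (fun r => detCLM (flow A s) * detCLM (flow A (r - s)))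
        (detCLM (flow A s) * 0) s := by
      refine HasDerivAt.const_mul _ ?_
      exact HasDerivAt.comp_sub_const s s (f := fun s => detCLM (flow A s)) (f' := 0)
        (by simpa using h0)
    rw [mul_zero] at h1
    convert h1 using 1
    funext r
    rw [← hadd, add_sub_cancel]
  have hconst := is_const_of_deriv_eq_zero (fun s => (hder s).differentiableAt)
    (fun s => (hder s).deriv) l 0
  simpa [flow_zero, hone] using hconst

lemma measurePreserving_flow {A : Matrix (Fin d) (Fin d) ℝ} (hA : A.trace = 0) (l : ℝ) :
    MeasurePreserving (flow A l) (volume : Measure (Euc d)) volume := by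
  refine ⟨(flow A l).continuous.measurable, ?_⟩
  have hdet : LinearMap.det (flow A l : Euc d →ₗ[ℝ] Euc d) = 1 := by
    rw [← detCLM_flow hA l, detCLM]
    obtain ⟨B, hB⟩ : ∃ B, Matrix.toEuclideanCLM (n := Fin d) (𝕜 := ℝ) B = flow A l :=
      (Matrix.toEuclideanCLM (n := Fin d) (𝕜 := ℝ)).surjective (flow A l)
    rw [← hB, StarAlgEquiv.symm_apply_apply, Matrix.coe_toEuclideanCLM_eq_toEuclideanLin,
      Matrix.toEuclideanLin_eq_toLin_orthonormal, LinearMap.det_toLin]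
  have := Measure.map_linearMap_addHaar_eq_smul_addHaar (μ := (volume : Measure (Euc d)))
    (f := (flow A l : Euc d →ₗ[ℝ] Euc d)) (by rw [hdet]; exact one_ne_zero)
  rw [hdet] at this
  simpa using this

lemma measurableEmbedding_flow (A : Matrix (Fin d) (Fin d) ℝ) (l : ℝ) :
    MeasurableEmbedding (flow A l) := by
  refine MeasurableEquiv.measurableEmbedding
    { toFun := flow A l
      invFun := flow A (-l)
      left_inv := flow_neg_flow A l
      right_inv := fun x => by simpa using flow_neg_flow A (-l) x
      measurable_toFun := (flow A l).continuous.measurable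
      measurable_invFun := (flow A (-l)).continuous.measurable }

/-! ### Rescaled kernels -/

lemma ContDiff.rescale {f : Euc d → ℝ} (hf : ContDiff ℝ ∞ f) (r : ℝ) : ContDiff ℝ ∞ (rescale f r) :=
  contDiff_const.mul (hf.comp (contDiff_id.const_smul r⁻¹))

lemma gradient_rescale {f : Euc d → ℝ} (hf : ContDiff ℝ ∞ f) (r : ℝ) (h : Euc d) :
    gradient (rescale f r) h = ((r ^ d)⁻¹ * r⁻¹) • gradient f (r⁻¹ • h) := by
  have h1 : HasFDerivAt f (fderiv ℝ f (r⁻¹ • h)) (r⁻¹ • h) :=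
    (hf.differentiable (by simp) _).hasFDerivAt
  have h2 : HasFDerivAt (fun h : Euc d => r⁻¹ • h) (r⁻¹ • ContinuousLinearMap.id ℝ (Euc d)) h :=
    (hasFDerivAt_id h).const_smul r⁻¹
  refine gradient_eq_of_hasFDerivAt ((h1.comp h h2).const_mul ((r ^ d)⁻¹)) fun w => ?_
  rw [inner_smul_right, inner_gradient]
  simp [mul_assoc]

lemma integral_comp_inv_smul_euc {F : Type*} [NormedAddCommGroup F] [NormedSpace ℝ F]
    (f : Euc d → F) {r : ℝ} (hr : 0 < r) : ∫ h, f (r⁻¹ • h) = (r ^ d) • ∫ h, f h := by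
  rw [Measure.integral_comp_inv_smul]
  simp [abs_of_pos hr]

lemma lintegral_comp_inv_smul_euc (f : Euc d → ENNReal) {r : ℝ} (hr : 0 < r) :
    ∫⁻ h, f (r⁻¹ • h) = ENNReal.ofReal (r ^ d) * ∫⁻ h, f h := by
  have hne : r⁻¹ ≠ 0 := inv_ne_zero hr.ne'
  have := (measurableEmbedding_const_smul₀ (α := Euc d) hne).lintegral_map (μ := volume) f
  rw [← this, Measure.map_addHaar_smul _ hne, lintegral_smul_measure]
  simp [abs_of_pos hr, smul_eq_mul]

lemma integral_rescale (f : Euc d → ℝ) {r : ℝ} (hr : 0 < r) : ∫ h, rescale f r h = ∫ h, f h := by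
  simp only [rescale]
  rw [integral_const_mul, integral_comp_inv_smul_euc f hr, smul_eq_mul, inv_mul_cancel_left₀]
  positivity

lemma rescale_eq_zero {f : Euc d → ℝ} {R r : ℝ} (hr : 0 < r) (hf : ∀ h, R ≤ ‖h‖ → f h = 0)
    {h : Euc d} (hh : r * R ≤ ‖h‖) : rescale f r h = 0 := by
  rw [rescale, hf, mul_zero]
  rw [norm_smul, Real.norm_eq_abs, abs_of_pos (inv_pos.2 hr), inv_mul_eq_div, le_div_iff₀ hr]
  linarith

lemma hasCompactSupport_of_eq_zero {F : Type*} [Zero F] {f : Euc d → F} {R : ℝ}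
    (hf : ∀ h, R ≤ ‖h‖ → f h = 0) : HasCompactSupport f := by
  refine HasCompactSupport.intro (isCompact_closedBall (0 : Euc d) R) fun x hx => hf x ?_
  simp only [Metric.mem_closedBall, dist_zero_right, not_le] at hx
  exact hx.le

namespace IsMollifier

variable {η : Euc d → ℝ}

lemma hasCompactSupport (hη : IsMollifier η) : HasCompactSupport η :=
  hasCompactSupport_of_eq_zero hη.eq_zero

lemma integrable (hη : IsMollifier η) : Integrable η :=
  hη.smooth.continuous.integrable_of_hasCompactSupport hη.hasCompactSupport

lemma exists_le (hη : IsMollifier η) : ∃ H, 0 < H ∧ ∀ h, η h ≤ H := by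
  obtain ⟨C, hC⟩ := hη.hasCompactSupport.exists_bound_of_continuous hη.smooth.continuous
  refine ⟨max C 1, by positivity, fun h => ?_⟩
  exact ((Real.le_norm_self _).trans (hC h)).trans (le_max_left _ _)

lemma exists_norm_gradient_le (hη : IsMollifier η) : ∃ H, 0 < H ∧ ∀ h, ‖gradient η h‖ ≤ H := by
  obtain ⟨C, hC⟩ := hη.hasCompactSupport.gradient.exists_bound_of_continuous
    hη.smooth.gradient.continuous
  exact ⟨max C 1, by positivity, fun h => (hC h).trans (le_max_left _ _)⟩

lemma exists_ge (hη : IsMollifier η) : ∃ c, 0 < c ∧ ∀ h, ‖h‖ ≤ 1 / 2 → c ≤ η h := by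
  obtain ⟨x, hx, hmin⟩ := (isCompact_closedBall (0 : Euc d) (1 / 2)).exists_isMinOn
    ⟨0, by simp⟩ hη.smooth.continuous.continuousOn
  refine ⟨η x, hη.pos x (by simpa using hx), fun h hh => hmin (by simpa using hh)⟩

lemma rescale (hη : IsMollifier η) {r : ℝ} (hr : 0 < r) :
    ContDiff ℝ ∞ (_root_.rescale η r) ∧ HasCompactSupport (_root_.rescale η r) ∧
    (∀ h, 0 ≤ _root_.rescale η r h) ∧ ∫ h, _root_.rescale η r h = 1 ∧
    (∀ h, r ≤ ‖h‖ → _root_.rescale η r h = 0) := by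
  have h0 : ∀ h : Euc d, r ≤ ‖h‖ → _root_.rescale η r h = 0 := fun h hh =>
    rescale_eq_zero hr hη.eq_zero (by simpa using hh)
  exact ⟨hη.smooth.rescale r, hasCompactSupport_of_eq_zero h0,
    fun h => mul_nonneg (by positivity) (hη.nonneg _),
    by rw [integral_rescale η hr, hη.integral_eq_one], h0⟩

end IsMollifier

/-! ### The anisotropic mollifier -/

section Alberti

variable {η : Euc d → ℝ} {Λ : ℝ} {A : Matrix (Fin d) (Fin d) ℝ}

lemma albertiMollifier_eq (h : Euc d) :
    albertiMollifier η Λ A h = Λ⁻¹ * ∫ l in (0 : ℝ)..Λ, η (flow A l h) := by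
  simp only [albertiMollifier, flow_apply]

lemma contDiff_comp_flow (hη : ContDiff ℝ ∞ η) :
    ContDiff ℝ ∞ (Function.uncurry fun (l : ℝ) (h : Euc d) => η (flow A l h)) :=
  hη.comp (contDiff_flow A)

lemma contDiff_albertiMollifier (hη : ContDiff ℝ ∞ η) :
    ContDiff ℝ ∞ (albertiMollifier η Λ A) := by
  rw [funext (albertiMollifier_eq (η := η) (Λ := Λ) (A := A))]
  exact contDiff_const.mul (contDiff_intervalIntegral_param (contDiff_comp_flow hη) 0 Λ).1

lemma fderiv_comp_flow (hη : ContDiff ℝ ∞ η) (l : ℝ) (h : Euc d) :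
    fderiv ℝ (fun h => η (flow A l h)) h = (fderiv ℝ η (flow A l h)).comp (flow A l) := by
  have h1 : HasFDerivAt η (fderiv ℝ η (flow A l h)) (flow A l h) :=
    (hη.differentiable (by simp) _).hasFDerivAt
  exact (h1.comp h (flow A l).hasFDerivAt).fderiv

lemma fderiv_albertiMollifier (hη : ContDiff ℝ ∞ η) (h : Euc d) :
    fderiv ℝ (albertiMollifier η Λ A) h =
      Λ⁻¹ • ∫ l in (0 : ℝ)..Λ, (fderiv ℝ η (flow A l h)).comp (flow A l) := by
  have := (contDiff_intervalIntegral_param (contDiff_comp_flow (A := A) hη) 0 Λ).2 h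
  simp only [fderiv_comp_flow hη] at this
  rw [funext (albertiMollifier_eq (η := η) (Λ := Λ) (A := A))]
  exact (this.const_mul Λ⁻¹).fderiv

lemma continuous_albertiMollifier (hη : ContDiff ℝ ∞ η) :
    Continuous fun p : Matrix (Fin d) (Fin d) ℝ × Euc d => albertiMollifier η Λ p.1 p.2 := by
  simp only [albertiMollifier_eq]
  refine continuous_const.mul ?_
  exact intervalIntegral.continuous_parametric_intervalIntegral_of_continuous'
    (f := fun (p : Matrix (Fin d) (Fin d) ℝ × Euc d) l => η (flow p.1 l p.2))
    (hη.continuous.comp continuous_flow) 0 Λ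

lemma continuous_gradient_albertiMollifier (hη : ContDiff ℝ ∞ η) :
    Continuous fun p : Matrix (Fin d) (Fin d) ℝ × Euc d =>
      gradient (albertiMollifier η Λ p.1) p.2 := by
  suffices h : Continuous fun p : Matrix (Fin d) (Fin d) ℝ × Euc d =>
      fderiv ℝ (albertiMollifier η Λ p.1) p.2 from
    (InnerProductSpace.toDual ℝ (Euc d)).symm.continuous.comp h
  simp only [fderiv_albertiMollifier hη]
  have h1 : Continuous fun p : (Matrix (Fin d) (Fin d) ℝ × Euc d) × ℝ =>
      fderiv ℝ η (flow p.1.1 p.2 p.1.2) := (hη.continuous_fderiv (by simp)).comp continuous_flow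
  have h2 : Continuous fun p : (Matrix (Fin d) (Fin d) ℝ × Euc d) × ℝ => flow p.1.1 p.2 :=
    continuous_flow_left.comp ((continuous_fst.comp continuous_fst).prodMk continuous_snd)
  have h3 := intervalIntegral.continuous_parametric_intervalIntegral_of_continuous' (μ := volume)
    (f := fun (p : Matrix (Fin d) (Fin d) ℝ × Euc d) l =>
      (fderiv ℝ η (flow p.1 l p.2)).comp (flow p.1 l)) (h1.clm_comp h2) 0 Λ
  exact h3.const_smul Λ⁻¹

lemma continuous_comp_flow_left (hη : ContDiff ℝ ∞ η) (h : Euc d) :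
    Continuous fun l => η (flow A l h) :=
  hη.continuous.comp ((contDiff_flow A).continuous.comp (continuous_id.prodMk continuous_const))

lemma albertiMollifier_nonneg (hη : IsMollifier η) (hΛ : 0 < Λ) (h : Euc d) :
    0 ≤ albertiMollifier η Λ A h := by
  rw [albertiMollifier_eq]
  refine mul_nonneg (inv_pos.2 hΛ).le ?_
  exact intervalIntegral.integral_nonneg hΛ.le fun l _ => hη.nonneg _

lemma albertiMollifier_le (hη : IsMollifier η) (hΛ : 0 < Λ) {H : ℝ} (hH : ∀ h, η h ≤ H)
    (h : Euc d) : albertiMollifier η Λ A h ≤ H := by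
  rw [albertiMollifier_eq]
  have h1 : ∫ l in (0 : ℝ)..Λ, η (flow A l h) ≤ ∫ _ in (0 : ℝ)..Λ, H :=
    intervalIntegral.integral_mono_on hΛ.le
      ((continuous_comp_flow_left hη.smooth h).intervalIntegrable _ _) (by simp) fun l _ => hH _
  rw [intervalIntegral.integral_const, sub_zero, smul_eq_mul] at h1
  rw [inv_mul_le_iff₀ hΛ]
  exact h1

lemma one_le_norm_flow (hA : frob A ≤ 1) {l : ℝ} (hl : l ∈ Set.Icc 0 Λ) {h : Euc d}
    (hh : Real.exp Λ ≤ ‖h‖) : 1 ≤ ‖flow A l h‖ := by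
  have h1 := norm_le_exp_mul_norm_flow hA l h
  have h2 : Real.exp |l| ≤ Real.exp Λ := by
    rw [abs_of_nonneg hl.1]; exact Real.exp_le_exp.2 hl.2
  have h3 : 0 < Real.exp |l| := Real.exp_pos _
  have h4 : Real.exp |l| * 1 ≤ Real.exp |l| * ‖flow A l h‖ := by linarith
  exact le_of_mul_le_mul_left h4 h3

lemma albertiMollifier_eq_zero (hη : IsMollifier η) (hΛ : 0 < Λ) (hA : frob A ≤ 1) {h : Euc d}
    (hh : Real.exp Λ ≤ ‖h‖) : albertiMollifier η Λ A h = 0 := by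
  rw [albertiMollifier_eq, intervalIntegral.integral_congr (g := fun _ => (0 : ℝ)) fun l hl => ?_]
  · simp
  · rw [Set.uIcc_of_le hΛ.le] at hl
    exact hη.eq_zero _ (one_le_norm_flow hA hl hh)

/-- At such a point the nonnegative mollifier vanishes, hence has a minimum. This argument also
covers the sphere ‖h‖ = e^Λ itself. -/
lemma gradient_albertiMollifier_eq_zero (hη : IsMollifier η) (hΛ : 0 < Λ) (hA : frob A ≤ 1)
    {h : Euc d} (hh : Real.exp Λ ≤ ‖h‖) : gradient (albertiMollifier η Λ A) h = 0 := by
  have : IsLocalMin (albertiMollifier η Λ A) h := Filter.Eventually.of_forall fun y => by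
    rw [albertiMollifier_eq_zero hη hΛ hA hh]; exact albertiMollifier_nonneg hη hΛ y
  rw [gradient, this.fderiv_eq_zero, map_zero]

lemma continuous_norm_gradient_comp_flow (hη : ContDiff ℝ ∞ η) :
    Continuous fun p : ℝ × Euc d => ‖gradient η (flow A p.1 p.2)‖ :=
  (hη.gradient.continuous.comp (contDiff_flow A).continuous).norm

lemma norm_gradient_albertiMollifier_le (hη : ContDiff ℝ ∞ η) (hΛ : 0 < Λ) (hA : frob A ≤ 1)
    (h : Euc d) : ‖gradient (albertiMollifier η Λ A) h‖ ≤
      Λ⁻¹ * (Real.exp Λ * ∫ l in (0 : ℝ)..Λ, ‖gradient η (flow A l h)‖) := by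
  rw [norm_gradient, fderiv_albertiMollifier hη, norm_smul, Real.norm_eq_abs,
    abs_of_pos (inv_pos.2 hΛ), ← intervalIntegral.integral_const_mul]
  refine mul_le_mul_of_nonneg_left ?_ (inv_pos.2 hΛ).le
  refine intervalIntegral.norm_integral_le_of_norm_le hΛ.le (Filter.Eventually.of_forall
    fun l hl => ?_) ?_
  · refine (ContinuousLinearMap.opNorm_comp_le _ _).trans ?_
    rw [mul_comm, norm_gradient]
    gcongr
    refine (norm_flow_le hA l).trans ?_
    rw [abs_of_pos hl.1]
    exact Real.exp_le_exp.2 hl.2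
  · exact (continuous_const.mul ((continuous_norm_gradient_comp_flow hη).comp
      (continuous_id.prodMk continuous_const))).intervalIntegrable _ _

lemma norm_gradient_albertiMollifier_le_const (hη : IsMollifier η) (hΛ : 0 < Λ) (hA : frob A ≤ 1)
    {H : ℝ} (hH : ∀ h, ‖gradient η h‖ ≤ H) (h : Euc d) :
    ‖gradient (albertiMollifier η Λ A) h‖ ≤ Real.exp Λ * H := by
  refine (norm_gradient_albertiMollifier_le hη.smooth hΛ hA h).trans ?_
  have h1 : ∫ l in (0 : ℝ)..Λ, ‖gradient η (flow A l h)‖ ≤ ∫ _ in (0 : ℝ)..Λ, H :=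
    intervalIntegral.integral_mono_on hΛ.le
      (((continuous_norm_gradient_comp_flow hη.smooth).comp
      (continuous_id.prodMk continuous_const)).intervalIntegrable _ _) (by simp) fun l _ => hH _
  rw [intervalIntegral.integral_const, sub_zero, smul_eq_mul] at h1
  rw [inv_mul_le_iff₀ hΛ]
  calc _ ≤ Real.exp Λ * (Λ * H) := by gcongr
    _ = _ := by ring

/-- Each map `flow A l` preserves volume, so all functions g ∘ `flow A l` have the same integral as
g, and so does their average over l. -/
lemma lintegral_lintegral_comp_flow (htr : A.trace = 0) (hΛ : 0 < Λ) {g : Euc d → ENNReal}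
    (hg : Measurable g) :
    ∫⁻ h, ENNReal.ofReal Λ⁻¹ * ∫⁻ l in Set.Ioc 0 Λ, g (flow A l h) = ∫⁻ h, g h := by
  have hmeas : Measurable (Function.uncurry fun (h : Euc d) (l : ℝ) => g (flow A l h)) :=
    hg.comp ((contDiff_flow A).continuous.measurable.comp measurable_swap)
  have hinner : ∀ l, ∫⁻ h, g (flow A l h) = ∫⁻ h, g h := fun l =>
    (measurePreserving_flow htr l).lintegral_comp_emb (measurableEmbedding_flow A l) g
  have h1 : Measurable fun h => ∫⁻ l in Set.Ioc 0 Λ, g (flow A l h) := hmeas.lintegral_prod_right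
  rw [lintegral_const_mul _ h1, lintegral_lintegral_swap hmeas.aemeasurable]
  simp only [hinner, lintegral_const, Measure.restrict_apply_univ, Real.volume_Ioc, sub_zero]
  rw [mul_comm (∫⁻ h, g h), ← mul_assoc, ← ENNReal.ofReal_mul (inv_pos.2 hΛ).le,
    inv_mul_cancel₀ hΛ.ne', ENNReal.ofReal_one, one_mul]

/-- The chain rule costs a factor ‖`flow A l`‖ ≤ e^Λ, while composition with the flow costs nothing
in L¹. This is why a single e^Λ, and no power e^{dΛ}, appears. -/
lemma lintegral_gradient_albertiMollifier_le (hη : IsMollifier η) (hΛ : 0 < Λ) (hA : frob A ≤ 1)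
    (htr : A.trace = 0) : ∫⁻ h, ‖gradient (albertiMollifier η Λ A) h‖ₑ ≤
      ENNReal.ofReal (Real.exp Λ) * ∫⁻ h, ‖gradient η h‖ₑ := by
  have hc := continuous_norm_gradient_comp_flow (A := A) hη.smooth
  have hpt : ∀ h, ‖gradient (albertiMollifier η Λ A) h‖ₑ ≤
      ENNReal.ofReal Λ⁻¹ * (ENNReal.ofReal (Real.exp Λ) *
        ∫⁻ l in Set.Ioc 0 Λ, ‖gradient η (flow A l h)‖ₑ) := fun h => by
    rw [← ofReal_norm]
    refine (ENNReal.ofReal_le_ofReal (norm_gradient_albertiMollifier_le hη.smooth hΛ hA h)).trans ?_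
    rw [ENNReal.ofReal_mul (inv_pos.2 hΛ).le, ENNReal.ofReal_mul (Real.exp_pos _).le,
      intervalIntegral.integral_of_le hΛ.le, ofReal_integral_eq_lintegral_ofReal]
    · simp [ofReal_norm]
    · exact ((hc.comp (continuous_id.prodMk continuous_const)).intervalIntegrable 0 Λ).1
    · exact Filter.Eventually.of_forall fun _ => norm_nonneg _
  rw [← lintegral_lintegral_comp_flow htr hΛ hη.smooth.gradient.continuous.measurable.enorm]
  rw [← lintegral_const_mul' _ _ ENNReal.ofReal_ne_top]
  refine lintegral_mono fun h => (hpt h).trans_eq ?_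
  rw [mul_left_comm]

lemma lintegral_albertiMollifier (hη : IsMollifier η) (hΛ : 0 < Λ) (htr : A.trace = 0) :
    ∫⁻ h, ENNReal.ofReal (albertiMollifier η Λ A h) = 1 := by
  have hpt : ∀ h, ENNReal.ofReal (albertiMollifier η Λ A h) =
      ENNReal.ofReal Λ⁻¹ * ∫⁻ l in Set.Ioc 0 Λ, ENNReal.ofReal (η (flow A l h)) := fun h => by
    rw [albertiMollifier_eq, ENNReal.ofReal_mul (inv_pos.2 hΛ).le,
      intervalIntegral.integral_of_le hΛ.le, ofReal_integral_eq_lintegral_ofReal]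
    · exact ((continuous_comp_flow_left hη.smooth h).intervalIntegrable 0 Λ).1
    · exact Filter.Eventually.of_forall fun _ => hη.nonneg _
  simp only [hpt]
  rw [lintegral_lintegral_comp_flow htr hΛ hη.smooth.continuous.measurable.ennreal_ofReal,
    ← ofReal_integral_eq_lintegral_ofReal hη.integrable (Filter.Eventually.of_forall hη.nonneg),
    hη.integral_eq_one, ENNReal.ofReal_one]

lemma integral_albertiMollifier (hη : IsMollifier η) (hΛ : 0 < Λ) (htr : A.trace = 0) :
    ∫ h, albertiMollifier η Λ A h = 1 := by
  rw [integral_eq_lintegral_of_nonneg_ae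
    (Filter.Eventually.of_forall (albertiMollifier_nonneg hη hΛ))
    (contDiff_albertiMollifier hη.smooth).continuous.aestronglyMeasurable,
    lintegral_albertiMollifier hη hΛ htr, ENNReal.toReal_one]

lemma flowGen_apply (A : Matrix (Fin d) (Fin d) ℝ) (h : Euc d) (j : Fin d) :
    flowGen A h j = -∑ i, h i * A i j := by
  have : flowGen A h j = ((-A.transpose).mulVec h.ofLp) j := rfl
  rw [this]
  simp [Matrix.mulVec, dotProduct, mul_comm]

lemma sandwich_eq_inner (h w : Euc d) : sandwich h A w = -inner ℝ (flowGen A h) w := by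
  rw [sandwich, Finset.sum_comm, PiLp.inner_apply, ← Finset.sum_neg_distrib]
  refine Finset.sum_congr rfl fun j _ => ?_
  rw [flowGen_apply]
  simp only [← Finset.sum_mul, RCLike.inner_apply, conj_trivial]
  ring

/-- The flow commutes with its generator -Aᵀ, so differentiating η along the orbit l ↦ `flow A l h`
gives the derivative of η ∘ `flow A l` at h in the direction -Aᵀh. The average over l in [0, Λ] is
then the integral of an exact derivative. This is the source of the factor 1/Λ in the bound for I₅'.
-/
lemma sandwich_gradient_albertiMollifier (hη : ContDiff ℝ ∞ η) (h : Euc d) :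
    sandwich h A (gradient (albertiMollifier η Λ A) h) = Λ⁻¹ * (η h - η (flow A Λ h)) := by
  rw [sandwich_eq_inner, inner_gradient, fderiv_albertiMollifier hη]
  have hc : Continuous fun l => (fderiv ℝ η (flow A l h)).comp (flow A l) :=
    Continuous.clm_comp ((hη.continuous_fderiv (by simp)).comp
      ((contDiff_flow A).continuous.comp (continuous_id.prodMk continuous_const)))
      (continuous_flow_left.comp (continuous_const.prodMk continuous_id))
  have hder : ∀ l, HasDerivAt (fun l => η (flow A l h))
      (fderiv ℝ η (flow A l h) (flow A l (flowGen A h))) l := fun l =>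
    ((hη.differentiable (by simp) _).hasFDerivAt).comp_hasDerivAt l (hasDerivAt_flow A l h)
  rw [smul_apply, ContinuousLinearMap.intervalIntegral_apply
    (hc.intervalIntegrable _ _)]
  simp only [ContinuousLinearMap.comp_apply]
  rw [intervalIntegral.integral_eq_sub_of_hasDerivAt (fun l _ => hder l)
    ((hc.clm_apply continuous_const).intervalIntegrable _ _), flow_zero, smul_eq_mul]
  simp only [one_apply_eq_self]
  ring

end Alberti

/-! ### Mollification -/

/-- Smooth compactly supported probability densities. -/
structure IsKernel (k : Euc d → ℝ) : Prop where
  smooth : ContDiff ℝ ∞ k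
  compact : HasCompactSupport k
  nonneg : ∀ h, 0 ≤ k h
  integral_eq_one : ∫ h, k h = 1

namespace IsKernel
variable {k : Euc d → ℝ}

lemma integrable (hk : IsKernel k) : Integrable k :=
  hk.smooth.continuous.integrable_of_hasCompactSupport hk.compact

lemma lintegral_eq_one (hk : IsKernel k) : ∫⁻ h, ENNReal.ofReal (k h) = 1 := by
  rw [← ofReal_integral_eq_lintegral_ofReal hk.integrable (Filter.Eventually.of_forall hk.nonneg),
    hk.integral_eq_one, ENNReal.ofReal_one]

lemma lintegral_enorm (hk : IsKernel k) : ∫⁻ h, ‖k h‖ₑ = 1 := by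
  rw [← hk.lintegral_eq_one]
  exact lintegral_congr fun h => Real.enorm_of_nonneg (hk.nonneg h)

end IsKernel

lemma IsMollifier.isKernel_rescale {η : Euc d → ℝ} (hη : IsMollifier η) {r : ℝ} (hr : 0 < r) :
    IsKernel (_root_.rescale η r) :=
  ⟨(hη.rescale hr).1, (hη.rescale hr).2.1, (hη.rescale hr).2.2.1, (hη.rescale hr).2.2.2.1⟩

/-- Lebesgue differentiation. One sequence of kernels serves all locally integrable functions and
all target spaces. -/
lemma exists_approx_kernels (d : ℕ) : ∃ k : ℕ → Euc d → ℝ, (∀ n, IsKernel (k n)) ∧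
    ∀ {F : Type} [NormedAddCommGroup F] [NormedSpace ℝ F] [CompleteSpace F] (f : Euc d → F),
      LocallyIntegrable f → ∀ᵐ x, Filter.Tendsto (fun n => mollify f (k n) x) Filter.atTop
        (nhds (f x)) := by
  let b : ℕ → ContDiffBump (0 : Euc d) := fun n =>
    -- The ratio of outer to inner radius stays equal to 2, as the differentiation theorem for bump
    -- functions requires.
    ⟨1 / (n + 1), 2 / (n + 1), by positivity, by
      rw [div_lt_div_iff_of_pos_right (by positivity)]; norm_num⟩
  refine ⟨fun n => (b n).normed volume, fun n => ⟨(b n).contDiff_normed,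
    (b n).hasCompactSupport_normed, (b n).nonneg_normed, (b n).integral_normed⟩, ?_⟩
  intro F _ _ _ f hf
  refine ContDiffBump.ae_convolution_tendsto_right_of_locallyIntegrable (φ := b) (K := 2) ?_ ?_ hf
  · have := (tendsto_one_div_add_atTop_nhds_zero_nat (𝕜 := ℝ)).const_mul 2
    simpa [b, div_eq_mul_inv] using this
  · exact Filter.Eventually.of_forall fun n => by simp [b, div_eq_mul_inv]

lemma locallyIntegrable_comp_sub_left {F : Type*} [NormedAddCommGroup F] {f : Euc d → F}
    (hf : LocallyIntegrable f) (x : Euc d) :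
    LocallyIntegrable fun h => f (x - h) := by
  rw [locallyIntegrable_iff] at hf ⊢
  intro K hK
  have hK' : IsCompact ((fun h => x - h) '' K) := hK.image (by fun_prop)
  have := ((Measure.measurePreserving_sub_left volume x).integrableOn_comp_preimage
    (MeasurableEquiv.subLeft x).measurableEmbedding).2 (hf _ hK')
  exact this.mono_set (Set.subset_preimage_image _ _)

section Mollify

variable {F : Type*} [NormedAddCommGroup F] [NormedSpace ℝ F] {f : Euc d → F} {k : Euc d → ℝ}

lemma mollify_apply (f : Euc d → F) (k : Euc d → ℝ) (x : Euc d) :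
    mollify f k x = ∫ h, k h • f (x - h) := rfl

lemma integrable_mollify_integrand (hf : LocallyIntegrable f) (hk : Continuous k)
    (hc : HasCompactSupport k) (x : Euc d) : Integrable fun h => k h • f (x - h) :=
  (locallyIntegrable_comp_sub_left hf x).integrable_smul_left_of_hasCompactSupport hk hc

lemma contDiff_mollify (hf : LocallyIntegrable f) (hk : ContDiff ℝ ∞ k)
    (hc : HasCompactSupport k) : ContDiff ℝ ∞ (mollify f k) :=
  hc.contDiff_convolution_left _ hk hf

lemma IsPeriodic.mollify (hf : IsPeriodic f) (k : Euc d → ℝ) : IsPeriodic (mollify f k) :=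
  fun x i => by
    rw [mollify_apply, mollify_apply]
    congr 1; ext h
    rw [add_sub_right_comm, hf]

lemma fderiv_mollify (hf : LocallyIntegrable f) (hk : ContDiff ℝ ∞ k)
    (hc : HasCompactSupport k) (x w : Euc d) :
    fderiv ℝ (mollify f k) x w = ∫ h, fderiv ℝ k h w • f (x - h) := by
  have h1 := hc.hasFDerivAt_convolution_left (ContinuousLinearMap.lsmul ℝ ℝ) (hk.of_le (by simp))
    hf x (μ := volume)
  have h2 : Integrable fun h => (ContinuousLinearMap.precompL (Euc d)
      (ContinuousLinearMap.lsmul ℝ ℝ : ℝ →L[ℝ] F →L[ℝ] F)) (fderiv ℝ k h) (f (x - h)) :=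
    (hc.fderiv (𝕜 := ℝ)).convolutionExists_left _ (hk.continuous_fderiv (by simp)) hf x
  rw [show mollify f k = convolution k f (ContinuousLinearMap.lsmul ℝ ℝ) volume from rfl,
    h1.fderiv, convolution, ContinuousLinearMap.integral_apply h2]
  rfl

lemma norm_mollify_le {C : ℝ} (hk : IsKernel k) (hf : ∀ x, ‖f x‖ ≤ C) (x : Euc d) :
    ‖mollify f k x‖ ≤ C := by
  rw [mollify_apply]
  refine (norm_integral_le_of_norm_le (hk.integrable.mul_const C)
    (Filter.Eventually.of_forall fun h => ?_)).trans_eq ?_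
  · rw [norm_smul, Real.norm_of_nonneg (hk.nonneg h)]
    exact mul_le_mul_of_nonneg_left (hf _) (hk.nonneg h)
  · rw [integral_mul_const, hk.integral_eq_one, one_mul]

end Mollify

lemma IsPeriodic.exists_eq_mem_cell {F : Type*} {f : Euc d → F} (hf : IsPeriodic f) (x : Euc d) :
    ∃ y ∈ cell d, f x = f y := by
  refine ⟨x - ZSpan.floor (stdBasis d) x, ?_, ?_⟩
  · rw [cell_eq_fundamentalDomain]
    exact ZSpan.fract_mem_fundamentalDomain _ x
  · have := hf.add_lattice (ZSpan.floor (stdBasis d) x).2 (x - ZSpan.floor (stdBasis d) x)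
    rwa [sub_add_cancel] at this

lemma IsPeriodic.exists_bound {F : Type*} [NormedAddCommGroup F] {f : Euc d → F}
    (hf : IsPeriodic f) (hc : Continuous f) : ∃ B, 0 < B ∧ ∀ x, ‖f x‖ ≤ B := by
  obtain ⟨B, hB⟩ := (isCompact_closedBall (0 : Euc d) d).exists_bound_of_continuousOn
    hc.continuousOn
  refine ⟨max B 1, by positivity, fun x => ?_⟩
  obtain ⟨y, hy, hxy⟩ := hf.exists_eq_mem_cell x
  rw [hxy]
  exact (hB _ (by simpa using norm_le_of_mem_cell hy)).trans (le_max_left _ _)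

/-- After Fubini, periodicity allows the shift by h to be moved from f to ψ for each h separately.
-/
lemma integral_cell_mul_translate {f ψ : Euc d → ℝ} {κ : Euc d → ℝ} (hf : IsPeriodic f)
    (hfi : Integrable f (torusMeasure d)) (hfm : Measurable f)
    (hψ : IsPeriodic ψ) (hψc : Continuous ψ) (hκ : Continuous κ) (hc : HasCompactSupport κ) :
    ∫ x in cell d, ψ x * ∫ h, κ h * f (x - h) = ∫ y in cell d, f y * ∫ h, κ h * ψ (y + h) := by
  obtain ⟨B, -, hB⟩ := hψ.exists_bound hψc
  have hmeas : Measurable (Function.uncurry fun (x h : Euc d) => κ h * (ψ x * f (x - h))) := by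
    have h1 := hκ.measurable; have h2 := hψc.measurable
    exact (h1.comp measurable_snd).mul ((h2.comp measurable_fst).mul
      (hfm.comp (measurable_fst.sub measurable_snd)))
  have hint : Integrable (Function.uncurry fun (x h : Euc d) => κ h * (ψ x * f (x - h)))
      ((volume.restrict (cell d)).prod volume) := by
    refine ⟨hmeas.aestronglyMeasurable, ?_⟩
    rw [HasFiniteIntegral, lintegral_prod _ hmeas.enorm.aemeasurable,
      lintegral_lintegral_swap hmeas.enorm.aemeasurable]
    have hle : ∀ h, ∫⁻ x in cell d, ‖κ h * (ψ x * f (x - h))‖ₑ ≤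
        ‖κ h‖ₑ * (ENNReal.ofReal B * ∫⁻ x in cell d, ‖f x‖ₑ) := fun h => by
      have hp : IsPeriodic fun x => ‖f x‖ₑ := fun x i => by simp only [hf x i]
      rw [← lintegral_cell_sub hp h, ← lintegral_const_mul' _ _ ENNReal.ofReal_ne_top,
        ← lintegral_const_mul' _ _ enorm_ne_top]
      refine lintegral_mono fun x => ?_
      rw [enorm_mul, enorm_mul]
      gcongr
      rw [← ofReal_norm]
      exact ENNReal.ofReal_le_ofReal (hB x)
    refine (lintegral_mono hle).trans_lt ?_
    have hfi' : ∫⁻ x in cell d, ‖f x‖ₑ < ⊤ := hfi.2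
    rw [lintegral_mul_const' _ _ (ENNReal.mul_ne_top ENNReal.ofReal_ne_top hfi'.ne)]
    exact ENNReal.mul_lt_top (hκ.integrable_of_hasCompactSupport hc).2
      (ENNReal.mul_lt_top ENNReal.ofReal_lt_top hfi')
  calc ∫ x in cell d, ψ x * ∫ h, κ h * f (x - h)
      = ∫ x in cell d, ∫ h, κ h * (ψ x * f (x - h)) := by
        congr 1; ext x
        rw [← integral_const_mul]
        congr 1; ext h; ring
    _ = ∫ h, ∫ x in cell d, κ h * (ψ x * f (x - h)) := integral_integral_swap hint
    _ = ∫ h, ∫ y in cell d, κ h * (ψ (y + h) * f y) := by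
        congr 1; ext h
        have hp : IsPeriodic fun x => κ h * (ψ x * f (x - h)) := fun x i => by
          simp only [hψ x i, add_sub_right_comm, hf (x - h) i]
        rw [← integral_cell_add hp h]
        simp
    _ = ∫ y in cell d, ∫ h, κ h * (ψ (y + h) * f y) := by
        refine (integral_integral_swap (f := fun y h => κ h * (ψ (y + h) * f y)) ?_).symm
        have hdom : Integrable (fun p : Euc d × Euc d => (B * ‖f p.1‖) * ‖κ p.2‖)
            ((volume.restrict (cell d)).prod volume) :=
          (Integrable.norm hfi |>.const_mul B).mul_prod
            (hκ.integrable_of_hasCompactSupport hc).norm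
        have h1 := hκ.measurable
        have h2 := hψc.measurable
        refine hdom.mono' (Measurable.aestronglyMeasurable ?_)
          (Filter.Eventually.of_forall fun p => ?_)
        · exact (h1.comp measurable_snd).mul ((h2.comp (measurable_fst.add measurable_snd)).mul
            (hfm.comp measurable_fst))
        · simp only [Function.uncurry, norm_mul]
          rw [mul_comm]
          gcongr
          exact hB _
    _ = _ := by
        congr 1; ext y
        rw [← integral_const_mul]
        congr 1; ext h; ring

/-! ### Matrices as Euclidean vectors -/

/-- A matrix as a vector of the Euclidean space of dimension `d²`. -/
def frobVec (A : Matrix (Fin d) (Fin d) ℝ) : EuclideanSpace ℝ (Fin d × Fin d) :=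
  WithLp.toLp 2 fun p => A p.1 p.2

lemma norm_frobVec (A : Matrix (Fin d) (Fin d) ℝ) : ‖frobVec A‖ = frob A := by
  rw [EuclideanSpace.norm_eq, frob, Fintype.sum_prod_type]
  simp [frobVec]

lemma inner_frobVec (A B : Matrix (Fin d) (Fin d) ℝ) :
    inner ℝ (frobVec A) (frobVec B) = ∑ i, ∑ j, A i j * B i j := by
  rw [PiLp.inner_apply, Fintype.sum_prod_type]
  simp [frobVec, mul_comm]

lemma frobVec_smul (c : ℝ) (A : Matrix (Fin d) (Fin d) ℝ) : frobVec (c • A) = c • frobVec A := rfl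

lemma frobVec_sub (A B : Matrix (Fin d) (Fin d) ℝ) : frobVec (A - B) = frobVec A - frobVec B := rfl

lemma frob_smul (c : ℝ) (A : Matrix (Fin d) (Fin d) ℝ) : frob (c • A) = |c| * frob A := by
  rw [← norm_frobVec, frobVec_smul, norm_smul, norm_frobVec, Real.norm_eq_abs]

lemma continuous_frobVec {X : Type*} [TopologicalSpace X] {A : X → Matrix (Fin d) (Fin d) ℝ}
    (hA : ∀ i j, Continuous fun x => A x i j) : Continuous fun x => frobVec (A x) :=
  (PiLp.continuous_toLp 2 _).comp (continuous_pi fun p => hA p.1 p.2)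

lemma continuous_frob {X : Type*} [TopologicalSpace X] {A : X → Matrix (Fin d) (Fin d) ℝ}
    (hA : ∀ i j, Continuous fun x => A x i j) : Continuous fun x => frob (A x) := by
  simp only [← norm_frobVec]
  exact (continuous_frobVec hA).norm

/-! ### Gradients of smooth vector fields -/

lemma gradMatrix_apply (v : Euc d → Euc d) (x : Euc d) (i j : Fin d) :
    gradMatrix v x i j = fderiv ℝ v x (EuclideanSpace.single i 1) j := rfl

lemma contDiff_gradMatrix {v : Euc d → Euc d} (hv : ContDiff ℝ ∞ v) (i j : Fin d) :
    ContDiff ℝ ∞ fun x => gradMatrix v x i j := by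
  have h : ContDiff ℝ ∞ fun x => fderiv ℝ v x (EuclideanSpace.single i 1) :=
    (hv.fderiv_right (m := ∞) le_rfl).clm_apply contDiff_const
  exact (contDiff_piLp 2).1 h j

lemma fderiv_apply_eq_sum (v : Euc d → Euc d) (x h : Euc d) (j : Fin d) :
    fderiv ℝ v x h j = ∑ i, h i * gradMatrix v x i j := by
  conv_lhs => rw [← (EuclideanSpace.basisFun (Fin d) ℝ).sum_repr h, map_sum]
  simp [gradMatrix_apply]

lemma sandwich_gradMatrix (v : Euc d → Euc d) (x h w : Euc d) :
    sandwich h (gradMatrix v x) w = inner ℝ (fderiv ℝ v x h) w := by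
  rw [sandwich, Finset.sum_comm, PiLp.inner_apply]
  refine Finset.sum_congr rfl fun j _ => ?_
  rw [fderiv_apply_eq_sum]
  simp only [← Finset.sum_mul, RCLike.inner_apply, conj_trivial]
  ring

lemma abs_sandwich_le (h : Euc d) (A : Matrix (Fin d) (Fin d) ℝ) (w : Euc d) :
    |sandwich h A w| ≤ ‖h‖ * frob A * ‖w‖ := by
  rw [sandwich_eq_inner, abs_neg]
  refine (abs_real_inner_le_norm _ _).trans ?_
  gcongr
  refine ((flowGen A).le_opNorm h).trans ?_
  rw [mul_comm]
  gcongr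
  exact norm_flowGen_le A

lemma norm_fderiv_apply_le (v : Euc d → Euc d) (x h : Euc d) :
    ‖fderiv ℝ v x h‖ ≤ ‖h‖ * frob (gradMatrix v x) := by
  rcases eq_or_ne (fderiv ℝ v x h) 0 with h0 | h0
  · rw [h0, norm_zero]
    exact mul_nonneg (norm_nonneg h) (frob_nonneg _)
  · have h1 := abs_sandwich_le h (gradMatrix v x) (fderiv ℝ v x h)
    rw [sandwich_gradMatrix, real_inner_self_eq_norm_mul_norm, abs_mul, abs_norm] at h1
    exact le_of_mul_le_mul_right h1 (norm_pos_iff.2 h0)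

lemma sub_eq_integral_fderiv {v : Euc d → Euc d} (hv : ContDiff ℝ ∞ v) (x h : Euc d) :
    v x - v (x - h) = ∫ s in (0 : ℝ)..1, fderiv ℝ v (x - s • h) h := by
  have hder : ∀ s : ℝ, HasDerivAt (fun s : ℝ => v (x - s • h)) (-(fderiv ℝ v (x - s • h) h)) s := by
    intro s
    have h1 : HasDerivAt (fun s : ℝ => x - s • h) (-h) s := by
      simpa using ((hasDerivAt_id s).smul_const h).const_sub x
    have h2 := ((hv.differentiable (by simp)) (x - s • h)).hasFDerivAt.comp_hasDerivAt s h1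
    exact h2.congr_deriv (map_neg _ _)
  have hcont : Continuous fun s : ℝ => fderiv ℝ v (x - s • h) h :=
    ((hv.continuous_fderiv (by simp)).comp (by fun_prop)).clm_apply continuous_const
  have := intervalIntegral.integral_eq_sub_of_hasDerivAt (a := 0) (b := 1) (fun s _ => hder s)
    (hcont.neg.intervalIntegrable _ _)
  rw [intervalIntegral.integral_neg] at this
  rw [← neg_inj, this]
  simp

lemma continuous_frob_gradMatrix {v : Euc d → Euc d} (hv : ContDiff ℝ ∞ v) :
    Continuous fun x => frob (gradMatrix v x) :=
  continuous_frob fun i j => (contDiff_gradMatrix hv i j).continuous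

lemma IsPeriodic.frob_gradMatrix {v : Euc d → Euc d} (hp : IsPeriodic v) :
    IsPeriodic fun x => frob (_root_.gradMatrix v x) := fun x i => by
  simp only [hp.gradMatrix x i]

lemma IsPeriodic.integrable_of_continuous {F : Type*} [NormedAddCommGroup F] [MeasurableSpace F]
    [BorelSpace F] [SecondCountableTopology F] {f : Euc d → F}
    (hp : IsPeriodic f) (hc : Continuous f) : Integrable f (torusMeasure d) := by
  obtain ⟨B, -, hB⟩ := hp.exists_bound hc
  exact (integrable_const B).mono' hc.aestronglyMeasurable (Filter.Eventually.of_forall hB)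

lemma gradNormL1_nonneg (v : Euc d → Euc d) : 0 ≤ gradNormL1 v :=
  integral_nonneg fun _ => frob_nonneg _

lemma lintegral_frob_gradMatrix {v : Euc d → Euc d} (hv : ContDiff ℝ ∞ v) (hp : IsPeriodic v) :
    ∫⁻ x in cell d, ENNReal.ofReal (frob (gradMatrix v x)) = ENNReal.ofReal (gradNormL1 v) := by
  rw [gradNormL1, ofReal_integral_eq_lintegral_ofReal]
  · exact hp.frob_gradMatrix.integrable_of_continuous (continuous_frob_gradMatrix hv)
  · exact Filter.Eventually.of_forall fun _ => frob_nonneg _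

/-- The increment is the integral of the derivative along the segment from x - h to x, and every
translate of |∇v| has the same integral over the cell. -/
lemma lintegral_sub_translate_le_of_contDiff {v : Euc d → Euc d} (hv : ContDiff ℝ ∞ v)
    (hp : IsPeriodic v) (h : Euc d) :
    ∫⁻ x in cell d, ‖v x - v (x - h)‖ₑ ≤ ENNReal.ofReal (‖h‖ * gradNormL1 v) := by
  have hcf := continuous_frob_gradMatrix hv
  have hpt : ∀ x, ‖v x - v (x - h)‖ₑ ≤ ∫⁻ s in Set.Ioc (0 : ℝ) 1,
      ENNReal.ofReal ‖h‖ * ENNReal.ofReal (frob (gradMatrix v (x - s • h))) := fun x => by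
    rw [sub_eq_integral_fderiv hv, intervalIntegral.integral_of_le zero_le_one]
    refine (enorm_integral_le_lintegral_enorm _).trans (lintegral_mono fun s => ?_)
    rw [← ofReal_norm, ← ENNReal.ofReal_mul (norm_nonneg h)]
    exact ENNReal.ofReal_le_ofReal (norm_fderiv_apply_le _ _ _)
  refine (lintegral_mono hpt).trans ?_
  have hm : Measurable (Function.uncurry fun (x : Euc d) (s : ℝ) =>
      ENNReal.ofReal ‖h‖ * ENNReal.ofReal (frob (gradMatrix v (x - s • h)))) :=
    ((hcf.comp (by fun_prop : Continuous fun p : Euc d × ℝ => p.1 - p.2 • h)).measurable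
      ).ennreal_ofReal.const_mul _
  rw [lintegral_lintegral_swap hm.aemeasurable]
  have hin : ∀ s : ℝ, ∫⁻ x in cell d, ENNReal.ofReal ‖h‖ *
      ENNReal.ofReal (frob (gradMatrix v (x - s • h))) =
      ENNReal.ofReal (‖h‖ * gradNormL1 v) := fun s => by
    have hpp : IsPeriodic fun x => ENNReal.ofReal (frob (gradMatrix v x)) := fun x i => by
      simp only [hp.gradMatrix x i]
    rw [lintegral_const_mul' _ _ ENNReal.ofReal_ne_top, lintegral_cell_sub hpp,
      lintegral_frob_gradMatrix hv hp, ENNReal.ofReal_mul (norm_nonneg h)]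
  simp only [hin, lintegral_const, Measure.restrict_apply_univ, Real.volume_Ioc, sub_zero,
    ENNReal.ofReal_one, mul_one, le_refl]

/-! ### Functions of bounded variation -/

/-- Measurable, periodic and integrable vector fields. -/
structure IsNiceField (u : Euc d → Euc d) : Prop where
  measurable : Measurable u
  periodic : IsPeriodic u
  integrable : Integrable u (torusMeasure d)

namespace IsNiceField

variable {u : Euc d → Euc d} {k : Euc d → ℝ}

lemma locallyIntegrable (hu : IsNiceField u) : LocallyIntegrable u :=
  hu.periodic.locallyIntegrable hu.integrable

lemma integrable_apply (hu : IsNiceField u) (j : Fin d) :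
    Integrable (fun x => u x j) (torusMeasure d) :=
  hu.integrable.mono ((measurable_coord j).comp hu.measurable |>.aestronglyMeasurable)
    (Filter.Eventually.of_forall fun x => PiLp.norm_apply_le (u x) j)

lemma periodic_apply (hu : IsNiceField u) (j : Fin d) : IsPeriodic fun x => u x j :=
  fun x i => by simp only [hu.periodic x i]

lemma measurable_apply (hu : IsNiceField u) (j : Fin d) : Measurable fun x => u x j :=
  (measurable_coord j).comp hu.measurable

lemma gradMatrix_mollify (hu : IsNiceField u) (hk : ContDiff ℝ ∞ k) (hc : HasCompactSupport k)
    (x : Euc d) (i j : Fin d) :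
    gradMatrix (mollify u k) x i j =
      ∫ h, fderiv ℝ k h (EuclideanSpace.single i 1) * u (x - h) j := by
  rw [gradMatrix_apply, fderiv_mollify hu.locallyIntegrable hk hc]
  have hint : Integrable fun h => fderiv ℝ k h (EuclideanSpace.single i 1) • u (x - h) :=
    integrable_mollify_integrand hu.locallyIntegrable
      ((hk.continuous_fderiv (by simp)).clm_apply continuous_const)
      ((hc.fderiv (𝕜 := ℝ)).comp_left (g := fun L : Euc d →L[ℝ] ℝ =>
        L (EuclideanSpace.single i 1)) rfl) x
  exact ((EuclideanSpace.proj (𝕜 := ℝ) j).integral_comp_comm hint).symm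

lemma contDiff_mollify (hu : IsNiceField u) (hk : ContDiff ℝ ∞ k) (hc : HasCompactSupport k) :
    ContDiff ℝ ∞ (mollify u k) := _root_.contDiff_mollify hu.locallyIntegrable hk hc

lemma of_contDiff {v : Euc d → Euc d} (hv : ContDiff ℝ ∞ v) (hp : IsPeriodic v) : IsNiceField v :=
  ⟨hv.continuous.measurable, hp, hp.integrable_of_continuous hv.continuous⟩

end IsNiceField

/-- The derivative sits on the kernel, and the translation is moved from u to ψ. Reflecting the
kernel turns the result into the gradient of a mollified test function, up to a sign. -/
lemma integral_cell_mul_gradMatrix_mollify {u : Euc d → Euc d} (hu : IsNiceField u)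
    {k : Euc d → ℝ} (hk : ContDiff ℝ ∞ k) (hc : HasCompactSupport k) {ψ : Euc d → ℝ}
    (hψ : IsTestFunction ψ) (i j : Fin d) :
    ∫ x in cell d, ψ x * gradMatrix (mollify u k) x i j =
      - ∫ y in cell d, u y j * gradient (mollify ψ fun h => k (-h)) y i := by
  simp only [hu.gradMatrix_mollify hk hc]
  rw [integral_cell_mul_translate (hu.periodic_apply j) (hu.integrable_apply j)
    (hu.measurable_apply j) hψ.2 hψ.1.continuous
    ((hk.continuous_fderiv (by simp)).clm_apply continuous_const)
    ((hc.fderiv (𝕜 := ℝ)).comp_left (g := fun L : Euc d →L[ℝ] ℝ =>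
        L (EuclideanSpace.single i 1)) rfl), ← integral_neg]
  congr 1; ext y
  have hk' : ContDiff ℝ ∞ fun h => k (-h) := hk.comp contDiff_neg
  have hc' : HasCompactSupport fun h => k (-h) := hc.comp_homeomorph (Homeomorph.neg _)
  rw [gradient_apply, fderiv_mollify hψ.1.continuous.locallyIntegrable hk' hc', ← mul_neg, ← integral_neg, ← integral_neg_eq_self]
  congr 2; ext h
  have : HasFDerivAt (fun h => k (-h)) (-fderiv ℝ k (-h)) h := by
    have h1 : HasFDerivAt k (fderiv ℝ k (-h)) (-h) := (hk.differentiable (by simp) _).hasFDerivAt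
    have h2 := h1.comp h (hasFDerivAt_id h).neg
    refine h2.congr_fderiv ?_
    ext w
    simp
  rw [this.fderiv]
  simp [sub_eq_add_neg]

lemma neg_mem_variationSet {u : Euc d → Euc d} {s : ℝ} (hs : s ∈ variationSet u) :
    -s ∈ variationSet u := by
  obtain ⟨Ψ, h1, h2, rfl⟩ := hs
  refine ⟨fun x => -Ψ x, fun i j => ⟨(h1 i j).1.neg, fun x i' => ?_⟩, fun x => ?_, ?_⟩
  · have := (h1 i j).2 x i'
    simp only [Matrix.neg_apply, this]
  · rw [frob_neg]; exact h2 x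
  · rw [← integral_neg]
    congr 1; ext x
    simp only [← Finset.sum_neg_distrib, gradient_apply, Matrix.neg_apply]
    refine Finset.sum_congr rfl fun i _ => Finset.sum_congr rfl fun j _ => ?_
    rw [fderiv_fun_neg]
    simp

lemma zero_mem_variationSet (u : Euc d → Euc d) : 0 ∈ variationSet u :=
  ⟨fun _ => 0, fun _ _ => ⟨contDiff_const, fun _ _ => rfl⟩, fun _ => by simp [frob], by
    simp⟩

lemma totalVariation_nonneg {u : Euc d → Euc d} (hb : BddAbove (variationSet u)) :
    0 ≤ totalVariation u := le_csSup hb (zero_mem_variationSet u)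

/-- Mollifying Ψ with the reflected kernel averages its values, so the constraint |Ψ| ≤ 1 survives
by convexity of the norm, and the pairing is minus an admissible number in the variation of u. -/
lemma integral_inner_gradMatrix_mollify_le {u : Euc d → Euc d} (hu : IsNiceField u)
    (hb : BddAbove (variationSet u)) {k : Euc d → ℝ} (hk : IsKernel k)
    {Ψ : Euc d → Matrix (Fin d) (Fin d) ℝ} (hΨ : ∀ i j, IsTestFunction fun x => Ψ x i j)
    (hΨ1 : ∀ x, frob (Ψ x) ≤ 1) :
    ∫ x in cell d, ∑ i, ∑ j, Ψ x i j * gradMatrix (mollify u k) x i j ≤ totalVariation u := by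
  have hk' : ContDiff ℝ ∞ fun h => k (-h) := hk.smooth.comp contDiff_neg
  have hc' : HasCompactSupport fun h => k (-h) := hk.compact.comp_homeomorph (Homeomorph.neg _)
  have hker : IsKernel fun h => k (-h) :=
    ⟨hk', hc', fun h => hk.nonneg _, by rw [integral_neg_eq_self (fun h => k h)]
                                        exact hk.integral_eq_one⟩
  set Φ : Euc d → Matrix (Fin d) (Fin d) ℝ :=
    fun y => Matrix.of fun i j => mollify (fun x => Ψ x i j) (fun h => k (-h)) y with hΦ
  have hΦt : ∀ i j, IsTestFunction fun x => Φ x i j := fun i j =>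
    ⟨contDiff_mollify (hΨ i j).1.continuous.locallyIntegrable hk' hc', (hΨ i j).2.mollify _⟩
  have hΨc : Continuous fun x => frobVec (Ψ x) :=
    continuous_frobVec fun i j => (hΨ i j).1.continuous
  have hΦ1 : ∀ x, frob (Φ x) ≤ 1 := fun x => by
    have : frobVec (Φ x) = mollify (fun x => frobVec (Ψ x)) (fun h => k (-h)) x := by
      ext p
      rw [mollify_apply]
      have hint := integrable_mollify_integrand hΨc.locallyIntegrable hk'.continuous hc' x
      exact (EuclideanSpace.proj (𝕜 := ℝ) p).integral_comp_comm hint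
    rw [← norm_frobVec, this]
    exact norm_mollify_le hker (fun x => (norm_frobVec _).trans_le (hΨ1 x)) x
  have hmem : ∫ x in cell d, ∑ i, ∑ j, u x j * gradient (fun y => Φ y i j) x i ∈ variationSet u :=
    ⟨Φ, hΦt, hΦ1, rfl⟩
  have hle := le_csSup hb (neg_mem_variationSet hmem)
  refine le_trans (le_of_eq ?_) hle
  have hI1 : ∀ i j, Integrable (fun x => Ψ x i j * gradMatrix (mollify u k) x i j)
      (volume.restrict (cell d)) := fun i j => by
    have hcont : ContDiff ℝ ∞ (mollify u k) := hu.contDiff_mollify hk.smooth hk.compact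
    refine IsPeriodic.integrable_of_continuous (fun x i' => ?_)
      ((hΨ i j).1.continuous.mul (contDiff_gradMatrix hcont i j).continuous)
    have := (hΨ i j).2 x i'
    simp only [this, (hu.periodic.mollify k).gradMatrix x i']
  have hI2 : ∀ i j, Integrable (fun x => u x j * gradient (fun y => Φ y i j) x i)
      (volume.restrict (cell d)) := fun i j => by
    have hgc : Continuous (gradient fun y => Φ y i j) := (hΦt i j).1.gradient.continuous
    obtain ⟨B, -, hB⟩ := ((hΦt i j).2.gradient).exists_bound hgc
    refine (hu.integrable_apply j).mul_bdd (c := B)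
      ((measurable_coord i).comp hgc.measurable).aestronglyMeasurable
      (Filter.Eventually.of_forall fun x => (PiLp.norm_apply_le _ i).trans (hB x))
  rw [integral_finsetSum _ fun i _ => integrable_finsetSum _ fun j _ => hI1 i j,
    integral_finsetSum _ fun i _ => integrable_finsetSum _ fun j _ => hI2 i j,
    ← Finset.sum_neg_distrib]
  refine Finset.sum_congr rfl fun i _ => ?_
  rw [integral_finsetSum _ fun j _ => hI1 i j, integral_finsetSum _ fun j _ => hI2 i j,
    ← Finset.sum_neg_distrib]
  refine Finset.sum_congr rfl fun j _ => ?_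
  exact integral_cell_mul_gradMatrix_mollify hu hk.smooth hk.compact (hΨ i j) i j

/-- The optimal direction G/|G| for G = ∇(u*k) need not be smooth. The field G/√(|G|² + τ²) is
smooth, has norm at most 1, and recovers the integral of |G| up to τ. -/
lemma gradNormL1_mollify_le {u : Euc d → Euc d} (hu : IsNiceField u)
    (hb : BddAbove (variationSet u)) {k : Euc d → ℝ} (hk : IsKernel k) :
    gradNormL1 (mollify u k) ≤ totalVariation u := by
  have hv : ContDiff ℝ ∞ (mollify u k) := hu.contDiff_mollify hk.smooth hk.compact
  have hp := hu.periodic.mollify k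
  set G := gradMatrix (mollify u k) with hG
  refine le_of_forall_pos_le_add fun τ hτ => ?_
  have hpos : ∀ x, 0 < frob (G x) ^ 2 + τ ^ 2 := fun x => by positivity
  have hroot : ContDiff ℝ ∞ fun x => √(frob (G x) ^ 2 + τ ^ 2) := by
    refine ContDiff.sqrt (ContDiff.add ?_ contDiff_const) fun x => (hpos x).ne'
    simp only [frob_sq]
    exact ContDiff.sum fun i _ => ContDiff.sum fun j _ => (contDiff_gradMatrix hv i j).pow 2
  have hΨ : ∀ i j, IsTestFunction fun x => ((√(frob (G x) ^ 2 + τ ^ 2))⁻¹ • G x) i j := fun i j => by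
    refine ⟨?_, fun x i' => ?_⟩
    · exact (hroot.inv fun x => (Real.sqrt_pos.2 (hpos x)).ne').mul (contDiff_gradMatrix hv i j)
    · simp only [hG, hp.gradMatrix x i']
  have h1 := integral_inner_gradMatrix_mollify_le hu hb hk hΨ fun x => by
    rw [frob_smul, abs_of_nonneg (by positivity), inv_mul_le_iff₀ (Real.sqrt_pos.2 (hpos x)), mul_one]
    exact Real.le_sqrt_of_sq_le (by nlinarith [sq_nonneg τ])
  have hfc := continuous_frob_gradMatrix hv
  have hint : Integrable (fun x => frob (G x)) (volume.restrict (cell d)) :=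
    hp.frob_gradMatrix.integrable_of_continuous hfc
  have h2 : ∫ x in cell d, (frob (G x) - τ) ≤
      ∫ x in cell d, ∑ i, ∑ j, ((√(frob (G x) ^ 2 + τ ^ 2))⁻¹ • G x) i j * G x i j := by
    refine integral_mono (hint.sub (integrable_const τ)) ?_ fun x => ?_
    · refine integrable_finsetSum _ fun i _ => integrable_finsetSum _ fun j _ => ?_
      refine IsPeriodic.integrable_of_continuous (fun x i' => ?_)
        ((hΨ i j).1.continuous.mul (contDiff_gradMatrix hv i j).continuous)
      simp only [hG, hp.gradMatrix x i']
    · have hs := Real.sqrt_pos.2 (hpos x)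
      have hs2 := Real.sq_sqrt (hpos x).le
      simp only [Matrix.smul_apply, smul_eq_mul, mul_assoc, ← Finset.mul_sum]
      have : ∑ i, ∑ j, G x i j * G x i j = frob (G x) ^ 2 := by
        rw [frob_sq]; simp only [sq]
      rw [this, le_inv_mul_iff₀ hs]
      -- The claim (|G| - τ)√(|G|² + τ²) ≤ |G|² is trivial if |G| ≤ τ; otherwise the root is at most
      -- |G| + τ and the product at most |G|² - τ².
      have hle : √(frob (G x) ^ 2 + τ ^ 2) ≤ frob (G x) + τ := by
        refine Real.sqrt_le_iff.2 ⟨by have := frob_nonneg (G x); positivity, ?_⟩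
        nlinarith [frob_nonneg (G x)]
      by_cases hc : frob (G x) ≤ τ
      · nlinarith [sq_nonneg (frob (G x))]
      · push Not at hc
        nlinarith [sq_nonneg τ]
  rw [integral_sub hint (integrable_const τ), integral_const, measureReal_restrict_apply_univ,
    measureReal_def, volume_cell] at h2
  simp only [ENNReal.toReal_one, smul_eq_mul, one_mul] at h2
  rw [gradNormL1]
  linarith

/-- The smooth case applies to mollifications of u, whose gradients do not exceed the total
variation; Fatou passes to the limit. -/
lemma lintegral_sub_translate_le {u : Euc d → Euc d} (hu : IsNiceField u)
    (hb : BddAbove (variationSet u)) (h : Euc d) :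
    ∫⁻ x in cell d, ‖u x - u (x - h)‖ₑ ≤ ENNReal.ofReal (‖h‖ * totalVariation u) := by
  obtain ⟨k, hk, hlim⟩ := exists_approx_kernels d
  have h0 : ∀ᵐ x, Filter.Tendsto (fun n => mollify u (k n) x) Filter.atTop (nhds (u x)) :=
    hlim u hu.locallyIntegrable
  have h1 : ∀ᵐ x, Filter.Tendsto (fun n => mollify u (k n) (x - h)) Filter.atTop
      (nhds (u (x - h))) :=
    (measurePreserving_sub_right volume h).quasiMeasurePreserving.ae h0
  have hsm : ∀ n, ContDiff ℝ ∞ (mollify u (k n)) := fun n =>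
    hu.contDiff_mollify (hk n).smooth (hk n).compact
  calc ∫⁻ x in cell d, ‖u x - u (x - h)‖ₑ
      ≤ ∫⁻ x in cell d, Filter.liminf (fun n => ‖mollify u (k n) x - mollify u (k n) (x - h)‖ₑ)
          Filter.atTop := by
        refine lintegral_mono_ae (ae_restrict_of_ae ?_)
        filter_upwards [h0, h1] with x hx hx'
        exact ((hx.sub hx').enorm.liminf_eq).ge
    _ ≤ Filter.liminf (fun n => ∫⁻ x in cell d,
          ‖mollify u (k n) x - mollify u (k n) (x - h)‖ₑ) Filter.atTop :=
        lintegral_liminf_le fun n => ((hsm n).continuous.measurable.sub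
          ((hsm n).continuous.measurable.comp (measurable_id.sub_const h))).enorm
    _ ≤ ENNReal.ofReal (‖h‖ * totalVariation u) := by
        refine Filter.liminf_le_of_le (by isBoundedDefault) fun b hb' => ?_
        obtain ⟨n, hn⟩ := hb'.exists
        refine hn.trans ((lintegral_sub_translate_le_of_contDiff (hsm n)
          (hu.periodic.mollify _) h).trans ?_)
        gcongr
        exact gradNormL1_mollify_le hu hb (hk n)

lemma IsPeriodic.enorm {F : Type*} [NormedAddCommGroup F] {f : Euc d → F} (hf : IsPeriodic f) :
    IsPeriodic fun x => ‖f x‖ₑ := fun x i => by simp only [hf x i]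

lemma enorm_sub_mollify_le {F : Type*} [NormedAddCommGroup F] [NormedSpace ℝ F] [CompleteSpace F]
    {f : Euc d → F} (hf : LocallyIntegrable f) {k : Euc d → ℝ} (hk : IsKernel k) (x : Euc d) :
    ‖f x - mollify f k x‖ₑ ≤ ∫⁻ h, ‖k h‖ₑ * ‖f x - f (x - h)‖ₑ := by
  have : f x - mollify f k x = ∫ h, k h • (f x - f (x - h)) := by
    simp only [smul_sub]
    rw [integral_sub (hk.integrable.smul_const _)
      (integrable_mollify_integrand hf hk.smooth.continuous hk.compact x),
      integral_smul_const, hk.integral_eq_one, one_smul, mollify_apply]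
  rw [this]
  refine (enorm_integral_le_lintegral_enorm _).trans_eq ?_
  simp only [enorm_smul]

/-- The difference is an average of increments u(x) - u(x-h) over ‖h‖ < r, each bounded in L¹ by r
times the total variation. -/
lemma lintegral_sub_mollify_le {u : Euc d → Euc d} (hu : IsNiceField u)
    (hb : BddAbove (variationSet u)) {k : Euc d → ℝ} (hk : IsKernel k) {r : ℝ}
    (hr : ∀ h, r ≤ ‖h‖ → k h = 0) :
    ∫⁻ x in cell d, ‖u x - mollify u k x‖ₑ ≤ ENNReal.ofReal (r * totalVariation u) := by
  refine (lintegral_mono fun x => enorm_sub_mollify_le hu.locallyIntegrable hk x).trans ?_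
  have hm : Measurable (Function.uncurry fun x h : Euc d => ‖k h‖ₑ * ‖u x - u (x - h)‖ₑ) :=
    (hk.smooth.continuous.measurable.comp measurable_snd).enorm.mul
      ((hu.measurable.comp measurable_fst).sub
        (hu.measurable.comp (measurable_fst.sub measurable_snd))).enorm
  rw [lintegral_lintegral_swap hm.aemeasurable]
  calc ∫⁻ h, ∫⁻ x in cell d, ‖k h‖ₑ * ‖u x - u (x - h)‖ₑ
      ≤ ∫⁻ h, ‖k h‖ₑ * ENNReal.ofReal (r * totalVariation u) := by
        refine lintegral_mono fun h => ?_
        simp only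
        rw [lintegral_const_mul' _ _ enorm_ne_top]
        by_cases hh : r ≤ ‖h‖
        · simp [hr h hh]
        · gcongr
          refine (lintegral_sub_translate_le hu hb h).trans (ENNReal.ofReal_le_ofReal ?_)
          exact mul_le_mul_of_nonneg_right (le_of_lt (not_le.1 hh)) (totalVariation_nonneg hb)
    _ = ENNReal.ofReal (r * totalVariation u) := by
        rw [lintegral_mul_const' _ _ ENNReal.ofReal_ne_top, hk.lintegral_enorm, one_mul]

lemma lintegral_enorm_mollify_le {u : Euc d → Euc d} (hu : IsNiceField u) {k : Euc d → ℝ}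
    (hk : IsKernel k) : ∫⁻ x in cell d, ‖mollify u k x‖ₑ ≤ ∫⁻ x in cell d, ‖u x‖ₑ := by
  have hpt : ∀ x, ‖mollify u k x‖ₑ ≤ ∫⁻ h, ‖k h‖ₑ * ‖u (x - h)‖ₑ := fun x => by
    rw [mollify_apply]
    refine (enorm_integral_le_lintegral_enorm _).trans_eq ?_
    simp only [enorm_smul]
  refine (lintegral_mono hpt).trans ?_
  have hm : Measurable (Function.uncurry fun x h : Euc d => ‖k h‖ₑ * ‖u (x - h)‖ₑ) :=
    (hk.smooth.continuous.measurable.comp measurable_snd).enorm.mul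
      (hu.measurable.comp (measurable_fst.sub measurable_snd)).enorm
  rw [lintegral_lintegral_swap hm.aemeasurable]
  refine le_of_eq ?_
  calc ∫⁻ h, ∫⁻ x in cell d, ‖k h‖ₑ * ‖u (x - h)‖ₑ
      = ∫⁻ h, ‖k h‖ₑ * ∫⁻ x in cell d, ‖u x‖ₑ := by
        refine lintegral_congr fun h => ?_
        rw [lintegral_const_mul' _ _ enorm_ne_top, lintegral_cell_sub hu.periodic.enorm]
    _ = _ := by
        have hfin : ∫⁻ x in cell d, ‖u x‖ₑ ≠ ⊤ := hu.integrable.2.ne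
        rw [lintegral_mul_const' _ _ hfin, hk.lintegral_enorm, one_mul]

/-- A Poincaré inequality. The deviation u(x) - ∫u is the mean of u(x) - u(x+h) over h in the cell,
and such h have norm at most d. -/
lemma lintegral_enorm_le {u : Euc d → Euc d} (hu : IsNiceField u)
    (hb : BddAbove (variationSet u)) :
    ∫⁻ x in cell d, ‖u x‖ₑ ≤ ENNReal.ofReal (d * totalVariation u + ‖∫ x in cell d, u x‖) := by
  have hint : Integrable u (volume.restrict (cell d)) := hu.integrable
  have hpt : ∀ x, ‖u x‖ₑ ≤ (∫⁻ h in cell d, ‖u x - u (x - -h)‖ₑ) + ‖∫ x in cell d, u x‖ₑ := by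
    intro x
    have h1 : u x = (∫ y in cell d, (u x - u y)) + ∫ y in cell d, u y := by
      rw [integral_sub (integrable_const _) hint]
      simp
    conv_lhs => rw [h1]
    refine (enorm_add_le _ _).trans ?_
    gcongr
    refine (enorm_integral_le_lintegral_enorm _).trans_eq ?_
    have hp : IsPeriodic fun y => ‖u x - u y‖ₑ := fun y i => by simp only [hu.periodic y i]
    rw [← lintegral_cell_add hp x]
    refine lintegral_congr fun h => ?_
    rw [sub_neg_eq_add, add_comm]
  refine (lintegral_mono hpt).trans ?_
  have hm : Measurable (Function.uncurry fun x h : Euc d => ‖u x - u (x - -h)‖ₑ) :=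
    ((hu.measurable.comp measurable_fst).sub
      (hu.measurable.comp (measurable_fst.sub measurable_snd.neg))).enorm
  rw [lintegral_add_right _ measurable_const, lintegral_lintegral_swap hm.aemeasurable,
    ENNReal.ofReal_add (by have := totalVariation_nonneg hb; positivity) (norm_nonneg _)]
  gcongr
  · calc ∫⁻ h in cell d, ∫⁻ x in cell d, ‖u x - u (x - -h)‖ₑ
        ≤ ∫⁻ h in cell d, ENNReal.ofReal (d * totalVariation u) := by
          refine setLIntegral_mono measurable_const fun h hh => ?_
          refine (lintegral_sub_translate_le hu hb _).trans (ENNReal.ofReal_le_ofReal ?_)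
          rw [norm_neg]
          exact mul_le_mul_of_nonneg_right (norm_le_of_mem_cell hh) (totalVariation_nonneg hb)
      _ = _ := by simp
  · simp [ofReal_norm]

lemma exists_lintegral_closedBall_le (d : ℕ) (r : ℝ) : ∃ N : ℕ, ∀ f : Euc d → ENNReal,
    IsPeriodic f → ∫⁻ x in Metric.closedBall 0 r, f x ≤ N * ∫⁻ x in cell d, f x := by
  obtain ⟨s, hs, hr⟩ := exists_finite_cover_cell (d := d) r
  refine ⟨hs.toFinset.card, fun f hf => ?_⟩
  have hr' : Metric.closedBall (0 : Euc d) r ⊆ ⋃ g ∈ hs.toFinset, (g : Euc d) +ᵥ cell d := by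
    simpa using hr
  have hle : ∀ t : Finset (intLattice d), ∫⁻ x in ⋃ g ∈ t, (g : Euc d) +ᵥ cell d, f x ≤
      ∑ g ∈ t, ∫⁻ x in (g : Euc d) +ᵥ cell d, f x := fun t => by
    classical
    induction t using Finset.induction_on with
    | empty => simp
    | insert a t ha ih =>
      rw [Finset.set_biUnion_insert, Finset.sum_insert ha]
      exact (lintegral_union_le _ _ _).trans (by gcongr)
  refine (lintegral_mono_set hr').trans ((hle _).trans ?_)
  rw [← nsmul_eq_mul, ← Finset.sum_const]
  refine Finset.sum_le_sum fun g _ => le_of_eq ?_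
  exact (isAddFundamentalDomain_vadd_cell _).setLIntegral_eq isAddFundamentalDomain_cell f hf.vadd

/-- The Sobolev inequality for smooth periodic fields. -/
lemma exists_eLpNorm_le_of_contDiff (d : ℕ) {p : NNReal} (hp : (d : NNReal).HolderConjugate p) :
    ∃ C : NNReal, ∀ w : Euc d → Euc d, ContDiff ℝ ∞ w → IsPeriodic w →
      eLpNorm w p (torusMeasure d) ≤ C * (ENNReal.ofReal (gradNormL1 w) + ∫⁻ x in cell d, ‖w x‖ₑ) := by
  -- The cell lies in the ball of radius d, so this cutoff equals 1 on it. The whole-space Sobolev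
  -- inequality is applied to the product of w with the cutoff.
  let χ : ContDiffBump (0 : Euc d) := ⟨d + 1, d + 2, by positivity, by linarith⟩
  have hχ : ContDiff ℝ ∞ χ := χ.contDiff
  obtain ⟨B, hB⟩ := (χ.hasCompactSupport.fderiv (𝕜 := ℝ)).exists_bound_of_continuous
    (hχ.continuous_fderiv (by simp))
  obtain ⟨N, hN⟩ := exists_lintegral_closedBall_le d (d + 2)
  set C0 := eLpNormLESNormFDerivOneConst (volume : Measure (Euc d)) p
  refine ⟨C0 * N * max 1 B.toNNReal, fun w hw hwp => ?_⟩
  have hcell : ∀ x ∈ cell d, χ x • w x = w x := fun x hx => by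
    rw [χ.one_of_mem_closedBall, one_smul]
    have := norm_le_of_mem_cell hx
    simp only [Metric.mem_closedBall, dist_zero_right]
    change _ ≤ (d : ℝ) + 1
    linarith
  have hsm : ContDiff ℝ ∞ fun x => χ x • w x := hχ.smul hw
  have hcs : HasCompactSupport fun x => χ x • w x := χ.hasCompactSupport.smul_right
  have h1 : eLpNorm w p (torusMeasure d) ≤ eLpNorm (fun x => χ x • w x) p volume := by
    rw [← eLpNorm_congr_ae (f := fun x => χ x • w x)]
    · exact eLpNorm_mono_measure _ Measure.restrict_le_self
    · exact (ae_restrict_iff' measurableSet_cell).2 (Filter.Eventually.of_forall hcell)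
  have h2 := eLpNorm_le_eLpNorm_fderiv_one volume (hsm.of_le (by simp)) hcs
    (p := p) (by simpa using hp)
  refine h1.trans (h2.trans ?_)
  rw [eLpNorm_one_eq_lintegral_enorm]
  -- Product rule: |∇w| comes with a factor at most 1 and |w| with the bound for the derivative of
  -- the cutoff. Both live in the ball of radius d + 2, which finitely many cells cover.
  have hder : ∀ x, ‖fderiv ℝ (fun x => χ x • w x) x‖ₑ ≤
      (Metric.closedBall (0 : Euc d) (d + 2)).indicator
        (fun x => (max 1 B.toNNReal : NNReal) *
          (ENNReal.ofReal (frob (gradMatrix w x)) + ‖w x‖ₑ)) x := by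
    intro x
    by_cases hx : x ∈ Metric.closedBall (0 : Euc d) (d + 2)
    · rw [Set.indicator_of_mem hx, fderiv_fun_smul (hχ.differentiable (by simp) x)
        (hw.differentiable (by simp) x)]
      refine (enorm_add_le (E := Euc d →L[ℝ] Euc d) _ _).trans ?_
      rw [mul_add]
      gcongr
      · rw [enorm_smul]
        gcongr
        · refine le_trans ?_ (ENNReal.coe_le_coe.2 (le_max_left _ _))
          rw [ENNReal.coe_one, Real.enorm_of_nonneg χ.nonneg, ← ENNReal.ofReal_one]
          exact ENNReal.ofReal_le_ofReal χ.le_one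
        · rw [← ofReal_norm]
          refine ENNReal.ofReal_le_ofReal (ContinuousLinearMap.opNorm_le_bound _ (frob_nonneg _) ?_)
          intro h
          rw [mul_comm]
          exact norm_fderiv_apply_le w x h
      · rw [← ofReal_norm, ContinuousLinearMap.norm_smulRight_apply,
          ENNReal.ofReal_mul (norm_nonneg _), ofReal_norm (w x)]
        gcongr
        refine le_trans ?_ (ENNReal.coe_le_coe.2 (le_max_right _ _))
        exact ENNReal.ofReal_le_ofReal (hB x)
    · rw [Set.indicator_of_notMem hx]
      have hnot : x ∉ tsupport fun x => χ x • w x := fun hmem => hx <| by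
        have := tsupport_smul_subset_left χ w hmem
        rwa [χ.tsupport_eq] at this
      rw [fderiv_of_notMem_tsupport (𝕜 := ℝ) hnot]
      exact (enorm_zero (E := Euc d →L[ℝ] Euc d)).le
  have hcont := continuous_frob_gradMatrix hw
  have h3 : ∫⁻ x, ‖fderiv ℝ (fun x => χ x • w x) x‖ₑ ≤ (max 1 B.toNNReal : NNReal) * (N *
      (ENNReal.ofReal (gradNormL1 w) + ∫⁻ x in cell d, ‖w x‖ₑ)) := by
    refine (lintegral_mono hder).trans ?_
    rw [lintegral_indicator Metric.isClosed_closedBall.measurableSet,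
      lintegral_const_mul' _ _ ENNReal.coe_ne_top]
    gcongr
    refine (hN _ fun x i => ?_).trans_eq ?_
    · simp only [hwp.gradMatrix x i, hwp x i]
    · rw [lintegral_add_left hcont.measurable.ennreal_ofReal, lintegral_frob_gradMatrix hw hwp]
  refine (mul_le_mul_right h3 _).trans_eq ?_
  push_cast
  ring

/-- The Sobolev inequality in `BV`. -/
lemma exists_eLpNorm_le (d : ℕ) {p : NNReal} (hp : (d : NNReal).HolderConjugate p) :
    ∃ C : ℝ, 0 < C ∧ ∀ u : Euc d → Euc d, IsNiceField u → BddAbove (variationSet u) →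
      eLpNorm u p (torusMeasure d) ≤
        ENNReal.ofReal (C * (totalVariation u + ‖∫ x in cell d, u x‖)) := by
  obtain ⟨C, hC⟩ := exists_eLpNorm_le_of_contDiff d hp
  -- C + 1 makes the constant positive; d + 1 collects one total variation from the gradient and d
  -- of them from the Poincaré bound for ∫|u|.
  refine ⟨(C + 1) * (d + 1), by positivity, fun u hu hb => ?_⟩
  obtain ⟨k, hk, hlim⟩ := exists_approx_kernels d
  have htv := totalVariation_nonneg hb
  have hsm : ∀ n, ContDiff ℝ ∞ (mollify u (k n)) := fun n =>
    hu.contDiff_mollify (hk n).smooth (hk n).compact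
  have h0 : ∀ᵐ x ∂torusMeasure d, Filter.Tendsto (fun n => mollify u (k n) x) Filter.atTop
      (nhds (u x)) := ae_restrict_of_ae (hlim u hu.locallyIntegrable)
  -- Lower semicontinuity of the L^p norm under almost everywhere convergence of the mollifications.
  refine (Lp.eLpNorm_lim_le_liminf_eLpNorm (fun n =>
    (hsm n).continuous.aestronglyMeasurable) u h0).trans ?_
  refine Filter.liminf_le_of_le (by isBoundedDefault) fun b hb' => ?_
  obtain ⟨n, hn⟩ := hb'.exists
  refine hn.trans ((hC _ (hsm n) (hu.periodic.mollify _)).trans ?_)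
  have h1 : ENNReal.ofReal (gradNormL1 (mollify u (k n))) + ∫⁻ x in cell d, ‖mollify u (k n) x‖ₑ ≤
      ENNReal.ofReal (totalVariation u + (d * totalVariation u + ‖∫ x in cell d, u x‖)) := by
    rw [ENNReal.ofReal_add htv (by positivity)]
    gcongr
    · exact gradNormL1_mollify_le hu hb (hk n)
    · exact (lintegral_enorm_mollify_le hu (hk n)).trans (lintegral_enorm_le hu hb)
  refine (mul_le_mul_right h1 _).trans ?_
  rw [← ENNReal.ofReal_coe_nnreal, ← ENNReal.ofReal_mul C.coe_nonneg]
  refine ENNReal.ofReal_le_ofReal ?_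
  rw [mul_assoc]
  refine mul_le_mul (by simp) ?_ (by positivity) (by positivity)
  have : 0 ≤ (d : ℝ) * ‖∫ x in cell d, u x‖ := by positivity
  linarith

/-! ### Periodization -/

section Periodize

variable {F G : Type*} [NormedAddCommGroup F] [NormedAddCommGroup G]

/-- The sum of the integer translates of a compactly supported function. -/
def periodize (ψ : Euc d → F) (x : Euc d) : F := ∑ᶠ g : intLattice d, ψ (g +ᵥ x)

/-- A single finite set of lattice vectors works for all functions vanishing outside radius R and
all points of the ball of radius r. On bounded sets a periodisation can therefore be differentiated
and integrated term by term. -/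
lemma exists_periodize_eq_sum (d : ℕ) (R r : ℝ) : ∃ s : Finset (intLattice d),
    (∀ g ∉ s, ∀ x : Euc d, ‖x‖ ≤ r → R < ‖g +ᵥ x‖) ∧
    ∀ {F : Type} [NormedAddCommGroup F] (ψ : Euc d → F),
      (∀ h, R < ‖h‖ → ψ h = 0) → ∀ x, ‖x‖ ≤ r → periodize ψ x = ∑ g ∈ s, ψ (g +ᵥ x) := by
  have hfin : {g : intLattice d | ‖(g : Euc d)‖ ≤ R + r}.Finite := by
    have := ZSpan.setFinite_inter (stdBasis d) (Metric.isBounded_closedBall (x := (0 : Euc d))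
      (r := R + r))
    refine Set.Finite.of_finite_image (f := Subtype.val) (this.subset ?_)
      Subtype.val_injective.injOn
    rintro _ ⟨g, hg, rfl⟩
    exact ⟨by simpa using hg, g.2⟩
  have hout : ∀ g ∉ hfin.toFinset, ∀ x : Euc d, ‖x‖ ≤ r → R < ‖g +ᵥ x‖ := fun g hg x hx => by
    simp only [Set.Finite.mem_toFinset, Set.mem_ofPred_eq, not_le] at hg
    rw [Submodule.vadd_def, vadd_eq_add]
    have := norm_sub_le ((g : Euc d) + x) x
    rw [add_sub_cancel_right] at this
    linarith
  refine ⟨hfin.toFinset, hout, fun ψ hψ x hx => ?_⟩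
  refine finsum_eq_sum_of_support_subset _ fun g hg => ?_
  by_contra hns
  exact hg (hψ _ (hout g hns x hx))

lemma isPeriodic_periodize (ψ : Euc d → F) : IsPeriodic (periodize ψ) := fun x i => by
  have hmem : EuclideanSpace.single i (1 : ℝ) ∈ intLattice d :=
    Submodule.subset_span ⟨i, stdBasis_apply i⟩
  rw [periodize, periodize]
  refine finsum_eq_of_bijective (fun g => g + ⟨_, hmem⟩) (AddGroup.addRight_bijective _) fun g => ?_
  congr 1
  simp only [Submodule.vadd_def, vadd_eq_add, Submodule.coe_add]
  abel

lemma exists_radius {ψ : Euc d → F} (hc : HasCompactSupport ψ) :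
    ∃ R, 0 < R ∧ ∀ h, R < ‖h‖ → ψ h = 0 := by
  obtain ⟨R, hR⟩ := hc.isCompact.isBounded.subset_closedBall 0
  refine ⟨max R 1, by positivity, fun h hh => image_eq_zero_of_notMem_tsupport fun hm => ?_⟩
  have := hR hm
  simp only [Metric.mem_closedBall, dist_zero_right] at this
  exact absurd hh (not_lt.2 (this.trans (le_max_left _ _)))

lemma contDiff_periodize {ψ : Euc d → ℝ} (hψ : ContDiff ℝ ∞ ψ) (hc : HasCompactSupport ψ) :
    ContDiff ℝ ∞ (periodize ψ) ∧ ∀ x, gradient (periodize ψ) x = periodize (gradient ψ) x := by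
  obtain ⟨R, -, hR⟩ := exists_radius hc
  obtain ⟨R', -, hR'⟩ := exists_radius hc.gradient
  have hloc : ∀ x : Euc d, ∃ s : Finset (intLattice d),
      periodize ψ =ᶠ[nhds x] (fun y => ∑ g ∈ s, ψ ((g : Euc d) + y)) ∧
      periodize (gradient ψ) x = ∑ g ∈ s, gradient ψ ((g : Euc d) + x) := fun x => by
    obtain ⟨s, -, hs⟩ := exists_periodize_eq_sum d (max R R') (‖x‖ + 1)
    refine ⟨s, ?_, ?_⟩
    · filter_upwards [Metric.ball_mem_nhds x one_pos] with y hy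
      refine hs ψ (fun h hh => hR h ((le_max_left _ _).trans_lt hh)) y ?_
      have := norm_sub_norm_le y x
      rw [mem_ball_iff_norm] at hy
      linarith
    · exact hs (gradient ψ) (fun h hh => hR' h ((le_max_right _ _).trans_lt hh)) x (by linarith)
  refine ⟨contDiff_iff_contDiffAt.2 fun x => ?_, fun x => ?_⟩
  · obtain ⟨s, hs, -⟩ := hloc x
    refine ContDiffAt.congr_of_eventuallyEq ?_ hs
    exact (ContDiff.sum fun g _ => hψ.comp (contDiff_const.add contDiff_id)).contDiffAt
  · obtain ⟨s, hs, hs'⟩ := hloc x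
    rw [hs.gradient_eq, hs']
    have h1 : HasFDerivAt (fun y => ∑ g ∈ s, ψ ((g : Euc d) + y))
        (∑ g ∈ s, fderiv ℝ ψ ((g : Euc d) + x)) x := by
      refine HasFDerivAt.fun_sum fun g _ => ?_
      have h2 : HasFDerivAt ψ (fderiv ℝ ψ ((g : Euc d) + x)) ((g : Euc d) + x) :=
        (hψ.differentiable (by simp) _).hasFDerivAt
      have h3 := h2.comp x ((hasFDerivAt_id x).const_add (g : Euc d))
      rwa [ContinuousLinearMap.comp_id] at h3
    refine gradient_eq_of_hasFDerivAt h1 fun w => ?_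
    simp [inner_sum]

lemma isTestFunction_periodize {ψ : Euc d → ℝ} (hψ : ContDiff ℝ ∞ ψ) (hc : HasCompactSupport ψ) :
    IsTestFunction (periodize ψ) := ⟨(contDiff_periodize hψ hc).1, isPeriodic_periodize ψ⟩

lemma integrable_bilinear_of_compact [NormedSpace ℝ F] [NormedSpace ℝ G] (L : F →L[ℝ] G →L[ℝ] ℝ) {f : Euc d → F} {ψ : Euc d → G}
    (hf : LocallyIntegrable f) (hψ : Continuous ψ) (hc : HasCompactSupport ψ) :
    Integrable fun x => L (f x) (ψ x) := by
  have h1 : Integrable fun x => ‖ψ x‖ • f x :=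
    hf.integrable_smul_left_of_hasCompactSupport hψ.norm hc.norm
  refine (h1.norm.const_mul ‖L‖).mono' (L.aestronglyMeasurable_comp₂ hf.aestronglyMeasurable
    hψ.aestronglyMeasurable) (Filter.Eventually.of_forall fun x => ?_)
  refine (L.le_opNorm₂ _ _).trans_eq ?_
  rw [norm_smul, norm_norm]
  ring

end Periodize

/-- Unfolding: the integral over ℝ^d is the sum over the lattice of integrals over translated cells,
and periodicity of f collects them against the sum of the translates of ψ. -/
lemma integral_cell_periodize {F G : Type} [NormedAddCommGroup F] [NormedSpace ℝ F]
    [NormedAddCommGroup G] [NormedSpace ℝ G] (L : F →L[ℝ] G →L[ℝ] ℝ) {f : Euc d → F} {ψ : Euc d → G}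
    (hp : IsPeriodic f) (hf : Integrable f (torusMeasure d)) (hψ : Continuous ψ)
    (hc : HasCompactSupport ψ) :
    ∫ x in cell d, L (f x) (periodize ψ x) = ∫ x, L (f x) (ψ x) := by
  have hloc := hp.locallyIntegrable hf
  obtain ⟨R, -, hR⟩ := exists_radius hc
  obtain ⟨s, hs, hsum⟩ := exists_periodize_eq_sum d R d
  rw [isAddFundamentalDomain_cell.integral_eq_tsum'' _ (integrable_bilinear_of_compact L hloc hψ hc),
    tsum_eq_sum (s := s)]
  · rw [← integral_finsetSum]
    · refine setIntegral_congr_fun measurableSet_cell fun x hx => ?_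
      simp only [hp.vadd]
      rw [hsum ψ hR x (norm_le_of_mem_cell hx), map_sum]
    · intro g _
      simp only [hp.vadd]
      have hψ' : Continuous fun x => ψ ((g : Euc d) + x) := by fun_prop
      have hc' : HasCompactSupport fun x => ψ ((g : Euc d) + x) :=
        hc.comp_homeomorph (Homeomorph.addLeft (g : Euc d))
      exact (integrable_bilinear_of_compact L hloc hψ' hc').restrict
  · intro g hg
    rw [setIntegral_eq_zero_of_forall_eq_zero]
    intro x hx
    rw [hR _ (hs g hg x (norm_le_of_mem_cell hx)), map_zero]

/-! ### Weak solutions on the whole space -/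

/-- Measurable periodic functions, bounded by `B`. -/
structure IsNiceFun (f : Euc d → ℝ) (B : ℝ) : Prop where
  measurable : Measurable f
  periodic : IsPeriodic f
  bound : ∀ x, |f x| ≤ B

/-- Measurable space-time functions, periodic in space and bounded by `B`. -/
structure IsNiceDensity (f : Euc d → ℝ → ℝ) (B : ℝ) : Prop where
  measurable : Measurable (Function.uncurry f)
  periodic : ∀ t, IsPeriodic fun x => f x t
  bound : ∀ x t, |f x t| ≤ B

lemma IsNiceDensity.slice {f : Euc d → ℝ → ℝ} {B : ℝ} (hf : IsNiceDensity f B) (t : ℝ) :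
    IsNiceFun (fun x => f x t) B :=
  ⟨hf.measurable.comp (measurable_id.prodMk measurable_const), hf.periodic t, fun x => hf.bound x t⟩

namespace IsNiceFun

variable {f : Euc d → ℝ} {B : ℝ}

lemma nonneg (hf : IsNiceFun f B) : 0 ≤ B := (abs_nonneg _).trans (hf.bound 0)

lemma integrable (hf : IsNiceFun f B) : Integrable f (torusMeasure d) :=
  (integrable_const B).mono' hf.measurable.aestronglyMeasurable
    (Filter.Eventually.of_forall hf.bound)

lemma locallyIntegrable (hf : IsNiceFun f B) : LocallyIntegrable f :=
  hf.periodic.locallyIntegrable hf.integrable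

lemma smul_field (hf : IsNiceFun f B) {u : Euc d → Euc d} (hu : IsNiceField u) :
    IsNiceField fun x => f x • u x :=
  ⟨hf.measurable.smul hu.measurable, fun x i => by simp only [hf.periodic x i, hu.periodic x i],
    hu.integrable.bdd_smul B hf.measurable.aestronglyMeasurable
      (Filter.Eventually.of_forall hf.bound)⟩

end IsNiceFun

/-- Smooth compactly supported functions on `ℝ^d`. -/
def IsBump (ψ : Euc d → ℝ) : Prop := ContDiff ℝ ∞ ψ ∧ HasCompactSupport ψ

/-- The pairing `∫ f ψ`. -/
def pair (f ψ : Euc d → ℝ) : ℝ := ∫ x, f x * ψ x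

/-- The pairing `∫ f u · ∇ψ`. -/
def flux (u : Euc d → Euc d) (f ψ : Euc d → ℝ) : ℝ := ∫ x, f x * inner ℝ (u x) (gradient ψ x)

lemma integrable_pair {f ψ : Euc d → ℝ} {B : ℝ} (hf : IsNiceFun f B) (hψ : Continuous ψ)
    (hc : HasCompactSupport ψ) : Integrable fun x => f x * ψ x :=
  integrable_bilinear_of_compact (ContinuousLinearMap.mul ℝ ℝ) hf.locallyIntegrable hψ hc

lemma integrable_flux {u : Euc d → Euc d} (hu : IsNiceField u) {f ψ : Euc d → ℝ} {B : ℝ}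
    (hf : IsNiceFun f B) (hψ : IsBump ψ) :
    Integrable fun x => f x * inner ℝ (u x) (gradient ψ x) := by
  have := integrable_bilinear_of_compact (innerSL ℝ) (hf.smul_field hu).locallyIntegrable
    hψ.1.gradient.continuous hψ.2.gradient
  refine this.congr (Filter.Eventually.of_forall fun x => ?_)
  change inner ℝ (f x • u x) (gradient ψ x) = _
  exact real_inner_smul_left (u x) (gradient ψ x) (f x)

lemma integral_cell_pair {f ψ : Euc d → ℝ} {B : ℝ} (hf : IsNiceFun f B) (hψ : IsBump ψ) :
    ∫ x in cell d, f x * periodize ψ x = pair f ψ :=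
  integral_cell_periodize (ContinuousLinearMap.mul ℝ ℝ) hf.periodic hf.integrable hψ.1.continuous
    hψ.2

lemma integral_cell_flux {u : Euc d → Euc d} (hu : IsNiceField u) {f ψ : Euc d → ℝ} {B : ℝ}
    (hf : IsNiceFun f B) (hψ : IsBump ψ) :
    ∫ x in cell d, f x * inner ℝ (u x) (gradient (periodize ψ) x) = flux u f ψ := by
  have := integral_cell_periodize (innerSL ℝ) (hf.smul_field hu).periodic
    (hf.smul_field hu).integrable hψ.1.gradient.continuous hψ.2.gradient
  have hinner : ∀ x w : Euc d, innerSL ℝ (f x • u x) w = f x * inner ℝ (u x) w := fun x w =>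
    real_inner_smul_left (u x) w (f x)
  simp only [hinner] at this
  rw [flux, ← this]
  congr 1; ext x
  rw [(contDiff_periodize hψ.1 hψ.2).2]

/-- Weak solutions given by bounded measurable representatives. -/
structure IsNiceSolution (u : Euc d → Euc d) (T : ℝ) (ρ : Euc d → ℝ → ℝ) (ρ₀ ρT : Euc d → ℝ)
    (B B' : ℝ) : Prop where
  density : IsNiceDensity ρ B
  initial : IsNiceFun ρ₀ B'
  final : IsNiceFun ρT B'
  weak : ∀ ψ : Euc d → ℝ → ℝ, IsSpaceTimeTestFunction ψ →
    ∫ t in (0 : ℝ)..T, ∫ x in cell d,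
        ρ x t * (deriv (fun s => ψ x s) t + inner ℝ (u x) (gradient (fun y => ψ y t) x))
      = (∫ x in cell d, ρT x * ψ x T) - ∫ x in cell d, ρ₀ x * ψ x 0

lemma measurable_pair {ρ : Euc d → ℝ → ℝ} {B : ℝ} (hρ : IsNiceDensity ρ B) {ψ : Euc d → ℝ}
    (hψ : Measurable ψ) : Measurable fun t => pair (fun x => ρ x t) ψ := by
  have : Measurable (Function.uncurry fun (t : ℝ) (x : Euc d) => ρ x t * ψ x) :=
    (hρ.measurable.comp measurable_swap).mul (hψ.comp measurable_snd)
  exact this.stronglyMeasurable.integral_prod_right.measurable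

lemma measurable_flux {u : Euc d → Euc d} (hu : IsNiceField u) {ρ : Euc d → ℝ → ℝ} {B : ℝ}
    (hρ : IsNiceDensity ρ B) {ψ : Euc d → ℝ} (hψ : Measurable (gradient ψ)) :
    Measurable fun t => flux u (fun x => ρ x t) ψ := by
  have : Measurable (Function.uncurry fun (t : ℝ) (x : Euc d) =>
      ρ x t * inner ℝ (u x) (gradient ψ x)) :=
    (hρ.measurable.comp measurable_swap).mul
      ((hu.measurable.comp measurable_snd).inner (hψ.comp measurable_snd))
  exact this.stronglyMeasurable.integral_prod_right.measurable

lemma abs_pair_le {f ψ : Euc d → ℝ} {B : ℝ} (hf : IsNiceFun f B) (hψ : Continuous ψ)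
    (hc : HasCompactSupport ψ) : |pair f ψ| ≤ B * ∫ x, |ψ x| := by
  rw [pair, ← integral_const_mul, ← Real.norm_eq_abs]
  have hi : Integrable ψ := hψ.integrable_of_hasCompactSupport hc
  refine norm_integral_le_of_norm_le (hi.abs.const_mul B)
    (Filter.Eventually.of_forall fun x => ?_)
  rw [norm_mul]
  exact mul_le_mul_of_nonneg_right (hf.bound x) (norm_nonneg _)

lemma integrable_norm_mul_norm_gradient {u : Euc d → Euc d} (hu : IsNiceField u) {ψ : Euc d → ℝ}
    (hψ : IsBump ψ) : Integrable fun x => ‖u x‖ * ‖gradient ψ x‖ := by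
  have h1 : Integrable fun x => ‖gradient ψ x‖ • u x :=
    hu.locallyIntegrable.integrable_smul_left_of_hasCompactSupport hψ.1.gradient.continuous.norm
      hψ.2.gradient.norm
  refine h1.norm.congr (Filter.Eventually.of_forall fun x => ?_)
  simp only [norm_smul, norm_norm]
  ring

lemma abs_flux_le {u : Euc d → Euc d} (hu : IsNiceField u) {f ψ : Euc d → ℝ} {B : ℝ}
    (hf : IsNiceFun f B) (hψ : IsBump ψ) :
    |flux u f ψ| ≤ B * ∫ x, ‖u x‖ * ‖gradient ψ x‖ := by
  rw [flux, ← integral_const_mul, ← Real.norm_eq_abs]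
  refine norm_integral_le_of_norm_le ((integrable_norm_mul_norm_gradient hu hψ).const_mul B)
    (Filter.Eventually.of_forall fun x => ?_)
  rw [norm_mul]
  exact mul_le_mul (hf.bound x) (norm_inner_le_norm (𝕜 := ℝ) _ _) (norm_nonneg _) hf.nonneg

namespace IsNiceSolution

variable {u : Euc d → Euc d} {T : ℝ} {ρ : Euc d → ℝ → ℝ} {ρ₀ ρT : Euc d → ℝ} {B B' : ℝ}

/-- Testing with products of a periodised bump and a function of time reduces the equation, for each
bump, to a weak ordinary differential equation for t ↦ ∫ ρ(·,t) ψ whose right-hand side is the flux.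
-/
lemma weak_mul (h : IsNiceSolution u T ρ ρ₀ ρT B B') (hu : IsNiceField u) {ψ : Euc d → ℝ}
    (hψ : IsBump ψ) {θ : ℝ → ℝ} (hθ : ContDiff ℝ ∞ θ) :
    ∫ t in (0 : ℝ)..T, (deriv θ t * pair (fun x => ρ x t) ψ + θ t * flux u (fun x => ρ x t) ψ) =
      θ T * pair ρT ψ - θ 0 * pair ρ₀ ψ := by
  have hΨ := isTestFunction_periodize hψ.1 hψ.2
  have hst : IsSpaceTimeTestFunction fun (x : Euc d) t => periodize ψ x * θ t :=
    ⟨(hΨ.1.comp contDiff_fst).mul (hθ.comp contDiff_snd), fun t x i => by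
      simp only [isPeriodic_periodize ψ x i]⟩
  have hw := h.weak _ hst
  have hgrad : ∀ t x, gradient (fun y => periodize ψ y * θ t) x =
      θ t • gradient (periodize ψ) x := fun t x => by
    have h1 : HasFDerivAt (periodize ψ) (fderiv ℝ (periodize ψ) x) x :=
      (hΨ.1.differentiable (by simp) _).hasFDerivAt
    refine gradient_eq_of_hasFDerivAt (h1.mul_const (θ t)) fun w => ?_
    rw [inner_smul_right, inner_gradient]
    simp
  have hder : ∀ t x, deriv (fun s => periodize ψ x * θ s) t = periodize ψ x * deriv θ t :=
    fun t x => deriv_const_mul _ (hθ.differentiable (by simp) t)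
  have hfin : ∀ {f : Euc d → ℝ}, IsNiceFun f B' → ∀ c : ℝ,
      ∫ x in cell d, f x * (periodize ψ x * c) = c * pair f ψ := fun hf c => by
    rw [← integral_cell_pair hf hψ, ← integral_const_mul]
    congr 1; ext x; ring
  rw [hfin h.final, hfin h.initial] at hw
  rw [← hw]
  refine intervalIntegral.integral_congr fun t _ => ?_
  simp only [hder]
  have hn := h.density.slice t
  rw [← integral_cell_pair hn hψ, ← integral_cell_flux hu hn hψ, ← integral_const_mul,
    ← integral_const_mul, ← integral_add]
  · congr 1; ext x
    rw [hgrad, inner_smul_right]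
    ring
  · obtain ⟨C, -, hC⟩ := hΨ.2.exists_bound hΨ.1.continuous
    exact (hn.integrable.mul_bdd (c := C) hΨ.1.continuous.aestronglyMeasurable
      (Filter.Eventually.of_forall hC)).const_mul _
  · obtain ⟨C, -, hC⟩ := hΨ.2.gradient.exists_bound hΨ.1.gradient.continuous
    refine Integrable.const_mul ?_ _
    have hi : Integrable (fun x => C * ‖ρ x t • u x‖) (volume.restrict (cell d)) :=
      (hn.smul_field hu).integrable.norm.const_mul C
    refine hi.mono' (hn.measurable.mul (hu.measurable.inner
      hΨ.1.gradient.continuous.measurable)).aestronglyMeasurable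
      (Filter.Eventually.of_forall fun x => ?_)
    rw [norm_mul, norm_smul, mul_left_comm, mul_comm C]
    refine mul_le_mul_of_nonneg_left ((norm_inner_le_norm (𝕜 := ℝ) _ _).trans ?_) (norm_nonneg _)
    gcongr
    exact hC x

end IsNiceSolution

/-- The weak formulation with boundary values says that D is the distributional derivative of g and
that a, b are its end values. Comparison with the absolutely continuous primitive of D shows that g
differs from it by a almost everywhere. -/
lemma eq_add_integral_of_weak {g D : ℝ → ℝ} {T a b : ℝ} (hT : 0 < T)
    (hg : IntervalIntegrable g volume 0 T) (hD : IntervalIntegrable D volume 0 T)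
    (h : ∀ θ : ℝ → ℝ, ContDiff ℝ ∞ θ →
      ∫ t in (0 : ℝ)..T, (deriv θ t * g t + θ t * D t) = θ T * b - θ 0 * a) :
    b = a + ∫ t in (0 : ℝ)..T, D t ∧
      ∀ᵐ t, t ∈ Set.Ioo 0 T → g t = a + ∫ s in (0 : ℝ)..t, D s := by
  have hb : b = a + ∫ t in (0 : ℝ)..T, D t := by
    -- The constant test function gives the balance between the two end times.
    have := h (fun _ => 1) contDiff_const
    simp only [deriv_const, zero_mul, one_mul, zero_add] at this
    linarith
  refine ⟨hb, ?_⟩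
  let G : ℝ → ℝ := fun t => ∫ s in (0 : ℝ)..t, D s
  have hGac : AbsolutelyContinuousOnInterval G 0 T :=
    hD.absolutelyContinuousOnInterval_intervalIntegral (c := 0) (by simp)
  have hGd : ∀ᵐ t, t ∈ Set.uIcc 0 T → HasDerivAt G (D t) t := by
    filter_upwards [hD.ae_hasDerivAt_integral] with t ht htm using ht htm 0 (by simp)
  have hGi : IntervalIntegrable G volume 0 T := hGac.continuousOn.intervalIntegrable
  have hfi : IntervalIntegrable (fun t => g t - (a + G t)) volume 0 T :=
    hg.sub (intervalIntegrable_const.add hGi)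
  have hloc : LocallyIntegrableOn (fun t => g t - (a + G t)) (Set.Ioo 0 T) volume :=
    (((intervalIntegrable_iff_integrableOn_Ioo_of_le hT.le).1 hfi).locallyIntegrableOn)
  have := isOpen_Ioo.ae_eq_zero_of_integral_contDiff_smul_eq_zero hloc fun c hc hcc hcs => ?_
  · filter_upwards [this] with t ht htm using sub_eq_zero.1 (ht htm)
  -- The test function is the primitive of c that vanishes at 0. It need not vanish at T; its end
  -- value multiplies b, which is already known.
  have hθc : ContDiff ℝ ∞ fun t => ∫ s in (0 : ℝ)..t, c s := by
    rw [contDiff_infty_iff_deriv]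
    have hd : ∀ t, HasDerivAt (fun t => ∫ s in (0 : ℝ)..t, c s) (c t) t := fun t =>
      intervalIntegral.integral_hasDerivAt_right (hc.continuous.intervalIntegrable _ _)
        (hc.continuous.stronglyMeasurableAtFilter _ _) hc.continuous.continuousAt
    refine ⟨fun t => (hd t).differentiableAt, ?_⟩
    rwa [funext fun t => (hd t).deriv]
  set θ : ℝ → ℝ := fun t => ∫ s in (0 : ℝ)..t, c s with hθ
  have hθd : ∀ t, deriv θ t = c t := fun t =>
    (intervalIntegral.integral_hasDerivAt_right (hc.continuous.intervalIntegrable _ _)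
        (hc.continuous.stronglyMeasurableAtFilter _ _) hc.continuous.continuousAt).deriv
  have hθ0 : θ 0 = 0 := by simp [hθ]
  have hθac : AbsolutelyContinuousOnInterval θ 0 T :=
    (hc.continuous.intervalIntegrable 0 T).absolutelyContinuousOnInterval_intervalIntegral
      (c := 0) (by simp)
  have hibp := hθac.integral_deriv_mul_eq_sub hGac
  have hw := h θ hθc
  have hcg : IntervalIntegrable (fun t => c t * g t) volume 0 T :=
    hg.continuousOn_mul hc.continuous.continuousOn
  have hcG : IntervalIntegrable (fun t => c t * G t) volume 0 T :=
    hGi.continuousOn_mul hc.continuous.continuousOn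
  have hθD : IntervalIntegrable (fun t => θ t * D t) volume 0 T :=
    hD.continuousOn_mul hθc.continuous.continuousOn
  have e1 : ∫ t in (0 : ℝ)..T, (deriv θ t * G t + θ t * deriv G t) =
      ∫ t in (0 : ℝ)..T, (c t * G t + θ t * D t) := by
    refine intervalIntegral.integral_congr_ae ?_
    filter_upwards [hGd] with t ht htm
    rw [hθd, (ht (Set.uIoc_subset_uIcc htm)).deriv]
  simp only [hθd] at hw
  rw [e1, intervalIntegral.integral_add hcG hθD, hθ0, zero_mul, sub_zero] at hibp
  rw [intervalIntegral.integral_add hcg hθD, hθ0, zero_mul, sub_zero] at hw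
  have h1 : ∫ t, c t • (g t - (a + G t)) = ∫ t in (0 : ℝ)..T, c t * (g t - (a + G t)) := by
    rw [intervalIntegral.integral_of_le hT.le]
    symm
    refine setIntegral_eq_integral_of_forall_compl_eq_zero fun t ht => ?_
    rw [image_eq_zero_of_notMem_tsupport fun hm => ht (Set.Ioo_subset_Ioc_self (hcs hm)), zero_mul]
  have h2 : ∫ t in (0 : ℝ)..T, c t * (g t - (a + G t)) =
      (∫ t in (0 : ℝ)..T, c t * g t) - ((∫ t in (0 : ℝ)..T, c t) * a +
        ∫ t in (0 : ℝ)..T, c t * G t) := by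
    rw [← intervalIntegral.integral_mul_const, ← intervalIntegral.integral_add
      ((hc.continuous.intervalIntegrable 0 T).mul_const a) hcG, ← intervalIntegral.integral_sub hcg
      (((hc.continuous.intervalIntegrable 0 T).mul_const a).add hcG)]
    congr 1; ext t; ring
  rw [h1, h2]
  change (∫ t in (0 : ℝ)..T, c t * g t) - (θ T * a + ∫ t in (0 : ℝ)..T, c t * G t) = 0
  have h3 : G T = b - a := by rw [hb]; simp [G]
  rw [h3] at hibp
  linarith

/-! ### One null set of exceptional times for all test functions -/

lemma IsBump.sub {ψ χ : Euc d → ℝ} (hψ : IsBump ψ) (hχ : IsBump χ) :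
    IsBump fun x => ψ x - χ x := ⟨hψ.1.sub hχ.1, hψ.2.sub hχ.2⟩

lemma gradient_fun_sub' {ψ χ : Euc d → ℝ} (hψ : ContDiff ℝ ∞ ψ) (hχ : ContDiff ℝ ∞ χ) (x : Euc d) :
    gradient (fun y => ψ y - χ y) x = gradient ψ x - gradient χ x := by
  have h1 := (hψ.differentiable (by simp) x).hasFDerivAt
  have h2 := (hχ.differentiable (by simp) x).hasFDerivAt
  refine gradient_eq_of_hasFDerivAt (h1.sub h2) fun w => ?_
  simp [inner_sub_right]

lemma pair_sub {f ψ χ : Euc d → ℝ} {B : ℝ} (hf : IsNiceFun f B) (hψ : IsBump ψ) (hχ : IsBump χ) :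
    pair f (fun x => ψ x - χ x) = pair f ψ - pair f χ := by
  rw [pair, pair, pair, ← integral_sub (integrable_pair hf hψ.1.continuous hψ.2)
    (integrable_pair hf hχ.1.continuous hχ.2)]
  simp only [mul_sub]

lemma flux_sub {u : Euc d → Euc d} (hu : IsNiceField u) {f ψ χ : Euc d → ℝ} {B : ℝ}
    (hf : IsNiceFun f B) (hψ : IsBump ψ) (hχ : IsBump χ) :
    flux u f (fun x => ψ x - χ x) = flux u f ψ - flux u f χ := by
  rw [flux, flux, flux, ← integral_sub (integrable_flux hu hf hψ) (integrable_flux hu hf hχ)]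
  simp only [gradient_fun_sub' hψ.1 hχ.1, inner_sub_right, mul_sub]

/-- Continuous functions on a compact ball form a separable metric space, and so does the subset of
pairs (ψ, ∇ψ). This countable C¹-dense family is what makes an exceptional set of times independent
of the test function. -/
lemma exists_countable_dense_bump (d : ℕ) (R : ℝ) : ∃ S : Set (Euc d → ℝ), S.Countable ∧
    (∀ ψ ∈ S, IsBump ψ ∧ ∀ h, R < ‖h‖ → ψ h = 0) ∧
    ∀ ψ, IsBump ψ → (∀ h, R < ‖h‖ → ψ h = 0) → ∀ τ > 0, ∃ χ ∈ S, ∀ x, ‖x‖ ≤ R →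
      |ψ x - χ x| ≤ τ ∧ ‖gradient ψ x - gradient χ x‖ ≤ τ := by
  let X := {ψ : Euc d → ℝ // IsBump ψ ∧ ∀ h, R < ‖h‖ → ψ h = 0}
  let Φ : X → C(Metric.closedBall (0 : Euc d) R, ℝ × Euc d) := fun ψ =>
    ⟨fun x => (ψ.1 x, gradient ψ.1 x), (ψ.2.1.1.continuous.prodMk
      ψ.2.1.1.gradient.continuous).comp continuous_subtype_val⟩
  obtain ⟨S, hSc, hSd⟩ := TopologicalSpace.exists_countable_dense (Set.range Φ)
  choose σ hσ using fun f : Set.range Φ => f.2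
  refine ⟨(fun f => (σ f).1) '' S, hSc.image _, ?_, fun ψ hψ hψR τ hτ => ?_⟩
  · rintro _ ⟨f, -, rfl⟩
    exact (σ f).2
  obtain ⟨χ, hχS, hχ⟩ := hSd.exists_dist_lt ⟨Φ ⟨ψ, hψ, hψR⟩, Set.mem_range_self _⟩ hτ
  rw [Subtype.dist_eq, ← hσ χ] at hχ
  refine ⟨(σ χ).1, ⟨χ, hχS, rfl⟩, fun x hx => ?_⟩
  have := (ContinuousMap.dist_apply_le_dist (f := Φ ⟨ψ, hψ, hψR⟩) (g := Φ (σ χ))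
    ⟨x, by simpa using hx⟩).trans hχ.le
  rw [Prod.dist_eq, max_le_iff] at this
  exact ⟨(Real.dist_eq _ _).symm.trans_le this.1, (dist_eq_norm _ _).symm.trans_le this.2⟩

lemma gradient_eq_zero_of_eq_zero {ψ : Euc d → ℝ} {R : ℝ} (hR : ∀ h, R < ‖h‖ → ψ h = 0)
    {x : Euc d} (hx : R < ‖x‖) : gradient ψ x = 0 := by
  have : ψ =ᶠ[nhds x] fun _ => 0 := by
    filter_upwards [(isOpen_lt continuous_const continuous_norm).mem_nhds hx] with y hy using hR y hy
  rw [this.gradient_eq]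
  simp [gradient]

namespace IsNiceSolution

variable {u : Euc d → Euc d} {T : ℝ} {ρ : Euc d → ℝ → ℝ} {ρ₀ ρT : Euc d → ℝ} {B B' : ℝ}

lemma intervalIntegrable_flux (h : IsNiceDensity ρ B) (hu : IsNiceField u) {ψ : Euc d → ℝ}
    (hψ : IsBump ψ) (a b : ℝ) :
    IntervalIntegrable (fun t => flux u (fun x => ρ x t) ψ) volume a b :=
  (intervalIntegrable_const (c := B * ∫ x, ‖u x‖ * ‖gradient ψ x‖)).mono_fun'
    (measurable_flux hu h hψ.1.gradient.continuous.measurable).aestronglyMeasurable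
    (Filter.Eventually.of_forall fun t => abs_flux_le hu (h.slice t) hψ)

lemma intervalIntegrable_pair (h : IsNiceDensity ρ B) {ψ : Euc d → ℝ}
    (hψ : IsBump ψ) (a b : ℝ) :
    IntervalIntegrable (fun t => pair (fun x => ρ x t) ψ) volume a b :=
  (intervalIntegrable_const (c := B * ∫ x, |ψ x|)).mono_fun'
    (measurable_pair h hψ.1.continuous.measurable).aestronglyMeasurable
    (Filter.Eventually.of_forall fun t => abs_pair_le (h.slice t) hψ.1.continuous hψ.2)

lemma pair_final (h : IsNiceSolution u T ρ ρ₀ ρT B B') (hu : IsNiceField u) (hT : 0 < T)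
    {ψ : Euc d → ℝ} (hψ : IsBump ψ) :
    pair ρT ψ = pair ρ₀ ψ + ∫ t in (0 : ℝ)..T, flux u (fun x => ρ x t) ψ :=
  (eq_add_integral_of_weak hT (intervalIntegrable_pair h.density hψ _ _)
    (intervalIntegrable_flux h.density hu hψ _ _) fun _ hθ => h.weak_mul hu hψ hθ).1

/-- The failure of the weak formulation on `[0, t]`. -/
def defect (u : Euc d → Euc d) (ρ : Euc d → ℝ → ℝ) (ρ₀ : Euc d → ℝ) (t : ℝ) (ψ : Euc d → ℝ) : ℝ :=
  pair (fun x => ρ x t) ψ - pair ρ₀ ψ - ∫ s in (0 : ℝ)..t, flux u (fun x => ρ x s) ψ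

/-- The two pairings see only the values of ψ - χ and the flux only its gradient, weighted by the
integral of |u| over the ball; so for fixed t the defect is C¹-Lipschitz. -/
lemma abs_defect_sub_le (h : IsNiceSolution u T ρ ρ₀ ρT B B') (hu : IsNiceField u) (R t : ℝ) :
    ∃ C, 0 ≤ C ∧ ∀ ψ χ, IsBump ψ → IsBump χ → (∀ h, R < ‖h‖ → ψ h = 0) → (∀ h, R < ‖h‖ → χ h = 0) →
      ∀ τ, 0 < τ → (∀ x, ‖x‖ ≤ R → |ψ x - χ x| ≤ τ ∧ ‖gradient ψ x - gradient χ x‖ ≤ τ) →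
      |defect u ρ ρ₀ t ψ - defect u ρ ρ₀ t χ| ≤ C * τ := by
  let V := volume.real (Metric.closedBall (0 : Euc d) R)
  let U := ∫ x in Metric.closedBall (0 : Euc d) R, ‖u x‖
  have hV : 0 ≤ V := ENNReal.toReal_nonneg
  have hU : 0 ≤ U := integral_nonneg fun _ => norm_nonneg _
  have hB := (h.density.slice 0).nonneg
  have hB' := h.initial.nonneg
  refine ⟨B * V + B' * V + B * U * |t|, by positivity, fun ψ χ hψ hχ hψR hχR τ hτ hd => ?_⟩
  have hs := hψ.sub hχ
  have hz : ∀ x, R < ‖x‖ → ψ x - χ x = 0 := fun x hx => by rw [hψR x hx, hχR x hx, sub_zero]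
  have hsup : ∫ x, |ψ x - χ x| ≤ V * τ := by
    rw [← setIntegral_eq_integral_of_forall_compl_eq_zero (s := Metric.closedBall (0 : Euc d) R)
      (fun x hx => by rw [hz x (by simpa using hx), abs_zero]), ← smul_eq_mul V τ,
      ← setIntegral_const]
    refine setIntegral_mono_on (hs.1.continuous.integrable_of_hasCompactSupport hs.2).abs.integrableOn
      (by simp [integrableOn_const_iff, measure_closedBall_lt_top]) Metric.isClosed_closedBall.measurableSet fun x hx => ?_
    exact (hd x (by simpa using hx)).1
  have hgsup : ∫ x, ‖u x‖ * ‖gradient (fun x => ψ x - χ x) x‖ ≤ U * τ := by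
    rw [← setIntegral_eq_integral_of_forall_compl_eq_zero (s := Metric.closedBall (0 : Euc d) R)
      (fun x hx => by
        rw [gradient_eq_zero_of_eq_zero hz (by simpa using hx), norm_zero, mul_zero]),
      ← integral_mul_const]
    refine setIntegral_mono_on (integrable_norm_mul_norm_gradient hu hs).integrableOn
      ((hu.locallyIntegrable.integrableOn_isCompact
        (isCompact_closedBall 0 R)).norm.mul_const τ) Metric.isClosed_closedBall.measurableSet fun x hx => ?_
    rw [gradient_fun_sub' hψ.1 hχ.1]
    exact mul_le_mul_of_nonneg_left (hd x (by simpa using hx)).2 (norm_nonneg _)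
  have e : defect u ρ ρ₀ t ψ - defect u ρ ρ₀ t χ =
      pair (fun x => ρ x t) (fun x => ψ x - χ x) - pair ρ₀ (fun x => ψ x - χ x) -
        ∫ s in (0 : ℝ)..t, flux u (fun x => ρ x s) (fun x => ψ x - χ x) := by
    rw [defect, defect, pair_sub (h.density.slice t) hψ hχ, pair_sub h.initial hψ hχ]
    simp only [fun s => flux_sub hu (h.density.slice s) hψ hχ]
    rw [intervalIntegral.integral_sub (intervalIntegrable_flux h.density hu hψ _ _)
      (intervalIntegrable_flux h.density hu hχ _ _)]
    ring
  have b1 := (abs_pair_le (h.density.slice t) hs.1.continuous hs.2).trans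
    (mul_le_mul_of_nonneg_left hsup hB)
  have b2 := (abs_pair_le h.initial hs.1.continuous hs.2).trans
    (mul_le_mul_of_nonneg_left hsup hB')
  have b3 : |∫ s in (0 : ℝ)..t, flux u (fun x => ρ x s) (fun x => ψ x - χ x)| ≤
      B * (U * τ) * |t - 0| :=
    (Real.norm_eq_abs _).symm.trans_le <| intervalIntegral.norm_integral_le_of_norm_le_const fun s _ =>
      (abs_flux_le hu (h.density.slice s) hs).trans (mul_le_mul_of_nonneg_left hgsup hB)
  rw [sub_zero] at b3
  rw [e]
  refine (abs_sub _ _).trans ((add_le_add ((abs_sub _ _).trans (add_le_add b1 b2)) b3).trans_eq ?_)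
  ring

/-- The weak equation gives a null set of times for each test function. The union over a countable
C¹-dense family is still null, and C¹ continuity of the defect extends the identity to all test
functions. -/
lemma ae_pair (h : IsNiceSolution u T ρ ρ₀ ρT B B') (hu : IsNiceField u) (hT : 0 < T) :
    ∀ᵐ t, t ∈ Set.Ioo 0 T → ∀ ψ, IsBump ψ → pair (fun x => ρ x t) ψ =
      pair ρ₀ ψ + ∫ s in (0 : ℝ)..t, flux u (fun x => ρ x s) ψ := by
  choose S hSc hSb hSd using exists_countable_dense_bump d
  have hall : ∀ᵐ t, ∀ n : ℕ, ∀ χ ∈ S n, t ∈ Set.Ioo 0 T → defect u ρ ρ₀ t χ = 0 := by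
    rw [ae_all_iff]
    intro n
    rw [ae_ball_iff (hSc n)]
    intro χ hχ
    have hb := (hSb n χ hχ).1
    filter_upwards [(eq_add_integral_of_weak hT (intervalIntegrable_pair h.density hb _ _)
      (intervalIntegrable_flux h.density hu hb _ _) fun _ hθ => h.weak_mul hu hb hθ).2] with t ht htm
    rw [defect, ht htm]
    ring
  filter_upwards [hall] with t ht htm ψ hψ
  suffices defect u ρ ρ₀ t ψ = 0 by rw [defect] at this; linarith
  obtain ⟨R, -, hR⟩ := exists_radius hψ.2
  obtain ⟨n, hn⟩ := exists_nat_ge R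
  have hRn : ∀ x, (n : ℝ) < ‖x‖ → ψ x = 0 := fun x hx => hR x (hn.trans_lt hx)
  obtain ⟨C, hC0, hC⟩ := h.abs_defect_sub_le hu n t
  by_contra hne
  have hpos := abs_pos.2 hne
  -- With this accuracy the defect would be at most C/(2(C+1)) times itself, which is impossible
  -- unless it is zero.
  obtain ⟨χ, hχ, hd⟩ := hSd n ψ hψ hRn (|defect u ρ ρ₀ t ψ| / (2 * (C + 1))) (by positivity)
  have := hC ψ χ hψ (hSb n χ hχ).1 hRn (hSb n χ hχ).2 _ (by positivity) hd
  rw [ht n χ hχ htm, sub_zero, ← mul_div_assoc, le_div_iff₀ (by positivity)] at this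
  nlinarith

end IsNiceSolution

/-! ### Reflected kernels and the transport of a mollification -/

lemma integral_sub_self_eq {F : Type*} [NormedAddCommGroup F] [NormedSpace ℝ F]
    (f : Euc d → F) (x : Euc d) : ∫ y, f (x - y) = ∫ y, f y :=
  integral_sub_left_eq_self f volume x

/-- The kernel `y ↦ κ (x - y)`. -/
def reflect (κ : Euc d → ℝ) (x y : Euc d) : ℝ := κ (x - y)

lemma IsBump.reflect {κ : Euc d → ℝ} (hκ : IsBump κ) (x : Euc d) : IsBump (reflect κ x) :=
  ⟨hκ.1.comp (contDiff_const.sub contDiff_id), hκ.2.comp_homeomorph (Homeomorph.subLeft x)⟩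

lemma IsBump.fderiv_apply {κ : Euc d → ℝ} (hκ : IsBump κ) (w : Euc d) :
    IsBump fun h => fderiv ℝ κ h w :=
  ⟨(hκ.1.fderiv_right (m := ∞) le_rfl).clm_apply contDiff_const,
    (hκ.2.fderiv (𝕜 := ℝ)).comp_left (g := fun L : Euc d →L[ℝ] ℝ => L w) rfl⟩

lemma fderiv_reflect {κ : Euc d → ℝ} (hκ : IsBump κ) (x y w : Euc d) :
    fderiv ℝ (reflect κ x) y w = - fderiv ℝ κ (x - y) w := by
  have h1 : HasFDerivAt κ (fderiv ℝ κ (x - y)) (x - y) :=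
    (hκ.1.differentiable (by simp) _).hasFDerivAt
  have h2 := h1.comp y ((hasFDerivAt_id y).const_sub x)
  rw [show reflect κ x = κ ∘ fun y => x - y from rfl]
  erw [h2.fderiv]
  simp

lemma pair_reflect (f κ : Euc d → ℝ) (x : Euc d) : pair f (reflect κ x) = mollify f κ x := by
  rw [mollify_apply, pair, ← integral_sub_self_eq _ x]
  simp only [reflect, sub_sub_cancel, smul_eq_mul, mul_comm]

/-- The flux through `reflect κ x` as a function of `x`. -/
def transport (u : Euc d → Euc d) (f κ : Euc d → ℝ) (x : Euc d) : ℝ := flux u f (reflect κ x)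

lemma transport_eq {κ : Euc d → ℝ} (hκ : IsBump κ) (u : Euc d → Euc d) (f : Euc d → ℝ)
    (x : Euc d) : transport u f κ x = - ∫ y, f y * fderiv ℝ κ (x - y) (u y) := by
  rw [transport, flux, ← integral_neg]
  simp only [inner_gradient, fderiv_reflect hκ, mul_neg]

lemma transport_eq_convolution {κ : Euc d → ℝ} (hκ : IsBump κ) (u : Euc d → Euc d)
    (f : Euc d → ℝ) : transport u f κ = fun x => - convolution (fderiv ℝ κ) (fun y => f y • u y)
      (ContinuousLinearMap.id ℝ (Euc d →L[ℝ] ℝ)) volume x := by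
  ext x
  rw [transport_eq hκ, convolution, ← integral_sub_self_eq _ x]
  simp

section

variable {u : Euc d → Euc d} {f κ : Euc d → ℝ} {B : ℝ}

lemma contDiff_transport (hu : IsNiceField u) (hf : IsNiceFun f B) (hκ : IsBump κ) :
    ContDiff ℝ ∞ (transport u f κ) := by
  rw [transport_eq_convolution hκ]
  exact ((hκ.2.fderiv (𝕜 := ℝ)).contDiff_convolution_left _ (hκ.1.fderiv_right (m := ∞) le_rfl)
    (hf.smul_field hu).locallyIntegrable).neg

lemma transport_eq_sum (hu : IsNiceField u) (hf : IsNiceFun f B) (hκ : IsBump κ) (x : Euc d) :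
    transport u f κ x = - ∑ j, mollify (fun y => (f y • u y) j)
      (fun h => fderiv ℝ κ h (EuclideanSpace.single j 1)) x := by
  have hloc : ∀ j, LocallyIntegrable fun y => (f y • u y) j := fun j =>
    ((hf.smul_field hu).periodic_apply j).locallyIntegrable ((hf.smul_field hu).integrable_apply j)
  have hb := fun j => hκ.fderiv_apply (EuclideanSpace.single j (1 : ℝ))
  rw [transport_eq hκ, ← integral_sub_self_eq _ x]
  simp only [mollify_apply]
  rw [← integral_finsetSum _ fun j _ => integrable_mollify_integrand (hloc j)
    (hb j).1.continuous (hb j).2 x]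
  congr 2; ext h
  rw [sub_sub_cancel, ← smul_eq_mul, ← map_smul]
  conv_lhs => rw [← (EuclideanSpace.basisFun (Fin d) ℝ).sum_repr (f (x - h) • u (x - h)), map_sum]
  refine Finset.sum_congr rfl fun j _ => ?_
  rw [map_smul, EuclideanSpace.basisFun_apply, smul_eq_mul, smul_eq_mul, mul_comm]
  rfl

/-- The transport contains Dκ(x-y) applied to u(y). Differentiating in direction w produces D²κ(w,
u(y)), and symmetry of the second derivative rewrites it as the same expression for the kernel Dκ·w.
-/
lemma fderiv_transport (hu : IsNiceField u) (hf : IsNiceFun f B) (hκ : IsBump κ) (x w : Euc d) :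
    fderiv ℝ (transport u f κ) x w = transport u f (fun h => fderiv ℝ κ h w) x := by
  have hκ' : ContDiff ℝ ∞ (fderiv ℝ κ) := hκ.1.fderiv_right (m := ∞) le_rfl
  have hloc : ∀ j, LocallyIntegrable fun y => (f y • u y) j := fun j =>
    ((hf.smul_field hu).periodic_apply j).locallyIntegrable ((hf.smul_field hu).integrable_apply j)
  have hb := fun j => hκ.fderiv_apply (EuclideanSpace.single j (1 : ℝ))
  have hd : ∀ h v w, fderiv ℝ (fun h => fderiv ℝ κ h w) h v = fderiv ℝ (fderiv ℝ κ) h v w :=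
    fun h v w => by
      have h3 : HasFDerivAt (fun h => fderiv ℝ κ h w)
          ((ContinuousLinearMap.apply ℝ ℝ w).comp (fderiv ℝ (fderiv ℝ κ) h)) h :=
        (ContinuousLinearMap.apply ℝ ℝ w).hasFDerivAt.comp h
          (hκ'.differentiable (by simp) h).hasFDerivAt
      rw [h3.fderiv]
      rfl
  have hsymm : ∀ h, IsSymmSndFDerivAt ℝ κ h := fun h =>
    hκ.1.contDiffAt.isSymmSndFDerivAt (by
      rw [minSmoothness_of_isRCLikeNormedField]
      exact WithTop.coe_le_coe.2 (le_top : (2 : ℕ∞) ≤ ⊤))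
  have e : transport u f κ = fun x => - ∑ j, mollify (fun y => (f y • u y) j)
      (fun h => fderiv ℝ κ h (EuclideanSpace.single j 1)) x := funext (transport_eq_sum hu hf hκ)
  have hdm : ∀ j, HasFDerivAt (mollify (fun y => (f y • u y) j)
      (fun h => fderiv ℝ κ h (EuclideanSpace.single j 1))) (fderiv ℝ (mollify
        (fun y => (f y • u y) j) (fun h => fderiv ℝ κ h (EuclideanSpace.single j 1))) x) x :=
    fun j => ((contDiff_mollify (hloc j) (hb j).1 (hb j).2).differentiable (by simp)
      x).hasFDerivAt
  rw [transport_eq_sum hu hf (hκ.fderiv_apply w), e,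
    (HasFDerivAt.fun_sum fun j (_ : j ∈ Finset.univ) => hdm j).fun_neg.fderiv,
    _root_.neg_apply, _root_.sum_apply]
  congr 1
  refine Finset.sum_congr rfl fun j _ => ?_
  rw [fderiv_mollify (hloc j) (hb j).1 (hb j).2, mollify_apply]
  congr 1; ext h
  rw [hd, hd, hsymm h]

end

/-- Reflected approximate identities have L¹ norm one and recover f(x) at almost every x. -/
lemma abs_le_of_abs_pair_le {f : Euc d → ℝ} {B B' : ℝ} (hf : IsNiceFun f B)
    (h : ∀ ψ, IsBump ψ → |pair f ψ| ≤ B' * ∫ x, |ψ x|) : ∀ᵐ x, |f x| ≤ B' := by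
  obtain ⟨k, hk, hlim⟩ := exists_approx_kernels d
  filter_upwards [hlim f hf.locallyIntegrable] with x hx
  refine le_of_tendsto hx.abs (Filter.Eventually.of_forall fun n => ?_)
  have hb : IsBump (k n) := ⟨(hk n).smooth, (hk n).compact⟩
  have h1 : ∫ y, |reflect (k n) x y| = 1 := by
    simp only [reflect]
    rw [integral_sub_self_eq (fun y => |k n y|) x, ← (hk n).integral_eq_one]
    congr 1; ext y
    exact abs_of_nonneg ((hk n).nonneg y)
  have := h _ (hb.reflect x)
  rwa [pair_reflect, h1, mul_one] at this

namespace IsNiceSolution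

variable {u : Euc d → Euc d} {T : ℝ} {ρ : Euc d → ℝ → ℝ} {ρ₀ ρT : Euc d → ℝ} {B B' : ℝ}

lemma exists_mem_of_ae {p : ℝ → Prop} (hp : ∀ᵐ t, t ∈ Set.Ioo 0 T → p t) {a b : ℝ}
    (ha : 0 ≤ a) (hab : a < b) (hb : b ≤ T) : ∃ t ∈ Set.Ioo a b, p t := by
  by_contra! hne
  have h1 : volume {t | ¬(t ∈ Set.Ioo 0 T → p t)} = 0 := ae_iff.1 hp
  have hsub : Set.Ioo a b ⊆ {t | ¬(t ∈ Set.Ioo 0 T → p t)} := fun t ht hq =>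
    hne t ht (hq ⟨ha.trans_lt ht.1, ht.2.trans_le hb⟩)
  have h0 := measure_mono_null hsub h1
  rw [Real.volume_Ioo, ENNReal.ofReal_eq_zero] at h0
  linarith

/-- At almost every time the pairing is controlled by the bound of the density, and over a short
time interval the flux contributes arbitrarily little. The weak traces thus inherit the bound B,
although a priori only B' is known for them. -/
lemma abs_pair_trace_le (h : IsNiceSolution u T ρ ρ₀ ρT B B') (hu : IsNiceField u) (hT : 0 < T)
    {ψ : Euc d → ℝ} (hψ : IsBump ψ) :
    |pair ρ₀ ψ| ≤ B * ∫ x, |ψ x| ∧ |pair ρT ψ| ≤ B * ∫ x, |ψ x| := by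
  set K := B * ∫ x, ‖u x‖ * ‖gradient ψ x‖ with hK
  have hB := (h.density.slice 0).nonneg
  have hK0 : 0 ≤ K := mul_nonneg hB (integral_nonneg fun _ => by positivity)
  have hflux : ∀ a b, |∫ s in a..b, flux u (fun x => ρ x s) ψ| ≤ K * |b - a| := fun a b =>
    (Real.norm_eq_abs _).symm.trans_le <| intervalIntegral.norm_integral_le_of_norm_le_const
      fun s _ => abs_flux_le hu (h.density.slice s) hψ
  have hfin := h.pair_final hu hT hψ
  have hae := h.ae_pair hu hT
  refine ⟨le_of_forall_pos_le_add fun τ hτ => ?_, le_of_forall_pos_le_add fun τ hτ => ?_⟩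
  -- The flux over [0, t] is at most Kt, hence below τ; the 1 in K + 1 covers K = 0.
  · obtain ⟨t, ht, hp⟩ := exists_mem_of_ae hae le_rfl
      (lt_min hT (show 0 < τ / (K + 1) by positivity)) (min_le_left _ _)
    have h1 := abs_pair_le (h.density.slice t) hψ.1.continuous hψ.2
    have h2 := hflux 0 t
    have h3 : t < τ / (K + 1) := ht.2.trans_le (min_le_right _ _)
    rw [lt_div_iff₀ (by positivity)] at h3
    rw [sub_zero, abs_of_pos ht.1] at h2
    have h4 := hp ψ hψ
    have h5 : pair ρ₀ ψ = pair (fun x => ρ x t) ψ - ∫ s in (0 : ℝ)..t, flux u (fun x => ρ x s) ψ := by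
      linarith
    rw [h5]
    refine (abs_sub _ _).trans (add_le_add h1 (h2.trans ?_))
    nlinarith [ht.1]
  · obtain ⟨t, ht, hp⟩ := exists_mem_of_ae hae (le_max_left 0 (T - τ / (K + 1)))
      (max_lt hT (by linarith [show 0 < τ / (K + 1) by positivity])) le_rfl
    have h1 := abs_pair_le (h.density.slice t) hψ.1.continuous hψ.2
    have h2 := hflux t T
    have h3 : T - t < τ / (K + 1) := by linarith [(le_max_right 0 (T - τ / (K + 1))).trans_lt ht.1]
    rw [lt_div_iff₀ (by positivity)] at h3
    rw [abs_of_pos (sub_pos.2 ht.2)] at h2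
    have h4 := hp ψ hψ
    have hint : ∀ a b, IntervalIntegrable (fun s => flux u (fun x => ρ x s) ψ) volume a b :=
      intervalIntegrable_flux h.density hu hψ
    have h5 : pair ρT ψ = pair (fun x => ρ x t) ψ + ∫ s in t..T, flux u (fun x => ρ x s) ψ := by
      rw [hfin, h4, add_assoc, intervalIntegral.integral_add_adjacent_intervals (hint _ _)
        (hint _ _)]
    rw [h5]
    refine (abs_add_le _ _).trans (add_le_add h1 (h2.trans ?_))
    nlinarith [ht.2]

lemma abs_initial_le (h : IsNiceSolution u T ρ ρ₀ ρT B B') (hu : IsNiceField u) (hT : 0 < T) :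
    ∀ᵐ x, |ρ₀ x| ≤ B := abs_le_of_abs_pair_le h.initial fun _ hψ => (h.abs_pair_trace_le hu hT hψ).1

lemma abs_final_le (h : IsNiceSolution u T ρ ρ₀ ρT B B') (hu : IsNiceField u) (hT : 0 < T) :
    ∀ᵐ x, |ρT x| ≤ B := abs_le_of_abs_pair_le h.final fun _ hψ => (h.abs_pair_trace_le hu hT hψ).2

end IsNiceSolution

/-- Both iterated integrals are integrals over the square of H cut off to the triangle s < t, so
Fubini applies. -/
lemma integral_triangle {H : ℝ → ℝ → ℝ} {C T : ℝ} (hT : 0 ≤ T)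
    (hH : Measurable (Function.uncurry H)) (hC : ∀ t s, |H t s| ≤ C) :
    IntervalIntegrable (fun s => ∫ t in s..T, H t s) volume 0 T ∧
    IntervalIntegrable (fun t => ∫ s in (0 : ℝ)..t, H t s) volume 0 T ∧
    ∫ s in (0 : ℝ)..T, ∫ t in s..T, H t s = ∫ t in (0 : ℝ)..T, ∫ s in (0 : ℝ)..t, H t s := by
  let K : ℝ → ℝ → ℝ := fun t s => if s < t then H t s else 0
  have hK : Measurable (Function.uncurry K) :=
    Measurable.ite (measurableSet_lt measurable_snd measurable_fst) hH measurable_const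
  have hC0 : 0 ≤ C := (abs_nonneg _).trans (hC 0 0)
  have hKC : ∀ t s, ‖K t s‖ ≤ C := fun t s => by
    simp only [K]
    split_ifs
    · exact hC t s
    · simpa using hC0
  have hint : Integrable (Function.uncurry K)
      ((volume.restrict (Set.Ioc 0 T)).prod (volume.restrict (Set.Ioc 0 T))) :=
    (integrable_const C).mono' hK.aestronglyMeasurable
      (Filter.Eventually.of_forall fun p => hKC p.1 p.2)
  have h1 : ∀ s ∈ Set.Ioc 0 T, ∫ t in s..T, H t s = ∫ t in Set.Ioc 0 T, K t s := fun s hs => by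
    rw [intervalIntegral.integral_of_le hs.2]
    rw [show (fun t => K t s) = (Set.Ioi s).indicator fun t => H t s from funext fun t => by
      simp [K, Set.indicator_apply], setIntegral_indicator measurableSet_Ioi,
      Set.Ioc_inter_Ioi, max_eq_right hs.1.le]
  have h2 : ∀ t ∈ Set.Ioc 0 T, ∫ s in (0 : ℝ)..t, H t s = ∫ s in Set.Ioc 0 T, K t s :=
    fun t ht => by
      rw [intervalIntegral.integral_of_le ht.1.le, integral_Ioc_eq_integral_Ioo]
      rw [show (fun s => K t s) = (Set.Iio t).indicator fun s => H t s from funext fun s => by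
        simp [K, Set.indicator_apply], setIntegral_indicator measurableSet_Iio]
      congr 2
      ext s
      simp only [Set.mem_Ioo, Set.mem_inter_iff, Set.mem_Ioc, Set.mem_Iio]
      exact ⟨fun h => ⟨⟨h.1, h.2.le.trans ht.2⟩, h.2⟩, fun h => ⟨h.1.1, h.2⟩⟩
  refine ⟨?_, ?_, ?_⟩
  · rw [intervalIntegrable_iff_integrableOn_Ioc_of_le hT]
    exact hint.integral_prod_right.congr ((ae_restrict_iff' measurableSet_Ioc).2
      (Filter.Eventually.of_forall fun s hs => (h1 s hs).symm))
  · rw [intervalIntegrable_iff_integrableOn_Ioc_of_le hT]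
    exact hint.integral_prod_left.congr ((ae_restrict_iff' measurableSet_Ioc).2
      (Filter.Eventually.of_forall fun t ht => (h2 t ht).symm))
  · rw [intervalIntegral.integral_of_le hT, intervalIntegral.integral_of_le hT,
      setIntegral_congr_fun measurableSet_Ioc h1, setIntegral_congr_fun measurableSet_Ioc h2]
    exact (integral_integral_swap hint).symm

/-! ### Uniform bounds and joint measurability of the transport -/

lemma IsBump.mul_smooth {χ g : Euc d → ℝ} (hχ : IsBump χ) (hg : ContDiff ℝ ∞ g) :
    IsBump fun x => χ x * g x := ⟨hχ.1.mul hg, hχ.2.mul_right⟩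

lemma inner_gradient_mul {χ g : Euc d → ℝ} (hχ : ContDiff ℝ ∞ χ) (hg : ContDiff ℝ ∞ g)
    (x w : Euc d) : inner ℝ w (gradient (fun y => χ y * g y) x) =
      χ x * fderiv ℝ g x w + g x * fderiv ℝ χ x w := by
  rw [inner_gradient, fderiv_fun_mul (hχ.differentiable (by simp) x)
    (hg.differentiable (by simp) x)]
  simp

lemma IsBump.exists_fderiv_le {κ : Euc d → ℝ} (hκ : IsBump κ) :
    ∃ G, 0 ≤ G ∧ ∀ h, ‖fderiv ℝ κ h‖ ≤ G := by
  obtain ⟨G, hG⟩ := (hκ.2.fderiv (𝕜 := ℝ)).exists_bound_of_continuous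
    (hκ.1.continuous_fderiv (by simp))
  exact ⟨G, (norm_nonneg _).trans (hG 0), hG⟩

section Transport

variable {u : Euc d → Euc d} {f κ : Euc d → ℝ} {φ : Euc d → ℝ → ℝ} {A : ℝ}

lemma abs_transport_le (hu : IsNiceField u) (hf : IsNiceFun f A) (hκ : IsBump κ) {G r R : ℝ}
    (hG : ∀ h, ‖fderiv ℝ κ h‖ ≤ G) (hr : ∀ h, r < ‖h‖ → κ h = 0) {x : Euc d} (hx : ‖x‖ ≤ R) :
    |transport u f κ x| ≤ A * (G * ∫ y in Metric.closedBall (0 : Euc d) (R + r), ‖u y‖) := by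
  refine (abs_flux_le hu hf (hκ.reflect x)).trans (mul_le_mul_of_nonneg_left ?_ hf.nonneg)
  have hz : ∀ y, R + r < ‖y‖ → reflect κ x y = 0 := fun y hy => hr _ (by
    have := norm_sub_norm_le y x
    rw [norm_sub_rev] at this
    linarith)
  rw [← setIntegral_eq_integral_of_forall_compl_eq_zero
    (s := Metric.closedBall (0 : Euc d) (R + r)) (fun y hy => by
      rw [gradient_eq_zero_of_eq_zero hz (by simpa using hy), norm_zero, mul_zero]),
    ← integral_const_mul]
  refine setIntegral_mono_on (integrable_norm_mul_norm_gradient hu (hκ.reflect x)).integrableOn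
    ((hu.locallyIntegrable.integrableOn_isCompact (isCompact_closedBall 0 _)).norm.const_mul G)
    Metric.isClosed_closedBall.measurableSet fun y _ => ?_
  rw [mul_comm]
  refine mul_le_mul_of_nonneg_right ?_ (norm_nonneg _)
  rw [norm_gradient]
  refine ContinuousLinearMap.opNorm_le_bound _ ((norm_nonneg _).trans (hG 0)) fun w => ?_
  rw [fderiv_reflect hκ, norm_neg]
  exact ContinuousLinearMap.le_of_opNorm_le _ (hG _) w

lemma fderiv_fderiv_apply (hκ : IsBump κ) (h w v : Euc d) :
    fderiv ℝ (fun h => fderiv ℝ κ h w) h v = fderiv ℝ (fderiv ℝ κ) h v w := by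
  have h3 : HasFDerivAt (fun h => fderiv ℝ κ h w)
      ((ContinuousLinearMap.apply ℝ ℝ w).comp (fderiv ℝ (fderiv ℝ κ) h)) h :=
    (ContinuousLinearMap.apply ℝ ℝ w).hasFDerivAt.comp h
      ((hκ.1.fderiv_right (m := ∞) le_rfl).differentiable (by simp) h).hasFDerivAt
  rw [h3.fderiv]
  rfl

lemma measurable_transport (hu : IsNiceField u) (hφ : IsNiceDensity φ A) (hκ : IsBump κ) :
    Measurable fun p : ℝ × Euc d => transport u (fun y => φ y p.1) κ p.2 := by
  simp only [transport_eq hκ]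
  have hc : Continuous fun q : Euc d × Euc d => fderiv ℝ κ q.1 q.2 :=
    (hκ.1.continuous_fderiv (by simp)).comp continuous_fst |>.clm_apply continuous_snd
  have hm : Measurable (Function.uncurry fun (p : ℝ × Euc d) (y : Euc d) =>
      φ y p.1 * fderiv ℝ κ (p.2 - y) (u y)) :=
    (hφ.measurable.comp (measurable_snd.prodMk (measurable_fst.comp measurable_fst))).mul
      (hc.measurable.comp (((measurable_snd.comp measurable_fst).sub measurable_snd).prodMk
        (hu.measurable.comp measurable_snd)))
  exact (hm.stronglyMeasurable.integral_prod_right).measurable.neg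

lemma measurable_transport_fderiv (hu : IsNiceField u) (hφ : IsNiceDensity φ A) (hκ : IsBump κ) :
    Measurable fun p : ℝ × Euc d =>
      transport u (fun y => φ y p.1) (fun h => fderiv ℝ κ h (u p.2)) p.2 := by
  simp only [transport_eq (hκ.fderiv_apply _), fderiv_fderiv_apply hκ]
  have hc : Continuous fun q : Euc d × Euc d × Euc d => fderiv ℝ (fderiv ℝ κ) q.1 q.2.1 q.2.2 :=
    (((hκ.1.fderiv_right (m := ∞) le_rfl).continuous_fderiv (by simp)).comp continuous_fst
      |>.clm_apply (continuous_fst.comp continuous_snd)).clm_apply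
        (continuous_snd.comp continuous_snd)
  have hm : Measurable (Function.uncurry fun (p : ℝ × Euc d) (y : Euc d) =>
      φ y p.1 * fderiv ℝ (fderiv ℝ κ) (p.2 - y) (u y) (u p.2)) :=
    (hφ.measurable.comp (measurable_snd.prodMk (measurable_fst.comp measurable_fst))).mul
      (hc.measurable.comp (((measurable_snd.comp measurable_fst).sub measurable_snd).prodMk
        ((hu.measurable.comp measurable_snd).prodMk
          (hu.measurable.comp (measurable_snd.comp measurable_fst)))))
  exact (hm.stronglyMeasurable.integral_prod_right).measurable.neg

end Transport

lemma fderiv_mollify_eq {f κ : Euc d → ℝ} {A : ℝ} (hf : IsNiceFun f A) (hκ : IsBump κ)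
    (x w : Euc d) : fderiv ℝ (mollify f κ) x w = mollify f (fun h => fderiv ℝ κ h w) x := by
  rw [fderiv_mollify hf.locallyIntegrable hκ.1 hκ.2, mollify_apply]

/-- In u(x) - u(x-h) the first summand gives the derivative of f*κ in direction u(x), and the second
gives the transport. In the doubling these arise from the equation for ρ and from the equation for φ
respectively. -/
lemma velocityCommutator_eq {u : Euc d → Euc d} {f κ : Euc d → ℝ} {A : ℝ} (hu : IsNiceField u)
    (hf : IsNiceFun f A) (hκ : IsBump κ) (x : Euc d) :
    velocityCommutator f u κ x = fderiv ℝ (mollify f κ) x (u x) + transport u f κ x := by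
  have hb := hκ.fderiv_apply (u x)
  have i1 := integrable_mollify_integrand hf.locallyIntegrable hb.1.continuous hb.2 x
  have i2 : Integrable fun h => f (x - h) * fderiv ℝ κ h (u (x - h)) := by
    have := (integrable_flux hu hf (hκ.reflect x)).neg
    rw [← (Measure.measurePreserving_sub_left volume x).integrable_comp_emb
      (MeasurableEquiv.subLeft x).measurableEmbedding] at this
    refine this.congr (Filter.Eventually.of_forall fun h => ?_)
    simp only [Function.comp_apply, inner_gradient, fderiv_reflect hκ, sub_sub_cancel, mul_neg,
      Pi.neg_apply, neg_neg]
  rw [fderiv_mollify_eq hf hκ, transport_eq hκ, ← integral_sub_self_eq _ x, mollify_apply,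
    ← sub_eq_add_neg]
  simp only [sub_sub_cancel]
  rw [← integral_sub i1 i2, velocityCommutator]
  congr 1; ext h
  rw [inner_gradient, map_sub, smul_eq_mul]
  ring

section

variable {u : Euc d → Euc d} {κ χ : Euc d → ℝ} {φ : Euc d → ℝ → ℝ} {A : ℝ}

lemma IsBump.exists_fderiv_fderiv_le (hκ : IsBump κ) :
    ∃ H, 0 ≤ H ∧ ∀ h, ‖fderiv ℝ (fderiv ℝ κ) h‖ ≤ H := by
  have hc : Continuous (fderiv ℝ (fderiv ℝ κ)) :=
    (hκ.1.fderiv_right (m := ∞) le_rfl).continuous_fderiv (by simp)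
  obtain ⟨r, hr0, hr⟩ := exists_radius hκ.2
  have hev : ∀ F : Euc d → ℝ, (∀ h, r < ‖h‖ → F h = 0) → ∀ h, r < ‖h‖ → F =ᶠ[nhds h] fun _ => 0 :=
    fun F hF h hh => by
      filter_upwards [(isOpen_lt continuous_const continuous_norm).mem_nhds hh] with y hy
        using hF y hy
  obtain ⟨H, hH⟩ := IsCompact.exists_bound_of_continuousOn
    (E := Euc d →L[ℝ] Euc d →L[ℝ] ℝ) (isCompact_closedBall (0 : Euc d) r) (by exact hc.continuousOn)
  have hH0 : 0 ≤ H := (norm_nonneg _).trans (hH 0 (by simpa using hr0.le))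
  refine ⟨H, hH0, fun h => ?_⟩
  by_cases hh : ‖h‖ ≤ r
  · exact hH h (by simpa using hh)
  · refine ContinuousLinearMap.opNorm_le_bound _ hH0 fun v => ?_
    refine ContinuousLinearMap.opNorm_le_bound _ (by positivity) fun w => ?_
    have h0 : (fun y => fderiv ℝ κ y w) =ᶠ[nhds h] fun _ => 0 :=
      hev _ (fun y hy => by
        rw [← inner_gradient, gradient_eq_zero_of_eq_zero hr hy, inner_zero_right]) h
        (not_le.1 hh)
    rw [← fderiv_fderiv_apply hκ, h0.fderiv_eq, fderiv_fun_const]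
    simp only [Pi.zero_apply, zero_apply, norm_zero]
    positivity

/-- The bounds do not depend on the time s, so they dominate the integrands in every exchange of
space and time integrals in the doubling. The gradient bound keeps a factor |u(x)|, which is only
integrable. -/
lemma exists_transport_bound (hu : IsNiceField u) (hφ : IsNiceDensity φ A) (hκ : IsBump κ)
    (hχ : IsBump χ) : ∃ R C, 0 ≤ C ∧ (∀ x, R < ‖x‖ → χ x = 0) ∧
      (∀ s x, |χ x * transport u (fun y => φ y s) κ x| ≤ C) ∧
      ∀ s x, |inner ℝ (u x) (gradient (fun y => χ y * transport u (fun y => φ y s) κ y) x)| ≤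
        (Metric.closedBall (0 : Euc d) R).indicator (fun x => C * ‖u x‖) x := by
  obtain ⟨R, -, hR⟩ := exists_radius hχ.2
  obtain ⟨r, -, hr⟩ := exists_radius hκ.2
  obtain ⟨G, hG0, hG⟩ := hκ.exists_fderiv_le
  obtain ⟨X, hX0, hX⟩ := hχ.exists_fderiv_le
  obtain ⟨Y, hY⟩ := hχ.2.exists_bound_of_continuous hχ.1.continuous
  have hY0 : 0 ≤ Y := (norm_nonneg _).trans (hY 0)
  obtain ⟨H, hH0, hH⟩ := hκ.exists_fderiv_fderiv_le
  have hA : 0 ≤ A := (hφ.slice 0).nonneg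
  set U := ∫ y in Metric.closedBall (0 : Euc d) (R + r), ‖u y‖
  have hU : 0 ≤ U := integral_nonneg fun _ => norm_nonneg _
  have ht : ∀ s x, ‖x‖ ≤ R → |transport u (fun y => φ y s) κ x| ≤ A * (G * U) := fun s x hx =>
    abs_transport_le hu (hφ.slice s) hκ hG hr hx
  have ht' : ∀ s x w, ‖x‖ ≤ R → |transport u (fun y => φ y s) (fun h => fderiv ℝ κ h w) x| ≤
      A * ((H * ‖w‖) * U) := fun s x w hx => by
    refine abs_transport_le hu (hφ.slice s) (hκ.fderiv_apply w) (fun h => ?_) (fun h hh => ?_) hx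
    · refine ContinuousLinearMap.opNorm_le_bound _ (by positivity) fun v => ?_
      rw [fderiv_fderiv_apply hκ]
      refine (ContinuousLinearMap.le_opNorm₂ _ _ _).trans ?_
      rw [mul_right_comm]
      exact mul_le_mul_of_nonneg_right (mul_le_mul_of_nonneg_right (hH h) (norm_nonneg _))
        (norm_nonneg _)
    · rw [← inner_gradient, gradient_eq_zero_of_eq_zero hr hh, inner_zero_right]
  refine ⟨R, Y * (A * (G * U)) + Y * (A * (H * U)) + A * (G * U) * X, by positivity, hR,
    fun s x => ?_, fun s x => ?_⟩
  · by_cases hx : ‖x‖ ≤ R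
    · rw [abs_mul]
      calc |χ x| * |transport u (fun y => φ y s) κ x| ≤ Y * (A * (G * U)) := by
            gcongr
            exacts [hY x, ht s x hx]
        _ ≤ _ := by
            have h1 : 0 ≤ Y * (A * (H * U)) := by positivity
            have h2 : 0 ≤ A * (G * U) * X := by positivity
            linarith
    · rw [hR x (not_le.1 hx), zero_mul, abs_zero]
      positivity
  · by_cases hx : ‖x‖ ≤ R
    · rw [Set.indicator_of_mem (by simpa using hx),
        inner_gradient_mul hχ.1 (contDiff_transport hu (hφ.slice s) hκ),
        fderiv_transport hu (hφ.slice s) hκ]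
      calc _ ≤ |χ x * transport u (fun y => φ y s) (fun h => fderiv ℝ κ h (u x)) x| +
            |transport u (fun y => φ y s) κ x * fderiv ℝ χ x (u x)| := abs_add_le _ _
        _ ≤ Y * (A * ((H * ‖u x‖) * U)) + (A * (G * U)) * (X * ‖u x‖) := by
            rw [abs_mul, abs_mul]
            gcongr
            · exact hY x
            · exact ht' s x _ hx
            · exact ht s x hx
            · exact ContinuousLinearMap.le_of_opNorm_le _ (hX x) _
        _ ≤ _ := by
            have h1 : 0 ≤ Y * (A * (G * U)) * ‖u x‖ := by positivity
            linarith
    · rw [Set.indicator_of_notMem (by simpa using hx), gradient_eq_zero_of_eq_zero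
        (R := R) (fun y hy => by rw [hR y hy, zero_mul]) (not_le.1 hx), inner_zero_right, abs_zero]

lemma measurable_inner_gradient_transport (hu : IsNiceField u) (hφ : IsNiceDensity φ A)
    (hκ : IsBump κ) (hχ : IsBump χ) : Measurable fun p : ℝ × Euc d =>
      inner ℝ (u p.2) (gradient (fun y => χ y * transport u (fun y => φ y p.1) κ y) p.2) := by
  simp only [fun s => inner_gradient_mul hχ.1 (contDiff_transport hu (hφ.slice s) hκ),
    fun s => fderiv_transport hu (hφ.slice s) hκ]
  have hc : Continuous fun q : Euc d × Euc d => fderiv ℝ χ q.1 q.2 :=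
    (hχ.1.continuous_fderiv (by simp)).comp continuous_fst |>.clm_apply continuous_snd
  exact ((hχ.1.continuous.measurable.comp measurable_snd).mul
    (measurable_transport_fderiv hu hφ hκ)).add ((measurable_transport hu hφ hκ).mul
      (hc.measurable.comp (measurable_snd.prodMk (hu.measurable.comp measurable_snd))))

end

/-- Doubling of variables. -/
lemma IsNiceSolution.doubling {u : Euc d → Euc d} {T : ℝ} {ρ φ : Euc d → ℝ → ℝ}
    {ρ₀ ρT φ₀ φT : Euc d → ℝ} {B B' A A' : ℝ} (hρ : IsNiceSolution u T ρ ρ₀ ρT B B')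
    (hφ : IsNiceSolution u T φ φ₀ φT A A') (hu : IsNiceField u) (hT : 0 < T) {κ χ : Euc d → ℝ}
    (hκ : IsBump κ) (hχ : IsBump χ) :
    pair ρT (fun x => χ x * mollify φT κ x) - pair ρ₀ (fun x => χ x * mollify φ₀ κ x) =
      ∫ t in (0 : ℝ)..T, ∫ x, ρ x t * (χ x * velocityCommutator (fun y => φ y t) u κ x +
        mollify (fun y => φ y t) κ x * inner ℝ (u x) (gradient χ x)) := by
  obtain ⟨R, C, hC0, hR, hCp, hCg⟩ := exists_transport_bound hu hφ.density hκ hχ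
  -- g s is the time derivative of φ(·,s)*κ. The natural test function χ (φ(·,t)*κ) depends on t
  -- only through a primitive of g, so it is not inserted directly. It is expanded as χ (φ₀*κ) plus
  -- the integral of the time-independent test functions χ g s.
  obtain ⟨g, hg⟩ : ∃ g : ℝ → Euc d → ℝ, ∀ s, g s = transport u (fun y => φ y s) κ :=
    ⟨_, fun _ => rfl⟩
  have hgx : ∀ s x, transport u (fun y => φ y s) κ x = g s x := fun s x => by rw [hg]
  have hgs : ∀ s, ContDiff ℝ ∞ (g s) := fun s => hg s ▸ contDiff_transport hu (hφ.density.slice s) hκ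
  have hsm : ∀ {f : Euc d → ℝ} {B : ℝ}, IsNiceFun f B → ContDiff ℝ ∞ (mollify f κ) := fun hf =>
    contDiff_mollify hf.locallyIntegrable hκ.1 hκ.2
  have hb0 : IsBump fun x => χ x * mollify φ₀ κ x := hχ.mul_smooth (hsm hφ.initial)
  have hbg : ∀ s, IsBump fun x => χ x * g s x := fun s => hχ.mul_smooth (hgs s)
  have hgm : Measurable (Function.uncurry g) := by
    have := measurable_transport hu hφ.density hκ
    simp only [hgx] at this
    exact this
  simp only [hgx] at hCp hCg
  obtain ⟨Q, hQ⟩ : ∃ Q : ℝ → Euc d → ℝ, ∀ s x,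
      inner ℝ (u x) (gradient (fun y => χ y * g s y) x) = Q s x := ⟨_, fun _ _ => rfl⟩
  have hQm : Measurable (Function.uncurry Q) := by
    have := measurable_inner_gradient_transport hu hφ.density hκ hχ
    simp only [hgx, hQ] at this
    exact this
  simp only [hQ] at hCg
  have hB0 : 0 ≤ B := (hρ.density.slice 0).nonneg
  have hB0' : 0 ≤ B' := hρ.final.nonneg
  obtain ⟨D, hD⟩ : ∃ D, D = (Metric.closedBall (0 : Euc d) R).indicator fun x => C * ‖u x‖ :=
    ⟨_, rfl⟩
  rw [← hD] at hCg
  have hdomi : Integrable D := by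
    have h1 := (hu.locallyIntegrable.integrableOn_isCompact (isCompact_closedBall 0 R)).norm
    rw [hD, integrable_indicator_iff Metric.isClosed_closedBall.measurableSet]
    exact h1.const_mul C
  -- H t s is the flux of ρ(·,t) through the frozen test function χ g s.
  obtain ⟨H, hH⟩ : ∃ H : ℝ → ℝ → ℝ, ∀ t s, H t s = ∫ x, ρ x t * Q s x := ⟨_, fun _ _ => rfl⟩
  have hHf : ∀ t s, flux u (fun x => ρ x t) (fun x => χ x * g s x) = H t s := fun t s => by
    simp only [flux, hQ, hH]
  have hHm : Measurable (Function.uncurry H) := by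
    have : Measurable (Function.uncurry fun (p : ℝ × ℝ) (x : Euc d) => ρ x p.1 * Q p.2 x) :=
      (hρ.density.measurable.comp (measurable_snd.prodMk (measurable_fst.comp measurable_fst))).mul
        (hQm.comp ((measurable_snd.comp measurable_fst).prodMk measurable_snd))
    have h2 := this.stronglyMeasurable.integral_prod_right (ν := volume)
    have e : Function.uncurry H = fun p : ℝ × ℝ => ∫ x, ρ x p.1 * Q p.2 x := by
      ext p; exact hH p.1 p.2
    rw [e]
    exact h2.measurable
  have hHC : ∀ t s, |H t s| ≤
      B * ∫ x, D x := fun t s => by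
    rw [← integral_const_mul, hH]
    refine (Real.norm_eq_abs _).symm.trans_le (norm_integral_le_of_norm_le (hdomi.const_mul B)
      (Filter.Eventually.of_forall fun x => ?_))
    rw [norm_mul]
    exact mul_le_mul (hρ.density.bound x t) (hCg s x) (norm_nonneg _) hB0
  obtain ⟨i1, i2, htri⟩ := integral_triangle hT.le hHm hHC
  -- The expansion of the mollified solution and of its derivative. It applies to φ(·,t) for almost
  -- every t and to φT.
  have hexp : ∀ {f : Euc d → ℝ} {B t}, IsNiceFun f B → (∀ ψ, IsBump ψ → pair f ψ = pair φ₀ ψ +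
      ∫ s in (0 : ℝ)..t, flux u (fun x => φ x s) ψ) → ∀ x,
      mollify f κ x = mollify φ₀ κ x + ∫ s in (0 : ℝ)..t, g s x ∧
      ∀ w, fderiv ℝ (mollify f κ) x w = fderiv ℝ (mollify φ₀ κ) x w +
        ∫ s in (0 : ℝ)..t, fderiv ℝ (g s) x w := fun hf hW x => by
    refine ⟨?_, fun w => ?_⟩
    · rw [← pair_reflect, hW _ (hκ.reflect x), pair_reflect]
      simp only [hg, transport]
    · rw [fderiv_mollify_eq hf hκ, fderiv_mollify_eq hφ.initial hκ, ← pair_reflect,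
        hW _ ((hκ.fderiv_apply w).reflect x), pair_reflect]
      simp only [hg, fun s => fderiv_transport hu (hφ.density.slice s) hκ]
      simp only [transport]
  -- The flux through the mollified solution
  have hflux : ∀ᵐ t, t ∈ Set.Ioo 0 T → flux u (fun x => ρ x t)
      (fun x => χ x * mollify (fun y => φ y t) κ x) =
      flux u (fun x => ρ x t) (fun x => χ x * mollify φ₀ κ x) + ∫ s in (0 : ℝ)..t, H t s := by
    filter_upwards [hφ.ae_pair hu hT] with t ht htm
    have hW := hexp (hφ.density.slice t) (ht htm)
    have hpt : ∀ x, inner ℝ (u x) (gradient (fun x => χ x * mollify (fun y => φ y t) κ x) x) =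
        inner ℝ (u x) (gradient (fun x => χ x * mollify φ₀ κ x) x) + ∫ s in (0 : ℝ)..t, Q s x :=
      fun x => by
        simp only [← hQ, fun s => inner_gradient_mul hχ.1 (hgs s)]
        have hi1 : ∀ w, IntervalIntegrable (fun s => fderiv ℝ (g s) x w) volume 0 t := fun w => by
          simp only [hg, fun s => fderiv_transport hu (hφ.density.slice s) hκ]
          exact IsNiceSolution.intervalIntegrable_flux hφ.density hu
            ((hκ.fderiv_apply w).reflect x) _ _
        have hi2 : IntervalIntegrable (fun s => g s x) volume 0 t := by
          simp only [hg]
          exact IsNiceSolution.intervalIntegrable_flux hφ.density hu (hκ.reflect x) _ _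
        rw [inner_gradient_mul hχ.1 (hsm (hφ.density.slice t)),
          inner_gradient_mul hχ.1 (hsm hφ.initial), (hW x).1, (hW x).2,
          intervalIntegral.integral_add ((hi1 _).const_mul _) (hi2.mul_const _),
          intervalIntegral.integral_const_mul, intervalIntegral.integral_mul_const]
        ring
    have hint : Integrable (Function.uncurry fun (s : ℝ) (x : Euc d) => ρ x t * Q s x)
        ((volume.restrict (Set.uIoc 0 t)).prod volume) := by
      have hd : Integrable (fun p : ℝ × Euc d => B * D p.2)
          ((volume.restrict (Set.uIoc 0 t)).prod volume) := by
        have : IsFiniteMeasure (volume.restrict (Set.uIoc 0 t)) :=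
          ⟨by rw [Measure.restrict_apply_univ, Set.uIoc]; exact measure_Ioc_lt_top⟩
        exact (hdomi.comp_snd _).const_mul B
      refine hd.mono' ((hρ.density.measurable.comp (measurable_snd.prodMk measurable_const)).mul
        hQm).aestronglyMeasurable (Filter.Eventually.of_forall fun p => ?_)
      rw [Function.uncurry, norm_mul]
      exact mul_le_mul (hρ.density.bound _ t) (hCg _ _) (norm_nonneg _) hB0
    have hsw : ∫ s in (0 : ℝ)..t, H t s = ∫ x, ∫ s in (0 : ℝ)..t, ρ x t * Q s x := by
      simp only [hH]
      exact intervalIntegral_integral_swap hint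
    rw [hsw, flux, flux, ← integral_add (integrable_flux hu (hρ.density.slice t) hb0)]
    · congr 1; ext x
      rw [hpt, intervalIntegral.integral_const_mul]
      ring
    · simp only [intervalIntegral.integral_of_le htm.1.le]
      rw [Set.uIoc_of_le htm.1.le] at hint
      exact hint.integral_prod_right
  have hfluxg : ∀ a b, IntervalIntegrable (fun t => flux u (fun x => ρ x t)
      fun x => χ x * mollify φ₀ κ x) volume a b :=
    IsNiceSolution.intervalIntegrable_flux hρ.density hu hb0
  -- The expansion of φT*κ inside the pairing with ρT.
  have hfinal : pair ρT (fun x => χ x * mollify φT κ x) =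
      pair ρT (fun x => χ x * mollify φ₀ κ x) +
        ∫ s in (0 : ℝ)..T, pair ρT fun x => χ x * g s x := by
    have hW := hexp hφ.final (fun ψ hψ => hφ.pair_final hu hT hψ)
    have hint : Integrable (Function.uncurry fun (s : ℝ) (x : Euc d) => ρT x * (χ x * g s x))
        ((volume.restrict (Set.uIoc 0 T)).prod volume) := by
      have : IsFiniteMeasure (volume.restrict (Set.uIoc 0 T)) :=
        ⟨by rw [Measure.restrict_apply_univ, Set.uIoc]; exact measure_Ioc_lt_top⟩
      have hd : Integrable (fun p : ℝ × Euc d => B' *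
          (Metric.closedBall (0 : Euc d) R).indicator (fun _ => C) p.2)
          ((volume.restrict (Set.uIoc 0 T)).prod volume) := by
        have h1 : Integrable ((Metric.closedBall (0 : Euc d) R).indicator fun _ => C) := by
          rw [integrable_indicator_iff Metric.isClosed_closedBall.measurableSet]
          simp [integrableOn_const_iff, measure_closedBall_lt_top]
        exact (h1.comp_snd _).const_mul B'
      refine hd.mono' ((hρ.final.measurable.comp measurable_snd).mul
        ((hχ.1.continuous.measurable.comp measurable_snd).mul hgm)).aestronglyMeasurable
        (Filter.Eventually.of_forall fun p => ?_)
      rw [Function.uncurry, norm_mul]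
      refine mul_le_mul (hρ.final.bound _) ?_ (norm_nonneg _) hB0'
      by_cases hx : ‖p.2‖ ≤ R
      · rw [Set.indicator_of_mem (by simpa using hx)]
        exact hCp _ _
      · rw [hR _ (not_le.1 hx), zero_mul, norm_zero]
        exact Set.indicator_nonneg (fun _ _ => hC0) _
    have hsw : ∫ s in (0 : ℝ)..T, pair ρT (fun x => χ x * g s x) =
        ∫ x, ∫ s in (0 : ℝ)..T, ρT x * (χ x * g s x) :=
      intervalIntegral_integral_swap hint
    rw [hsw, pair, pair, ← integral_add (integrable_pair hρ.final hb0.1.continuous hb0.2)]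
    · congr 1; ext x
      rw [(hW x).1, intervalIntegral.integral_const_mul, intervalIntegral.integral_const_mul]
      ring
    · simp only [intervalIntegral.integral_of_le hT.le]
      rw [Set.uIoc_of_le hT.le] at hint
      exact hint.integral_prod_right
  have hpairm : Measurable fun s => pair (fun x => ρ x s) fun x => χ x * g s x := by
    have : Measurable (Function.uncurry fun (s : ℝ) (x : Euc d) => ρ x s * (χ x * g s x)) :=
      (hρ.density.measurable.comp measurable_swap).mul
        ((hχ.1.continuous.measurable.comp measurable_snd).mul hgm)
    exact this.stronglyMeasurable.integral_prod_right.measurable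
  have hpairi : IntervalIntegrable (fun s => pair (fun x => ρ x s) fun x => χ x * g s x)
      volume 0 T := by
    refine (intervalIntegrable_const (c := B * ∫ x : Euc d,
      (Metric.closedBall (0 : Euc d) R).indicator (fun _ => C) x)).mono_fun'
      hpairm.aestronglyMeasurable (Filter.Eventually.of_forall fun s => ?_)
    refine (abs_pair_le (hρ.density.slice s) (hbg s).1.continuous (hbg s).2).trans
      (mul_le_mul_of_nonneg_left ?_ hB0)
    refine integral_mono ((hbg s).1.continuous.integrable_of_hasCompactSupport (hbg s).2).abs
      ?_ fun x => ?_
    · rw [integrable_indicator_iff Metric.isClosed_closedBall.measurableSet]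
      simp [integrableOn_const_iff, measure_closedBall_lt_top]
    · by_cases hx : ‖x‖ ≤ R
      · rw [Set.indicator_of_mem (by simpa using hx)]
        exact hCp _ _
      · simp only [hR _ (not_le.1 hx), zero_mul, abs_zero]
        exact Set.indicator_nonneg (fun _ _ => hC0) _
  -- For fixed s, the equation for ρ is used from time s to T with the test function χ g s.
  have hback : ∫ s in (0 : ℝ)..T, pair ρT (fun x => χ x * g s x) =
      ∫ s in (0 : ℝ)..T, (pair (fun x => ρ x s) (fun x => χ x * g s x) + ∫ t in s..T, H t s) := by
    refine intervalIntegral.integral_congr_ae ?_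
    have hne : ∀ᵐ s : ℝ, s ≠ T := by simp [ae_iff, measure_singleton]
    filter_upwards [hρ.ae_pair hu hT, hne] with s hs hsT hsm
    rw [Set.uIoc_of_le hT.le] at hsm
    have hi : ∀ a b, IntervalIntegrable (fun t => H t s) volume a b := by
      simp only [← hHf]
      exact IsNiceSolution.intervalIntegrable_flux hρ.density hu (hbg s)
    rw [hρ.pair_final hu hT (hbg s), hs ⟨hsm.1, lt_of_le_of_ne hsm.2 hsT⟩ _ (hbg s), add_assoc]
    simp only [hHf]
    rw [intervalIntegral.integral_add_adjacent_intervals (hi _ _) (hi _ _)]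
  -- The double integral of H over s < t < T produced by `hback` is, after the exchange on the
  -- triangle, the one that completes the flux through χ (φ₀*κ) to the flux through χ (φ(·,t)*κ).
  have hsum : pair ρT (fun x => χ x * mollify φT κ x) - pair ρ₀ (fun x => χ x * mollify φ₀ κ x) =
      ∫ t in (0 : ℝ)..T, (flux u (fun x => ρ x t) (fun x => χ x * mollify φ₀ κ x) +
        (∫ s in (0 : ℝ)..t, H t s) + pair (fun x => ρ x t) fun x => χ x * g t x) := by
    rw [intervalIntegral.integral_add ((hfluxg _ _).add i2) hpairi,
      intervalIntegral.integral_add (hfluxg _ _) i2, hfinal, hback,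
      intervalIntegral.integral_add hpairi i1, htri, hρ.pair_final hu hT hb0]
    ring
  rw [hsum]
  refine intervalIntegral.integral_congr_ae ?_
  have hne : ∀ᵐ s : ℝ, s ≠ T := by simp [ae_iff, measure_singleton]
  filter_upwards [hflux, hne] with t ht htT htm
  rw [Set.uIoc_of_le hT.le] at htm
  have hn := hρ.density.slice t
  have hf := hφ.density.slice t
  rw [← ht ⟨htm.1, lt_of_le_of_ne htm.2 htT⟩, flux, pair, ← integral_add
    (integrable_flux hu hn (hχ.mul_smooth (hsm hf)))
    (integrable_pair hn (hbg t).1.continuous (hbg t).2)]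
  congr 1; ext x
  -- The product rule separates the gradient of χ; the remaining derivative of φ*κ and the transport
  -- add up to the commutator.
  rw [inner_gradient_mul hχ.1 (hsm hf), velocityCommutator_eq hu hf hκ, hgx, inner_gradient]
  ring

/-! ### Families of kernels -/

lemma lintegral_gradient_rescale {f : Euc d → ℝ} (hf : ContDiff ℝ ∞ f) {r : ℝ} (hr : 0 < r) :
    ∫⁻ h, ‖gradient (rescale f r) h‖ₑ = ENNReal.ofReal r⁻¹ * ∫⁻ h, ‖gradient f h‖ₑ := by
  have h1 : ∀ h, ‖gradient (rescale f r) h‖ₑ =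
      ENNReal.ofReal ((r ^ d)⁻¹ * r⁻¹) * ‖gradient f (r⁻¹ • h)‖ₑ := fun h => by
    rw [gradient_rescale hf, enorm_smul, Real.enorm_eq_ofReal (by positivity)]
  simp only [h1]
  rw [lintegral_const_mul' _ _ ENNReal.ofReal_ne_top,
    lintegral_comp_inv_smul_euc (fun h => ‖gradient f h‖ₑ) hr, ← mul_assoc,
    ← ENNReal.ofReal_mul (by positivity)]
  congr 2
  field_simp

/-- Measurable periodic fields of trace-free matrices in the unit ball. -/
structure IsUnitField (M : Euc d → Matrix (Fin d) (Fin d) ℝ) : Prop where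
  measurable : ∀ i j, Measurable fun z => M z i j
  periodic : IsPeriodic M
  frob_le : ∀ z, frob (M z) ≤ 1
  trace_eq : ∀ z, (M z).trace = 0

lemma measurable_comp_matrix {X : Type*} [MeasurableSpace X] {F : Type*} [TopologicalSpace F]
    [MeasurableSpace F] [BorelSpace F]
    {Φ : Matrix (Fin d) (Fin d) ℝ × Euc d → F} (hΦ : Continuous Φ)
    {M : X → Matrix (Fin d) (Fin d) ℝ} (hM : ∀ i j, Measurable fun z => M z i j)
    {h : X → Euc d} (hh : Measurable h) : Measurable fun x => Φ (M x, h x) := by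
  have hc : Continuous fun p : (Fin d → Fin d → ℝ) × Euc d => Φ (Matrix.of p.1, p.2) :=
    hΦ.comp ((continuous_id.comp continuous_fst).prodMk continuous_snd)
  have hm : Measurable fun x => ((fun i j => M x i j : Fin d → Fin d → ℝ), h x) :=
    (measurable_pi_iff.2 fun i => measurable_pi_iff.2 fun j => hM i j).prodMk hh
  exact hc.measurable.comp hm

/-- Periodic measurable families of kernels with uniform bounds. -/
structure IsKernelFamily (k : Euc d → Euc d → ℝ) (r S K G : ℝ) : Prop where
  kernel : ∀ z, IsKernel (k z)
  eq_zero : ∀ z h, r ≤ ‖h‖ → k z h = 0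
  le : ∀ z h, k z h ≤ S
  gradient_le : ∀ z h, ‖gradient (k z) h‖ ≤ K
  lintegral_gradient_le : ∀ z, ∫⁻ h, ‖gradient (k z) h‖ₑ ≤ ENNReal.ofReal G
  measurable : Measurable (Function.uncurry k)
  measurable_gradient : Measurable (Function.uncurry fun z h => gradient (k z) h)
  periodic : IsPeriodic k

lemma IsKernel.isBump {k : Euc d → ℝ} (hk : IsKernel k) : IsBump k := ⟨hk.smooth, hk.compact⟩

/-- H is the sum of sup η, sup |∇η| and ∫ |∇η|. The sup of the gradient carries e^Λ δ^{-d-1}, but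
its integral only e^Λ δ⁻¹, because the trace-free flows preserve volume. The support radius is δe^Λ.
-/
lemma exists_isKernelFamily {η : Euc d → ℝ} (hη : IsMollifier η) : ∃ H, 0 < H ∧
    ∀ (Λ δ : ℝ) (M : Euc d → Matrix (Fin d) (Fin d) ℝ), 0 < Λ → 0 < δ → IsUnitField M →
      IsKernelFamily (fun z => rescale (albertiMollifier η Λ (M z)) δ) (δ * Real.exp Λ)
        (H * (δ ^ d)⁻¹) (H * (Real.exp Λ * ((δ ^ d)⁻¹ * δ⁻¹))) (H * (Real.exp Λ * δ⁻¹)) := by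
  obtain ⟨H₀, hH₀, hle⟩ := hη.exists_le
  obtain ⟨H₁, hH₁, hgle⟩ := hη.exists_norm_gradient_le
  have hgi : ∫⁻ h, ‖gradient η h‖ₑ < ⊤ :=
    ((hη.smooth.gradient.continuous).integrable_of_hasCompactSupport
      hη.hasCompactSupport.gradient).2
  set H₂ := (∫⁻ h, ‖gradient η h‖ₑ).toReal with hH₂
  have hH₂' : ∫⁻ h, ‖gradient η h‖ₑ = ENNReal.ofReal H₂ := (ENNReal.ofReal_toReal hgi.ne).symm
  have hH₂0 : 0 ≤ H₂ := ENNReal.toReal_nonneg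
  refine ⟨H₀ + H₁ + H₂, by positivity, fun Λ δ M hΛ hδ hM => ?_⟩
  have hsm : ∀ z, ContDiff ℝ ∞ (albertiMollifier η Λ (M z)) := fun z =>
    contDiff_albertiMollifier hη.smooth
  have hz : ∀ z h, δ * Real.exp Λ ≤ ‖h‖ → rescale (albertiMollifier η Λ (M z)) δ h = 0 :=
    fun z h hh => rescale_eq_zero hδ
      (fun _ => albertiMollifier_eq_zero hη hΛ (hM.frob_le z)) hh
  have hgr := fun z h => gradient_rescale (hsm z) δ h
  have hinv : Measurable fun p : Euc d × Euc d => δ⁻¹ • p.2 :=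
    (continuous_snd.const_smul δ⁻¹).measurable
  have hM' : ∀ i j, Measurable fun p : Euc d × Euc d => M p.1 i j := fun i j =>
    (hM.measurable i j).comp measurable_fst
  refine ⟨fun z => ⟨(hsm z).rescale δ, hasCompactSupport_of_eq_zero (hz z), fun h => ?_, ?_⟩, hz,
    fun z h => ?_, fun z h => ?_, fun z => ?_, ?_, ?_, fun z i => ?_⟩
  · exact mul_nonneg (by positivity) (albertiMollifier_nonneg hη hΛ _)
  · rw [integral_rescale _ hδ, integral_albertiMollifier hη hΛ (hM.trace_eq z)]
  · rw [rescale, mul_comm]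
    refine mul_le_mul_of_nonneg_right ((albertiMollifier_le hη hΛ hle _).trans ?_) (by positivity)
    linarith
  · rw [hgr, norm_smul, Real.norm_of_nonneg (by positivity)]
    calc (δ ^ d)⁻¹ * δ⁻¹ * ‖gradient (albertiMollifier η Λ (M z)) (δ⁻¹ • h)‖
        ≤ (δ ^ d)⁻¹ * δ⁻¹ * (Real.exp Λ * (H₀ + H₁ + H₂)) := by
          gcongr
          refine (norm_gradient_albertiMollifier_le_const hη hΛ (hM.frob_le z) hgle _).trans ?_
          gcongr
          linarith
      _ = _ := by ring
  · rw [lintegral_gradient_rescale (hsm z) hδ]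
    refine (mul_le_mul_right (lintegral_gradient_albertiMollifier_le hη hΛ (hM.frob_le z)
      (hM.trace_eq z)) _).trans ?_
    rw [hH₂', ← ENNReal.ofReal_mul (by positivity), ← ENNReal.ofReal_mul (by positivity)]
    refine ENNReal.ofReal_le_ofReal ?_
    calc δ⁻¹ * (Real.exp Λ * H₂) ≤ δ⁻¹ * (Real.exp Λ * (H₀ + H₁ + H₂)) := by
          gcongr
          linarith
      _ = _ := by ring
  · have := measurable_comp_matrix (continuous_albertiMollifier (Λ := Λ) hη.smooth) hM' hinv
    exact this.const_mul _
  · have := measurable_comp_matrix (continuous_gradient_albertiMollifier (Λ := Λ) hη.smooth) hM' hinv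
    have h2 : (Function.uncurry fun z h => gradient (rescale (albertiMollifier η Λ (M z)) δ) h) =
        fun p : Euc d × Euc d => ((δ ^ d)⁻¹ * δ⁻¹) •
          gradient (albertiMollifier η Λ (M p.1)) (δ⁻¹ • p.2) := by
      ext1 p
      exact hgr _ _
    rw [h2]
    exact this.const_smul ((δ ^ d)⁻¹ * δ⁻¹)
  · simp only [hM.periodic z i]

/-! ### Divergence-free fields -/

/-- The divergence of u*k at x is, up to sign, the flux of the constant density 1 through the kernel
reflected at x. By unfolding this is the divergence condition tested with a periodised kernel. -/
lemma IsDivFree.trace_gradMatrix_mollify {u : Euc d → Euc d} (hdiv : IsDivFree u)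
    (hu : IsNiceField u) {k : Euc d → ℝ} (hk : IsBump k) (x : Euc d) :
    (gradMatrix (_root_.mollify u k) x).trace = 0 := by
  have h1 : IsNiceFun (fun _ : Euc d => (1 : ℝ)) 1 :=
    ⟨measurable_const, fun _ _ => rfl, fun _ => by simp⟩
  have h2 : transport u (fun _ => 1) k x = 0 := by
    rw [transport, ← integral_cell_flux hu h1 (hk.reflect x)]
    simp only [one_mul]
    exact hdiv _ (isTestFunction_periodize (hk.reflect x).1 (hk.reflect x).2)
  rw [transport_eq_sum hu h1 hk, neg_eq_zero] at h2
  rw [← h2, Matrix.trace]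
  refine Finset.sum_congr rfl fun i _ => ?_
  rw [Matrix.diag_apply, hu.gradMatrix_mollify hk.1 hk.2, mollify_apply]
  simp only [one_smul, smul_eq_mul]

/-- The derivative of h ↦ k(h) v_j(x-h) integrates to zero, which moves the derivative from the
kernel to v. -/
lemma gradMatrix_mollify_of_contDiff {v : Euc d → Euc d} (hv : ContDiff ℝ ∞ v) (hp : IsPeriodic v)
    {k : Euc d → ℝ} (hk : IsBump k) (x : Euc d) (i j : Fin d) :
    gradMatrix (mollify v k) x i j = ∫ h, k h * gradMatrix v (x - h) i j := by
  have hvj : ContDiff ℝ ∞ fun h => v (x - h) j :=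
    (EuclideanSpace.proj (𝕜 := ℝ) j).contDiff.comp (hv.comp (contDiff_const.sub contDiff_id))
  have hd : ∀ h, fderiv ℝ (fun h => k h * v (x - h) j) h (EuclideanSpace.single i 1) =
      fderiv ℝ k h (EuclideanSpace.single i 1) * v (x - h) j -
        k h * gradMatrix v (x - h) i j := fun h => by
    have h0 : HasFDerivAt v (fderiv ℝ v (x - h)) (x - h) :=
      (hv.differentiable (by simp) _).hasFDerivAt
    have h1 : HasFDerivAt (fun h => v (x - h) j) ((EuclideanSpace.proj (𝕜 := ℝ) j).comp
        ((fderiv ℝ v (x - h)).comp (-ContinuousLinearMap.id ℝ (Euc d)))) h :=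
      (EuclideanSpace.proj (𝕜 := ℝ) j).hasFDerivAt.comp h
        (h0.comp h ((hasFDerivAt_id h).const_sub x))
    have h2 : HasFDerivAt k (fderiv ℝ k h) h := (hk.1.differentiable (by simp) h).hasFDerivAt
    rw [(h2.fun_mul h1).fderiv]
    simp only [add_apply, smul_apply, ContinuousLinearMap.comp_apply, neg_apply,
      ContinuousLinearMap.id_apply, map_neg, smul_eq_mul, gradMatrix_apply, PiLp.proj_apply]
    ring
  have hcd : Continuous fun h => fderiv ℝ k h (EuclideanSpace.single i 1) * v (x - h) j :=
    (hk.fderiv_apply _).1.continuous.mul hvj.continuous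
  have hcg : Continuous fun h => k h * gradMatrix v (x - h) i j :=
    hk.1.continuous.mul ((contDiff_gradMatrix hv i j).continuous.comp (by fun_prop))
  have h0 := integral_fderiv_eq_zero (hk.1.mul hvj) hk.2.mul_right
    (EuclideanSpace.single i (1 : ℝ))
  simp only [hd] at h0
  rw [integral_sub (hcd.integrable_of_hasCompactSupport
    (hk.fderiv_apply (EuclideanSpace.single i (1 : ℝ))).2.mul_right)
    (hcg.integrable_of_hasCompactSupport hk.2.mul_right)] at h0
  rw [(IsNiceField.of_contDiff hv hp).gradMatrix_mollify hk.1 hk.2]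
  linarith

lemma trace_gradMatrix_mollify {v : Euc d → Euc d} (hv : ContDiff ℝ ∞ v) (hp : IsPeriodic v)
    (htr : ∀ x, (gradMatrix v x).trace = 0) {k : Euc d → ℝ} (hk : IsBump k) (x : Euc d) :
    (gradMatrix (mollify v k) x).trace = 0 := by
  have hig : ∀ i, Integrable fun h => k h * gradMatrix v (x - h) i i := fun i =>
    (hk.1.continuous.mul ((contDiff_gradMatrix hv i i).continuous.comp
      (by fun_prop))).integrable_of_hasCompactSupport hk.2.mul_right
  rw [Matrix.trace]
  simp only [Matrix.diag_apply, gradMatrix_mollify_of_contDiff hv hp hk]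
  rw [← integral_finsetSum _ fun i _ => hig i]
  simp only [← Finset.mul_sum]
  have : ∀ h, ∑ i, gradMatrix v (x - h) i i = 0 := fun h => htr _
  simp [this]

lemma isUnitField_unitGradient {w : Euc d → Euc d} (hw : ContDiff ℝ ∞ w) (hp : IsPeriodic w)
    (htr : ∀ x, (gradMatrix w x).trace = 0) : IsUnitField (unitGradient w) where
  measurable i j := by
    have h1 := (continuous_frob_gradMatrix hw).measurable.inv
    exact h1.mul (contDiff_gradMatrix hw i j).continuous.measurable
  periodic x i := by
    rw [unitGradient, unitGradient, hp.gradMatrix x i]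
  frob_le z := by
    rw [unitGradient, frob_smul, abs_of_nonneg (inv_nonneg.2 (frob_nonneg _))]
    -- Where the gradient vanishes the inverse is 0 and the field is 0, so no case distinction is
    -- needed.
    exact inv_mul_le_one_of_le₀ le_rfl (frob_nonneg _)
  trace_eq z := by rw [unitGradient, Matrix.trace_smul, htr, smul_zero]

/-! ### Elementary bounds -/

lemma abs_integral_le_of_lintegral {X : Type*} [MeasurableSpace X] {μ : Measure X} {f : X → ℝ}
    {g : X → ENNReal} {K : ℝ} (hK : 0 ≤ K) (h : ∀ᵐ x ∂μ, ‖f x‖ₑ ≤ g x)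
    (hg : ∫⁻ x, g x ∂μ ≤ ENNReal.ofReal K) : |∫ x, f x ∂μ| ≤ K := by
  have h1 : ‖∫ x, f x ∂μ‖ₑ ≤ ENNReal.ofReal K :=
    (enorm_integral_le_lintegral_enorm f).trans ((lintegral_mono_ae h).trans hg)
  rw [← ofReal_norm, ENNReal.ofReal_le_ofReal_iff hK] at h1
  exact h1

lemma abs_interval_integral_le {f : ℝ → ℝ} {T K : ℝ} (hT : 0 ≤ T) (h : ∀ t, |f t| ≤ K) :
    |∫ t in (0 : ℝ)..T, f t| ≤ T * K := by
  have : ‖∫ t in (0 : ℝ)..T, f t‖ ≤ K * |T - 0| :=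
    intervalIntegral.norm_integral_le_of_norm_le_const fun t _ => h t
  rwa [sub_zero, abs_of_nonneg hT, mul_comm] at this

lemma enorm_le_ofReal {a b : ℝ} (h : |a| ≤ b) : ‖a‖ₑ ≤ ENNReal.ofReal b := by
  rw [← ofReal_norm]
  exact ENNReal.ofReal_le_ofReal h

lemma lintegral_enorm_comp_sub {F : Type*} [NormedAddCommGroup F] (f : Euc d → F) (x : Euc d) :
    ∫⁻ z, ‖f (z - x)‖ₑ = ∫⁻ z, ‖f z‖ₑ :=
  lintegral_sub_right_eq_self (fun z => ‖f z‖ₑ) x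

lemma ae_comp_sub_left {p : Euc d → Prop} (h : ∀ᵐ y, p y) (x : Euc d) : ∀ᵐ y, p (x - y) :=
  (Measure.measurePreserving_sub_left volume x).quasiMeasurePreserving.ae h

lemma IsNiceFun.integrable_mollify {f k : Euc d → ℝ} {B : ℝ} (hf : IsNiceFun f B) (hk : IsBump k)
    (x : Euc d) : Integrable fun h => k h • f (x - h) :=
  integrable_mollify_integrand hf.locallyIntegrable hk.1.continuous hk.2 x

lemma IsNiceFun.measurable_mollify {f k : Euc d → ℝ} {B : ℝ} (hf : IsNiceFun f B)
    (hk : IsBump k) : IsNiceFun (mollify f k) (B * ∫ h, |k h|) :=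
  ⟨(contDiff_mollify hf.locallyIntegrable hk.1 hk.2).continuous.measurable, hf.periodic.mollify k,
    fun x => by
      rw [← pair_reflect]
      refine (abs_pair_le hf (hk.reflect x).1.continuous (hk.reflect x).2).trans_eq ?_
      simp only [reflect]
      rw [integral_sub_self_eq fun y => |k y|]⟩

lemma IsNiceFun.mollify {f k : Euc d → ℝ} {B : ℝ} (hf : IsNiceFun f B) (hk : IsKernel k) :
    IsNiceFun (_root_.mollify f k) B :=
  ⟨(hf.measurable_mollify hk.isBump).measurable, hf.periodic.mollify k,
    fun x =>
    (Real.norm_eq_abs _).symm.trans_le (norm_mollify_le hk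
      (fun y => (Real.norm_eq_abs _).trans_le (hf.bound y)) x)⟩

lemma abs_sub_mollify_le {f k : Euc d → ℝ} (hf : LocallyIntegrable f) (hk : IsKernel k) {r L : ℝ}
    (hL : 0 ≤ L) (hr : ∀ h, r ≤ ‖h‖ → k h = 0) {x : Euc d}
    (hx : ∀ᵐ y, |f x - f y| ≤ L * ‖x - y‖) : |f x - mollify f k x| ≤ L * r := by
  have h1 : ‖f x - mollify f k x‖ₑ ≤ ENNReal.ofReal (L * r) := by
    refine (enorm_sub_mollify_le hf hk x).trans ?_
    have h2 : ∀ᵐ h, ‖k h‖ₑ * ‖f x - f (x - h)‖ₑ ≤ ‖k h‖ₑ * ENNReal.ofReal (L * r) := by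
      filter_upwards [ae_comp_sub_left hx x] with h hh
      by_cases hn : r ≤ ‖h‖
      · simp [hr h hn]
      · gcongr
        refine enorm_le_ofReal (hh.trans ?_)
        rw [sub_sub_cancel]
        exact mul_le_mul_of_nonneg_left (not_le.1 hn).le hL
    refine (lintegral_mono_ae h2).trans_eq ?_
    rw [lintegral_mul_const' _ _ ENNReal.ofReal_ne_top, hk.lintegral_enorm, one_mul]
  by_cases hr0 : 0 ≤ r
  · rwa [← ofReal_norm, ENNReal.ofReal_le_ofReal_iff (by positivity)] at h1
  -- For negative r the support condition would force k = 0, contradicting unit mass.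
  · have h0 : k = 0 := funext fun h => hr h ((not_le.1 hr0).le.trans (norm_nonneg _))
    have := hk.integral_eq_one
    simp [h0] at this

/-- The derivative of a mollification of f is a mean of the weak gradient against a probability
density on the torus, so it is bounded by L. The Lipschitz bound passes to f at the points where the
mollifications converge. -/
lemma ae_lipschitz_of_weakGradient {f : Euc d → ℝ} {B L : ℝ} (hf : IsNiceFun f B)
    {g : Euc d → Euc d} (hg : HasWeakGradient f g) (hgi : Integrable g (torusMeasure d))
    (hL : ∀ᵐ x ∂torusMeasure d, ‖g x‖ ≤ L) : ∀ᵐ x, ∀ᵐ y, |f x - f y| ≤ L * ‖x - y‖ := by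
  obtain ⟨k, hk, hlim⟩ := exists_approx_kernels d
  have hone : IsNiceFun (fun _ : Euc d => (1 : ℝ)) 1 :=
    ⟨measurable_const, fun _ _ => rfl, fun _ => by simp⟩
  have hfd : ∀ n x w, |fderiv ℝ (mollify f (k n)) x w| ≤ L * ‖w‖ := fun n x w => by
    have hb := (hk n).isBump
    have hr := hb.reflect x
    -- Periodising the reflected kernel makes it an admissible torus test function; it stays
    -- nonnegative with integral 1 over the cell.
    set P := periodize (reflect (k n) x) with hP
    have hPt : IsTestFunction P := isTestFunction_periodize hr.1 hr.2
    have hP0 : ∀ y, 0 ≤ P y := fun y => finsum_nonneg fun _ => (hk n).nonneg _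
    have hPi : Integrable P (torusMeasure d) := hPt.2.integrable_of_continuous hPt.1.continuous
    have hP1 : ∫ y in cell d, P y = 1 := by
      have := integral_cell_pair hone hr
      simp only [one_mul, pair, reflect] at this
      rw [integral_sub_self_eq (k n) x, (hk n).integral_eq_one] at this
      exact this
    obtain ⟨C, -, hC⟩ := hPt.2.exists_bound hPt.1.continuous
    obtain ⟨C', -, hC'⟩ := hPt.2.gradient.exists_bound hPt.1.gradient.continuous
    have hgc : ∀ i, Integrable (fun y => g y i * P y) (volume.restrict (cell d)) := fun i =>
      (((EuclideanSpace.proj (𝕜 := ℝ) i).integrable_comp hgi)).mul_bdd (c := C)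
        hPt.1.continuous.aestronglyMeasurable (Filter.Eventually.of_forall hC)
    have hfc : ∀ i, Integrable (fun y => f y * gradient P y i) (volume.restrict (cell d)) := fun i =>
      hf.integrable.mul_bdd (c := C') ((EuclideanSpace.proj (𝕜 := ℝ)
        i).continuous.comp hPt.1.gradient.continuous).aestronglyMeasurable
        (Filter.Eventually.of_forall fun y => (PiLp.norm_apply_le _ i).trans (hC' y))
    have e1 : fderiv ℝ (mollify f (k n)) x w = - ∫ y in cell d, f y * inner ℝ w (gradient P y) := by
      have hw : IsNiceField fun _ : Euc d => w :=
        ⟨measurable_const, fun _ _ => rfl, integrable_const _⟩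
      rw [integral_cell_flux hw hf hr, fderiv_mollify_eq hf hb, ← pair_reflect]
      have := transport_eq hb (fun _ => w) f x
      rw [transport] at this
      rw [this, neg_neg]
      rfl
    have e2 : ∫ y in cell d, f y * inner ℝ w (gradient P y) =
        - ∫ y in cell d, inner ℝ w (g y) * P y := by
      have a1 : ∀ y, f y * inner ℝ w (gradient P y) = ∑ i, w i * (f y * gradient P y i) :=
        fun y => by
          rw [PiLp.inner_apply, Finset.mul_sum]
          exact Finset.sum_congr rfl fun i _ => by simp; ring
      have a2 : ∀ y, inner ℝ w (g y) * P y = ∑ i, w i * (g y i * P y) := fun y => by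
        rw [PiLp.inner_apply, Finset.sum_mul]
        exact Finset.sum_congr rfl fun i _ => by simp; ring
      simp only [a1, a2]
      rw [integral_finsetSum _ fun i _ => (hfc i).const_mul _,
        integral_finsetSum _ fun i _ => (hgc i).const_mul _, ← Finset.sum_neg_distrib]
      refine Finset.sum_congr rfl fun i _ => ?_
      rw [integral_const_mul, integral_const_mul, hg P hPt i, mul_neg]
    rw [e1, e2, neg_neg, ← mul_one (L * ‖w‖), ← hP1, ← integral_const_mul]
    refine (Real.norm_eq_abs _).symm.trans_le (norm_integral_le_of_norm_le (hPi.const_mul _) ?_)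
    filter_upwards [hL] with y hy
    rw [norm_mul, Real.norm_of_nonneg (hP0 y)]
    refine mul_le_mul_of_nonneg_right ?_ (hP0 y)
    refine (norm_inner_le_norm (𝕜 := ℝ) _ _).trans ?_
    rw [mul_comm]
    gcongr
  have hLip : ∀ n x y, |mollify f (k n) x - mollify f (k n) y| ≤ L * ‖x - y‖ := fun n x y => by
    have hd : Differentiable ℝ (mollify f (k n)) :=
      (contDiff_mollify hf.locallyIntegrable (hk n).smooth (hk n).compact).differentiable (by simp)
    have hL0 : 0 ≤ L := by
      obtain ⟨z, hz⟩ := hL.exists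
      exact (norm_nonneg _).trans hz
    exact Convex.norm_image_sub_le_of_norm_fderiv_le (𝕜 := ℝ) (fun z _ => hd z)
      (fun z _ => ContinuousLinearMap.opNorm_le_bound _ hL0 fun w => hfd n z w) convex_univ
      (Set.mem_univ y) (Set.mem_univ x)
  have hae := hlim f hf.locallyIntegrable
  filter_upwards [hae] with x hx
  filter_upwards [hae] with y hy
  exact le_of_tendsto (hx.sub hy).abs (Filter.Eventually.of_forall fun n => hLip n x y)

/-- Estimate for I₁: mollifying an L-Lipschitz function with a kernel of radius r changes it by at
most Lr, and the weights θ(z - x) have mass one in z. -/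
lemma abs_final_term_le {k : Euc d → Euc d → ℝ} {r S K G : ℝ} (hk : IsKernelFamily k r S K G)
    {θ : Euc d → ℝ} (hθ : IsKernel θ) {f g : Euc d → ℝ} {A B L : ℝ} (hB : 0 ≤ B)
    (hg : ∀ᵐ x, |g x| ≤ B) (hf : IsNiceFun f A) (hL : 0 ≤ L) (hr : 0 ≤ r)
    (hlip : ∀ᵐ x, ∀ᵐ y, |f x - f y| ≤ L * ‖x - y‖) :
    |∫ x in cell d, ∫ z, g x * (f x - mollify f (k z) x) * θ (z - x)| ≤ B * (L * r) := by
  refine abs_integral_le_of_lintegral (g := fun _ => ENNReal.ofReal (B * (L * r)))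
    (by positivity) ?_ (by rw [lintegral_const, measure_univ, mul_one])
  filter_upwards [ae_restrict_of_ae hg, ae_restrict_of_ae hlip] with x hx hx'
  refine (enorm_integral_le_lintegral_enorm _).trans ?_
  calc ∫⁻ z, ‖g x * (f x - mollify f (k z) x) * θ (z - x)‖ₑ
      ≤ ∫⁻ z, ENNReal.ofReal (B * (L * r)) * ‖θ (z - x)‖ₑ := by
        refine lintegral_mono fun z => ?_
        rw [enorm_mul]
        gcongr
        refine enorm_le_ofReal ?_
        rw [abs_mul]
        exact mul_le_mul hx (abs_sub_mollify_le hf.locallyIntegrable (hk.kernel z) hL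
          (hk.eq_zero z) hx') (abs_nonneg _) hB
    _ = _ := by
        rw [lintegral_const_mul' _ _ ENNReal.ofReal_ne_top, lintegral_enorm_comp_sub,
          hθ.lintegral_enorm, mul_one]

lemma mollify_comm {f k κ : Euc d → ℝ} {A : ℝ} (hf : IsNiceFun f A) (hk : IsBump k)
    (hκ : IsBump κ) (x : Euc d) : mollify (mollify f κ) k x = mollify (mollify f k) κ x := by
  simp only [mollify_apply, smul_eq_mul]
  have hdom : Integrable (fun p : Euc d × Euc d => A * (‖k p.1‖ * ‖κ p.2‖))
      (volume.prod volume) :=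
    ((hk.1.continuous.integrable_of_hasCompactSupport hk.2).norm.mul_prod
      (hκ.1.continuous.integrable_of_hasCompactSupport hκ.2).norm).const_mul A
  have hint : Integrable (Function.uncurry fun h a => k h * (κ a * f (x - h - a)))
      (volume.prod volume) := by
    refine hdom.mono' (Measurable.aestronglyMeasurable ?_) (Filter.Eventually.of_forall fun p => ?_)
    · exact (hk.1.continuous.measurable.comp measurable_fst).mul
        ((hκ.1.continuous.measurable.comp measurable_snd).mul
          (hf.measurable.comp ((measurable_const.sub measurable_fst).sub measurable_snd)))
    · simp only [Function.uncurry, norm_mul]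
      rw [← mul_assoc, mul_comm A]
      exact mul_le_mul_of_nonneg_left (hf.bound _) (by positivity)
  calc ∫ h, k h * ∫ a, κ a * f (x - h - a)
      = ∫ h, ∫ a, k h * (κ a * f (x - h - a)) := by simp only [integral_const_mul]
    _ = ∫ a, ∫ h, k h * (κ a * f (x - h - a)) := integral_integral_swap hint
    _ = _ := by
        congr 1; ext a
        rw [← integral_const_mul]
        congr 1; ext h
        rw [sub_right_comm]
        ring

lemma abs_fderiv_mollify_le {f k : Euc d → ℝ} {A G : ℝ} (hf : IsNiceFun f A) (hk : IsBump k)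
    (hG0 : 0 ≤ G) (hG : ∫⁻ h, ‖gradient k h‖ₑ ≤ ENNReal.ofReal G) (x w : Euc d) :
    |fderiv ℝ (mollify f k) x w| ≤ A * G * ‖w‖ := by
  have hA := hf.nonneg
  rw [fderiv_mollify hf.locallyIntegrable hk.1 hk.2]
  refine abs_integral_le_of_lintegral (g := fun h => ENNReal.ofReal (A * ‖w‖) * ‖gradient k h‖ₑ)
    (by positivity) (Filter.Eventually.of_forall fun h => ?_) ?_
  · rw [← ofReal_norm (gradient k h), ← ENNReal.ofReal_mul (by positivity)]
    refine enorm_le_ofReal ?_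
    rw [smul_eq_mul, abs_mul, norm_gradient, mul_comm, mul_assoc, mul_comm ‖w‖]
    exact mul_le_mul (hf.bound _) ((Real.norm_eq_abs _).symm.trans_le
      (ContinuousLinearMap.le_opNorm (fderiv ℝ k h) w)) (abs_nonneg _) hA
  · rw [lintegral_const_mul' _ _ ENNReal.ofReal_ne_top]
    refine (mul_le_mul_right hG _).trans_eq ?_
    rw [← ENNReal.ofReal_mul (by positivity)]
    congr 1; ring

/-- Convolutions commute, so the function is f*k minus its own mollification by κ. Since f*k is
Lipschitz with constant A∫|∇k|, the difference is bounded by that constant times the radius of κ. In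
R₁ this gives the ratio δ'/δ without any regularity of f. -/
lemma abs_mollify_sub_mollify_le {f k κ : Euc d → ℝ} {A G r : ℝ} (hf : IsNiceFun f A)
    (hk : IsBump k) (hκ : IsKernel κ) (hr : ∀ h, r ≤ ‖h‖ → κ h = 0) (hG0 : 0 ≤ G)
    (hG : ∫⁻ h, ‖gradient k h‖ₑ ≤ ENNReal.ofReal G) (x : Euc d) :
    |mollify (fun y => f y - mollify f κ y) k x| ≤ A * G * r := by
  have hA := hf.nonneg
  have hm := hf.mollify hκ
  have h1 : mollify (fun y => f y - mollify f κ y) k x =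
      mollify f k x - mollify (mollify f k) κ x := by
    rw [← mollify_comm hf hk hκ.isBump, mollify_apply, mollify_apply, mollify_apply,
      ← integral_sub (hf.integrable_mollify hk x) (hm.integrable_mollify hk x)]
    simp only [smul_sub]
  rw [h1]
  have hc := contDiff_mollify hf.locallyIntegrable hk.1 hk.2
  refine abs_sub_mollify_le hc.continuous.locallyIntegrable hκ (by positivity) hr
    (Filter.Eventually.of_forall fun y => ?_)
  exact Convex.norm_image_sub_le_of_norm_fderiv_le (𝕜 := ℝ)
    (fun z _ => hc.differentiable (by simp) z)
    (fun z _ => ContinuousLinearMap.opNorm_le_bound _ (by positivity) fun w =>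
      abs_fderiv_mollify_le hf hk hG0 hG z w) convex_univ (Set.mem_univ y) (Set.mem_univ x)

/-! ### Crude bounds for the localisation term and the commutator -/

lemma enorm_inner_le (v w : Euc d) : ‖(inner ℝ v w : ℝ)‖ₑ ≤ ‖v‖ₑ * ‖w‖ₑ := by
  rw [← ofReal_norm v, ← ofReal_norm w, ← ENNReal.ofReal_mul (norm_nonneg _)]
  exact enorm_le_ofReal (norm_inner_le_norm (𝕜 := ℝ) v w)

lemma abs_localisation_le {θ : Euc d → ℝ} {u : Euc d → Euc d} {g : Euc d → ℝ}
    {m : Euc d → Euc d → ℝ} {B D U N : ℝ} (hB : 0 ≤ B) (hD : 0 ≤ D) (hU0 : 0 ≤ U) (hN0 : 0 ≤ N)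
    (hg : ∀ x, |g x| ≤ B) (hm : ∀ z x, |m z x| ≤ D)
    (hU : ∫⁻ x in cell d, ‖u x‖ₑ ≤ ENNReal.ofReal U)
    (hN : ∫⁻ h, ‖gradient θ h‖ₑ ≤ ENNReal.ofReal N) :
    |∫ x in cell d, ∫ z, g x * m z x * inner ℝ (u x) (gradient θ (z - x))| ≤ B * D * (U * N) := by
  refine abs_integral_le_of_lintegral
    (g := fun x => ENNReal.ofReal (B * D) * (‖u x‖ₑ * ENNReal.ofReal N)) (by positivity)
    (Filter.Eventually.of_forall fun x => ?_) ?_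
  · refine (enorm_integral_le_lintegral_enorm _).trans ?_
    calc ∫⁻ z, ‖g x * m z x * inner ℝ (u x) (gradient θ (z - x))‖ₑ
        ≤ ∫⁻ z, ENNReal.ofReal (B * D) * (‖u x‖ₑ * ‖gradient θ (z - x)‖ₑ) := by
          refine lintegral_mono fun z => ?_
          rw [enorm_mul]
          gcongr
          · refine enorm_le_ofReal ?_
            rw [abs_mul]
            exact mul_le_mul (hg x) (hm z x) (abs_nonneg _) hB
          · exact enorm_inner_le _ _
      _ ≤ _ := by
          rw [lintegral_const_mul' _ _ ENNReal.ofReal_ne_top,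
            lintegral_const_mul' _ _ enorm_ne_top, lintegral_enorm_comp_sub]
          gcongr
  · rw [lintegral_const_mul' _ _ ENNReal.ofReal_ne_top,
      lintegral_mul_const' _ _ ENNReal.ofReal_ne_top]
    refine (mul_le_mul_right (mul_le_mul_left hU _) _).trans_eq ?_
    rw [← ENNReal.ofReal_mul hU0, ← ENNReal.ofReal_mul (by positivity)]

lemma volume_closedBall_euc {r : ℝ} (hr : 0 ≤ r) : volume (Metric.closedBall (0 : Euc d) r) =
    ENNReal.ofReal (r ^ d * volume.real (Metric.closedBall (0 : Euc d) 1)) := by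
  rw [Measure.addHaar_closedBall' _ _ hr, ENNReal.ofReal_mul (by positivity), Measure.real,
    ENNReal.ofReal_toReal measure_closedBall_lt_top.ne, finrank_euclideanSpace_fin]

lemma enorm_velocityCommutator_le {f : Euc d → ℝ} {w : Euc d → Euc d} {k : Euc d → ℝ} {A K r : ℝ}
    (hA : 0 ≤ A) (hK : 0 ≤ K) (hf : ∀ x, |f x| ≤ A) (hgk : ∀ h, ‖gradient k h‖ ≤ K)
    (hr : ∀ h, r ≤ ‖h‖ → k h = 0) (x : Euc d) : ‖velocityCommutator f w k x‖ₑ ≤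
      ENNReal.ofReal (A * K) * ∫⁻ h in Metric.closedBall 0 r, ‖w x - w (x - h)‖ₑ := by
  refine (enorm_integral_le_lintegral_enorm _).trans ?_
  rw [← lintegral_const_mul' _ _ ENNReal.ofReal_ne_top,
    ← lintegral_indicator Metric.isClosed_closedBall.measurableSet]
  refine lintegral_mono fun h => ?_
  by_cases hh : h ∈ Metric.closedBall (0 : Euc d) r
  · rw [Set.indicator_of_mem hh, ← ofReal_norm (w x - w (x - h)),
      ← ENNReal.ofReal_mul (by positivity)]
    refine enorm_le_ofReal ?_
    rw [abs_mul]
    calc |f (x - h)| * |inner ℝ (w x - w (x - h)) (gradient k h)|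
        ≤ A * (‖w x - w (x - h)‖ * K) := by
          gcongr
          · exact hf _
          · refine (norm_inner_le_norm (𝕜 := ℝ) _ _).trans ?_
            gcongr
            exact hgk h
      _ = _ := by ring
  · rw [Set.indicator_of_notMem hh]
    have hh' : r < ‖h‖ := by simpa using hh
    rw [gradient_eq_zero_of_eq_zero (fun y hy => hr y hy.le) hh']
    simp

/-- Estimate for R₂. The kernel depends on z, so its gradient is replaced by the sup K, after which
the increments of w can be integrated in x first. Replacing the integral of |∇k| by sup times volume
of the support ball costs r^d K, that is e^{(d+1)Λ}/δ for the kernels in use. -/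
lemma abs_commutator_term_le {k : Euc d → Euc d → ℝ} {r S K G : ℝ} (hk : IsKernelFamily k r S K G)
    {θ : Euc d → ℝ} (hθ : IsKernel θ) {f g : Euc d → ℝ} {w : Euc d → Euc d} {A B W : ℝ}
    (hA : 0 ≤ A) (hB : 0 ≤ B) (hr : 0 ≤ r) (hW0 : 0 ≤ W) (hK : 0 ≤ K) (hf : ∀ x, |f x| ≤ A)
    (hg : ∀ x, |g x| ≤ B) (hw : IsNiceField w)
    (hW : ∫⁻ x in cell d, ‖w x‖ₑ ≤ ENNReal.ofReal W) :
    |∫ x in cell d, ∫ z, g x * velocityCommutator f w (k z) x * θ (z - x)| ≤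
      B * (A * K) * (2 * W * (r ^ d * volume.real (Metric.closedBall (0 : Euc d) 1))) := by
  refine abs_integral_le_of_lintegral (g := fun x => ENNReal.ofReal (B * (A * K)) *
    ∫⁻ h in Metric.closedBall 0 r, ‖w x - w (x - h)‖ₑ) (by positivity)
    (Filter.Eventually.of_forall fun x => ?_) ?_
  · refine (enorm_integral_le_lintegral_enorm _).trans ?_
    have hpt : ∀ z, ‖g x * velocityCommutator f w (k z) x * θ (z - x)‖ₑ ≤
        (ENNReal.ofReal (B * (A * K)) * ∫⁻ h in Metric.closedBall 0 r, ‖w x - w (x - h)‖ₑ) *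
          ‖θ (z - x)‖ₑ := fun z => by
      rw [enorm_mul, enorm_mul, ENNReal.ofReal_mul hB, mul_assoc (ENNReal.ofReal B)]
      gcongr
      · exact enorm_le_ofReal (hg x)
      · exact enorm_velocityCommutator_le hA hK hf (hk.gradient_le z) (hk.eq_zero z) x
    refine (lintegral_mono hpt).trans_eq ?_
    have hm : Measurable fun z => ‖θ (z - x)‖ₑ :=
      (hθ.smooth.continuous.comp (by fun_prop : Continuous fun z => z - x)).measurable.enorm
    rw [lintegral_const_mul _ hm, lintegral_enorm_comp_sub, hθ.lintegral_enorm, mul_one]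
  · rw [lintegral_const_mul' _ _ ENNReal.ofReal_ne_top]
    have hm : Measurable (Function.uncurry fun x h : Euc d => ‖w x - w (x - h)‖ₑ) :=
      ((hw.measurable.comp measurable_fst).sub
        (hw.measurable.comp (measurable_fst.sub measurable_snd))).enorm
    rw [lintegral_lintegral_swap hm.aemeasurable]
    have hle : ∀ h, ∫⁻ x in cell d, ‖w x - w (x - h)‖ₑ ≤ ENNReal.ofReal (2 * W) := fun h => by
      calc ∫⁻ x in cell d, ‖w x - w (x - h)‖ₑ
          ≤ ∫⁻ x in cell d, (‖w x‖ₑ + ‖w (x - h)‖ₑ) := lintegral_mono fun x => enorm_sub_le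
        _ = (∫⁻ x in cell d, ‖w x‖ₑ) + ∫⁻ x in cell d, ‖w x‖ₑ := by
            rw [lintegral_add_left hw.measurable.enorm, lintegral_cell_sub hw.periodic.enorm]
        _ ≤ _ := by
            rw [two_mul, ENNReal.ofReal_add hW0 hW0]
            gcongr
    refine (mul_le_mul_right (lintegral_mono hle) _).trans_eq ?_
    rw [lintegral_const, Measure.restrict_apply_univ, volume_closedBall_euc hr,
      ← ENNReal.ofReal_mul (by positivity), ← ENNReal.ofReal_mul (by positivity)]

/-! ### Measurability of families of mollifications -/

lemma gradient_mollify {f k : Euc d → ℝ} {A : ℝ} (hf : IsNiceFun f A) (hk : IsBump k) (x : Euc d) :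
    gradient (mollify f k) x = ∫ h, f (x - h) • gradient k h := by
  have hi : Integrable fun h => f (x - h) • gradient k h :=
    (locallyIntegrable_comp_sub_left hf.locallyIntegrable x).integrable_smul_right_of_hasCompactSupport
      hk.1.gradient.continuous hk.2.gradient
  refine ext_inner_left ℝ fun w => ?_
  rw [inner_gradient, fderiv_mollify hf.locallyIntegrable hk.1 hk.2, ← integral_inner hi]
  congr 1; ext h
  rw [inner_smul_right, inner_gradient, smul_eq_mul, mul_comm]

section Family

variable {k : Euc d → Euc d → ℝ} {r S K G : ℝ} {X : Type*} [MeasurableSpace X]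

lemma IsKernelFamily.measurable_mollify (hk : IsKernelFamily k r S K G) {f : X → Euc d → ℝ}
    (hf : Measurable (Function.uncurry f)) :
    Measurable fun p : X × Euc d × Euc d => mollify (f p.1) (k p.2.2) p.2.1 := by
  simp only [mollify_apply]
  have h1 : Measurable fun p : (X × Euc d × Euc d) × Euc d => k p.1.2.2 p.2 :=
    hk.measurable.comp ((measurable_snd.comp (measurable_snd.comp measurable_fst)).prodMk
      measurable_snd)
  have h2 : Measurable fun p : (X × Euc d × Euc d) × Euc d => f p.1.1 (p.1.2.1 - p.2) :=
    hf.comp ((measurable_fst.comp measurable_fst).prodMk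
      ((measurable_fst.comp (measurable_snd.comp measurable_fst)).sub measurable_snd))
  exact (h1.smul h2).stronglyMeasurable.integral_prod_right'.measurable

lemma IsKernelFamily.measurable_velocityCommutator (hk : IsKernelFamily k r S K G)
    {f : X → Euc d → ℝ} (hf : Measurable (Function.uncurry f)) {w : Euc d → Euc d}
    (hw : Measurable w) : Measurable fun p : X × Euc d × Euc d =>
      velocityCommutator (f p.1) w (k p.2.2) p.2.1 := by
  simp only [velocityCommutator]
  have h1 : Measurable fun p : (X × Euc d × Euc d) × Euc d => gradient (k p.1.2.2) p.2 :=
    hk.measurable_gradient.comp ((measurable_snd.comp (measurable_snd.comp measurable_fst)).prodMk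
      measurable_snd)
  have hx : Measurable fun p : (X × Euc d × Euc d) × Euc d => p.1.2.1 :=
    measurable_fst.comp (measurable_snd.comp measurable_fst)
  have h2 : Measurable fun p : (X × Euc d × Euc d) × Euc d => f p.1.1 (p.1.2.1 - p.2) :=
    hf.comp ((measurable_fst.comp measurable_fst).prodMk (hx.sub measurable_snd))
  have h3 := ((hw.comp hx).sub (hw.comp (hx.sub measurable_snd))).inner h1 (𝕜 := ℝ)
  exact (h2.mul h3).stronglyMeasurable.integral_prod_right'.measurable

lemma IsKernelFamily.measurable_gradient_mollify (hk : IsKernelFamily k r S K G) {f : Euc d → ℝ}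
    {A : ℝ} (hf : IsNiceFun f A) :
    Measurable fun p : Euc d × Euc d => gradient (mollify f (k p.2)) p.1 := by
  simp only [fun z => gradient_mollify hf (hk.kernel z).isBump]
  have h1 : Measurable fun p : (Euc d × Euc d) × Euc d => gradient (k p.1.2) p.2 :=
    hk.measurable_gradient.comp ((measurable_snd.comp measurable_fst).prodMk measurable_snd)
  have h2 : Measurable fun p : (Euc d × Euc d) × Euc d => f (p.1.1 - p.2) :=
    hf.measurable.comp ((measurable_fst.comp measurable_fst).sub measurable_snd)
  exact (h2.smul h1).stronglyMeasurable.integral_prod_right'.measurable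

end Family

/-! ### Testing against the dual norm of W^{1,∞} -/

lemma ae_abs_le_supNormTorus {F : Type*} [NormedAddCommGroup F] {f : Euc d → F}
    (hf : MemLp f ⊤ (torusMeasure d)) : ∀ᵐ x ∂torusMeasure d, ‖f x‖ ≤ supNormTorus f := by
  have h1 := ae_le_eLpNormEssSup (f := f) (μ := torusMeasure d)
  filter_upwards [h1] with x hx
  rw [supNormTorus, eLpNorm_exponent_top, ← toReal_enorm]
  refine ENNReal.toReal_mono ?_ hx
  rw [← eLpNorm_exponent_top]
  exact hf.2.ne

lemma supNormTorus_nonneg {F : Type*} [NormedAddCommGroup F] (f : Euc d → F) :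
    0 ≤ supNormTorus f := ENNReal.toReal_nonneg

lemma supNormTorus_le {F : Type*} [NormedAddCommGroup F] {f : Euc d → F} {B : ℝ} (hB : 0 ≤ B)
    (h : ∀ᵐ x ∂torusMeasure d, ‖f x‖ ≤ B) : supNormTorus f ≤ B := by
  refine ENNReal.toReal_le_of_le_ofReal hB ?_
  rw [eLpNorm_exponent_top]
  exact eLpNormEssSup_le_of_ae_bound h

lemma bddAbove_negSobolev {f : Euc d → ℝ} {B : ℝ} (hf : ∀ᵐ x ∂torusMeasure d, |f x| ≤ B) :
    BddAbove {s | ∃ ψ ∈ unitBallW1Inf d, s = ∫ x in cell d, f x * ψ x} := by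
  refine ⟨B, ?_⟩
  rintro _ ⟨ψ, ⟨hψ, g, -, -, hn⟩, rfl⟩
  have h1 : supNormTorus ψ ≤ 1 := by linarith [supNormTorus_nonneg g]
  have h2 := norm_integral_le_of_norm_le_const (μ := torusMeasure d) (f := fun x => f x * ψ x)
    (C := B) (by
      filter_upwards [hf, ae_abs_le_supNormTorus hψ.2] with x hx hx'
      rw [norm_mul]
      calc ‖f x‖ * ‖ψ x‖ ≤ B * 1 := mul_le_mul hx (hx'.trans h1) (norm_nonneg _)
            ((abs_nonneg _).trans hx)
        _ = B := mul_one B)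
  rw [measureReal_def, measure_univ, ENNReal.toReal_one, mul_one] at h2
  exact (le_abs_self _).trans h2

lemma HasWeakGradient.const_mul {f : Euc d → ℝ} {g : Euc d → Euc d} (h : HasWeakGradient f g)
    (c : ℝ) : HasWeakGradient (fun x => c * f x) fun x => c • g x := fun ψ hψ i => by
  have := h ψ hψ i
  simp only [PiLp.smul_apply, smul_eq_mul, mul_assoc]
  rw [integral_const_mul, integral_const_mul, this, mul_neg]

/-- Both ψ/c and -ψ/c belong to the unit ball of W^{1,∞}. The supremum defining the dual norm is
over a bounded set because f is essentially bounded, so it dominates each of its elements. -/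
lemma abs_integral_mul_le_negSobolevNorm {f ψ : Euc d → ℝ} {g : Euc d → Euc d} {B a b c : ℝ}
    (hf : ∀ᵐ x ∂torusMeasure d, |f x| ≤ B) (hψ : IsNiceFun ψ a) (hg : Measurable g)
    (hgb : ∀ x, ‖g x‖ ≤ b) (hw : HasWeakGradient ψ g) (hc : 0 < c) (hab : a + b ≤ c) :
    |∫ x in cell d, f x * ψ x| ≤ c * negSobolevNorm f := by
  have hmem : ∀ s : ℝ, |s| = 1 → (fun x => (s / c) * ψ x) ∈ unitBallW1Inf d := fun s hs => by
    have ha := hψ.nonneg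
    have hb : 0 ≤ b := (norm_nonneg _).trans (hgb 0)
    have hsc : |s / c| = c⁻¹ := by rw [abs_div, hs, abs_of_pos hc, one_div]
    have b1 : ∀ x, ‖s / c * ψ x‖ ≤ c⁻¹ * a := fun x => by
      rw [norm_mul, Real.norm_eq_abs, hsc]
      exact mul_le_mul_of_nonneg_left (hψ.bound x) (by positivity)
    have b2 : ∀ x, ‖(s / c) • g x‖ ≤ c⁻¹ * b := fun x => by
      rw [norm_smul, Real.norm_eq_abs, hsc]
      exact mul_le_mul_of_nonneg_left (hgb x) (by positivity)
    refine ⟨⟨fun x i => by simp only [hψ.periodic x i], ?_⟩, fun x => (s / c) • g x, ?_,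
      hw.const_mul _, ?_⟩
    · exact memLp_top_of_bound (hψ.measurable.const_mul _).aestronglyMeasurable _
        (Filter.Eventually.of_forall b1)
    · exact memLp_top_of_bound (hg.const_smul (s / c)).aestronglyMeasurable _
        (Filter.Eventually.of_forall b2)
    · have h1 := supNormTorus_le (f := fun x => s / c * ψ x) (B := c⁻¹ * a) (by positivity)
        (Filter.Eventually.of_forall b1)
      have h2 := supNormTorus_le (f := fun x => (s / c) • g x) (B := c⁻¹ * b) (by positivity)
        (Filter.Eventually.of_forall b2)
      have h3 : c⁻¹ * a + c⁻¹ * b ≤ 1 := by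
        rw [← mul_add, inv_mul_le_one₀ hc]
        exact hab
      linarith
  have hle : ∀ s : ℝ, |s| = 1 → s * ∫ x in cell d, f x * ψ x ≤ c * negSobolevNorm f := fun s hs => by
    have h1 : ∫ x in cell d, f x * (s / c * ψ x) ≤ negSobolevNorm f :=
      le_csSup (bddAbove_negSobolev hf) ⟨_, hmem s hs, rfl⟩
    have h2 : ∫ x in cell d, f x * (s / c * ψ x) = s / c * ∫ x in cell d, f x * ψ x := by
      rw [← integral_const_mul]
      congr 1; ext x; ring
    rw [h2] at h1
    calc s * ∫ x in cell d, f x * ψ x = c * (s / c * ∫ x in cell d, f x * ψ x) := by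
          field_simp
      _ ≤ _ := mul_le_mul_of_nonneg_left h1 hc.le
  refine abs_le.2 ⟨?_, ?_⟩
  · have := hle (-1) (by simp)
    linarith
  · have := hle 1 (by simp)
    linarith

section Initial

variable {k : Euc d → Euc d → ℝ} {r S K G : ℝ} {θ : Euc d → ℝ} {f : Euc d → ℝ} {A N : ℝ}

lemma gradient_mul_reflect (hk : IsKernelFamily k r S K G) (hθ : IsBump θ) (hf : IsNiceFun f A)
    (x z : Euc d) : gradient (fun y => mollify f (k z) y * reflect θ z y) x =
      θ (z - x) • gradient (mollify f (k z)) x - mollify f (k z) x • gradient θ (z - x) := by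
  have h1 : HasFDerivAt (mollify f (k z)) (fderiv ℝ (mollify f (k z)) x) x :=
    ((contDiff_mollify hf.locallyIntegrable (hk.kernel z).smooth (hk.kernel z).compact).differentiable
      (by simp) x).hasFDerivAt
  have h2 : HasFDerivAt (reflect θ z) (fderiv ℝ (reflect θ z) x) x :=
    ((hθ.reflect z).1.differentiable (by simp) x).hasFDerivAt
  refine gradient_eq_of_hasFDerivAt (h1.fun_mul h2) fun w => ?_
  rw [inner_sub_right, inner_smul_right, inner_smul_right, inner_gradient, inner_gradient]
  simp only [add_apply, smul_apply, fderiv_reflect hθ, smul_eq_mul, reflect]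
  ring

/-- The localized mollification of the initial datum is bounded in `W^{1,∞}`. -/
lemma abs_initial_term_le (hk : IsKernelFamily k r S K G) (hθ : IsKernel θ) (hf : IsNiceFun f A)
    (hG : 0 ≤ G) (hN0 : 0 ≤ N) (hN : ∫⁻ h, ‖gradient θ h‖ₑ ≤ ENNReal.ofReal N) {g : Euc d → ℝ}
    {B c : ℝ} (hg : ∀ᵐ x ∂torusMeasure d, |g x| ≤ B) (hc : 0 < c) (hAc : A * (1 + G + N) ≤ c) :
    |∫ x in cell d, ∫ z, g x * mollify f (k z) x * θ (z - x)| ≤ c * negSobolevNorm g := by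
  have hA := hf.nonneg
  have hsub : Measurable fun p : Euc d × Euc d => p.2 - p.1 := measurable_snd.sub measurable_fst
  have hmm : Measurable fun p : Euc d × Euc d => mollify f (k p.2) p.1 :=
    (hk.measurable_mollify (X := Unit) (f := fun _ => f)
      (hf.measurable.comp measurable_snd)).comp (measurable_const (a := ()) |>.prodMk measurable_id)
  have hgm := hk.measurable_gradient_mollify hf
  have hθm : Measurable fun p : Euc d × Euc d => θ (p.2 - p.1) :=
    hθ.smooth.continuous.measurable.comp hsub
  have hθgm : Measurable fun p : Euc d × Euc d => gradient θ (p.2 - p.1) :=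
    hθ.smooth.gradient.continuous.measurable.comp hsub
  have hmb : ∀ z, IsNiceFun (mollify f (k z)) A := fun z => hf.mollify (hk.kernel z)
  have hmp : ∀ z i x, mollify f (k (z + EuclideanSpace.single i 1)) (x + EuclideanSpace.single i 1) =
      mollify f (k z) x := fun z i x => by
    rw [hk.periodic z i]
    exact (hmb z).periodic x i
  have hgb : ∀ z x, ‖gradient (mollify f (k z)) x‖ ≤ A * G := fun z x => by
    rw [norm_gradient]
    exact ContinuousLinearMap.opNorm_le_bound _ (by positivity) fun w =>
      abs_fderiv_mollify_le hf (hk.kernel z).isBump hG (hk.lintegral_gradient_le z) x w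
  -- D x z is the gradient in x of (f*k_z)(x) θ(z-x). Its integral over z is the candidate for the
  -- weak gradient of Ψ, bounded by AG + AN.
  let D : Euc d → Euc d → Euc d := fun x z =>
    θ (z - x) • gradient (mollify f (k z)) x - mollify f (k z) x • gradient θ (z - x)
  have hDm : Measurable (Function.uncurry D) := (hθm.smul hgm).sub (hmm.smul hθgm)
  have hDb : ∀ x, ∫⁻ z, ‖D x z‖ₑ ≤ ENNReal.ofReal (A * G + A * N) := fun x => by
    have hpt : ∀ z, ‖D x z‖ₑ ≤ ENNReal.ofReal (A * G) * ‖θ (z - x)‖ₑ +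
        ENNReal.ofReal A * ‖gradient θ (z - x)‖ₑ := fun z => by
      refine enorm_sub_le.trans ?_
      rw [enorm_smul, enorm_smul, mul_comm]
      gcongr
      · rw [← ofReal_norm]
        exact ENNReal.ofReal_le_ofReal (hgb z x)
      · exact enorm_le_ofReal ((hmb z).bound x)
    have hm : Measurable fun z => ‖θ (z - x)‖ₑ :=
      (hθ.smooth.continuous.comp (by fun_prop : Continuous fun z => z - x)).measurable.enorm
    refine (lintegral_mono hpt).trans ?_
    rw [lintegral_add_left (hm.const_mul _), lintegral_const_mul' _ _ ENNReal.ofReal_ne_top,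
      lintegral_const_mul' _ _ ENNReal.ofReal_ne_top, lintegral_enorm_comp_sub,
      lintegral_enorm_comp_sub, hθ.lintegral_enorm, mul_one, ENNReal.ofReal_add (by positivity)
      (by positivity), ENNReal.ofReal_mul hA (q := N)]
    gcongr
  have hDi : ∀ x, Integrable (D x) := fun x =>
    ⟨(hDm.comp measurable_prodMk_left).aestronglyMeasurable,
      (hDb x).trans_lt ENNReal.ofReal_lt_top⟩
  let Ψ : Euc d → ℝ := fun x => ∫ z, mollify f (k z) x * θ (z - x)
  have hFb : ∀ x, ∫⁻ z, ‖mollify f (k z) x * θ (z - x)‖ₑ ≤ ENNReal.ofReal A := fun x => by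
    calc _ ≤ ∫⁻ z, ENNReal.ofReal A * ‖θ (z - x)‖ₑ := lintegral_mono fun z => by
          rw [enorm_mul]
          gcongr
          exact enorm_le_ofReal ((hmb z).bound x)
      _ = _ := by
          rw [lintegral_const_mul' _ _ ENNReal.ofReal_ne_top, lintegral_enorm_comp_sub,
            hθ.lintegral_enorm, mul_one]
  have hΨ : IsNiceFun Ψ A := by
    refine ⟨((hmm.mul hθm).stronglyMeasurable.integral_prod_right').measurable, fun x i => ?_,
      fun x => abs_integral_le_of_lintegral hA (Filter.Eventually.of_forall fun _ => le_rfl) (hFb x)⟩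
    simp only [Ψ]
    rw [← integral_add_right_eq_self _ (EuclideanSpace.single i (1 : ℝ))]
    simp only [hmp, add_sub_add_right_eq_sub]
  have hDper : ∀ x i z, D (x + EuclideanSpace.single i 1) (z + EuclideanSpace.single i 1) = D x z :=
    fun x i z => by
      simp only [D, add_sub_add_right_eq_sub, hk.periodic z i, (hmb z).periodic x i,
        (hmb z).periodic.gradient x i]
  -- The weak gradient is verified with z outermost: for fixed z everything is smooth and compactly
  -- supported in x, while the dependence on z is only measurable. Both sides are brought to this
  -- order by `integral_diag`.
  have hw : HasWeakGradient Ψ fun x => ∫ z, D x z := fun ψ hψ i => by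
    obtain ⟨C, hC0, hC⟩ := hψ.2.exists_bound hψ.1.continuous
    obtain ⟨C', hC0', hC'⟩ := hψ.2.gradient.exists_bound hψ.1.gradient.continuous
    have hψi : Continuous fun x => gradient ψ x i :=
      (EuclideanSpace.proj (𝕜 := ℝ) i).continuous.comp hψ.1.gradient.continuous
    have e1 : ∫ x in cell d, Ψ x * gradient ψ x i =
        ∫ z in cell d, ∫ x, mollify f (k z) x * θ (z - x) * gradient ψ x i := by
      rw [← integral_diag (f := fun x z => mollify f (k z) x * θ (z - x) * gradient ψ x i)]
      · simp only [Ψ, integral_mul_const]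
      · exact (hmm.mul hθm).mul (hψi.measurable.comp measurable_fst)
      · intro x z j
        simp only [hmp, add_sub_add_right_eq_sub, hψ.2.gradient x j]
      · refine ne_top_of_le_ne_top (b := ENNReal.ofReal A * ENNReal.ofReal C')
          (ENNReal.mul_ne_top ENNReal.ofReal_ne_top ENNReal.ofReal_ne_top) ?_
        refine (lintegral_mono (g := fun _ => ENNReal.ofReal A * ENNReal.ofReal C') fun x => ?_).trans_eq
          (by rw [lintegral_const, measure_univ, mul_one])
        simp only [enorm_mul _ (gradient ψ x i)]
        rw [lintegral_mul_const' _ _ enorm_ne_top]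
        exact mul_le_mul' (hFb x) (enorm_le_ofReal ((PiLp.norm_apply_le _ i).trans (hC' x)))
    have e2 : ∫ x in cell d, (∫ z, D x z) i * ψ x = ∫ z in cell d, ∫ x, D x z i * ψ x := by
      rw [← integral_diag (f := fun x z => D x z i * ψ x)]
      · congr 1; ext x
        rw [integral_mul_const]
        congr 1
        exact ((EuclideanSpace.proj (𝕜 := ℝ) i).integral_comp_comm (hDi x)).symm
      · exact ((measurable_coord i).comp hDm).mul (hψ.1.continuous.measurable.comp measurable_fst)
      · intro x z j
        simp only [hDper, hψ.2 x j]
      · refine ne_top_of_le_ne_top (b := ENNReal.ofReal (A * G + A * N) * ENNReal.ofReal C)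
          (ENNReal.mul_ne_top ENNReal.ofReal_ne_top ENNReal.ofReal_ne_top) ?_
        refine (lintegral_mono (g := fun _ => ENNReal.ofReal (A * G + A * N) * ENNReal.ofReal C)
          fun x => ?_).trans_eq (by rw [lintegral_const, measure_univ, mul_one])
        simp only [enorm_mul]
        rw [lintegral_mul_const' _ _ enorm_ne_top]
        refine mul_le_mul' ((lintegral_mono fun z => ?_).trans (hDb x)) (enorm_le_ofReal (hC x))
        rw [← ofReal_norm, ← ofReal_norm]
        exact ENNReal.ofReal_le_ofReal (PiLp.norm_apply_le _ i)
    rw [e1, e2, ← integral_neg]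
    congr 1; ext z
    have hbz : IsBump fun y => mollify f (k z) y * reflect θ z y :=
      ⟨(contDiff_mollify hf.locallyIntegrable (hk.kernel z).smooth (hk.kernel z).compact).mul
        (hθ.isBump.reflect z).1, (hθ.isBump.reflect z).2.mul_left⟩
    have hbz' : IsBump fun y => (mollify f (k z) y * reflect θ z y) * ψ y :=
      hbz.mul_smooth hψ.1
    have h0 := integral_fderiv_eq_zero hbz'.1 hbz'.2 (EuclideanSpace.single i (1 : ℝ))
    have hd : ∀ x, fderiv ℝ (fun y => (mollify f (k z) y * reflect θ z y) * ψ y) x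
        (EuclideanSpace.single i 1) =
        mollify f (k z) x * θ (z - x) * gradient ψ x i + D x z i * ψ x := fun x => by
      rw [← inner_gradient, inner_gradient_mul hbz.1 hψ.1, ← gradient_apply, ← gradient_apply,
        gradient_mul_reflect hk hθ.isBump hf]
      simp only [reflect]
      ring
    simp only [hd] at h0
    rw [integral_add] at h0
    · linarith
    · exact (hbz.1.continuous.mul hψi).integrable_of_hasCompactSupport hbz.2.mul_right
    · have hDc : (fun x => D x z i) = fun x =>
          gradient (fun y => mollify f (k z) y * reflect θ z y) x i := by
        ext x
        rw [gradient_mul_reflect hk hθ.isBump hf]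
      have hcs : HasCompactSupport fun x =>
          gradient (fun y => mollify f (k z) y * reflect θ z y) x i :=
        hbz.2.gradient.comp_left (g := fun v : Euc d => v i) rfl
      have hcc : Continuous fun x =>
          gradient (fun y => mollify f (k z) y * reflect θ z y) x i :=
        (EuclideanSpace.proj (𝕜 := ℝ) i).continuous.comp hbz.1.gradient.continuous
      have : Integrable fun x => (fun x => D x z i) x * ψ x := by
        rw [hDc]
        exact (hcc.mul hψ.1.continuous).integrable_of_hasCompactSupport hcs.mul_right
      exact this
  have hfin := abs_integral_mul_le_negSobolevNorm (f := g) (b := A * G + A * N) hg hΨ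
    hDm.stronglyMeasurable.integral_prod_right.measurable (fun x => ?_) hw hc (by linarith)
  · refine le_trans (le_of_eq ?_) hfin
    congr 2; ext x
    simp only [Ψ, mul_assoc, integral_const_mul]
  · have h1 := (enorm_integral_le_lintegral_enorm (D x)).trans (hDb x)
    rwa [← ofReal_norm, ENNReal.ofReal_le_ofReal_iff (by positivity)] at h1

end Initial

/-! ### The energy defect of a mollification -/

lemma integrable_sub_add {X : Type*} [MeasurableSpace X] {μ : Measure X} {f g h : X → ℝ}
    (hf : Integrable f μ) (hg : Integrable g μ) (hh : Integrable h μ) :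
    Integrable (fun x => f x - g x + h x) μ := (hf.sub hg).add hh

lemma integral_sub_add {X : Type*} [MeasurableSpace X] {μ : Measure X} {f g h : X → ℝ}
    (hf : Integrable f μ) (hg : Integrable g μ) (hh : Integrable h μ) :
    ∫ x, (f x - g x + h x) ∂μ = (∫ x, f x ∂μ) - (∫ x, g x ∂μ) + ∫ x, h x ∂μ := by
  have h1 : Integrable (fun x => f x - g x) μ := hf.sub hg
  rw [integral_add h1 hh, integral_sub hf hg]

/-- The mean of (F a - F b)² over two independent samples is twice the variance of F. -/
lemma lintegral_variance {η F : Euc d → ℝ} (hη : IsKernel η) {A : ℝ} (hF : Measurable F)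
    (hA : ∀ a, |F a| ≤ A) :
    ∫⁻ a, ∫⁻ b, ENNReal.ofReal (η a * (η b * (F a - F b) ^ 2)) =
      ENNReal.ofReal (2 * ((∫ a, η a * F a ^ 2) - (∫ a, η a * F a) ^ 2)) := by
  have i0 := hη.integrable
  have i1 : Integrable fun a => η a * F a := i0.mul_bdd (c := A) hF.aestronglyMeasurable
    (Filter.Eventually.of_forall hA)
  have i2 : Integrable fun a => η a * F a ^ 2 := by
    refine i0.mul_bdd (c := A ^ 2) (hF.pow_const 2).aestronglyMeasurable
      (Filter.Eventually.of_forall fun a => ?_)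
    rw [norm_pow]
    exact pow_le_pow_left₀ (norm_nonneg _) (hA a) 2
  set m := ∫ a, η a * F a
  set q := ∫ a, η a * F a ^ 2
  have hin : ∀ a, (∀ b, η a * (η b * (F a - F b) ^ 2) =
      η a * F a ^ 2 * η b - 2 * (η a * F a) * (η b * F b) + η a * (η b * F b ^ 2)) :=
    fun a b => by ring
  have hint : ∀ a, Integrable fun b => η a * (η b * (F a - F b) ^ 2) := fun a => by
    simp only [hin]
    exact ((i0.const_mul _).sub (i1.const_mul _)).add (i2.const_mul _)
  have e1 : ∀ a, ∫ b, η a * (η b * (F a - F b) ^ 2) =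
      η a * F a ^ 2 - 2 * m * (η a * F a) + q * η a := fun a => by
    simp only [hin]
    rw [integral_sub_add (i0.const_mul (η a * F a ^ 2)) (i1.const_mul (2 * (η a * F a)))
      (i2.const_mul (η a)), integral_const_mul, integral_const_mul, integral_const_mul,
      hη.integral_eq_one]
    ring
  have hnn : ∀ a b, 0 ≤ η a * (η b * (F a - F b) ^ 2) := fun a b =>
    mul_nonneg (hη.nonneg a) (mul_nonneg (hη.nonneg b) (sq_nonneg _))
  have e2 : ∀ a, ∫⁻ b, ENNReal.ofReal (η a * (η b * (F a - F b) ^ 2)) =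
      ENNReal.ofReal (η a * F a ^ 2 - 2 * m * (η a * F a) + q * η a) := fun a => by
    rw [← e1, ofReal_integral_eq_lintegral_ofReal (hint a)
      (Filter.Eventually.of_forall (hnn a))]
  simp only [e2]
  rw [← ofReal_integral_eq_lintegral_ofReal
    (integrable_sub_add i2 (i1.const_mul (2 * m)) (i0.const_mul q))
    (Filter.Eventually.of_forall fun a => by
      simp only [Pi.zero_apply, ← e1]
      exact integral_nonneg (hnn a)),
    integral_sub_add i2 (i1.const_mul (2 * m)) (i0.const_mul q), integral_const_mul,
    integral_const_mul, hη.integral_eq_one]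
  congr 1
  ring

lemma integral_cell_mollify {f k : Euc d → ℝ} {A : ℝ} (hf : IsNiceFun f A) (hk : IsKernel k) :
    ∫ x in cell d, mollify f k x = ∫ x in cell d, f x := by
  have := integral_cell_mul_translate (ψ := fun _ => 1) hf.periodic hf.integrable hf.measurable
    (fun _ _ => rfl) continuous_const hk.smooth.continuous hk.compact
  simp only [one_mul, mul_one, hk.integral_eq_one] at this
  simpa only [mollify_apply, smul_eq_mul] using this

lemma IsNiceFun.pow_two {f : Euc d → ℝ} {A : ℝ} (hf : IsNiceFun f A) :
    IsNiceFun (fun x => f x ^ 2) (A ^ 2) :=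
  ⟨hf.measurable.pow_const 2, fun x i => by simp only [hf.periodic x i], fun x => by
    rw [abs_pow]
    exact pow_le_pow_left₀ (abs_nonneg _) (hf.bound x) 2⟩

lemma sq_mollify_le {f η : Euc d → ℝ} {A : ℝ} (hf : IsNiceFun f A) (hη : IsKernel η) (x : Euc d) :
    mollify f η x ^ 2 ≤ mollify (fun y => f y ^ 2) η x := by
  have h1 : 0 ≤ ∫ a, η a * (f (x - a) - mollify f η x) ^ 2 :=
    integral_nonneg fun a => mul_nonneg (hη.nonneg a) (sq_nonneg _)
  have i1 := hf.integrable_mollify hη.isBump x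
  have i2 := hf.pow_two.integrable_mollify hη.isBump x
  simp only [smul_eq_mul] at i1 i2
  have e : ∀ a, η a * (f (x - a) - mollify f η x) ^ 2 = η a * f (x - a) ^ 2 -
      2 * mollify f η x * (η a * f (x - a)) + mollify f η x ^ 2 * η a := fun a => by ring
  simp only [e] at h1
  rw [integral_sub_add i2 (i1.const_mul (2 * mollify f η x))
    (hη.integrable.const_mul (mollify f η x ^ 2)), integral_const_mul, integral_const_mul,
    hη.integral_eq_one] at h1
  have e1 : ∫ a, η a * f (x - a) = mollify f η x := rfl
  have e2 : ∫ a, η a * f (x - a) ^ 2 = mollify (fun y => f y ^ 2) η x := rfl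
  rw [e1, e2] at h1
  nlinarith

/-- At each x the quantity f²*η - (f*η)² is the variance of f(x - ·) under η, and by periodicity
f²*η has the same integral over the cell as f². Writing the variance with two samples a and b = a +
h and integrating over x leaves the increments of f weighted by the autocorrelation of η. -/
lemma lintegral_energy {f η : Euc d → ℝ} {A : ℝ} (hf : IsNiceFun f A) (hη : IsKernel η) :
    ∫⁻ h, (∫⁻ a, ENNReal.ofReal (η a * η (a + h))) *
      ∫⁻ x in cell d, ENNReal.ofReal ((f x - f (x - h)) ^ 2) =
      ENNReal.ofReal (2 * ((∫ x in cell d, f x ^ 2) - ∫ x in cell d, mollify f η x ^ 2)) := by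
  have hηm := hη.smooth.continuous.measurable
  have hfm := hf.measurable
  have hm := hf.mollify hη
  have hv : ∀ x, ENNReal.ofReal (2 * (mollify (fun y => f y ^ 2) η x - mollify f η x ^ 2)) =
      ∫⁻ a, ∫⁻ b, ENNReal.ofReal (η a * (η b * (f (x - a) - f (x - b)) ^ 2)) := fun x =>
    (lintegral_variance hη (hfm.comp (measurable_const.sub measurable_id)) fun a =>
      hf.bound (x - a)).symm
  have hvnn : ∀ x, 0 ≤ 2 * (mollify (fun y => f y ^ 2) η x - mollify f η x ^ 2) := fun x => by
    linarith [sq_mollify_le hf hη x]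
  have i3 : Integrable (fun x => mollify (fun y => f y ^ 2) η x) (volume.restrict (cell d)) :=
    (hf.pow_two.mollify hη).integrable
  have i4 : Integrable (fun x => mollify f η x ^ 2) (volume.restrict (cell d)) :=
    hm.pow_two.integrable
  have i5 : Integrable (fun x => 2 * (mollify (fun y => f y ^ 2) η x - mollify f η x ^ 2))
      (volume.restrict (cell d)) := (i3.sub i4).const_mul 2
  rw [← integral_cell_mollify hf.pow_two hη, ← integral_sub i3 i4, ← integral_const_mul,
    ofReal_integral_eq_lintegral_ofReal i5
      (Filter.Eventually.of_forall hvnn)]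
  simp only [hv]
  have m3 : Measurable fun p : (Euc d × Euc d) × Euc d =>
      ENNReal.ofReal (η p.1.2 * (η p.2 * (f (p.1.1 - p.1.2) - f (p.1.1 - p.2)) ^ 2)) := by
    have hx : Measurable fun p : (Euc d × Euc d) × Euc d => p.1.1 :=
      measurable_fst.comp measurable_fst
    have ha : Measurable fun p : (Euc d × Euc d) × Euc d => p.1.2 :=
      measurable_snd.comp measurable_fst
    exact ((hηm.comp ha).mul ((hηm.comp measurable_snd).mul (((hfm.comp (hx.sub ha)).sub
      (hfm.comp (hx.sub measurable_snd))).pow_const 2))).ennreal_ofReal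
  rw [lintegral_lintegral_swap (m3.lintegral_prod_right').aemeasurable]
  -- After the substitution b = a + h a translation of x by a removes a from the inner integral.
  have s1 : ∀ a, ∫⁻ x in cell d, ∫⁻ b,
      ENNReal.ofReal (η a * (η b * (f (x - a) - f (x - b)) ^ 2)) =
      ∫⁻ h, ENNReal.ofReal (η a * η (a + h)) *
        ∫⁻ x in cell d, ENNReal.ofReal ((f x - f (x - h)) ^ 2) := fun a => by
    have m2 : Measurable fun p : Euc d × Euc d =>
        ENNReal.ofReal (η a * (η p.2 * (f (p.1 - a) - f (p.1 - p.2)) ^ 2)) :=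
      m3.comp ((measurable_fst.prodMk measurable_const).prodMk measurable_snd)
    rw [lintegral_lintegral_swap m2.aemeasurable,
      ← lintegral_add_left_eq_self _ a]
    refine lintegral_congr fun h => ?_
    have hper : IsPeriodic fun x => ENNReal.ofReal ((f x - f (x - h)) ^ 2) := fun x i => by
      simp only [add_sub_right_comm, hf.periodic x i, hf.periodic (x - h) i]
    rw [← lintegral_cell_sub hper a, ← lintegral_const_mul' _ _ ENNReal.ofReal_ne_top]
    refine lintegral_congr fun x => ?_
    rw [← ENNReal.ofReal_mul (mul_nonneg (hη.nonneg _) (hη.nonneg _)), mul_assoc, sub_sub x a h]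
  simp only [s1]
  have m4 : Measurable fun p : Euc d × Euc d => ENNReal.ofReal (η p.1 * η (p.1 + p.2)) :=
    ((hηm.comp measurable_fst).mul (hηm.comp (measurable_fst.add measurable_snd))).ennreal_ofReal
  have m5 : Measurable fun p : Euc d × Euc d => ENNReal.ofReal ((f p.2 - f (p.2 - p.1)) ^ 2) :=
    (((hfm.comp measurable_snd).sub (hfm.comp (measurable_snd.sub measurable_fst))).pow_const
      2).ennreal_ofReal
  have m6 : Measurable fun h => ∫⁻ x in cell d, ENNReal.ofReal ((f x - f (x - h)) ^ 2) :=
    m5.lintegral_prod_right'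
  rw [lintegral_lintegral_swap (f := fun a h => ENNReal.ofReal (η a * η (a + h)) *
    ∫⁻ x in cell d, ENNReal.ofReal ((f x - f (x - h)) ^ 2))
    (m4.mul (m6.comp measurable_snd)).aemeasurable]
  refine lintegral_congr fun h => ?_
  have m7 : Measurable fun a => ENNReal.ofReal (η a * η (a + h)) :=
    m4.comp (measurable_id.prodMk measurable_const)
  rw [lintegral_mul_const _ m7]

/-- The autocorrelation of η at scale 2r is bounded below for ‖h‖ ≤ r, so the energy identity
controls the increments over this ball. This explains the scale 2δe^Λ in the bound for I₃': the
kernels there have radius δe^Λ. -/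
lemma exists_lintegral_sq_sub_le {η : Euc d → ℝ} (hη : IsMollifier η) : ∃ c : ℝ, 0 < c ∧
    ∀ (r : ℝ) (f : Euc d → ℝ) (A : ℝ), 0 < r → IsNiceFun f A →
      ∫⁻ h in Metric.closedBall 0 r, ∫⁻ x in cell d, ENNReal.ofReal ((f x - f (x - h)) ^ 2) ≤
        ENNReal.ofReal (c * r ^ d *
          ((∫ x in cell d, f x ^ 2) - ∫ x in cell d, mollify f (rescale η (2 * r)) x ^ 2)) := by
  obtain ⟨b, hb, hge⟩ := hη.exists_ge
  set V := volume.real (Metric.closedBall (0 : Euc d) 1) with hV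
  have hVpos : 0 < V := by
    rw [hV, measureReal_def]
    exact ENNReal.toReal_pos (Metric.measure_closedBall_pos _ _ one_pos).ne'
      measure_closedBall_lt_top.ne
  -- The factor 2 comes from the variance identity, and b²V/(8r)^d is the lower bound for the
  -- autocorrelation.
  refine ⟨2 * 8 ^ d / (b ^ 2 * V), by positivity, fun r f A hr hf => ?_⟩
  have hk := hη.isKernel_rescale (r := 2 * r) (by positivity)
  have hlow : ∀ h ∈ Metric.closedBall (0 : Euc d) r, ENNReal.ofReal (b ^ 2 * V / (8 * r) ^ d) ≤
      ∫⁻ a, ENNReal.ofReal (rescale η (2 * r) a * rescale η (2 * r) (a + h)) := fun h hh => by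
    have hh' : ‖h‖ ≤ r := by simpa using hh
    have hres : ∀ a : Euc d, ‖a‖ ≤ r → ((2 * r) ^ d)⁻¹ * b ≤ rescale η (2 * r) a := fun a ha => by
      refine mul_le_mul_of_nonneg_left (hge _ ?_) (by positivity)
      rw [norm_smul, norm_inv, Real.norm_of_nonneg (by positivity), inv_mul_le_iff₀ (by positivity)]
      linarith
    -- If a lies within r/2 of -h/2, then a and a + h both have norm at most r, where the rescaled η
    -- is at least b(2r)^{-d}. The volume V(r/2)^d of this ball yields 8 = 2·2·2.
    calc ENNReal.ofReal (b ^ 2 * V / (8 * r) ^ d)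
        = ENNReal.ofReal ((((2 * r) ^ d)⁻¹ * b) * (((2 * r) ^ d)⁻¹ * b)) *
            volume (Metric.closedBall (-(2⁻¹ : ℝ) • h) (r / 2)) := by
          rw [Measure.addHaar_closedBall_center, volume_closedBall_euc (by positivity),
            ← ENNReal.ofReal_mul (by positivity), ← hV]
          congr 1
          rw [show (8 * r) ^ d = (2 * r) ^ d * (2 * r) ^ d * ((r / 2) ^ d)⁻¹ by
            rw [← inv_pow, ← mul_pow, ← mul_pow]; congr 1; field_simp; norm_num]
          field_simp
      _ = ∫⁻ a in Metric.closedBall (-(2⁻¹ : ℝ) • h) (r / 2),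
            ENNReal.ofReal ((((2 * r) ^ d)⁻¹ * b) * (((2 * r) ^ d)⁻¹ * b)) := by
          rw [lintegral_const, Measure.restrict_apply_univ]
      _ ≤ ∫⁻ a in Metric.closedBall (-(2⁻¹ : ℝ) • h) (r / 2),
            ENNReal.ofReal (rescale η (2 * r) a * rescale η (2 * r) (a + h)) := by
          refine setLIntegral_mono' Metric.isClosed_closedBall.measurableSet fun a ha => ?_
          rw [mem_closedBall_iff_norm] at ha
          have h2 : ‖(2⁻¹ : ℝ) • h‖ ≤ r / 2 := by
            rw [norm_smul, Real.norm_of_nonneg (by norm_num)]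
            linarith
          refine ENNReal.ofReal_le_ofReal (mul_le_mul (hres a ?_) (hres _ ?_) (by positivity)
            (hk.nonneg _))
          · have := norm_add_le (a - -(2⁻¹ : ℝ) • h) (-(2⁻¹ : ℝ) • h)
            rw [sub_add_cancel, neg_smul, norm_neg, ← neg_smul] at this
            linarith
          · have := norm_add_le (a - -(2⁻¹ : ℝ) • h) ((2⁻¹ : ℝ) • h)
            rw [show a - -(2⁻¹ : ℝ) • h + (2⁻¹ : ℝ) • h = a + h by
              rw [neg_smul, sub_neg_eq_add, add_assoc, ← add_smul]; norm_num] at this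
            linarith
      _ ≤ _ := setLIntegral_le_lintegral _ _
  set W : Euc d → ENNReal := fun h => ∫⁻ x in cell d, ENNReal.ofReal ((f x - f (x - h)) ^ 2)
  have key : ENNReal.ofReal (b ^ 2 * V / (8 * r) ^ d) * ∫⁻ h in Metric.closedBall 0 r, W h ≤
      ENNReal.ofReal (2 * ((∫ x in cell d, f x ^ 2) -
        ∫ x in cell d, mollify f (rescale η (2 * r)) x ^ 2)) := by
    rw [← lintegral_energy hf hk, ← lintegral_const_mul' _ _ ENNReal.ofReal_ne_top]
    refine (setLIntegral_mono' Metric.isClosed_closedBall.measurableSet fun h hh => ?_).trans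
      (setLIntegral_le_lintegral _ _)
    exact mul_le_mul_left (hlow h hh) _
  have hc : 0 < b ^ 2 * V / (8 * r) ^ d := by positivity
  calc ∫⁻ h in Metric.closedBall 0 r, W h
      = ENNReal.ofReal (b ^ 2 * V / (8 * r) ^ d)⁻¹ * (ENNReal.ofReal (b ^ 2 * V / (8 * r) ^ d) *
          ∫⁻ h in Metric.closedBall 0 r, W h) := by
        rw [← mul_assoc, ← ENNReal.ofReal_mul (by positivity), inv_mul_cancel₀ hc.ne',
          ENNReal.ofReal_one, one_mul]
    _ ≤ _ := mul_le_mul_right key _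
    _ = _ := by
        rw [← ENNReal.ofReal_mul (by positivity)]
        congr 1
        rw [mul_pow]
        field_simp

/-! ### The localisation term: cancellation and energy -/

lemma sq_lintegral_le {X : Type*} [MeasurableSpace X] (μ : Measure X) {f : X → ENNReal}
    (hf : AEMeasurable f μ) : (∫⁻ x, f x ∂μ) ^ 2 ≤ μ Set.univ * ∫⁻ x, f x ^ 2 ∂μ := by
  have h := ENNReal.lintegral_mul_le_Lp_mul_Lq μ Real.HolderConjugate.two_two
    (aemeasurable_const (b := (1 : ENNReal))) hf
  simp only [Pi.mul_apply, one_mul, ENNReal.one_rpow, lintegral_one] at h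
  have h2 : (∫⁻ x, f x ^ (2 : ℝ) ∂μ) = ∫⁻ x, f x ^ 2 ∂μ := by simp only [ENNReal.rpow_two]
  rw [h2] at h
  calc (∫⁻ x, f x ∂μ) ^ 2
      ≤ (μ Set.univ ^ (1 / 2 : ℝ) * (∫⁻ x, f x ^ 2 ∂μ) ^ (1 / 2 : ℝ)) ^ 2 := by gcongr
    _ = _ := by
        rw [mul_pow, ← ENNReal.rpow_two, ← ENNReal.rpow_two, ← ENNReal.rpow_mul,
          ← ENNReal.rpow_mul]
        norm_num

lemma integral_gradient_eq_zero {θ : Euc d → ℝ} (hθ : IsBump θ) : ∫ z, gradient θ z = 0 := by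
  have hint : Integrable (gradient θ) :=
    hθ.1.gradient.continuous.integrable_of_hasCompactSupport (by
      obtain ⟨R, -, hR⟩ := exists_radius hθ.2
      refine HasCompactSupport.of_support_subset_isCompact (isCompact_closedBall (0 : Euc d) R)
        fun h hh => ?_
      by_contra hn
      exact hh (gradient_eq_zero_of_eq_zero hR (by simpa using hn)))
  refine ext_inner_left ℝ fun w => ?_
  rw [← integral_inner hint, inner_zero_right]
  simp only [inner_gradient]
  have hb := hθ.fderiv_apply w
  have h1 := integral_mul_fderiv_eq_neg_fderiv_mul_of_integrable (μ := (volume : Measure (Euc d)))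
    (f := fun _ => (1 : ℝ)) (g := θ) (v := w) (by simp)
    (by simpa using hb.1.continuous.integrable_of_hasCompactSupport hb.2)
    (by simpa using hθ.1.continuous.integrable_of_hasCompactSupport hθ.2)
    (fun _ _ => differentiableAt_const _) (fun x _ => hθ.1.differentiable (by simp) x)
  simpa using h1

section Localisation

variable {k : Euc d → Euc d → ℝ} {r S K G : ℝ}

lemma IsKernelFamily.enorm_sub_mollify_le (hk : IsKernelFamily k r S K G) {f : Euc d → ℝ} {A : ℝ}
    (hf : IsNiceFun f A) (z x : Euc d) : ‖f x - mollify f (k z) x‖ₑ ≤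
      ENNReal.ofReal S * ∫⁻ h in Metric.closedBall 0 r, ‖f x - f (x - h)‖ₑ := by
  refine (_root_.enorm_sub_mollify_le hf.locallyIntegrable (hk.kernel z) x).trans ?_
  rw [← lintegral_const_mul' _ _ ENNReal.ofReal_ne_top,
    ← lintegral_indicator Metric.isClosed_closedBall.measurableSet]
  refine lintegral_mono fun h => ?_
  by_cases hh : h ∈ Metric.closedBall (0 : Euc d) r
  · rw [Set.indicator_of_mem hh]
    gcongr
    exact enorm_le_ofReal (by
      rw [abs_of_nonneg ((hk.kernel z).nonneg h)]
      exact hk.le z h)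
  · rw [hk.eq_zero z h (by simpa using (not_le.1 (by simpa using hh)).le)]
    simp

/-- The gradient of θ has integral zero, so the z-independent value f(x) may be subtracted from
(f*k_z)(x). The difference is bounded by increments of f over the support ball, uniformly in z; only
the sup bound S of the kernels enters, not their shape. -/
lemma IsKernelFamily.enorm_localisation_le (hk : IsKernelFamily k r S K G) {θ : Euc d → ℝ}
    (hθ : IsBump θ) {f : Euc d → ℝ} {A : ℝ} (hf : IsNiceFun f A) {B N : ℝ}
    (hN : ∫⁻ h, ‖gradient θ h‖ₑ ≤ ENNReal.ofReal N) {g : ℝ} (hg : |g| ≤ B) (x w : Euc d) :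
    ‖∫ z, g * mollify f (k z) x * inner ℝ w (gradient θ (z - x))‖ₑ ≤
      ENNReal.ofReal (B * (S * N)) *
        ((∫⁻ h in Metric.closedBall 0 r, ‖f x - f (x - h)‖ₑ) * ‖w‖ₑ) := by
  have hB : 0 ≤ B := (abs_nonneg g).trans hg
  have hS : 0 ≤ S := ((hk.kernel 0).nonneg 0).trans (hk.le 0 0)
  have hgc : Continuous (gradient θ) := hθ.1.gradient.continuous
  have hint : Integrable fun z => gradient θ (z - x) :=
    Integrable.comp_sub_right ⟨hgc.aestronglyMeasurable, hN.trans_lt ENNReal.ofReal_lt_top⟩ x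
  have hi : Integrable fun z => inner ℝ w (gradient θ (z - x)) := hint.const_inner w
  have h0 : ∫ z, inner ℝ w (gradient θ (z - x)) = 0 := by
    rw [integral_inner hint, integral_sub_right_eq_self (gradient θ) x,
      integral_gradient_eq_zero hθ, inner_zero_right]
  have hmm : Measurable fun z => mollify f (k z) x :=
    (hk.measurable_mollify (X := Unit) (f := fun _ => f) (hf.measurable.comp measurable_snd)).comp
      ((measurable_const (a := ())).prodMk (measurable_const.prodMk measurable_id))
  have hi2 : Integrable fun z => mollify f (k z) x * inner ℝ w (gradient θ (z - x)) :=
    hi.bdd_mul hmm.aestronglyMeasurable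
      (Filter.Eventually.of_forall fun z => (Real.norm_eq_abs _).trans_le
        ((hf.mollify (hk.kernel z)).bound x))
  have e : ∫ z, g * mollify f (k z) x * inner ℝ w (gradient θ (z - x)) =
      - ∫ z, g * ((f x - mollify f (k z) x) * inner ℝ w (gradient θ (z - x))) := by
    simp only [sub_mul, mul_assoc]
    rw [integral_const_mul, integral_const_mul, integral_sub (hi.const_mul (f x)) hi2,
      integral_const_mul, h0]
    ring
  rw [e, enorm_neg]
  refine (enorm_integral_le_lintegral_enorm _).trans ?_
  set D := ∫⁻ h in Metric.closedBall 0 r, ‖f x - f (x - h)‖ₑ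
  calc ∫⁻ z, ‖g * ((f x - mollify f (k z) x) * inner ℝ w (gradient θ (z - x)))‖ₑ
      ≤ ∫⁻ z, ENNReal.ofReal B * (ENNReal.ofReal S * D) * ‖w‖ₑ * ‖gradient θ (z - x)‖ₑ := by
        refine lintegral_mono fun z => ?_
        rw [enorm_mul, enorm_mul, mul_assoc, mul_assoc]
        gcongr
        · exact enorm_le_ofReal hg
        · exact hk.enorm_sub_mollify_le hf z x
        · exact enorm_inner_le _ _
    _ = ENNReal.ofReal B * (ENNReal.ofReal S * D) * ‖w‖ₑ * ∫⁻ h, ‖gradient θ h‖ₑ := by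
        have hm : Measurable fun z => ‖gradient θ (z - x)‖ₑ :=
          (hgc.measurable.comp (measurable_id.sub_const x)).enorm
        rw [lintegral_const_mul _ hm, lintegral_enorm_comp_sub]
    _ ≤ ENNReal.ofReal B * (ENNReal.ofReal S * D) * ‖w‖ₑ * ENNReal.ofReal N := by gcongr
    _ = _ := by
        rw [ENNReal.ofReal_mul hB, ENNReal.ofReal_mul hS]
        ring

end Localisation

lemma IsNiceDensity.mollifySpace {f : Euc d → ℝ → ℝ} {A : ℝ} (hf : IsNiceDensity f A)
    {κ : Euc d → ℝ} (hκ : IsKernel κ) : IsNiceDensity (_root_.mollifySpace f κ) A where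
  measurable := by
    have h : Measurable (Function.uncurry fun (p : Euc d × ℝ) (h : Euc d) =>
        κ h • f (p.1 - h) p.2) :=
      (hκ.smooth.continuous.measurable.comp measurable_snd).smul (hf.measurable.comp
        (((measurable_fst.comp measurable_fst).sub measurable_snd).prodMk
          (measurable_snd.comp measurable_fst)))
    have e : Function.uncurry (_root_.mollifySpace f κ) =
        fun p : Euc d × ℝ => ∫ h, κ h • f (p.1 - h) p.2 := by
      ext p
      exact mollify_apply (fun y => f y p.2) κ p.1
    rw [e]
    exact h.stronglyMeasurable.integral_prod_right.measurable
  periodic t := ((hf.slice t).mollify hκ).periodic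
  bound x t := ((hf.slice t).mollify hκ).bound x

lemma IsNiceDensity.intervalIntegrable_sq {f : Euc d → ℝ → ℝ} {A : ℝ} (hf : IsNiceDensity f A)
    (T : ℝ) : IntervalIntegrable (fun t => ∫ x in cell d, f x t ^ 2) volume 0 T := by
  have hm : Measurable (Function.uncurry fun (t : ℝ) (x : Euc d) => f x t ^ 2) :=
    (hf.measurable.comp measurable_swap).pow_const 2
  refine (intervalIntegrable_const (c := A ^ 2)).mono_fun'
    hm.stronglyMeasurable.integral_prod_right.measurable.aestronglyMeasurable
    (Filter.Eventually.of_forall fun t => ?_)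
  have := norm_integral_le_of_norm_le_const (μ := torusMeasure d) (f := fun x => f x t ^ 2)
    (C := A ^ 2) (Filter.Eventually.of_forall fun x =>
      (Real.norm_eq_abs _).trans_le ((hf.slice t).pow_two.bound x))
  rwa [probReal_univ, mul_one] at this

lemma integral_sq_mollify_le {f k : Euc d → ℝ} {A : ℝ} (hf : IsNiceFun f A) (hk : IsKernel k) :
    ∫ x in cell d, mollify f k x ^ 2 ≤ ∫ x in cell d, f x ^ 2 := by
  rw [← integral_cell_mollify hf.pow_two hk]
  exact integral_mono (hf.mollify hk).pow_two.integrable (hf.pow_two.mollify hk).integrable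
    fun x => sq_mollify_le hf hk x

lemma sqNormL2_mollifySpace_le {f : Euc d → ℝ → ℝ} {A : ℝ} (hf : IsNiceDensity f A) {k : Euc d → ℝ}
    (hk : IsKernel k) {T : ℝ} (hT : 0 ≤ T) : sqNormL2 T (mollifySpace f k) ≤ sqNormL2 T f :=
  intervalIntegral.integral_mono hT ((hf.mollifySpace hk).intervalIntegrable_sq T)
    (hf.intervalIntegrable_sq T) fun t => integral_sq_mollify_le (hf.slice t) hk

/-- Hölder in space-time with exponents d and d/(d-1). The field lies in L^{d/(d-1)} by the Sobolev
inequality and is constant in time, hence T^{(d-1)/d}. The d-th power of the bounded increments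
reduces to the square, which the energy loss controls. -/
lemma exists_lintegral_increment_mul_le (hd : 2 ≤ d) {η : Euc d → ℝ} (hη : IsMollifier η) :
    ∃ C : ℝ, 0 < C ∧ ∀ (u : Euc d → Euc d) (f : Euc d → ℝ → ℝ) (T r : ℝ), IsNiceField u →
      BddAbove (variationSet u) → IsNiceDensity f 1 → 0 < T → 0 < r →
      ∫⁻ t in Set.Ioc 0 T, ∫⁻ x in cell d,
          (∫⁻ h in Metric.closedBall 0 r, ‖f x t - f (x - h) t‖ₑ) * ‖u x‖ₑ ≤
        ENNReal.ofReal (C * (r ^ d * (T ^ (((d : ℝ) - 1) / d) *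
          (totalVariation u + ‖∫ x in cell d, u x‖) *
          (sqNormL2 T f - sqNormL2 T (mollifySpace f (rescale η (2 * r)))) ^ (1 / (d : ℝ))))) := by
  have hd0 : (0 : ℝ) < d := by positivity
  have hd1 : (1 : ℝ) < d := by exact_mod_cast (by omega : 1 < d)
  obtain ⟨q, hq⟩ : ∃ q : NNReal, (d : NNReal).HolderConjugate q :=
    ⟨_, NNReal.HolderConjugate.conjExponent (by exact_mod_cast (by omega : 1 < d))⟩
  have hqr : (d : ℝ).HolderConjugate q := by exact_mod_cast hq.coe
  have hq1 : 1 / (q : ℝ) = ((d : ℝ) - 1) / d := by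
    rw [one_div, ← hqr.one_sub_inv]
    field_simp
  obtain ⟨C₁, hC₁, hsob⟩ := exists_eLpNorm_le d hq
  obtain ⟨c, hc, hen⟩ := exists_lintegral_sq_sub_le hη
  set V := volume.real (Metric.closedBall (0 : Euc d) 1) with hV
  have hVpos : 0 < V := by
    rw [hV, measureReal_def]
    exact ENNReal.toReal_pos (Metric.measure_closedBall_pos _ _ one_pos).ne'
      measure_closedBall_lt_top.ne
  -- (2V)^{d-2} comes from the sup bound of the increments, V from Cauchy-Schwarz on the ball, c
  -- from the energy estimate and C₁ from Sobolev.
  refine ⟨((2 * V) ^ (d - 2) * V * c) ^ (1 / (d : ℝ)) * C₁, by positivity,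
    fun u f T r hu hb hf hT hr => ?_⟩
  have hk := hη.isKernel_rescale (r := 2 * r) (by positivity)
  have hfm := hf.measurable
  have htv := totalVariation_nonneg hb
  set U := totalVariation u + ‖∫ x in cell d, u x‖
  have hU : 0 ≤ U := by positivity
  set D : ℝ × Euc d → ENNReal := fun p =>
    ∫⁻ h in Metric.closedBall 0 r, ‖f p.2 p.1 - f (p.2 - h) p.1‖ₑ with hD
  have m0 : Measurable fun p : (ℝ × Euc d) × Euc d => f p.1.2 p.1.1 - f (p.1.2 - p.2) p.1.1 :=
    (hfm.comp ((measurable_snd.comp measurable_fst).prodMk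
      (measurable_fst.comp measurable_fst))).sub (hfm.comp
        (((measurable_snd.comp measurable_fst).sub measurable_snd).prodMk
          (measurable_fst.comp measurable_fst)))
  have mD : Measurable D := m0.enorm.lintegral_prod_right'
  have hvol : volume (Metric.closedBall (0 : Euc d) r) = ENNReal.ofReal (r ^ d * V) :=
    volume_closedBall_euc hr.le
  have hD1 : ∀ p, D p ≤ ENNReal.ofReal (2 * V * r ^ d) := fun p => by
    calc D p ≤ ∫⁻ _ in Metric.closedBall (0 : Euc d) r, ENNReal.ofReal 2 := by
          refine lintegral_mono fun h => enorm_le_ofReal ?_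
          refine (abs_sub _ _).trans ?_
          linarith [hf.bound p.2 p.1, hf.bound (p.2 - h) p.1]
      _ = _ := by
          rw [lintegral_const, Measure.restrict_apply_univ, hvol,
            ← ENNReal.ofReal_mul (by norm_num)]
          congr 1
          ring
  have hD2 : ∀ p, D p ^ 2 ≤ ENNReal.ofReal (r ^ d * V) * ∫⁻ h in Metric.closedBall 0 r,
      ENNReal.ofReal ((f p.2 p.1 - f (p.2 - h) p.1) ^ 2) := fun p => by
    refine (sq_lintegral_le _ ((m0.comp measurable_prodMk_left).enorm.aemeasurable)).trans_eq ?_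
    rw [Measure.restrict_apply_univ, hvol]
    congr 1
    refine lintegral_congr fun h => ?_
    simp only [Function.comp]
    rw [Real.enorm_eq_ofReal_abs, ← ENNReal.ofReal_pow (abs_nonneg _), sq_abs]
  -- Two of the d factors are kept for the L² increments and the other d - 2 are bounded by the sup;
  -- this uses d ≥ 2 and |f| ≤ 1.
  have hDd : ∀ p, D p ^ (d : ℝ) ≤ ENNReal.ofReal ((2 * V * r ^ d) ^ (d - 2) * (r ^ d * V)) *
      ∫⁻ h in Metric.closedBall 0 r, ENNReal.ofReal ((f p.2 p.1 - f (p.2 - h) p.1) ^ 2) := fun p => by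
    rw [ENNReal.rpow_natCast]
    calc D p ^ d = D p ^ (d - 2) * D p ^ 2 := by rw [← pow_add, Nat.sub_add_cancel hd]
      _ ≤ ENNReal.ofReal (2 * V * r ^ d) ^ (d - 2) * _ := by
          exact mul_le_mul' (pow_le_pow_left' (hD1 p) _) (hD2 p)
      _ = _ := by
          rw [← ENNReal.ofReal_pow (by positivity), ← mul_assoc,
            ← ENNReal.ofReal_mul (by positivity)]
  set E : ℝ → ℝ := fun t => (∫ x in cell d, f x t ^ 2) -
    ∫ x in cell d, mollify (fun y => f y t) (rescale η (2 * r)) x ^ 2 with hE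
  have hEint : IntervalIntegrable E volume 0 T :=
    (hf.intervalIntegrable_sq T).sub ((hf.mollifySpace hk).intervalIntegrable_sq T)
  have hE0 : ∀ t, 0 ≤ E t := fun t => sub_nonneg.2 (integral_sq_mollify_le (hf.slice t) hk)
  have hEtot : ∫ t in (0 : ℝ)..T, E t =
      sqNormL2 T f - sqNormL2 T (mollifySpace f (rescale η (2 * r))) :=
    intervalIntegral.integral_sub (hf.intervalIntegrable_sq T)
      ((hf.mollifySpace hk).intervalIntegrable_sq T)
  rw [← hEtot]
  set 𝓔 := ∫ t in (0 : ℝ)..T, E t with h𝓔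
  have h𝓔0 : 0 ≤ 𝓔 := intervalIntegral.integral_nonneg hT.le fun t _ => hE0 t
  set P := (volume.restrict (Set.Ioc (0 : ℝ) T)).prod (volume.restrict (cell d)) with hP
  have hint1 : ∫⁻ p, D p ^ (d : ℝ) ∂P ≤
      ENNReal.ofReal ((2 * V * r ^ d) ^ (d - 2) * (r ^ d * V) * (c * r ^ d * 𝓔)) := by
    have m1 : Measurable fun p : (ℝ × Euc d) × Euc d =>
        ENNReal.ofReal ((f p.1.2 p.1.1 - f (p.1.2 - p.2) p.1.1) ^ 2) :=
      (m0.pow_const 2).ennreal_ofReal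
    refine (lintegral_mono hDd).trans ?_
    rw [lintegral_const_mul' _ _ ENNReal.ofReal_ne_top,
      ENNReal.ofReal_mul (p := (2 * V * r ^ d) ^ (d - 2) * (r ^ d * V)) (by positivity), hP,
      lintegral_prod _ m1.lintegral_prod_right'.aemeasurable]
    gcongr
    calc ∫⁻ t in Set.Ioc 0 T, ∫⁻ x in cell d, ∫⁻ h in Metric.closedBall 0 r,
          ENNReal.ofReal ((f x t - f (x - h) t) ^ 2)
        ≤ ∫⁻ t in Set.Ioc 0 T, ENNReal.ofReal (c * r ^ d * E t) := by
          refine lintegral_mono fun t => ?_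
          have m2 : Measurable fun p : Euc d × Euc d =>
              ENNReal.ofReal ((f p.1 t - f (p.1 - p.2) t) ^ 2) :=
            m1.comp ((measurable_const.prodMk measurable_fst).prodMk measurable_snd)
          rw [lintegral_lintegral_swap m2.aemeasurable]
          exact hen r _ 1 hr (hf.slice t)
      _ = ENNReal.ofReal (∫ t in Set.Ioc 0 T, c * r ^ d * E t) := by
          rw [ofReal_integral_eq_lintegral_ofReal (hEint.1.const_mul _)
            (Filter.Eventually.of_forall fun t => mul_nonneg (by positivity) (hE0 t))]
      _ = _ := by rw [integral_const_mul, h𝓔, intervalIntegral.integral_of_le hT.le]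
  -- The integrand does not depend on time, so the time integral contributes T^{1/q} with 1/q =
  -- (d-1)/d.
  have hint2 : (∫⁻ p, ‖u p.2‖ₑ ^ (q : ℝ) ∂P) ^ (1 / (q : ℝ)) ≤
      ENNReal.ofReal (T ^ (((d : ℝ) - 1) / d) * (C₁ * U)) := by
    have hs := hsob u hu hb
    rw [eLpNorm_nnreal_eq_lintegral (by exact_mod_cast hqr.symm.pos.ne')] at hs
    have hm : Measurable fun p : ℝ × Euc d => ‖u p.2‖ₑ ^ (q : ℝ) :=
      (hu.measurable.comp measurable_snd).enorm.pow_const _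
    rw [hP, lintegral_prod _ hm.aemeasurable]
    simp only
    rw [
      lintegral_const, Measure.restrict_apply_univ, Real.volume_Ioc, sub_zero,
      ENNReal.mul_rpow_of_nonneg _ _ (by positivity), mul_comm,
      ENNReal.ofReal_rpow_of_nonneg hT.le (by positivity), ENNReal.ofReal_mul (by positivity),
      ← hq1]
    gcongr
    exact hs
  calc ∫⁻ t in Set.Ioc 0 T, ∫⁻ x in cell d, D (t, x) * ‖u x‖ₑ
      = ∫⁻ p, (D * fun p : ℝ × Euc d => ‖u p.2‖ₑ) p ∂P := by
        have hm : Measurable (D * fun p : ℝ × Euc d => ‖u p.2‖ₑ) :=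
          mD.mul (hu.measurable.comp measurable_snd).enorm
        rw [hP, lintegral_prod _ hm.aemeasurable]
        rfl
    _ ≤ (∫⁻ p, D p ^ (d : ℝ) ∂P) ^ (1 / (d : ℝ)) *
          (∫⁻ p, ‖u p.2‖ₑ ^ (q : ℝ) ∂P) ^ (1 / (q : ℝ)) :=
        ENNReal.lintegral_mul_le_Lp_mul_Lq P hqr mD.aemeasurable
          (hu.measurable.comp measurable_snd).enorm.aemeasurable
    _ ≤ ENNReal.ofReal ((2 * V * r ^ d) ^ (d - 2) * (r ^ d * V) * (c * r ^ d * 𝓔)) ^ (1 / (d : ℝ)) *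
          ENNReal.ofReal (T ^ (((d : ℝ) - 1) / d) * (C₁ * U)) := by gcongr
    _ = _ := by
        rw [ENNReal.ofReal_rpow_of_nonneg (by positivity) (by positivity),
          ← ENNReal.ofReal_mul (by positivity)]
        congr 1
        have e1 : (2 * V * r ^ d) ^ (d - 2) * (r ^ d * V) * (c * r ^ d * 𝓔) =
            ((2 * V) ^ (d - 2) * V * c) * ((r ^ d) ^ d * 𝓔) := by
          rw [show (r ^ d) ^ d = (r ^ d) ^ (d - 2) * (r ^ d) ^ 2 by
            rw [← pow_add, Nat.sub_add_cancel hd], mul_pow]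
          ring
        have e2 : ((r ^ d) ^ d) ^ (1 / (d : ℝ)) = r ^ d := by
          rw [one_div, Real.pow_rpow_inv_natCast (by positivity) (by positivity)]
        rw [e1, Real.mul_rpow (by positivity) (by positivity),
          Real.mul_rpow (by positivity) h𝓔0, e2]
        ring

lemma exists_abs_localisation_energy_le (hd : 2 ≤ d) {η : Euc d → ℝ} (hη : IsMollifier η) :
    ∃ C : ℝ, 0 < C ∧ ∀ (u : Euc d → Euc d) (ρ f : Euc d → ℝ → ℝ) (θ : Euc d → ℝ)
      (k : Euc d → Euc d → ℝ) (T r S K G B N : ℝ), IsNiceField u →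
      BddAbove (variationSet u) → IsNiceDensity ρ B → IsNiceDensity f 1 → IsBump θ →
      IsKernelFamily k r S K G → 0 ≤ N → ∫⁻ h, ‖gradient θ h‖ₑ ≤ ENNReal.ofReal N →
      0 < T → 0 < r →
      |∫ t in (0 : ℝ)..T, ∫ x in cell d, ∫ z,
          ρ x t * mollifySpace f (k z) x t * inner ℝ (u x) (gradient θ (z - x))| ≤
        C * (B * (S * N) * r ^ d * (T ^ (((d : ℝ) - 1) / d) *
          (totalVariation u + ‖∫ x in cell d, u x‖) *
          (sqNormL2 T f - sqNormL2 T (mollifySpace f (rescale η (2 * r)))) ^ (1 / (d : ℝ)))) := by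
  obtain ⟨C, hC, h⟩ := exists_lintegral_increment_mul_le hd hη
  refine ⟨C, hC, fun u ρ f θ k T r S K G B N hu hb hρ hf hθ hk hN0 hN hT hr => ?_⟩
  have hB := (hρ.slice 0).nonneg
  have hS : 0 ≤ S := ((hk.kernel 0).nonneg 0).trans (hk.le 0 0)
  have hmain := h u f T r hu hb hf hT hr
  set Q := r ^ d * (T ^ (((d : ℝ) - 1) / d) * (totalVariation u + ‖∫ x in cell d, u x‖) *
          (sqNormL2 T f - sqNormL2 T (mollifySpace f (rescale η (2 * r)))) ^ (1 / (d : ℝ))) with hQ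
  have hQ0 : 0 ≤ Q := by
    have h1 := sub_nonneg.2 (sqNormL2_mollifySpace_le hf
      (hη.isKernel_rescale (r := 2 * r) (by positivity)) hT.le)
    have h2 := totalVariation_nonneg hb
    positivity
  have e : C * (B * (S * N) * r ^ d * (T ^ (((d : ℝ) - 1) / d) *
      (totalVariation u + ‖∫ x in cell d, u x‖) *
      (sqNormL2 T f - sqNormL2 T (mollifySpace f (rescale η (2 * r)))) ^ (1 / (d : ℝ)))) =
      B * (S * N) * (C * Q) := by
    rw [hQ]
    ring
  rw [e, intervalIntegral.integral_of_le hT.le]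
  refine abs_integral_le_of_lintegral (g := fun t => ENNReal.ofReal (B * (S * N)) *
    ∫⁻ x in cell d, (∫⁻ h in Metric.closedBall 0 r, ‖f x t - f (x - h) t‖ₑ) * ‖u x‖ₑ)
    (by positivity) (Filter.Eventually.of_forall fun t => ?_) ?_
  · rw [← lintegral_const_mul' _ _ ENNReal.ofReal_ne_top]
    refine (enorm_integral_le_lintegral_enorm _).trans (lintegral_mono fun x => ?_)
    exact hk.enorm_localisation_le hθ (hf.slice t) hN (hρ.bound x t) x (u x)
  · rw [lintegral_const_mul' _ _ ENNReal.ofReal_ne_top,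
      ENNReal.ofReal_mul (p := B * (S * N)) (by positivity)]
    exact mul_le_mul_right hmain _

/-- The weight Q sits at the displaced point x - sδh. Taking this point as the new variable shifts
the argument of θ by at most ε, so θ may be replaced by cΘ. The integrals over s and h then decouple
and contribute only the total mass W of the kernel. -/
lemma lintegral_transport_le {θ Θ : Euc d → ℝ} (hθm : Measurable θ) (hΘm : Measurable Θ)
    {Q w : Euc d → Euc d → ENNReal} (hQ : Measurable (Function.uncurry Q))
    (hQp : IsDiagPeriodic Q) (hw : Measurable (Function.uncurry w)) (hwp : IsPeriodic w)
    {W c : ENNReal} (hc : c ≠ ⊤) (hW : ∀ z, ∫⁻ h, w z h ≤ W) {δ ε : ℝ}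
    (hsupp : ∀ z h, ε < ‖δ • h‖ → w z h = 0)
    (hθ : ∀ a b, ‖b‖ ≤ ε → ENNReal.ofReal (θ (a - b)) ≤ c * ENNReal.ofReal (Θ a)) :
    ∫⁻ x in cell d, ∫⁻ z, ∫⁻ h, (∫⁻ s in Set.Ioc (0 : ℝ) 1, Q z (x - (s * δ) • h)) * w z h *
        ENNReal.ofReal (θ (z - x)) ≤
      W * (c * ∫⁻ z in cell d, ∫⁻ x, Q z x * ENNReal.ofReal (Θ (z - x))) := by
  have mQ : Measurable fun p : ((Euc d × Euc d) × Euc d) × ℝ =>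
      Q p.1.1.2 (p.1.1.1 - (p.2 * δ) • p.1.2) :=
    hQ.comp ((measurable_snd.comp (measurable_fst.comp measurable_fst)).prodMk
      ((measurable_fst.comp (measurable_fst.comp measurable_fst)).sub
        ((measurable_snd.mul_const δ).smul (measurable_snd.comp measurable_fst))))
  have mF : Measurable fun p : (Euc d × Euc d) × Euc d =>
      (∫⁻ s in Set.Ioc (0 : ℝ) 1, Q p.1.2 (p.1.1 - (s * δ) • p.2)) * w p.1.2 p.2 *
        ENNReal.ofReal (θ (p.1.2 - p.1.1)) :=
    (mQ.lintegral_prod_right'.mul (hw.comp ((measurable_snd.comp measurable_fst).prodMk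
      measurable_snd))).mul (hθm.comp ((measurable_snd.comp measurable_fst).sub
        (measurable_fst.comp measurable_fst))).ennreal_ofReal
  have mΘ : Measurable (Function.uncurry fun z x => Q z x * ENNReal.ofReal (Θ (z - x))) :=
    hQ.mul (hΘm.comp (measurable_fst.sub measurable_snd)).ennreal_ofReal
  rw [lintegral_diag (f := fun x z => ∫⁻ h, (∫⁻ s in Set.Ioc (0 : ℝ) 1, Q z (x - (s * δ) • h)) *
    w z h * ENNReal.ofReal (θ (z - x))) mF.lintegral_prod_right' (fun x z j => by
      simp only [hwp z j, add_sub_add_right_eq_sub, add_sub_right_comm x _ _, hQp z _ j]),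
    ← lintegral_const_mul' _ _ hc, ← lintegral_const_mul _ (by
      exact (mΘ.lintegral_prod_right'.const_mul c))]
  refine lintegral_mono fun z => ?_
  set J := ∫⁻ x, Q z x * ENNReal.ofReal (Θ (z - x))
  have mz : Measurable fun p : Euc d × Euc d =>
      (∫⁻ s in Set.Ioc (0 : ℝ) 1, Q z (p.1 - (s * δ) • p.2)) * w z p.2 *
        ENNReal.ofReal (θ (z - p.1)) :=
    mF.comp ((measurable_fst.prodMk measurable_const).prodMk measurable_snd)
  rw [lintegral_lintegral_swap mz.aemeasurable]
  have hwz : Measurable (w z) := hw.comp measurable_prodMk_left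
  calc ∫⁻ h, ∫⁻ x, (∫⁻ s in Set.Ioc (0 : ℝ) 1, Q z (x - (s * δ) • h)) * w z h *
        ENNReal.ofReal (θ (z - x))
      ≤ ∫⁻ h, w z h * (c * J) := by
        refine lintegral_mono fun h => ?_
        by_cases hh : ε < ‖δ • h‖
        · simp [hsupp z h hh]
        have ms : Measurable fun p : Euc d × ℝ =>
            Q z (p.1 - (p.2 * δ) • h) * ENNReal.ofReal (θ (z - p.1)) :=
          (mQ.comp (((measurable_fst.prodMk measurable_const).prodMk measurable_const).prodMk
            measurable_snd)).mul (hθm.comp (measurable_const.sub measurable_fst)).ennreal_ofReal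
        have mq : ∀ x, Measurable fun s : ℝ => Q z (x - (s * δ) • h) := fun x =>
          mQ.comp ((measurable_const (a := ((x, z), h))).prodMk measurable_id)
        have mi : Measurable fun x => ∫⁻ s in Set.Ioc (0 : ℝ) 1,
            Q z (x - (s * δ) • h) * ENNReal.ofReal (θ (z - x)) := ms.lintegral_prod_right'
        have e : ∀ x, (∫⁻ s in Set.Ioc (0 : ℝ) 1, Q z (x - (s * δ) • h)) * w z h *
            ENNReal.ofReal (θ (z - x)) = w z h * ∫⁻ s in Set.Ioc (0 : ℝ) 1,
              Q z (x - (s * δ) • h) * ENNReal.ofReal (θ (z - x)) := fun x => by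
          rw [lintegral_mul_const _ (mq x)]
          ring
        simp only [e]
        rw [lintegral_const_mul _ mi, lintegral_lintegral_swap ms.aemeasurable]
        gcongr
        calc ∫⁻ s in Set.Ioc (0 : ℝ) 1, ∫⁻ x, Q z (x - (s * δ) • h) * ENNReal.ofReal (θ (z - x))
            ≤ ∫⁻ _ in Set.Ioc (0 : ℝ) 1, c * J := by
              refine setLIntegral_mono' measurableSet_Ioc fun s hs => ?_
              rw [← lintegral_add_right_eq_self _ ((s * δ) • h), ← lintegral_const_mul' _ _ hc]
              refine lintegral_mono fun x => ?_
              simp only [add_sub_cancel_right, ← sub_sub]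
              rw [mul_left_comm]
              gcongr
              refine hθ _ _ ?_
              rw [mul_smul, norm_smul, Real.norm_of_nonneg hs.1.le]
              exact (mul_le_of_le_one_left (norm_nonneg _) hs.2).trans (not_lt.1 hh)
          _ = c * J := by simp
    _ = (∫⁻ h, w z h) * (c * J) := lintegral_mul_const _ hwz
    _ ≤ W * (c * J) := by gcongr; exact hW z

/-- On the support of the left side ‖a‖ ≤ 2ε, which is half the radius of the mollifier at scale 4ε,
where η is bounded below. The factor 4^d compares the two normalisations. -/
lemma IsMollifier.exists_rescale_sub_le {η : Euc d → ℝ} (hη : IsMollifier η) : ∃ c : ℝ, 0 < c ∧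
    ∀ ε : ℝ, 0 < ε → ∀ a b : Euc d, ‖b‖ ≤ ε → ENNReal.ofReal (_root_.rescale η ε (a - b)) ≤
      ENNReal.ofReal c * ENNReal.ofReal (_root_.rescale η (4 * ε) a) := by
  obtain ⟨H, hH, hle⟩ := hη.exists_le
  obtain ⟨b₀, hb₀, hge⟩ := hη.exists_ge
  refine ⟨4 ^ d * H / b₀, by positivity, fun ε hε a b hb => ?_⟩
  rw [← ENNReal.ofReal_mul (by positivity)]
  refine ENNReal.ofReal_le_ofReal ?_
  by_cases hab : ε ≤ ‖a - b‖
  · rw [(hη.rescale hε).2.2.2.2 _ hab]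
    exact mul_nonneg (by positivity) ((hη.rescale (by positivity)).2.2.1 a)
  have ha : ‖a‖ ≤ 2 * ε := by
    have := norm_add_le (a - b) b
    rw [sub_add_cancel] at this
    linarith
  have h1 : b₀ ≤ η ((4 * ε)⁻¹ • a) := hge _ (by
    rw [norm_smul, norm_inv, Real.norm_of_nonneg (by positivity), inv_mul_le_iff₀ (by positivity)]
    linarith)
  calc (ε ^ d)⁻¹ * η (ε⁻¹ • (a - b)) ≤ (ε ^ d)⁻¹ * H := by gcongr; exact hle _
    _ = 4 ^ d * H / b₀ * (((4 * ε) ^ d)⁻¹ * b₀) := by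
        rw [mul_pow]
        field_simp
    _ ≤ 4 ^ d * H / b₀ * (((4 * ε) ^ d)⁻¹ * η ((4 * ε)⁻¹ • a)) := by gcongr

/-- Spatial integrals of the form occurring in the decomposition of the velocity commutator. -/
lemma abs_transport_term_le {θ Θ : Euc d → ℝ} (hθk : IsKernel θ) (hΘm : Measurable Θ)
    {Q w : Euc d → Euc d → ENNReal} (hQ : Measurable (Function.uncurry Q))
    (hQp : IsDiagPeriodic Q) (hw : Measurable (Function.uncurry w)) (hwp : IsPeriodic w)
    {W c : ENNReal} (hc : c ≠ ⊤) (hW : ∀ z, ∫⁻ h, w z h ≤ W) {δ ε : ℝ}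
    (hsupp : ∀ z h, ε < ‖δ • h‖ → w z h = 0)
    (hθ : ∀ a b, ‖b‖ ≤ ε → ENNReal.ofReal (θ (a - b)) ≤ c * ENNReal.ofReal (Θ a))
    {g f : Euc d → ℝ} {A B K : ℝ} (hA : 0 ≤ A) (hB : 0 ≤ B) (hK : 0 ≤ K) (hg : ∀ x, |g x| ≤ B)
    (hf : ∀ x, |f x| ≤ A) {E : Euc d → Euc d → Euc d → ℝ}
    (hE : ∀ y z h, ‖E y z h‖ₑ ≤ Q z y * w z h)
    (hKle : W * (c * ∫⁻ z in cell d, ∫⁻ x, Q z x * ENNReal.ofReal (Θ (z - x))) ≤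
      ENNReal.ofReal K) :
    |∫ x in cell d, ∫ z, ∫ h, g x * f (x - δ • h) *
      (∫ s in (0 : ℝ)..1, E (x - (s * δ) • h) z h) * θ (z - x)| ≤ B * A * K := by
  refine abs_integral_le_of_lintegral (g := fun x => ENNReal.ofReal (B * A) * ∫⁻ z, ∫⁻ h,
    (∫⁻ s in Set.Ioc (0 : ℝ) 1, Q z (x - (s * δ) • h)) * w z h * ENNReal.ofReal (θ (z - x)))
    (by positivity) (Filter.Eventually.of_forall fun x => ?_) ?_
  · rw [← lintegral_const_mul' _ _ ENNReal.ofReal_ne_top]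
    refine (enorm_integral_le_lintegral_enorm _).trans (lintegral_mono fun z => ?_)
    simp only
    rw [← lintegral_const_mul' _ _ ENNReal.ofReal_ne_top]
    refine (enorm_integral_le_lintegral_enorm _).trans (lintegral_mono fun h => ?_)
    have mq : Measurable fun s : ℝ => Q z (x - (s * δ) • h) :=
      hQ.comp (measurable_const.prodMk (measurable_const.sub
        ((measurable_id.mul_const δ).smul_const h)))
    have e : ENNReal.ofReal (B * A) * ((∫⁻ s in Set.Ioc (0 : ℝ) 1, Q z (x - (s * δ) • h)) * w z h *
        ENNReal.ofReal (θ (z - x))) = ENNReal.ofReal B * ENNReal.ofReal A *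
        (∫⁻ s in Set.Ioc (0 : ℝ) 1, Q z (x - (s * δ) • h) * w z h) *
          ENNReal.ofReal (θ (z - x)) := by
      rw [lintegral_mul_const _ mq, ENNReal.ofReal_mul hB]
      ring
    rw [e, enorm_mul, enorm_mul, enorm_mul, intervalIntegral.integral_of_le zero_le_one]
    exact mul_le_mul' (mul_le_mul' (mul_le_mul' (enorm_le_ofReal (hg x)) (enorm_le_ofReal (hf _)))
      ((enorm_integral_le_lintegral_enorm _).trans (lintegral_mono fun s => hE _ _ _)))
      (enorm_le_ofReal (abs_of_nonneg (hθk.nonneg _)).le)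
  · rw [lintegral_const_mul' _ _ ENNReal.ofReal_ne_top, ENNReal.ofReal_mul (p := B * A)
      (by positivity)]
    exact mul_le_mul_right ((lintegral_transport_le hθk.smooth.continuous.measurable hΘm hQ hQp hw
      hwp hc hW hsupp hθ).trans hKle) _

/-! ### The parts of the commutator along and transversal to M -/

lemma lintegral_diag_mul_kernel {q : Euc d → ENNReal} (hq : Measurable q) (hqp : IsPeriodic q)
    {Θ : Euc d → ℝ} (hΘ : IsKernel Θ) :
    ∫⁻ z in cell d, ∫⁻ x, q x * ENNReal.ofReal (Θ (z - x)) = ∫⁻ x in cell d, q x := by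
  have hΘm := hΘ.smooth.continuous.measurable
  have hm : Measurable (Function.uncurry fun x z => q x * ENNReal.ofReal (Θ (z - x))) :=
    (hq.comp measurable_fst).mul (hΘm.comp (measurable_snd.sub measurable_fst)).ennreal_ofReal
  rw [← lintegral_diag (f := fun x z => q x * ENNReal.ofReal (Θ (z - x))) hm
    (fun x z j => by simp only [hqp x j, add_sub_add_right_eq_sub])]
  refine lintegral_congr fun x => ?_
  have hm2 : Measurable fun z => ENNReal.ofReal (Θ (z - x)) :=
    (hΘm.comp (measurable_id.sub_const x)).ennreal_ofReal
  rw [lintegral_const_mul _ hm2, lintegral_sub_right_eq_self (fun z => ENNReal.ofReal (Θ z)) x,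
    hΘ.lintegral_eq_one, mul_one]

lemma measurable_frobVec {X : Type*} [MeasurableSpace X] {A : X → Matrix (Fin d) (Fin d) ℝ}
    (hA : ∀ i j, Measurable fun x => A x i j) : Measurable fun x => frobVec (A x) :=
  (PiLp.continuous_toLp 2 _).measurable.comp (measurable_pi_iff.2 fun p => hA p.1 p.2)

lemma measurable_frob {X : Type*} [MeasurableSpace X] {A : X → Matrix (Fin d) (Fin d) ℝ}
    (hA : ∀ i j, Measurable fun x => A x i j) : Measurable fun x => frob (A x) := by
  simp only [← norm_frobVec]
  exact (measurable_frobVec hA).norm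

lemma rescale_one (f : Euc d → ℝ) : rescale f 1 = f := by
  ext h
  simp [rescale]

lemma IsUnitField.measurable_comp_flow {M : Euc d → Matrix (Fin d) (Fin d) ℝ} (hM : IsUnitField M)
    {η : Euc d → ℝ} (hη : Continuous η) (Λ : ℝ) :
    Measurable fun p : Euc d × Euc d => η (flow (M p.1) Λ p.2) :=
  measurable_comp_matrix (Φ := fun q : Matrix (Fin d) (Fin d) ℝ × Euc d => η (flow q.1 Λ q.2))
    (hη.comp (continuous_flow.comp
      ((continuous_fst.prodMk continuous_snd).prodMk continuous_const) |>.congr fun _ => rfl))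
    (fun i j => (hM.measurable i j).comp measurable_fst) measurable_snd

/-- Both densities have mass one, the second because the flow of a trace-free matrix preserves
volume. The weight of I₅' thus has mass 2/Λ with no loss in e^Λ. -/
lemma lintegral_alignment {η : Euc d → ℝ} (hη : IsMollifier η) {Λ : ℝ} (hΛ : 0 < Λ)
    {M : Matrix (Fin d) (Fin d) ℝ} (hM : M.trace = 0) :
    ∫⁻ h, ENNReal.ofReal (Λ⁻¹ * (η h + η (flow M Λ h))) = ENNReal.ofReal (2 * Λ⁻¹) := by
  have m1 : Measurable fun h => ENNReal.ofReal (η h) :=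
    hη.smooth.continuous.measurable.ennreal_ofReal
  have hηk : ∫⁻ h, ENNReal.ofReal (η h) = 1 := by
    have := (hη.isKernel_rescale one_pos).lintegral_eq_one
    rwa [rescale_one] at this
  simp only [ENNReal.ofReal_mul (inv_nonneg.2 hΛ.le),
    fun h => ENNReal.ofReal_add (hη.nonneg h) (hη.nonneg (flow M Λ h))]
  rw [lintegral_const_mul' _ _ ENNReal.ofReal_ne_top, lintegral_add_left m1,
    (measurePreserving_flow hM Λ).lintegral_comp m1, hηk, ENNReal.ofReal_mul (by norm_num), mul_comm]
  norm_num

lemma abs_sandwich_gradient_le {η : Euc d → ℝ} (hη : IsMollifier η) {Λ : ℝ} (hΛ : 0 < Λ)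
    (M : Matrix (Fin d) (Fin d) ℝ) (h : Euc d) :
    |sandwich h M (gradient (albertiMollifier η Λ M) h)| ≤ Λ⁻¹ * (η h + η (flow M Λ h)) := by
  rw [sandwich_gradient_albertiMollifier hη.smooth, abs_mul, abs_of_nonneg (inv_nonneg.2 hΛ.le)]
  refine mul_le_mul_of_nonneg_left ?_ (by positivity)
  have h1 := hη.nonneg h
  have h2 := hη.nonneg (flow M Λ h)
  rw [abs_le]
  constructor <;> linarith

/-- The bound for the part of the velocity commutator along `|∇v| M`. -/
lemma exists_abs_alignment_term_le {η : Euc d → ℝ} (hη : IsMollifier η) : ∃ C : ℝ, 0 < C ∧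
    ∀ (Λ δ ε A B : ℝ) (M : Euc d → Matrix (Fin d) (Fin d) ℝ) (v : Euc d → Euc d) (g f : Euc d → ℝ),
      0 < Λ → 0 < δ → 0 < ε → δ ≤ ε * Real.exp (-Λ) → IsUnitField M → ContDiff ℝ ∞ v →
      IsPeriodic v → 0 ≤ A → 0 ≤ B → (∀ x, |g x| ≤ B) → (∀ x, |f x| ≤ A) →
      |∫ x in cell d, ∫ z, ∫ h, g x * f (x - δ • h) *
        (∫ s in (0 : ℝ)..1, frob (gradMatrix v (x - (s * δ) • h)) *
          sandwich h (M z) (gradient (albertiMollifier η Λ (M z)) h)) * rescale η ε (z - x)| ≤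
        B * A * (C * (Λ⁻¹ * gradNormL1 v)) := by
  obtain ⟨c, hc, hcle⟩ := hη.exists_rescale_sub_le
  refine ⟨2 * c, by positivity, fun Λ δ ε A B M v g f hΛ hδ hε hδε hM hv hp hA hB hg hf => ?_⟩
  have hk := hη.isKernel_rescale hε
  have hk4 := hη.isKernel_rescale (r := 4 * ε) (by positivity)
  have hδε' : δ * Real.exp Λ ≤ ε := by
    rw [Real.exp_neg] at hδε
    rwa [← div_eq_mul_inv, le_div_iff₀ (Real.exp_pos _)] at hδε
  have hqc := continuous_frob_gradMatrix hv
  have hηm := hη.smooth.continuous.measurable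
  refine abs_transport_term_le (Θ := rescale η (4 * ε)) hk hk4.smooth.continuous.measurable
    (Q := fun _ y => ENNReal.ofReal (frob (gradMatrix v y)))
    (w := fun z h => ENNReal.ofReal (Λ⁻¹ * (η h + η (flow (M z) Λ h))))
    (E := fun y z h => frob (gradMatrix v y) *
          sandwich h (M z) (gradient (albertiMollifier η Λ (M z)) h))
    (W := ENNReal.ofReal (2 * Λ⁻¹)) (c := ENNReal.ofReal c) (ε := ε)
    (hqc.measurable.comp measurable_snd).ennreal_ofReal
    (fun x z j => by beta_reduce; rw [hp.gradMatrix z j])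
    (((hηm.comp measurable_snd).add
      (hM.measurable_comp_flow hη.smooth.continuous Λ)).const_mul _).ennreal_ofReal
    (fun z j => by beta_reduce; rw [hM.periodic z j]) ENNReal.ofReal_ne_top (fun z => ?_)
    (fun z h hh => ?_) (hcle ε hε) hA hB ?_ hg hf (fun y z h => ?_) ?_
  · exact (lintegral_alignment hη hΛ (hM.trace_eq z)).le
  -- Here δe^Λ ≤ ε is used: displacements longer than ε correspond to ‖h‖ ≥ e^Λ, where both
  -- densities vanish.
  · have hh' : Real.exp Λ ≤ ‖h‖ := by
      rw [norm_smul, Real.norm_of_nonneg hδ.le] at hh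
      exact (lt_of_mul_lt_mul_left (hδε'.trans_lt hh) hδ.le).le
    beta_reduce
    rw [hη.eq_zero h ((Real.one_le_exp hΛ.le).trans hh'),
      hη.eq_zero _ (one_le_norm_flow (hM.frob_le z) ⟨hΛ.le, le_rfl⟩ hh')]
    simp
  · exact mul_nonneg (by positivity) (mul_nonneg (by positivity) (gradNormL1_nonneg v))
  · rw [← ENNReal.ofReal_mul (frob_nonneg _)]
    refine enorm_le_ofReal ?_
    rw [abs_mul, abs_of_nonneg (frob_nonneg _)]
    exact mul_le_mul_of_nonneg_left (abs_sandwich_gradient_le hη hΛ _ _) (frob_nonneg _)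
  · rw [lintegral_diag_mul_kernel hqc.measurable.ennreal_ofReal (fun x j => by
      beta_reduce; rw [hp.gradMatrix x j]) hk4, lintegral_frob_gradMatrix hv hp,
      ← ENNReal.ofReal_mul hc.le, ← ENNReal.ofReal_mul (by positivity)]
    refine ENNReal.ofReal_le_ofReal (le_of_eq ?_)
    ring

/-- Expanding the square gives |A|² - 2|A| A:M + |A|²|M|², and |M| ≤ 1. Distance from the direction
M is thus controlled by the square root of the amount by which A:M falls short of |A|. -/
lemma sq_frob_sub_smul_le (A M : Matrix (Fin d) (Fin d) ℝ) (hM : frob M ≤ 1) :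
    frob (A - frob A • M) ^ 2 ≤ 2 * frob A * (frob A - inner ℝ (frobVec A) (frobVec M)) := by
  have h1 := frob_nonneg A
  have h2 : frob M ^ 2 ≤ 1 := pow_le_one₀ (frob_nonneg _) hM
  rw [← norm_frobVec (A - _), frobVec_sub, frobVec_smul, norm_sub_sq_real, norm_smul, mul_pow,
    inner_smul_right, norm_frobVec, norm_frobVec, Real.norm_of_nonneg h1]
  nlinarith [mul_le_mul_of_nonneg_left h2 (sq_nonneg (frob A))]

lemma inner_frobVec_le (A M : Matrix (Fin d) (Fin d) ℝ) (hM : frob M ≤ 1) :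
    inner ℝ (frobVec A) (frobVec M) ≤ frob A := by
  refine (real_inner_le_norm _ _).trans ?_
  rw [norm_frobVec, norm_frobVec]
  exact mul_le_of_le_one_right (frob_nonneg _) hM

lemma inner_frobVec_unitGradient (w : Euc d → Euc d) (z : Euc d) :
    inner ℝ (frobVec (gradMatrix w z)) (frobVec (unitGradient w z)) = frob (gradMatrix w z) := by
  rw [unitGradient, frobVec_smul, inner_smul_right, real_inner_self_eq_norm_sq, norm_frobVec]
  rcases eq_or_ne (frob (gradMatrix w z)) 0 with h | h
  · simp [h]
  · field_simp

/-- For fixed z, averaging |∇v| - ∇v:M(z) against Θ gives (|∇v|*Θ)(z) - (∇v*Θ)(z):M(z), and M(z) is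
the direction of ∇(v*Θ)(z), so the last product is |∇(v*Θ)(z)|. Integration over z turns this into
the difference of the two gradient norms. -/
lemma lintegral_defect {v : Euc d → Euc d} (hv : ContDiff ℝ ∞ v) (hp : IsPeriodic v)
    {Θ : Euc d → ℝ} (hΘ : IsKernel Θ) (hM : IsUnitField (unitGradient (mollify v Θ))) :
    0 ≤ gradNormL1 v - gradNormL1 (mollify v Θ) ∧
    ∫⁻ z in cell d, ∫⁻ x, ENNReal.ofReal (frob (gradMatrix v x) -
        inner ℝ (frobVec (gradMatrix v x)) (frobVec (unitGradient (mollify v Θ) z))) *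
          ENNReal.ofReal (Θ (z - x)) ≤
      ENNReal.ofReal (gradNormL1 v - gradNormL1 (mollify v Θ)) := by
  have hb := hΘ.isBump
  have hqc := continuous_frob_gradMatrix hv
  obtain ⟨A, -, hA⟩ := hp.frob_gradMatrix.exists_bound hqc
  have hq : IsNiceFun (fun x => frob (gradMatrix v x)) A :=
    ⟨hqc.measurable, hp.frob_gradMatrix, fun x => (Real.norm_eq_abs _).symm.trans_le (hA x)⟩
  have hw : ContDiff ℝ ∞ (mollify v Θ) :=
    (IsNiceField.of_contDiff hv hp).contDiff_mollify hΘ.smooth hΘ.compact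
  have hwi : Integrable (fun z => frob (gradMatrix (mollify v Θ) z)) (torusMeasure d) :=
    (hp.mollify Θ).frob_gradMatrix.integrable_of_continuous (continuous_frob_gradMatrix hw)
  have hqi := (hq.mollify hΘ).integrable
  set M := unitGradient (mollify v Θ) with hMdef
  obtain ⟨e, he⟩ : ∃ e : Euc d → Euc d → ℝ, ∀ z x, e z x = frob (gradMatrix v x) -
      inner ℝ (frobVec (gradMatrix v x)) (frobVec (M z)) := ⟨_, fun _ _ => rfl⟩
  have he0 : ∀ z x, 0 ≤ e z x := fun z x => by
    rw [he]
    exact sub_nonneg.2 (inner_frobVec_le _ _ (hM.frob_le z))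
  have hec : ∀ z, Continuous fun h => Θ h * e z (z - h) := fun z => by
    simp only [he]
    have hs : Continuous fun h : Euc d => z - h := continuous_const.sub continuous_id
    exact hΘ.smooth.continuous.mul ((hqc.comp hs).sub ((continuous_frobVec fun i j =>
      ((contDiff_gradMatrix hv i j).continuous.comp hs)).inner continuous_const))
  have hei : ∀ z, Integrable fun h => Θ h * e z (z - h) := fun z =>
    (hec z).integrable_of_hasCompactSupport hΘ.compact.mul_right
  have hval : ∀ z, ∫ h, Θ h * e z (z - h) =
      mollify (fun x => frob (gradMatrix v x)) Θ z - frob (gradMatrix (mollify v Θ) z) := fun z => by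
    have hgi : ∀ i j, Integrable fun h => Θ h * gradMatrix v (z - h) i j := fun i j =>
      (hΘ.smooth.continuous.mul ((contDiff_gradMatrix hv i j).continuous.comp
        (by fun_prop))).integrable_of_hasCompactSupport hΘ.compact.mul_right
    have e1 : ∀ h, Θ h * e z (z - h) = Θ h * frob (gradMatrix v (z - h)) -
        ∑ i, ∑ j, Θ h * gradMatrix v (z - h) i j * M z i j := fun h => by
      rw [he, inner_frobVec, mul_sub, Finset.mul_sum]
      simp only [Finset.mul_sum, mul_assoc]
    have hq1 : Integrable fun h => Θ h * frob (gradMatrix v (z - h)) :=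
      hq.integrable_mollify hb z
    simp only [e1]
    have hsj : ∀ i, Integrable fun h => ∑ j, Θ h * gradMatrix v (z - h) i j * M z i j := fun i =>
      integrable_finsetSum _ fun j _ => (hgi i j).mul_const (M z i j)
    rw [integral_sub hq1 (integrable_finsetSum _ fun i _ => hsj i),
      integral_finsetSum _ fun i _ => hsj i, ← inner_frobVec_unitGradient, inner_frobVec, mollify_apply]
    congr 1
    refine Finset.sum_congr rfl fun i _ => ?_
    rw [integral_finsetSum _ fun j _ => (hgi i j).mul_const (M z i j)]
    refine Finset.sum_congr rfl fun j _ => ?_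
    rw [integral_mul_const, gradMatrix_mollify_of_contDiff hv hp hb]
  have hnn : ∀ z, 0 ≤ mollify (fun x => frob (gradMatrix v x)) Θ z -
      frob (gradMatrix (mollify v Θ) z) := fun z => by
    rw [← hval]
    exact integral_nonneg fun h => mul_nonneg (hΘ.nonneg h) (he0 _ _)
  have hdef : ∫ z in cell d, (mollify (fun x => frob (gradMatrix v x)) Θ z -
      frob (gradMatrix (mollify v Θ) z)) = gradNormL1 v - gradNormL1 (mollify v Θ) := by
    have e2 := integral_sub (μ := volume.restrict (cell d)) hqi hwi
    rw [e2, integral_cell_mollify hq hΘ]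
    rfl
  rw [← hdef]
  refine ⟨integral_nonneg hnn, ?_⟩
  simp only [← he]
  have hsub : Integrable (fun z => mollify (fun x => frob (gradMatrix v x)) Θ z -
      frob (gradMatrix (mollify v Θ) z)) (volume.restrict (cell d)) := hqi.sub hwi
  rw [ofReal_integral_eq_lintegral_ofReal hsub (Filter.Eventually.of_forall hnn)]
  refine lintegral_mono fun z => ?_
  rw [← hval, ofReal_integral_eq_lintegral_ofReal (hei z)
    (Filter.Eventually.of_forall fun h => mul_nonneg (hΘ.nonneg h) (he0 _ _)),
    ← lintegral_sub_left_eq_self (fun x => ENNReal.ofReal (e z x) * ENNReal.ofReal (Θ (z - x))) z]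
  refine lintegral_mono fun h => ?_
  rw [sub_sub_cancel, mul_comm, ← ENNReal.ofReal_mul (hΘ.nonneg h)]

/-- The bound for the part of the velocity commutator transversal to `M`. -/
lemma exists_abs_defect_term_le {η : Euc d → ℝ} (hη : IsMollifier η) : ∃ C : ℝ, 0 < C ∧
    ∀ (Λ δ ε A B : ℝ) (M : Euc d → Matrix (Fin d) (Fin d) ℝ) (v : Euc d → Euc d) (g f : Euc d → ℝ),
      0 < Λ → 0 < δ → 0 < ε → δ ≤ ε * Real.exp (-Λ) → IsUnitField M → ContDiff ℝ ∞ v →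
      M = unitGradient (mollify v (rescale η (4 * ε))) →
      IsPeriodic v → 0 ≤ A → 0 ≤ B → (∀ x, |g x| ≤ B) → (∀ x, |f x| ≤ A) →
      |∫ x in cell d, ∫ z, ∫ h, g x * f (x - δ • h) *
        (∫ s in (0 : ℝ)..1,
          sandwich h (gradMatrix v (x - (s * δ) • h) - frob (gradMatrix v (x - (s * δ) • h)) • M z)
            (gradient (albertiMollifier η Λ (M z)) h)) * rescale η ε (z - x)| ≤
        B * A * (C * (Real.exp (2 * Λ) * (gradNormL1 v ^ (1 / 2 : ℝ) *
          (gradNormL1 v - gradNormL1 (mollify v (rescale η (4 * ε)))) ^ (1 / 2 : ℝ)))) := by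
  obtain ⟨c, hc, hcle⟩ := hη.exists_rescale_sub_le
  obtain ⟨H, hH, hfam⟩ := exists_isKernelFamily hη
  refine ⟨H * (c * 2 ^ (1 / 2 : ℝ)), by positivity,
    fun Λ δ ε A B M v g f hΛ hδ hε hδε hM hv hMv hp hA hB hg hf => ?_⟩
  have hk := hη.isKernel_rescale hε
  have hk4 := hη.isKernel_rescale (r := 4 * ε) (by positivity)
  have hδε' : δ * Real.exp Λ ≤ ε := by
    rw [Real.exp_neg] at hδε
    rwa [← div_eq_mul_inv, le_div_iff₀ (Real.exp_pos _)] at hδε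
  -- Scale 1 gives the bounds for the unrescaled mollifier.
  have hF := hfam Λ 1 M hΛ one_pos hM
  simp only [rescale_one] at hF
  have hqc := continuous_frob_gradMatrix hv
  have hmA : ∀ i j, Measurable fun p : Euc d × Euc d => gradMatrix v p.2 i j := fun i j =>
    (contDiff_gradMatrix hv i j).continuous.measurable.comp measurable_snd
  have hmM : ∀ i j, Measurable fun p : Euc d × Euc d => M p.1 i j := fun i j =>
    (hM.measurable i j).comp measurable_fst
  have hmq : Measurable fun p : Euc d × Euc d => frob (gradMatrix v p.2) :=
    hqc.measurable.comp measurable_snd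
  have hmQ : Measurable fun p : Euc d × Euc d =>
      frob (gradMatrix v p.2 - frob (gradMatrix v p.2) • M p.1) :=
    measurable_frob fun i j => (hmA i j).sub (hmq.mul (hmM i j))
  have hΘm : Measurable fun p : Euc d × Euc d => ENNReal.ofReal (rescale η (4 * ε) (p.1 - p.2)) :=
    (hk4.smooth.continuous.measurable.comp (measurable_fst.sub measurable_snd)).ennreal_ofReal
  have hdef0 : 0 ≤ gradNormL1 v - gradNormL1 (mollify v (rescale η (4 * ε))) := by
    subst hMv
    exact (lintegral_defect hv hp hk4 hM).1
  -- The gradient already vanishes outside the ball; the indicator records that |h| is at most e^Λ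
  -- there. With the L¹ bound He^Λ for the gradient this makes the total weight He^{2Λ}.
  refine abs_transport_term_le (Θ := rescale η (4 * ε)) hk hk4.smooth.continuous.measurable
    (Q := fun z y => ENNReal.ofReal (frob (gradMatrix v y - frob (gradMatrix v y) • M z)))
    (w := fun z h => (Metric.ball 0 (Real.exp Λ)).indicator
      (fun h => ENNReal.ofReal (Real.exp Λ) * ‖gradient (albertiMollifier η Λ (M z)) h‖ₑ) h)
    (E := fun y z h => sandwich h (gradMatrix v y - frob (gradMatrix v y) • M z)
            (gradient (albertiMollifier η Λ (M z)) h))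
    (W := ENNReal.ofReal (H * Real.exp (2 * Λ))) (c := ENNReal.ofReal c) (ε := ε)
    hmQ.ennreal_ofReal
    (fun x z j => by beta_reduce; rw [hp.gradMatrix z j, hM.periodic x j]) ?_
    (fun z j => by beta_reduce; rw [hM.periodic z j]) ENNReal.ofReal_ne_top (fun z => ?_)
    (fun z h hh => ?_) (hcle ε hε) hA hB (by
      have := gradNormL1_nonneg v
      positivity) hg hf (fun y z h => ?_) ?_
  · exact (hF.measurable_gradient.enorm.const_mul _).indicator
      (Metric.isOpen_ball.measurableSet.preimage measurable_snd)
  · refine (lintegral_mono fun h => Set.indicator_le_self _ _ h).trans ?_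
    rw [lintegral_const_mul' _ _ ENNReal.ofReal_ne_top]
    refine (mul_le_mul_right (hF.lintegral_gradient_le z) _).trans_eq ?_
    rw [← ENNReal.ofReal_mul (Real.exp_pos _).le, two_mul, Real.exp_add]
    congr 1
    ring
  · refine Set.indicator_of_notMem (fun hmem => ?_) _
    rw [mem_ball_zero_iff] at hmem
    rw [norm_smul, Real.norm_of_nonneg hδ.le] at hh
    exact absurd (hδε'.trans_lt hh) (not_lt.2 (mul_le_mul_of_nonneg_left hmem.le hδ.le))
  · by_cases hh : h ∈ Metric.ball (0 : Euc d) (Real.exp Λ)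
    · simp only [Set.indicator_of_mem hh]
      rw [mem_ball_zero_iff] at hh
      rw [← mul_assoc, ← ofReal_norm (gradient _ _), ← ENNReal.ofReal_mul (frob_nonneg _),
        ← ENNReal.ofReal_mul (mul_nonneg (frob_nonneg _) (Real.exp_pos _).le)]
      refine enorm_le_ofReal ((abs_sandwich_le _ _ _).trans ?_)
      refine mul_le_mul_of_nonneg_right ?_ (norm_nonneg _)
      rw [mul_comm]
      exact mul_le_mul_of_nonneg_left hh.le (frob_nonneg _)
    · rw [mem_ball_zero_iff, not_lt] at hh
      rw [gradient_albertiMollifier_eq_zero hη hΛ (hM.frob_le z) hh]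
      simp [sandwich]
  · set P := (volume.restrict (cell d)).prod (volume : Measure (Euc d)) with hP
    set e : Euc d × Euc d → ℝ := fun p => frob (gradMatrix v p.2) -
      inner ℝ (frobVec (gradMatrix v p.2)) (frobVec (M p.1)) with he
    have hme : Measurable e := hmq.sub ((measurable_frobVec hmA).inner (measurable_frobVec hmM))
    have he0 : ∀ p, 0 ≤ e p := fun p => sub_nonneg.2 (inner_frobVec_le _ _ (hM.frob_le _))
    -- The two Cauchy-Schwarz factors: the square root of 2|∇v| and that of the shortfall e, each
    -- with the square root of Θ.
    set F : Euc d × Euc d → ENNReal := fun p =>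
      (ENNReal.ofReal (2 * frob (gradMatrix v p.2)) *
        ENNReal.ofReal (rescale η (4 * ε) (p.1 - p.2))) ^ (1 / 2 : ℝ)
    set G : Euc d × Euc d → ENNReal := fun p =>
      (ENNReal.ofReal (e p) * ENNReal.ofReal (rescale η (4 * ε) (p.1 - p.2))) ^ (1 / 2 : ℝ)
    have hFm : Measurable F := ((hmq.const_mul 2).ennreal_ofReal.mul hΘm).pow_const _
    have hGm : Measurable G := (hme.ennreal_ofReal.mul hΘm).pow_const _
    have hsq : ∀ a : ENNReal, (a ^ (1 / 2 : ℝ)) ^ (2 : ℝ) = a := fun a => by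
      rw [← ENNReal.rpow_mul]
      norm_num
    have hpt : ∀ p : Euc d × Euc d,
        ENNReal.ofReal (frob (gradMatrix v p.2 - frob (gradMatrix v p.2) • M p.1)) *
          ENNReal.ofReal (rescale η (4 * ε) (p.1 - p.2)) ≤ (F * G) p := fun p => by
      have h1 : ENNReal.ofReal (frob (gradMatrix v p.2 - frob (gradMatrix v p.2) • M p.1)) ≤
          (ENNReal.ofReal (2 * frob (gradMatrix v p.2)) * ENNReal.ofReal (e p)) ^ (1 / 2 : ℝ) := by
        rw [← ENNReal.ofReal_mul (mul_nonneg zero_le_two (frob_nonneg _)),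
          ENNReal.ofReal_rpow_of_nonneg (mul_nonneg (mul_nonneg zero_le_two (frob_nonneg _)) (he0 p))
            (by norm_num), ← Real.sqrt_eq_rpow]
        exact ENNReal.ofReal_le_ofReal (Real.le_sqrt_of_sq_le
          (sq_frob_sub_smul_le _ _ (hM.frob_le _)))
      have h2 : ∀ a : ENNReal, a ^ (1 / 2 : ℝ) * a ^ (1 / 2 : ℝ) = a := fun a => by
        rw [← sq, ← ENNReal.rpow_two, hsq]
      rw [Pi.mul_apply]
      refine (mul_le_mul_left h1 _).trans_eq ?_
      simp only [F, G]
      rw [ENNReal.mul_rpow_of_nonneg _ _ (by norm_num), ENNReal.mul_rpow_of_nonneg _ _ (by norm_num),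
        ENNReal.mul_rpow_of_nonneg _ _ (by norm_num), mul_mul_mul_comm, h2]
    have hF2 : ∫⁻ p, F p ^ (2 : ℝ) ∂P = ENNReal.ofReal (2 * gradNormL1 v) := by
      simp only [F, hsq]
      have hm : Measurable fun p : Euc d × Euc d => ENNReal.ofReal (2 * frob (gradMatrix v p.2)) *
          ENNReal.ofReal (rescale η (4 * ε) (p.1 - p.2)) :=
        (hmq.const_mul 2).ennreal_ofReal.mul hΘm
      rw [hP, lintegral_prod _ hm.aemeasurable,
        lintegral_diag_mul_kernel (hqc.measurable.const_mul 2).ennreal_ofReal (fun x j => by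
          beta_reduce; rw [hp.gradMatrix x j]) hk4]
      simp only [ENNReal.ofReal_mul zero_le_two]
      rw [lintegral_const_mul' _ _ ENNReal.ofReal_ne_top, lintegral_frob_gradMatrix hv hp]
    have hG2 : ∫⁻ p, G p ^ (2 : ℝ) ∂P ≤
        ENNReal.ofReal (gradNormL1 v - gradNormL1 (mollify v (rescale η (4 * ε)))) := by
      simp only [G, hsq]
      have hm : Measurable fun p : Euc d × Euc d => ENNReal.ofReal (e p) *
          ENNReal.ofReal (rescale η (4 * ε) (p.1 - p.2)) := hme.ennreal_ofReal.mul hΘm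
      rw [hP, lintegral_prod _ hm.aemeasurable]
      subst hMv
      exact (lintegral_defect hv hp hk4 hM).2
    have hCS := ENNReal.lintegral_mul_le_Lp_mul_Lq P Real.HolderConjugate.two_two
      hFm.aemeasurable hGm.aemeasurable
    have hfin : ∫⁻ z in cell d, ∫⁻ x,
        ENNReal.ofReal (frob (gradMatrix v x - frob (gradMatrix v x) • M z)) *
          ENNReal.ofReal (rescale η (4 * ε) (z - x)) ≤
        ENNReal.ofReal ((2 * gradNormL1 v) ^ (1 / 2 : ℝ) *
          (gradNormL1 v - gradNormL1 (mollify v (rescale η (4 * ε)))) ^ (1 / 2 : ℝ)) := by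
      have h0 := gradNormL1_nonneg v
      have hm : Measurable fun p : Euc d × Euc d =>
          ENNReal.ofReal (frob (gradMatrix v p.2 - frob (gradMatrix v p.2) • M p.1)) *
            ENNReal.ofReal (rescale η (4 * ε) (p.1 - p.2)) := hmQ.ennreal_ofReal.mul hΘm
      rw [← lintegral_prod (μ := volume.restrict (cell d)) (ν := (volume : Measure (Euc d)))
        _ hm.aemeasurable]
      refine ((lintegral_mono hpt).trans hCS).trans ?_
      rw [hF2, ENNReal.ofReal_mul (p := (2 * gradNormL1 v) ^ (1 / 2 : ℝ)) (by positivity),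
        ← ENNReal.ofReal_rpow_of_nonneg (by positivity) (by norm_num),
        ← ENNReal.ofReal_rpow_of_nonneg hdef0 (by norm_num)]
      gcongr
    refine (mul_le_mul_right (mul_le_mul_right hfin _) _).trans ?_
    rw [← ENNReal.ofReal_mul hc.le, ← ENNReal.ofReal_mul (by positivity)]
    refine ENNReal.ofReal_le_ofReal (le_of_eq ?_)
    rw [Real.mul_rpow zero_le_two (gradNormL1_nonneg v)]
    ring

/-! ### Additivity and Fubini for integrals localised near the diagonal -/

/-- Functions of `(t, x, z)` supported near the diagonal `x = z`, periodic along it, and dominated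
by an integrable function of `x`. -/
structure IsLocalised (F : ℝ → Euc d → Euc d → ℝ) : Prop where
  measurable : Measurable fun p : ℝ × Euc d × Euc d => F p.1 p.2.1 p.2.2
  periodic : ∀ t, IsDiagPeriodic (F t)
  bound : ∃ (g : Euc d → ℝ) (R : ℝ), Integrable g (torusMeasure d) ∧
    ∀ t x z, |F t x z| ≤ g x ∧ (R < ‖z - x‖ → F t x z = 0)

/-- The integral `∫_0^T ∫_{𝕋^d} ∫_{ℝ^d} F(t, x, z) dz dx dt`. -/
def localisedIntegral (T : ℝ) (F : ℝ → Euc d → Euc d → ℝ) : ℝ :=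
  ∫ t in (0 : ℝ)..T, ∫ x in cell d, ∫ z, F t x z

namespace IsLocalised

variable {F G : ℝ → Euc d → Euc d → ℝ}

lemma measurable_slice (hF : IsLocalised F) (t : ℝ) : Measurable (Function.uncurry (F t)) :=
  hF.measurable.comp (measurable_const.prodMk measurable_id)

lemma add (hF : IsLocalised F) (hG : IsLocalised G) :
    IsLocalised fun t x z => F t x z + G t x z where
  measurable := hF.measurable.add hG.measurable
  periodic t x z j := by simp only [hF.periodic t x z j, hG.periodic t x z j]
  bound := by
    obtain ⟨g, R, hg, h⟩ := hF.bound
    obtain ⟨g', R', hg', h'⟩ := hG.bound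
    refine ⟨fun x => g x + g' x, max R R', hg.add hg', fun t x z => ⟨?_, fun hz => ?_⟩⟩
    · exact (abs_add_le _ _).trans (add_le_add (h t x z).1 (h' t x z).1)
    · rw [(h t x z).2 ((le_max_left _ _).trans_lt hz), (h' t x z).2 ((le_max_right _ _).trans_lt hz),
        add_zero]

lemma neg (hF : IsLocalised F) : IsLocalised fun t x z => - F t x z where
  measurable := hF.measurable.neg
  periodic t x z j := by simp only [hF.periodic t x z j]
  bound := by
    obtain ⟨g, R, hg, h⟩ := hF.bound
    exact ⟨g, R, hg, fun t x z => ⟨by rw [abs_neg]; exact (h t x z).1,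
      fun hz => by rw [(h t x z).2 hz, neg_zero]⟩⟩

/-- For fixed x the function of z lives in a ball of radius R, whose volume does not depend on x. So
one integrable function of x dominates the z-integrals at all times, and every exchange of integrals
below rests on it. -/
lemma exists_lintegral_le (hF : IsLocalised F) : ∃ (q : Euc d → ENNReal) (K : ℝ), 0 ≤ K ∧
    (∀ x, q x ≠ ⊤) ∧ ∫⁻ x in cell d, q x ≤ ENNReal.ofReal K ∧
    ∀ t x, ∫⁻ z, ‖F t x z‖ₑ ≤ q x := by
  obtain ⟨g, R, hg, h⟩ := hF.bound
  set V := volume (Metric.closedBall (0 : Euc d) R)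
  have hV : V ≠ ⊤ := measure_closedBall_lt_top.ne
  have hgt : ∫⁻ x in cell d, ‖g x‖ₑ ≠ ⊤ := hg.2.ne
  refine ⟨fun x => ENNReal.ofReal (g x) * V, ((∫⁻ x in cell d, ‖g x‖ₑ) * V).toReal,
    ENNReal.toReal_nonneg, fun x => ENNReal.mul_ne_top ENNReal.ofReal_ne_top hV, ?_, fun t x => ?_⟩
  · rw [ENNReal.ofReal_toReal (ENNReal.mul_ne_top hgt hV), lintegral_mul_const' _ _ hV]
    gcongr with x
    rw [Real.enorm_eq_ofReal_abs]
    exact ENNReal.ofReal_le_ofReal (le_abs_self _)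
  · calc ∫⁻ z, ‖F t x z‖ₑ ≤ ∫⁻ z in Metric.closedBall x R, ENNReal.ofReal (g x) := by
          rw [← lintegral_indicator Metric.isClosed_closedBall.measurableSet]
          refine lintegral_mono fun z => ?_
          by_cases hz : z ∈ Metric.closedBall x R
          · rw [Set.indicator_of_mem hz]
            exact enorm_le_ofReal (h t x z).1
          · rw [(h t x z).2 (by rwa [mem_closedBall_iff_norm, not_le] at hz)]
            simp
      _ = _ := by rw [lintegral_const, Measure.restrict_apply_univ, Measure.addHaar_closedBall_center]

lemma integrable_right (hF : IsLocalised F) (t : ℝ) (x : Euc d) : Integrable (F t x) := by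
  obtain ⟨q, K, -, hq, -, hle⟩ := hF.exists_lintegral_le
  exact ⟨((hF.measurable_slice t).comp measurable_prodMk_left).aestronglyMeasurable,
    (hle t x).trans_lt (hq x).lt_top⟩

lemma measurable_integral (hF : IsLocalised F) :
    Measurable fun p : ℝ × Euc d => ∫ z, F p.1 p.2 z := by
  have : Measurable (Function.uncurry fun (p : ℝ × Euc d) z => F p.1 p.2 z) :=
    hF.measurable.comp ((measurable_fst.comp measurable_fst).prodMk
      ((measurable_snd.comp measurable_fst).prodMk measurable_snd))
  exact this.stronglyMeasurable.integral_prod_right.measurable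

lemma integrable_integral (hF : IsLocalised F) (t : ℝ) :
    Integrable (fun x => ∫ z, F t x z) (volume.restrict (cell d)) := by
  obtain ⟨q, K, -, hq, hK, hle⟩ := hF.exists_lintegral_le
  refine ⟨(hF.measurable_integral.comp measurable_prodMk_left).aestronglyMeasurable, ?_⟩
  exact ((lintegral_mono fun x => (enorm_integral_le_lintegral_enorm _).trans (hle t x)).trans
    hK).trans_lt ENNReal.ofReal_lt_top

lemma intervalIntegrable (hF : IsLocalised F) (T : ℝ) :
    IntervalIntegrable (fun t => ∫ x in cell d, ∫ z, F t x z) volume 0 T := by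
  obtain ⟨q, K, hK0, hq, hK, hle⟩ := hF.exists_lintegral_le
  refine (intervalIntegrable_const (c := K)).mono_fun' ?_ (Filter.Eventually.of_forall fun t =>
    (Real.norm_eq_abs _).trans_le (abs_integral_le_of_lintegral hK0 (Filter.Eventually.of_forall
      fun x => (enorm_integral_le_lintegral_enorm _).trans (hle t x)) hK))
  have : Measurable (Function.uncurry fun (t : ℝ) (x : Euc d) => ∫ z, F t x z) :=
    hF.measurable_integral
  exact (this.stronglyMeasurable.integral_prod_right (ν := volume.restrict
    (cell d))).measurable.aestronglyMeasurable

lemma localisedIntegral_add (hF : IsLocalised F) (hG : IsLocalised G) (T : ℝ) :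
    localisedIntegral T (fun t x z => F t x z + G t x z) =
      localisedIntegral T F + localisedIntegral T G := by
  rw [localisedIntegral, localisedIntegral, localisedIntegral,
    ← intervalIntegral.integral_add (hF.intervalIntegrable T) (hG.intervalIntegrable T)]
  congr 1
  ext t
  rw [← integral_add (hF.integrable_integral t) (hG.integrable_integral t)]
  congr 1
  ext x
  exact integral_add (hF.integrable_right t x) (hG.integrable_right t x)

lemma integral_swap (hF : IsLocalised F) (t : ℝ) :
    ∫ x in cell d, ∫ z, F t x z = ∫ z in cell d, ∫ x, F t x z := by
  obtain ⟨q, K, hK0, hq, hK, hle⟩ := hF.exists_lintegral_le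
  exact integral_diag (hF.measurable_slice t) (hF.periodic t)
    (((lintegral_mono fun x => hle t x).trans hK).trans_lt ENNReal.ofReal_lt_top).ne

lemma integrable_prod (hF : IsLocalised F) (T : ℝ) :
    Integrable (fun p : ℝ × Euc d => ∫ x, F p.1 x p.2)
      ((volume.restrict (Set.Ioc 0 T)).prod (volume.restrict (cell d))) := by
  obtain ⟨q, K, hK0, hq, hK, hle⟩ := hF.exists_lintegral_le
  have hm : Measurable (Function.uncurry fun (p : ℝ × Euc d) x => F p.1 x p.2) :=
    hF.measurable.comp ((measurable_fst.comp measurable_fst).prodMk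
      (measurable_snd.prodMk (measurable_snd.comp measurable_fst)))
  have hme : Measurable fun p : ℝ × Euc d => ∫⁻ x, ‖F p.1 x p.2‖ₑ :=
    hm.enorm.lintegral_prod_right'
  refine ⟨hm.stronglyMeasurable.integral_prod_right.measurable.aestronglyMeasurable, ?_⟩
  refine (lintegral_mono fun p => enorm_integral_le_lintegral_enorm _).trans_lt ?_
  rw [lintegral_prod _ hme.aemeasurable]
  calc ∫⁻ t in Set.Ioc 0 T, ∫⁻ z in cell d, ∫⁻ x, ‖F t x z‖ₑ
      ≤ ∫⁻ t in Set.Ioc 0 T, ENNReal.ofReal K := by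
        refine lintegral_mono fun t => ?_
        rw [← lintegral_diag (f := fun x z => ‖F t x z‖ₑ) (hF.measurable_slice t).enorm
          (fun x z j => by simp only [hF.periodic t x z j])]
        exact (lintegral_mono fun x => hle t x).trans hK
    _ < ⊤ := by
        rw [lintegral_const, Measure.restrict_apply_univ]
        exact ENNReal.mul_lt_top ENNReal.ofReal_lt_top (by simp)

/-- The doubling identity holds at fixed z, whereas the terms are defined with z innermost. Two
exchanges reconcile them: x with z along the diagonal, and t with z. -/
lemma integral_localisedIntegral (hF : IsLocalised F) {T : ℝ} (hT : 0 ≤ T) :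
    ∫ z in cell d, ∫ t in (0 : ℝ)..T, ∫ x, F t x z = localisedIntegral T F := by
  simp only [localisedIntegral, intervalIntegral.integral_of_le hT, hF.integral_swap]
  exact (integral_integral_swap (hF.integrable_prod T)).symm

lemma integrable_integral_left (hF : IsLocalised F) (t : ℝ) :
    Integrable (fun z => ∫ x, F t x z) (volume.restrict (cell d)) := by
  obtain ⟨q, K, hK0, hq, hK, hle⟩ := hF.exists_lintegral_le
  have hm : Measurable (Function.uncurry fun z x => F t x z) :=
    (hF.measurable_slice t).comp measurable_swap
  refine ⟨hm.stronglyMeasurable.integral_prod_right.measurable.aestronglyMeasurable, ?_⟩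
  refine (lintegral_mono fun z => enorm_integral_le_lintegral_enorm _).trans_lt ?_
  rw [← lintegral_diag (f := fun x z => ‖F t x z‖ₑ) (hF.measurable_slice t).enorm
    (fun x z j => by simp only [hF.periodic t x z j])]
  exact ((lintegral_mono fun x => hle t x).trans hK).trans_lt ENNReal.ofReal_lt_top

end IsLocalised

/-! ### Admissibility of the terms for the localised calculus -/

section Members

variable {k : Euc d → Euc d → ℝ} {r S K G : ℝ} {θ : Euc d → ℝ} {A B : ℝ}

lemma isLocalised_mollify_mul_inner (hk : IsKernelFamily k r S K G) (hθ : IsBump θ)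
    {ρ f : Euc d → ℝ → ℝ} (hρ : IsNiceDensity ρ B) (hf : IsNiceDensity f A) {u : Euc d → Euc d}
    (hu : IsNiceField u) : IsLocalised fun t x z =>
      ρ x t * mollifySpace f (k z) x t * inner ℝ (u x) (gradient θ (z - x)) := by
  obtain ⟨R, -, hR⟩ := exists_radius hθ.2
  obtain ⟨N, hN0, hN⟩ := hθ.exists_fderiv_le
  have hB := (hρ.slice 0).nonneg
  have hA := (hf.slice 0).nonneg
  have hm1 : Measurable fun p : ℝ × Euc d × Euc d => ρ p.2.1 p.1 :=
    hρ.measurable.comp ((measurable_fst.comp measurable_snd).prodMk measurable_fst)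
  have hm2 : Measurable fun p : ℝ × Euc d × Euc d => mollify (fun y => f y p.1) (k p.2.2) p.2.1 :=
    hk.measurable_mollify (f := fun t y => f y t) (hf.measurable.comp measurable_swap)
  have hm3 : Measurable fun p : ℝ × Euc d × Euc d =>
      inner ℝ (u p.2.1) (gradient θ (p.2.2 - p.2.1)) :=
    (hu.measurable.comp (measurable_fst.comp measurable_snd)).inner
      (hθ.1.gradient.continuous.measurable.comp ((measurable_snd.comp measurable_snd).sub
        (measurable_fst.comp measurable_snd)))
  refine ⟨(hm1.mul hm2).mul hm3, fun t x z j => ?_, fun x => B * A * (‖u x‖ * N), R,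
    (hu.integrable.norm.mul_const N).const_mul _, fun t x z => ⟨?_, fun hz => ?_⟩⟩
  · have h1 := hρ.periodic t x j
    have h2 := ((hf.slice t).mollify (hk.kernel z)).periodic x j
    simp only [mollifySpace] at h1 h2 ⊢
    rw [h1, hk.periodic z j, h2, hu.periodic x j, add_sub_add_right_eq_sub]
  · rw [abs_mul, abs_mul]
    refine mul_le_mul (mul_le_mul (hρ.bound x t) (((hf.slice t).mollify (hk.kernel z)).bound x)
      (abs_nonneg _) hB) ?_ (abs_nonneg _) (mul_nonneg hB hA)
    refine (abs_real_inner_le_norm _ _).trans (mul_le_mul_of_nonneg_left ?_ (norm_nonneg _))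
    rw [norm_gradient]
    exact hN _
  · rw [gradient_eq_zero_of_eq_zero hR hz, inner_zero_right, mul_zero]

lemma isLocalised_mul_mollify (hk : IsKernelFamily k r S K G) (hθ : IsBump θ)
    {g f : Euc d → ℝ} (hg : IsNiceFun g B) (hf : IsNiceFun f A) :
    IsLocalised fun _ x z => g x * mollify f (k z) x * θ (z - x) := by
  obtain ⟨R, -, hR⟩ := exists_radius hθ.2
  obtain ⟨N, hN⟩ := hθ.2.exists_bound_of_continuous hθ.1.continuous
  have hB := hg.nonneg
  have hA := hf.nonneg
  have hm2 : Measurable fun p : ℝ × Euc d × Euc d => mollify f (k p.2.2) p.2.1 :=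
    hk.measurable_mollify (f := fun _ y => f y) (hf.measurable.comp measurable_snd)
  have hx : Measurable fun p : ℝ × Euc d × Euc d => p.2.1 := measurable_fst.comp measurable_snd
  refine ⟨((hg.measurable.comp hx).mul hm2).mul (hθ.1.continuous.measurable.comp
      ((measurable_snd.comp measurable_snd).sub hx)), fun t x z j => ?_, fun _ => B * A * N, R,
      integrable_const _, fun t x z => ⟨?_, fun hz => ?_⟩⟩
  · have h2 := (hf.mollify (hk.kernel z)).periodic x j
    rw [hg.periodic x j, hk.periodic z j, h2, add_sub_add_right_eq_sub]
  · rw [abs_mul, abs_mul]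
    exact mul_le_mul (mul_le_mul (hg.bound x) ((hf.mollify (hk.kernel z)).bound x)
      (abs_nonneg _) hB) (hN _) (abs_nonneg _) (mul_nonneg hB hA)
  · rw [hR _ hz, mul_zero]

lemma isLocalised_mul_velocityCommutator (hk : IsKernelFamily k r S K G) (hθ : IsBump θ)
    {ρ f : Euc d → ℝ → ℝ} (hρ : IsNiceDensity ρ B) (hf : IsNiceDensity f A) {w : Euc d → Euc d}
    (hw : IsNiceField w) : IsLocalised fun t x z =>
      ρ x t * velocityCommutator (fun y => f y t) w (k z) x * θ (z - x) := by
  obtain ⟨R, -, hR⟩ := exists_radius hθ.2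
  obtain ⟨N, hN⟩ := hθ.2.exists_bound_of_continuous hθ.1.continuous
  have hB := (hρ.slice 0).nonneg
  have hA := (hf.slice 0).nonneg
  have hK : 0 ≤ K := (norm_nonneg _).trans (hk.gradient_le 0 0)
  -- This dominates the commutator uniformly in t and z. It is integrable over the cell although w
  -- is not assumed bounded.
  set Q : Euc d → ENNReal := fun x => ENNReal.ofReal (A * K) *
    ∫⁻ h in Metric.closedBall 0 r, ‖w x - w (x - h)‖ₑ with hQ
  have hm : Measurable (Function.uncurry fun x h : Euc d => ‖w x - w (x - h)‖ₑ) :=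
    ((hw.measurable.comp measurable_fst).sub
      (hw.measurable.comp (measurable_fst.sub measurable_snd))).enorm
  have hQm : Measurable Q := hm.lintegral_prod_right'.const_mul _
  have hQx : ∀ x, Q x ≠ ⊤ := fun x => by
    have h1 : IntegrableOn (fun h => w x - w (x - h)) (Metric.closedBall 0 r) :=
      (integrableOn_const (by exact measure_closedBall_lt_top.ne)).sub
        ((locallyIntegrable_comp_sub_left hw.locallyIntegrable x).integrableOn_isCompact
          (isCompact_closedBall _ _))
    exact ENNReal.mul_ne_top ENNReal.ofReal_ne_top h1.2.ne
  have hQi : ∫⁻ x in cell d, Q x ≠ ⊤ := by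
    rw [hQ, lintegral_const_mul' _ _ ENNReal.ofReal_ne_top, lintegral_lintegral_swap hm.aemeasurable]
    refine ENNReal.mul_ne_top ENNReal.ofReal_ne_top ?_
    have hwt : ∫⁻ x in cell d, ‖w x‖ₑ ≠ ⊤ := hw.integrable.2.ne
    refine ((lintegral_mono (g := fun _ => 2 * ∫⁻ x in cell d, ‖w x‖ₑ) fun h => ?_).trans_lt ?_).ne
    · refine (lintegral_mono fun x => enorm_sub_le).trans ?_
      rw [lintegral_add_left hw.measurable.enorm,
        lintegral_cell_sub (f := fun x => ‖w x‖ₑ) (fun x i => by beta_reduce; rw [hw.periodic x i]) h, two_mul]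
    · rw [lintegral_const, Measure.restrict_apply_univ]
      exact ENNReal.mul_lt_top (ENNReal.mul_lt_top (by simp) hwt.lt_top) measure_closedBall_lt_top
  have hx : Measurable fun p : ℝ × Euc d × Euc d => p.2.1 := measurable_fst.comp measurable_snd
  have hm1 : Measurable fun p : ℝ × Euc d × Euc d => ρ p.2.1 p.1 :=
    hρ.measurable.comp (hx.prodMk measurable_fst)
  have hm2 : Measurable fun p : ℝ × Euc d × Euc d =>
      velocityCommutator (fun y => f y p.1) w (k p.2.2) p.2.1 :=
    hk.measurable_velocityCommutator (f := fun t y => f y t) (hf.measurable.comp measurable_swap)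
      hw.measurable
  refine ⟨(hm1.mul hm2).mul (hθ.1.continuous.measurable.comp
      ((measurable_snd.comp measurable_snd).sub hx)), fun t x z j => ?_,
      fun x => B * (Q x).toReal * N, R,
      ((integrable_toReal_of_lintegral_ne_top hQm.aemeasurable hQi).const_mul B).mul_const N,
      fun t x z => ⟨?_, fun hz => ?_⟩⟩
  · have h1 := hρ.periodic t x j
    have h2 : velocityCommutator (fun y => f y t) w (k z) (x + EuclideanSpace.single j 1) =
        velocityCommutator (fun y => f y t) w (k z) x := by
      have h3 : ∀ h, f (x - h + EuclideanSpace.single j 1) t = f (x - h) t := fun h =>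
        hf.periodic t (x - h) j
      simp only [velocityCommutator, add_sub_right_comm, hw.periodic _ j, h3]
    simp only at h1
    rw [h1, hk.periodic z j, h2, add_sub_add_right_eq_sub]
  · rw [abs_mul, abs_mul]
    have h1 : |velocityCommutator (fun y => f y t) w (k z) x| ≤ (Q x).toReal := by
      have h2 := enorm_velocityCommutator_le (f := fun y => f y t) (w := w) hA hK
        (fun x => hf.bound x t) (hk.gradient_le z) (hk.eq_zero z) x
      rw [Real.enorm_eq_ofReal_abs, ENNReal.ofReal_le_iff_le_toReal (hQx x)] at h2
      exact h2
    exact mul_le_mul (mul_le_mul (hρ.bound x t) h1 (abs_nonneg _) hB) (hN _) (abs_nonneg _)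
      (mul_nonneg hB ENNReal.toReal_nonneg)
  · rw [hR _ hz, mul_zero]

lemma measurable_path_integral (δ : ℝ) {q₀ : Euc d → ℝ} (hq : Measurable q₀)
    {σ : Euc d → Euc d → ℝ} (hσ : Measurable (Function.uncurry σ)) (hθ : IsBump θ)
    {ρ f : Euc d → ℝ → ℝ} (hρ : IsNiceDensity ρ B) (hf : IsNiceDensity f A) :
    Measurable fun p : (ℝ × Euc d × Euc d) × Euc d =>
      ρ p.1.2.1 p.1.1 * f (p.1.2.1 - δ • p.2) p.1.1
        * (∫ s in (0 : ℝ)..1, q₀ (p.1.2.1 - (s * δ) • p.2) * σ p.1.2.2 p.2)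
        * θ (p.1.2.2 - p.1.2.1) := by
  have hx : Measurable fun p : (ℝ × Euc d × Euc d) × Euc d => p.1.2.1 :=
    measurable_fst.comp (measurable_snd.comp measurable_fst)
  have hz : Measurable fun p : (ℝ × Euc d × Euc d) × Euc d => p.1.2.2 :=
    measurable_snd.comp (measurable_snd.comp measurable_fst)
  have ht : Measurable fun p : (ℝ × Euc d × Euc d) × Euc d => p.1.1 :=
    measurable_fst.comp measurable_fst
  have hy : Measurable fun q : ((ℝ × Euc d × Euc d) × Euc d) × ℝ =>
      q.1.1.2.1 - (q.2 * δ) • q.1.2 :=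
    (hx.comp measurable_fst).sub ((measurable_snd.mul_const δ).smul
      (measurable_snd.comp measurable_fst))
  have hs1 : Measurable fun q : ((ℝ × Euc d × Euc d) × Euc d) × ℝ =>
      σ q.1.1.2.2 q.1.2 :=
    hσ.comp ((hz.prodMk measurable_snd).comp measurable_fst)
  have hS : Measurable fun q : ((ℝ × Euc d × Euc d) × Euc d) × ℝ =>
      q₀ (q.1.1.2.1 - (q.2 * δ) • q.1.2) *
        σ q.1.1.2.2 q.1.2 :=
    (hq.comp hy).mul hs1
  have hi : Measurable fun p : (ℝ × Euc d × Euc d) × Euc d => ∫ s in (0 : ℝ)..1,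
      q₀ (p.1.2.1 - (s * δ) • p.2) *
        σ p.1.2.2 p.2 := by
    simp only [intervalIntegral.integral_of_le zero_le_one]
    exact (hS.stronglyMeasurable.integral_prod_right'
      (ν := volume.restrict (Set.Ioc (0 : ℝ) 1))).measurable
  have h1 : Measurable fun p : (ℝ × Euc d × Euc d) × Euc d => ρ p.1.2.1 p.1.1 :=
    hρ.measurable.comp (hx.prodMk ht)
  have h2 : Measurable fun p : (ℝ × Euc d × Euc d) × Euc d => f (p.1.2.1 - δ • p.2) p.1.1 :=
    hf.measurable.comp ((hx.sub (measurable_snd.const_smul δ)).prodMk ht)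
  have h3 : Measurable fun p : (ℝ × Euc d × Euc d) × Euc d => θ (p.1.2.2 - p.1.2.1) :=
    hθ.1.continuous.measurable.comp (hz.sub hx)
  exact ((h1.mul h2).mul hi).mul h3

/-- The closed formula for the derivative along the flow replaces the gradient by values of η, whose
measurability in (z, h) is immediate. -/
lemma measurable_sandwich_gradient {η : Euc d → ℝ} (hη : IsMollifier η) (Λ : ℝ)
    {M : Euc d → Matrix (Fin d) (Fin d) ℝ} (hM : IsUnitField M) : Measurable (Function.uncurry
      fun z h => sandwich h (M z) (gradient (albertiMollifier η Λ (M z)) h)) := by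
  have h1 : Measurable fun p : Euc d × Euc d => Λ⁻¹ * (η p.2 - η (flow (M p.1) Λ p.2)) :=
    ((hη.smooth.continuous.measurable.comp measurable_snd).sub
      (hM.measurable_comp_flow hη.smooth.continuous Λ)).const_mul _
  have e : (Function.uncurry fun z h => sandwich h (M z) (gradient (albertiMollifier η Λ (M z)) h)) =
      fun p : Euc d × Euc d => Λ⁻¹ * (η p.2 - η (flow (M p.1) Λ p.2)) :=
    funext fun p => sandwich_gradient_albertiMollifier hη.smooth p.2
  rw [e]
  exact h1

lemma isLocalised_alignment {η : Euc d → ℝ} (hη : IsMollifier η) {Λ : ℝ} (hΛ : 0 < Λ) (δ : ℝ)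
    {M : Euc d → Matrix (Fin d) (Fin d) ℝ} (hM : IsUnitField M) (hθ : IsBump θ)
    {ρ f : Euc d → ℝ → ℝ} (hρ : IsNiceDensity ρ B) (hf : IsNiceDensity f A) {v : Euc d → Euc d}
    (hv : ContDiff ℝ ∞ v) (hp : IsPeriodic v) : IsLocalised fun t x z => ∫ h,
      ρ x t * f (x - δ • h) t
        * (∫ s in (0 : ℝ)..1, frob (gradMatrix v (x - (s * δ) • h))
            * sandwich h (M z) (gradient (albertiMollifier η Λ (M z)) h)) * θ (z - x) := by
  obtain ⟨R, -, hR⟩ := exists_radius hθ.2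
  obtain ⟨N, hN⟩ := hθ.2.exists_bound_of_continuous hθ.1.continuous
  have hN0 : 0 ≤ N := (norm_nonneg _).trans (hN 0)
  have hqc := continuous_frob_gradMatrix hv
  obtain ⟨Q, hQ0, hQ⟩ := hp.frob_gradMatrix.exists_bound hqc
  have hB := (hρ.slice 0).nonneg
  have hA := (hf.slice 0).nonneg
  have hH := measurable_path_integral δ hqc.measurable (measurable_sandwich_gradient hη Λ hM) hθ hρ hf
  refine ⟨hH.stronglyMeasurable.integral_prod_right'.measurable, fun t x z j => ?_,
    fun _ => B * A * (Q * (2 * Λ⁻¹)) * N, R, integrable_const _, fun t x z => ⟨?_, fun hz => ?_⟩⟩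
  · have h1 := hρ.periodic t x j
    have h3 : ∀ h, f (x - h + EuclideanSpace.single j 1) t = f (x - h) t := fun h =>
      hf.periodic t (x - h) j
    simp only at h1
    simp only [add_sub_right_comm x, hp.gradMatrix _ j, h1, h3, hM.periodic z j,
      add_sub_add_right_eq_sub]
  · refine abs_integral_le_of_lintegral (g := fun h => ENNReal.ofReal (B * A * Q * N) *
      ENNReal.ofReal (Λ⁻¹ * (η h + η (flow (M z) Λ h)))) (by positivity)
      (Filter.Eventually.of_forall fun h => ?_) ?_
    · rw [← ENNReal.ofReal_mul (by positivity)]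
      refine enorm_le_ofReal ?_
      have hs0 : 0 ≤ Λ⁻¹ * (η h + η (flow (M z) Λ h)) :=
        (abs_nonneg _).trans (abs_sandwich_gradient_le hη hΛ (M z) h)
      have hs : |∫ s in (0 : ℝ)..1, frob (gradMatrix v (x - (s * δ) • h))
          * sandwich h (M z) (gradient (albertiMollifier η Λ (M z)) h)| ≤
          Q * (Λ⁻¹ * (η h + η (flow (M z) Λ h))) := by
        have := abs_interval_integral_le (T := 1) (K := Q * (Λ⁻¹ * (η h + η (flow (M z) Λ h))))
          (f := fun s => frob (gradMatrix v (x - (s * δ) • h))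
          * sandwich h (M z) (gradient (albertiMollifier η Λ (M z)) h)) zero_le_one fun s => by
            rw [abs_mul]
            exact mul_le_mul ((Real.norm_eq_abs _).symm.trans_le (hQ _))
              (abs_sandwich_gradient_le hη hΛ _ _) (abs_nonneg _) hQ0.le
        rwa [one_mul] at this
      rw [abs_mul, abs_mul, abs_mul]
      calc |ρ x t| * |f (x - δ • h) t| * _ * |θ (z - x)|
          ≤ B * A * (Q * (Λ⁻¹ * (η h + η (flow (M z) Λ h)))) * N := by
            refine mul_le_mul (mul_le_mul (mul_le_mul (hρ.bound x t) (hf.bound _ t) (abs_nonneg _) hB)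
              hs (abs_nonneg _) (by positivity)) (hN _) (abs_nonneg _) (by positivity)
        _ = _ := by ring
    · rw [lintegral_const_mul' _ _ ENNReal.ofReal_ne_top, lintegral_alignment hη hΛ (hM.trace_eq z),
        ← ENNReal.ofReal_mul (by positivity)]
      refine ENNReal.ofReal_le_ofReal (le_of_eq ?_)
      ring
  · simp only [hR _ hz, mul_zero, integral_zero]

end Members

/-! ### Splitting the commutator of a smooth field -/

lemma sandwich_sub_smul (h w : Euc d) (A M : Matrix (Fin d) (Fin d) ℝ) (c : ℝ) :
    sandwich h (A - c • M) w = sandwich h A w - c * sandwich h M w := by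
  simp only [sandwich, Finset.mul_sum, ← Finset.sum_sub_distrib]
  refine Finset.sum_congr rfl fun i _ => Finset.sum_congr rfl fun j _ => ?_
  simp only [Matrix.sub_apply, Matrix.smul_apply, smul_eq_mul]
  ring

lemma inner_sub_eq_integral_sandwich {v : Euc d → Euc d} (hv : ContDiff ℝ ∞ v) {δ : ℝ} (hδ : δ ≠ 0)
    (x h w : Euc d) : inner ℝ (v x - v (x - δ • h)) (δ⁻¹ • w) =
      ∫ s in (0 : ℝ)..1, sandwich h (gradMatrix v (x - (s * δ) • h)) w := by
  have hc : Continuous fun s : ℝ => fderiv ℝ v (x - s • δ • h) (δ • h) :=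
    ((hv.continuous_fderiv (by simp)).comp (by fun_prop)).clm_apply continuous_const
  have hi : Integrable (fun s : ℝ => fderiv ℝ v (x - s • δ • h) (δ • h))
      (volume.restrict (Set.Ioc 0 1)) :=
    (hc.intervalIntegrable 0 1).1
  rw [sub_eq_integral_fderiv hv, real_inner_comm, intervalIntegral.integral_of_le zero_le_one,
    ← integral_inner hi, intervalIntegral.integral_of_le zero_le_one]
  congr 1
  ext s
  rw [sandwich_gradMatrix, map_smul, inner_smul_right, inner_smul_left, real_inner_comm, smul_smul]
  simp only [RCLike.conj_to_real]
  field_simp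

lemma velocityCommutator_rescale {f : Euc d → ℝ} {v : Euc d → Euc d} {α : Euc d → ℝ}
    (hα : ContDiff ℝ ∞ α) {δ : ℝ} (hδ : 0 < δ) (x : Euc d) :
    velocityCommutator f v (rescale α δ) x =
      ∫ h, f (x - δ • h) * inner ℝ (v x - v (x - δ • h)) (δ⁻¹ • gradient α h) := by
  obtain ⟨Φ, hΦ⟩ : ∃ Φ : Euc d → ℝ, ∀ h, Φ h =
    f (x - δ • h) * inner ℝ (v x - v (x - δ • h)) (δ⁻¹ • gradient α h) := ⟨_, fun _ => rfl⟩
  have e : ∀ h, f (x - h) * inner ℝ (v x - v (x - h)) (gradient (rescale α δ) h) =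
      (δ ^ d)⁻¹ * Φ (δ⁻¹ • h) := fun h => by
    rw [hΦ, smul_inv_smul₀ hδ.ne', gradient_rescale hα, mul_smul, inner_smul_right]
    ring
  simp only [velocityCommutator, e, ← hΦ]
  rw [integral_const_mul, integral_comp_inv_smul_euc _ hδ, smul_eq_mul, ← mul_assoc,
    inv_mul_cancel₀ (by positivity), one_mul]

/-- After rescaling h, the increment of v is the integral of ∇v along the segment; |∇v|M is
subtracted and added under that integral. Each half is integrable by itself, since the gradient of
the kernel has compact support. -/
lemma velocityCommutator_split {f : Euc d → ℝ} {A : ℝ} (hf : IsNiceFun f A) {v : Euc d → Euc d}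
    (hv : ContDiff ℝ ∞ v) {α : Euc d → ℝ} (hα : IsBump α) {δ : ℝ} (hδ : 0 < δ)
    (M : Matrix (Fin d) (Fin d) ℝ) (x : Euc d) (a b : ℝ) :
    a * velocityCommutator f v (rescale α δ) x * b =
      (∫ h, a * f (x - δ • h) * (∫ s in (0 : ℝ)..1,
        sandwich h (gradMatrix v (x - (s * δ) • h) - frob (gradMatrix v (x - (s * δ) • h)) • M)
          (gradient α h)) * b) +
      ∫ h, a * f (x - δ • h) * (∫ s in (0 : ℝ)..1, frob (gradMatrix v (x - (s * δ) • h)) *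
        sandwich h M (gradient α h)) * b := by
  have hfm : AEStronglyMeasurable (fun h => a * f (x - δ • h)) (volume : Measure (Euc d)) :=
    ((hf.measurable.comp (measurable_const.sub (measurable_id.const_smul δ))).const_mul
      a).aestronglyMeasurable
  have hfb : ∀ᵐ h : Euc d, ‖a * f (x - δ • h)‖ ≤ |a| * A := Filter.Eventually.of_forall fun h => by
    rw [norm_mul, Real.norm_eq_abs, Real.norm_eq_abs]
    exact mul_le_mul_of_nonneg_left (hf.bound _) (abs_nonneg _)
  have hgc := hα.1.gradient.continuous
  have hgs := hα.2.gradient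
  have hqc := continuous_frob_gradMatrix hv
  have hpath : Continuous fun p : Euc d × ℝ => x - (p.2 * δ) • p.1 := by fun_prop
  have hJ : ∀ h, ∫ s in (0 : ℝ)..1, frob (gradMatrix v (x - (s * δ) • h)) *
      sandwich h M (gradient α h) =
        (∫ s in (0 : ℝ)..1, frob (gradMatrix v (x - (s * δ) • h))) * sandwich h M (gradient α h) :=
    fun h => intervalIntegral.integral_mul_const _ _
  have hsc : Continuous fun h => sandwich h M (gradient α h) := by
    unfold sandwich
    exact continuous_finsetSum _ fun i _ => continuous_finsetSum _ fun j _ =>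
      (((PiLp.continuous_apply 2 _ i).mul continuous_const).mul
        ((PiLp.continuous_apply 2 _ j).comp hgc))
  have hss : HasCompactSupport fun h => sandwich h M (gradient α h) :=
    hgs.mono fun h hh hz => hh (by simp [sandwich, hz])
  have i5 : Integrable fun h => a * f (x - δ • h) * ((∫ s in (0 : ℝ)..1,
      frob (gradMatrix v (x - (s * δ) • h))) * sandwich h M (gradient α h)) := by
    have hc1 : Continuous fun h : Euc d => ∫ s in (0 : ℝ)..1, frob (gradMatrix v (x - (s * δ) • h)) :=
      intervalIntegral.continuous_parametric_intervalIntegral_of_continuous'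
        (f := fun (h : Euc d) (s : ℝ) => frob (gradMatrix v (x - (s * δ) • h)))
        (hqc.comp hpath) 0 1
    exact ((hc1.mul hsc).integrable_of_hasCompactSupport hss.mul_left).bdd_mul hfm hfb
  have iV : Integrable fun h => a * f (x - δ • h) *
      inner ℝ (v x - v (x - δ • h)) (δ⁻¹ • gradient α h) := by
    have hc : Continuous fun h => inner ℝ (v x - v (x - δ • h)) (δ⁻¹ • gradient α h) :=
      (continuous_const.sub (hv.continuous.comp (by fun_prop))).inner (hgc.fun_const_smul δ⁻¹)
    refine (hc.integrable_of_hasCompactSupport ?_).bdd_mul hfm hfb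
    exact hgs.mono fun h hh hz => hh (by simp [hz])
  have hsub : ∀ h, ∫ s in (0 : ℝ)..1, sandwich h
      (gradMatrix v (x - (s * δ) • h) - frob (gradMatrix v (x - (s * δ) • h)) • M) (gradient α h) =
      inner ℝ (v x - v (x - δ • h)) (δ⁻¹ • gradient α h) -
        (∫ s in (0 : ℝ)..1, frob (gradMatrix v (x - (s * δ) • h))) *
          sandwich h M (gradient α h) := fun h => by
    have hpath' : Continuous fun s : ℝ => x - (s * δ) • h := by fun_prop
    simp only [sandwich_sub_smul]
    rw [inner_sub_eq_integral_sandwich hv hδ.ne', ← hJ, intervalIntegral.integral_sub]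
    · refine Continuous.intervalIntegrable ?_ 0 1
      simp only [sandwich_gradMatrix]
      exact (((hv.continuous_fderiv (by simp)).comp hpath').clm_apply continuous_const).inner
        continuous_const
    · exact ((hqc.comp hpath').mul continuous_const).intervalIntegrable 0 1
  simp only [hsub, hJ]
  rw [integral_mul_const, integral_mul_const, ← add_mul, ← integral_add ?_ i5,
    velocityCommutator_rescale hα.1 hδ, ← integral_const_mul]
  · congr 2
    ext h
    ring
  · simp only [mul_sub]
    exact iV.sub i5

/-- The representation as derivative plus transport consists of integrable terms linear in the
field, so linearity can be read off there. -/
lemma velocityCommutator_sub {f κ : Euc d → ℝ} {A : ℝ} (hf : IsNiceFun f A) (hκ : IsBump κ)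
    {u v : Euc d → Euc d} (hu : IsNiceField u) (hv : IsNiceField v) (x : Euc d) :
    velocityCommutator f (fun y => u y - v y) κ x =
      velocityCommutator f u κ x - velocityCommutator f v κ x := by
  have hw : IsNiceField fun y => u y - v y :=
    ⟨hu.measurable.sub hv.measurable, fun x i => by simp only [hu.periodic x i, hv.periodic x i],
      hu.integrable.sub hv.integrable⟩
  rw [velocityCommutator_eq hw hf hκ, velocityCommutator_eq hu hf hκ, velocityCommutator_eq hv hf hκ,
    transport, transport, transport, flux, flux, flux, map_sub]
  simp only [inner_sub_left, mul_sub]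
  rw [integral_sub (integrable_flux hu hf (hκ.reflect x)) (integrable_flux hv hf (hκ.reflect x))]
  ring

lemma mollify_sub_apply {f g κ : Euc d → ℝ} {A B : ℝ} (hf : IsNiceFun f A) (hg : IsNiceFun g B)
    (hκ : IsBump κ) (x : Euc d) :
    mollify (fun y => f y - g y) κ x = mollify f κ x - mollify g κ x := by
  simp only [mollify_apply, smul_sub]
  exact integral_sub (hf.integrable_mollify hκ x) (hg.integrable_mollify hκ x)

lemma IsNiceDensity.sub {f g : Euc d → ℝ → ℝ} {A B : ℝ} (hf : IsNiceDensity f A)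
    (hg : IsNiceDensity g B) : IsNiceDensity (fun x t => f x t - g x t) (A + B) :=
  ⟨hf.measurable.sub hg.measurable, fun t x i => by
    have h1 := hf.periodic t x i
    have h2 := hg.periodic t x i
    simp only at h1 h2 ⊢
    rw [h1, h2], fun x t => (abs_sub _ _).trans (add_le_add (hf.bound x t) (hg.bound x t))⟩

lemma localisedIntegral_neg (T : ℝ) (F : ℝ → Euc d → Euc d → ℝ) :
    localisedIntegral T (fun t x z => - F t x z) = - localisedIntegral T F := by
  simp only [localisedIntegral, integral_neg, intervalIntegral.integral_neg]

lemma IsLocalised.of_slice {F : ℝ → Euc d → Euc d → ℝ} (hF : IsLocalised F) (t : ℝ) :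
    ∫ z in cell d, ∫ x, F t x z = ∫ x in cell d, ∫ z, F t x z := (hF.integral_swap t).symm

/-! ### The exact decomposition -/

lemma gradient_reflect {θ : Euc d → ℝ} (hθ : IsBump θ) (z x : Euc d) :
    gradient (reflect θ z) x = - gradient θ (z - x) := by
  refine gradient_eq_of_hasFDerivAt ((hθ.reflect z).1.differentiable (by simp) x).hasFDerivAt
    fun w => ?_
  rw [fderiv_reflect hθ, inner_neg_right, inner_gradient]

/-- The localised doubling identity, integrated over the centre of localisation. -/
lemma IsNiceSolution.localised_doubling {u v : Euc d → Euc d} {T : ℝ} {ρ φ ψ : Euc d → ℝ → ℝ}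
    {ρ₀ ρT φ₀ φT : Euc d → ℝ} {B B' A A' A'' : ℝ} (hρ : IsNiceSolution u T ρ ρ₀ ρT B B')
    (hφ : IsNiceSolution u T φ φ₀ φT A A') (hu : IsNiceField u) (hv : IsNiceField v) (hT : 0 < T)
    (hψ : IsNiceDensity ψ A'')
    {k : Euc d → Euc d → ℝ} {r S K G : ℝ} (hk : IsKernelFamily k r S K G) {θ : Euc d → ℝ}
    (hθ : IsBump θ) :
    (∫ x in cell d, ∫ z, ρT x * mollify φT (k z) x * θ (z - x)) -
      ∫ x in cell d, ∫ z, ρ₀ x * mollify φ₀ (k z) x * θ (z - x) =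
    localisedIntegral T (fun t x z => ρ x t *
        velocityCommutator (fun y => φ y t) (fun y => u y - v y) (k z) x * θ (z - x)) +
      localisedIntegral T (fun t x z => ρ x t *
        velocityCommutator (fun y => φ y t) v (k z) x * θ (z - x)) -
      localisedIntegral T (fun t x z => ρ x t * mollifySpace ψ (k z) x t *
        inner ℝ (u x) (gradient θ (z - x))) -
      localisedIntegral T (fun t x z => ρ x t * mollifySpace (fun x t => φ x t - ψ x t) (k z) x t *
        inner ℝ (u x) (gradient θ (z - x))) := by
  have hw : IsNiceField fun y => u y - v y :=
    ⟨hu.measurable.sub hv.measurable, fun x i => by simp only [hu.periodic x i, hv.periodic x i],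
      hu.integrable.sub hv.integrable⟩
  have lT := isLocalised_mul_mollify hk hθ hρ.final hφ.final
  have l0 := isLocalised_mul_mollify hk hθ hρ.initial hφ.initial
  have l1 := isLocalised_mul_velocityCommutator hk hθ hρ.density hφ.density hw
  have l2 := isLocalised_mul_velocityCommutator hk hθ hρ.density hφ.density hv
  have l3 := (isLocalised_mollify_mul_inner hk hθ hρ.density hψ hu).neg
  have l4 := (isLocalised_mollify_mul_inner hk hθ hρ.density (hφ.density.sub hψ) hu).neg
  have l := (l1.add l2).add (l3.add l4)
  have hsum := (l1.add l2).localisedIntegral_add (l3.add l4) T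
  rw [l1.localisedIntegral_add l2, l3.localisedIntegral_add l4, localisedIntegral_neg,
    localisedIntegral_neg] at hsum
  rw [← lT.of_slice 0, ← l0.of_slice 0,
    ← integral_sub (lT.integrable_integral_left 0) (l0.integrable_integral_left 0)]
  refine Eq.trans ?_ ((l.integral_localisedIntegral hT.le).trans (hsum.trans (by ring)))
  refine integral_congr_ae (Filter.Eventually.of_forall fun z => ?_)
  have hkz := (hk.kernel z).isBump
  -- Doubling with z frozen, the kernel k z and the cutoff θ(z - ·). The gradient of this cutoff is
  -- -∇θ(z - ·), whence the minus signs of the two flux terms.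
  have hd := hρ.doubling hφ hu hT hkz (hθ.reflect z)
  simp only [pair] at hd
  have e : ∀ (g f : Euc d → ℝ), ∫ x, g x * mollify f (k z) x * θ (z - x) =
      ∫ x, g x * (reflect θ z x * mollify f (k z) x) := fun g f => by
    congr 1
    ext x
    rw [reflect]
    ring
  beta_reduce
  rw [e, e, hd]
  congr 1
  ext t
  congr 1
  ext x
  have h1 := velocityCommutator_sub (hφ.density.slice t) hkz hu hv x
  have h2 := mollify_sub_apply (hφ.density.slice t) (hψ.slice t) hkz x
  simp only [mollifySpace]
  rw [h1, h2, gradient_reflect hθ, inner_neg_right, reflect]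
  ring

/-- The decomposition for solutions given by regular representatives. -/
lemma IsNiceSolution.decomposition {u v : Euc d → Euc d} {T : ℝ} {ρ φ : Euc d → ℝ → ℝ}
    {ρ₀ ρT φ₀ φT : Euc d → ℝ} {B B' A A' : ℝ} (hρ : IsNiceSolution u T ρ ρ₀ ρT B B')
    (hφ : IsNiceSolution u T φ φ₀ φT A A') (hu : IsNiceField u) (hT : 0 < T)
    (hv : ContDiff ℝ ∞ v) (hp : IsPeriodic v) {η : Euc d → ℝ} (hη : IsMollifier η)
    {Λ δ δ' ε : ℝ} (hΛ : 0 < Λ) (hδ : 0 < δ) (hδ' : 0 < δ') (hε : 0 < ε)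
    {M : Euc d → Matrix (Fin d) (Fin d) ℝ} (hM : IsUnitField M) :
    (∫ x in cell d, ρT x * φT x) = termI1 η Λ δ ε M ρT φT + termI2 η Λ δ ε M ρ₀ φ₀ +
      termI3 η Λ δ δ' ε T M u ρ φ + termI4 η Λ δ ε T M v ρ φ + termI5 η Λ δ ε T M v ρ φ +
      termR1 η Λ δ δ' ε T M u ρ φ + termR2 η Λ δ ε T M (fun x => u x - v x) ρ φ := by
  obtain ⟨H, -, hfam⟩ := exists_isKernelFamily hη
  have hk := hfam Λ δ M hΛ hδ hM
  have hθk := hη.isKernel_rescale hε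
  have hθ := hθk.isBump
  have hnv := IsNiceField.of_contDiff hv hp
  have hψ := hφ.density.mollifySpace (hη.isKernel_rescale hδ')
  have hα : ∀ z, IsBump (albertiMollifier η Λ (M z)) := fun z =>
    ⟨contDiff_albertiMollifier hη.smooth, hasCompactSupport_of_eq_zero fun _ =>
      albertiMollifier_eq_zero hη hΛ (hM.frob_le z)⟩
  have main := hρ.localised_doubling hφ hu hnv hT hψ hk hθ
  have lT := isLocalised_mul_mollify hk hθ hρ.final hφ.final
  have l2 := isLocalised_mul_velocityCommutator hk hθ hρ.density hφ.density hnv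
  have l5 := isLocalised_alignment hη hΛ δ hM hθ hρ.density hφ.density hv hp
  have hsplit : ∀ t x z, ρ x t * velocityCommutator (fun y => φ y t) v
      (rescale (albertiMollifier η Λ (M z)) δ) x * rescale η ε (z - x) = _ := fun t x z =>
    velocityCommutator_split (hφ.density.slice t) hv (hα z) hδ (M z) x (ρ x t) (rescale η ε (z - x))
  -- Admissibility of the transversal part follows by difference from that of the full commutator
  -- and of the part along M.
  have l4 : IsLocalised fun t x z => ∫ h, ρ x t * φ (x - δ • h) t
      * (∫ s in (0 : ℝ)..1,
          sandwich h (gradMatrix v (x - (s * δ) • h) - frob (gradMatrix v (x - (s * δ) • h)) • M z)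
            (gradient (albertiMollifier η Λ (M z)) h)) * rescale η ε (z - x) := by
    have := l2.add l5.neg
    simp only [hsplit, add_neg_cancel_right] at this
    exact this
  have h45 : localisedIntegral T (fun t x z => ρ x t * velocityCommutator (fun y => φ y t) v
      (rescale (albertiMollifier η Λ (M z)) δ) x * rescale η ε (z - x)) =
      termI4 η Λ δ ε T M v ρ φ + termI5 η Λ δ ε T M v ρ φ := by
    simp only [hsplit]
    exact l4.localisedIntegral_add l5 T
  -- The cutoffs integrate to one in z, so ∫ ρT φT can be written with the localising weight and
  -- compared with the mollified endpoint.
  have hI1 : termI1 η Λ δ ε M ρT φT = (∫ x in cell d, ρT x * φT x) -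
      ∫ x in cell d, ∫ z, ρT x * mollify φT (rescale (albertiMollifier η Λ (M z)) δ) x *
        rescale η ε (z - x) := by
    have hint : Integrable (fun x => ρT x * φT x) (volume.restrict (cell d)) :=
      hφ.final.integrable.bdd_mul hρ.final.measurable.aestronglyMeasurable
        (Filter.Eventually.of_forall fun x => (Real.norm_eq_abs _).trans_le (hρ.final.bound x))
    rw [← integral_sub hint (lT.integrable_integral 0), termI1]
    congr 1
    ext x
    have hi : Integrable fun z => rescale η ε (z - x) := hθk.integrable.comp_sub_right x
    have e1 : ∫ z, rescale η ε (z - x) = 1 := by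
      rw [integral_sub_right_eq_self (rescale η ε) x, hθk.integral_eq_one]
    have e2 : ρT x * φT x = ∫ z, ρT x * φT x * rescale η ε (z - x) := by
      rw [integral_const_mul, e1, mul_one]
    rw [e2, ← integral_sub (hi.const_mul _) (lT.integrable_right 0 x)]
    congr 1
    ext z
    ring
  rw [h45] at main
  have hI2 : termI2 η Λ δ ε M ρ₀ φ₀ = ∫ x in cell d, ∫ z, ρ₀ x *
      mollify φ₀ (rescale (albertiMollifier η Λ (M z)) δ) x * rescale η ε (z - x) := rfl
  have hR2 : termR2 η Λ δ ε T M (fun x => u x - v x) ρ φ = localisedIntegral T (fun t x z => ρ x t *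
        velocityCommutator (fun y => φ y t) (fun y => u y - v y)
          (rescale (albertiMollifier η Λ (M z)) δ) x * rescale η ε (z - x)) := rfl
  have hI3 : termI3 η Λ δ δ' ε T M u ρ φ = - localisedIntegral T (fun t x z => ρ x t *
      mollifySpace (mollifySpace φ (rescale η δ')) (rescale (albertiMollifier η Λ (M z)) δ) x t *
        inner ℝ (u x) (gradient (rescale η ε) (z - x))) := rfl
  have hR1 : termR1 η Λ δ δ' ε T M u ρ φ = - localisedIntegral T (fun t x z => ρ x t *
      mollifySpace (fun x t => φ x t - mollifySpace φ (rescale η δ') x t)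
        (rescale (albertiMollifier η Λ (M z)) δ) x t *
        inner ℝ (u x) (gradient (rescale η ε) (z - x))) := rfl
  rw [hI1, hI2, hI3, hR1, hR2]
  linarith

/-! ### The bounds for pointwise bounded data -/

lemma exists_lintegral_gradient_rescale_le {η : Euc d → ℝ} (hη : IsMollifier η) :
    ∃ N : ℝ, 0 < N ∧ ∀ ε : ℝ, 0 < ε →
      ∫⁻ h, ‖gradient (rescale η ε) h‖ₑ ≤ ENNReal.ofReal (N * ε⁻¹) := by
  have hb : IsBump η := by
    have := (hη.isKernel_rescale one_pos).isBump
    rwa [rescale_one] at this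
  have hi : ∫⁻ h, ‖gradient η h‖ₑ ≠ ⊤ :=
    (((ContDiff.gradient hb.1).continuous.integrable_of_hasCompactSupport
      (HasCompactSupport.gradient hb.2) : Integrable (gradient η) volume).2).ne
  refine ⟨(∫⁻ h, ‖gradient η h‖ₑ).toReal + 1, by positivity, fun ε hε => ?_⟩
  rw [lintegral_gradient_rescale hη.smooth hε, mul_comm, ENNReal.ofReal_mul (by positivity)]
  gcongr
  rw [← ENNReal.ofReal_toReal hi]
  exact ENNReal.ofReal_le_ofReal (by simp)

/-- Nonnegativity of X comes for free from the bound itself, so constants can be enlarged without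
inspecting the right-hand side. -/
lemma abs_le_mul_of_le {a c C X : ℝ} (hc : 0 < c) (hC : c ≤ C) (h : |a| ≤ c * X) : |a| ≤ C * X :=
  h.trans (mul_le_mul_of_nonneg_right hC
    (nonneg_of_mul_nonneg_right ((abs_nonneg _).trans h) hc))

lemma IsNiceSolution.exists_bounds (hd : 2 ≤ d) {η : Euc d → ℝ} (hη : IsMollifier η) :
    ∃ C : ℝ, 0 < C ∧
    ∀ (T B : ℝ) (u : Euc d → Euc d) (ρ φ : Euc d → ℝ → ℝ) (ρ₀ ρT φ₀ φT : Euc d → ℝ)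
      (g : Euc d → Euc d),
      0 < T → IsNiceField u → BddAbove (variationSet u) → IsDivFree u →
      IsNiceSolution u T ρ ρ₀ ρT B B → IsNiceSolution u T φ φ₀ φT 1 1 →
      HasWeakGradient φT g → Integrable g (torusMeasure d) →
      (∀ᵐ x ∂torusMeasure d, ‖g x‖ ≤ 1) →
    ∀ Λ δ δ' ε ε' : ℝ, 0 < Λ → 0 < δ → 0 < δ' → 0 < ε → 0 < ε' → δ ≤ ε * Real.exp (-Λ) →
    ∀ (v : Euc d → Euc d) (M : Euc d → Matrix (Fin d) (Fin d) ℝ),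
      v = mollify u (rescale η ε') →
      M = unitGradient (mollify v (rescale η (4 * ε))) →
      (∫ x in cell d, ρT x * φT x) = termI1 η Λ δ ε M ρT φT + termI2 η Λ δ ε M ρ₀ φ₀ +
        termI3 η Λ δ δ' ε T M u ρ φ + termI4 η Λ δ ε T M v ρ φ + termI5 η Λ δ ε T M v ρ φ +
        termR1 η Λ δ δ' ε T M u ρ φ + termR2 η Λ δ ε T M (fun x => u x - v x) ρ φ ∧
      |termI1 η Λ δ ε M ρT φT| ≤ C * (δ * Real.exp ((d + 1) * Λ) * B) ∧
      |termI2 η Λ δ ε M ρ₀ φ₀| ≤ C * ((1 + Real.exp Λ / δ + 1 / ε) * negSobolevNorm ρ₀) ∧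
      |termI3 η Λ δ δ' ε T M u ρ φ| ≤ C * (T ^ (((d : ℝ) - 1) / d) * (Real.exp (d * Λ) / ε) * B
        * (totalVariation u + ‖∫ x in cell d, u x‖)
        * (sqNormL2 T (mollifySpace φ (rescale η δ'))
            - sqNormL2 T (mollifySpace (mollifySpace φ (rescale η δ'))
                (rescale η (2 * δ * Real.exp Λ)))) ^ (1 / (d : ℝ))) ∧
      |termI4 η Λ δ ε T M v ρ φ| ≤ C * (T * Real.exp (2 * Λ) * B
        * totalVariation u ^ (1 / 2 : ℝ)
        * (gradNormL1 v - gradNormL1 (mollify v (rescale η (4 * ε)))) ^ (1 / 2 : ℝ)) ∧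
      |termI5 η Λ δ ε T M v ρ φ| ≤ C * (T / Λ * B * totalVariation u) ∧
      |termR1 η Λ δ δ' ε T M u ρ φ| ≤ C * (T * (δ' * Real.exp ((d + 1) * Λ) / (ε * δ)) * B
        * (totalVariation u + ‖∫ x in cell d, u x‖)) ∧
      |termR2 η Λ δ ε T M (fun x => u x - v x) ρ φ| ≤
        C * (T * (ε' * Real.exp ((d + 1) * Λ) / δ) * B * totalVariation u) := by
  obtain ⟨N, hN, hηN⟩ := exists_lintegral_gradient_rescale_le hη
  obtain ⟨H, hH, hfam⟩ := exists_isKernelFamily hη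
  obtain ⟨C₃, hC₃, h₃⟩ := exists_abs_localisation_energy_le hd hη
  obtain ⟨C₄, hC₄, h₄⟩ := exists_abs_defect_term_le hη
  obtain ⟨C₅, hC₅, h₅⟩ := exists_abs_alignment_term_le hη
  have hV : 0 ≤ volume.real (Metric.closedBall (0 : Euc d) 1) := measureReal_nonneg
  obtain ⟨V, hVd⟩ : ∃ V, V = volume.real (Metric.closedBall (0 : Euc d) 1) := ⟨_, rfl⟩
  rw [← hVd] at hV
  have hd0 : (0 : ℝ) < d := by positivity
  -- The sum of the constants of I₂, I₃', I₄', I₅', R₁ and R₂; the constant 1 of I₁ is absorbed in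
  -- the first.
  refine ⟨(1 + H + N) + C₃ * H * N + C₄ + C₅ + H * N * d + 2 * H * (V + 1), by positivity, ?_⟩
  intro T B u ρ φ ρ₀ ρT φ₀ φT g hT hu hb hdiv hρ hφ hg hgi hg1 Λ δ δ' ε ε' hΛ hδ hδ' hε hε' hδε
    v M hv hM
  have hB : 0 ≤ B := hρ.initial.nonneg
  have hkv : IsKernel (rescale η ε') := hη.isKernel_rescale hε'
  have hk4 : IsKernel (rescale η (4 * ε)) := hη.isKernel_rescale (by positivity)
  have hkε : IsKernel (rescale η ε) := hη.isKernel_rescale hε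
  have hkδ : IsKernel (rescale η δ') := hη.isKernel_rescale hδ'
  have hvs : ContDiff ℝ ∞ v := hv ▸ hu.contDiff_mollify hkv.smooth hkv.compact
  have hvp : IsPeriodic v := hv ▸ hu.periodic.mollify _
  have htr : ∀ x, (gradMatrix v x).trace = 0 := fun x => by
    rw [hv]; exact hdiv.trace_gradMatrix_mollify hu hkv.isBump x
  have hvn : IsNiceField v := IsNiceField.of_contDiff hvs hvp
  have hMu : IsUnitField M := hM ▸ isUnitField_unitGradient
    (hvn.contDiff_mollify hk4.smooth hk4.compact) (hvp.mollify _)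
    (trace_gradMatrix_mollify hvs hvp htr hk4.isBump)
  have hK := hfam Λ δ M hΛ hδ hMu
  have hNε := hηN ε hε
  have hTV := totalVariation_nonneg hb
  have hgv : gradNormL1 v ≤ totalVariation u := hv ▸ gradNormL1_mollify_le hu hb hkv
  have hgv0 := gradNormL1_nonneg v
  have hφb : ∀ t x, |φ x t| ≤ 1 := fun t x => hφ.density.bound x t
  have hρb : ∀ t x, |ρ x t| ≤ B := fun t x => hρ.density.bound x t
  have he1 : Real.exp Λ ≤ Real.exp ((d + 1) * Λ) := by
    apply Real.exp_le_exp.2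
    nlinarith [mul_nonneg hd0.le hΛ.le]
  have hed : Real.exp ((d + 1) * Λ) = Real.exp Λ ^ d * Real.exp Λ := by
    rw [add_mul, Real.exp_add, one_mul, Real.exp_nat_mul]
  have hE := Real.exp_pos Λ
  have hHN : 0 ≤ C₃ * H * N := by positivity
  have hHd : 0 ≤ H * N * d := by positivity
  have hHw : 0 ≤ 2 * H * (V + 1) := by positivity
  refine ⟨hρ.decomposition hφ hu hT hvs hvp hη hΛ hδ hδ' hε hMu, ?_, ?_, ?_, ?_, ?_, ?_, ?_⟩
  · refine abs_le_mul_of_le one_pos (by linarith) ?_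
    refine (abs_final_term_le hK hkε hB (hρ.abs_final_le hu hT) hφ.final zero_le_one
      (by positivity) (ae_lipschitz_of_weakGradient hφ.final hg hgi hg1)).trans ?_
    -- A single e^Λ would suffice here; it is weakened to e^{(d+1)Λ}.
    calc B * (1 * (δ * Real.exp Λ)) = δ * Real.exp Λ * B := by ring
      _ ≤ δ * Real.exp ((d + 1) * Λ) * B := by gcongr
      _ = _ := (one_mul _).symm
  · refine abs_le_mul_of_le (c := 1 + H + N) (by positivity) (by linarith) ?_
    rw [← mul_assoc]
    refine abs_initial_term_le hK hkε hφ.initial (by positivity) (by positivity) hNε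
      (Filter.Eventually.of_forall hρ.initial.bound) (by positivity) ?_
    have h1 : 0 ≤ Real.exp Λ / δ := by positivity
    have h2 : 0 ≤ 1 / ε := by positivity
    have e1 : Real.exp Λ * δ⁻¹ = Real.exp Λ / δ := rfl
    have e2 : ε⁻¹ = 1 / ε := by rw [one_div]
    rw [e1, e2]
    nlinarith [mul_nonneg hH.le h1, mul_nonneg hN.le h2, mul_nonneg hH.le h2, mul_nonneg hN.le h1]
  · refine abs_le_mul_of_le (c := C₃ * H * N) (by positivity) (by linarith) ?_
    rw [termI3, localisationTerm, abs_neg]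
    refine (h₃ u ρ (mollifySpace φ (rescale η δ')) (rescale η ε) _ T (δ * Real.exp Λ) _ _ _ B _ hu hb
      hρ.density (hφ.density.mollifySpace hkδ) hkε.isBump hK (by positivity) hNε hT
      (by positivity)).trans (le_of_eq ?_)
    -- The sup bound Hδ^{-d} of the kernels times the d-th power of the radius δe^Λ gives He^{dΛ},
    -- and twice that radius is the energy scale.
    rw [← mul_assoc 2 δ, Real.exp_nat_mul, mul_pow]
    field_simp
  · refine abs_le_mul_of_le (c := C₄) (by positivity) (by linarith) ?_
    rw [termI4]
    refine (abs_interval_integral_le hT.le fun t =>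
      h₄ Λ δ ε 1 B M v (fun x => ρ x t) (fun x => φ x t) hΛ hδ hε hδε hMu hvs hM hvp zero_le_one hB
        (hρb t) (hφb t)).trans ?_
    have hdef : 0 ≤ gradNormL1 v - gradNormL1 (mollify v (rescale η (4 * ε))) :=
      (lintegral_defect hvs hvp hk4 (hM ▸ hMu)).1
    calc T * (B * 1 * (C₄ * (Real.exp (2 * Λ) * (gradNormL1 v ^ (1 / 2 : ℝ) *
          (gradNormL1 v - gradNormL1 (mollify v (rescale η (4 * ε)))) ^ (1 / 2 : ℝ)))))
        = C₄ * (T * Real.exp (2 * Λ) * B * gradNormL1 v ^ (1 / 2 : ℝ) *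
          (gradNormL1 v - gradNormL1 (mollify v (rescale η (4 * ε)))) ^ (1 / 2 : ℝ)) := by ring
      _ ≤ _ := by gcongr
  · refine abs_le_mul_of_le (c := C₅) (by positivity) (by linarith) ?_
    rw [termI5]
    refine (abs_interval_integral_le hT.le fun t =>
      h₅ Λ δ ε 1 B M v (fun x => ρ x t) (fun x => φ x t) hΛ hδ hε hδε hMu hvs hvp zero_le_one hB
        (hρb t) (hφb t)).trans ?_
    calc T * (B * 1 * (C₅ * (Λ⁻¹ * gradNormL1 v))) = C₅ * (T / Λ * B * gradNormL1 v) := by ring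
      _ ≤ _ := by gcongr
  · refine abs_le_mul_of_le (c := H * N * d) (by positivity) (by linarith) ?_
    rw [termR1, localisationTerm, abs_neg]
    have hU0 : 0 ≤ d * totalVariation u + ‖∫ x in cell d, u x‖ := by positivity
    refine (abs_interval_integral_le hT.le fun t => abs_localisation_le
      (D := 1 * (H * (Real.exp Λ * δ⁻¹)) * δ') hB (by positivity) hU0 (N := N * ε⁻¹)
      (by positivity) (hρb t) (fun z x => ?_) (lintegral_enorm_le hu hb) hNε).trans ?_
    · exact abs_mollify_sub_mollify_le (hφ.density.slice t) (hK.kernel z).isBump hkδ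
        (fun h hh => (hη.rescale hδ').2.2.2.2 h hh) (by positivity) (hK.lintegral_gradient_le z) x
    · have hd1 : (1 : ℝ) ≤ d := by exact_mod_cast (by omega : 1 ≤ d)
      -- The Poincaré bound has the factor d only on the total variation; since d ≥ 1 it may be put
      -- on both summands.
      have hle : d * totalVariation u + ‖∫ x in cell d, u x‖ ≤
          d * (totalVariation u + ‖∫ x in cell d, u x‖) := by
        nlinarith [norm_nonneg (∫ x in cell d, u x)]
      calc T * (B * (1 * (H * (Real.exp Λ * δ⁻¹)) * δ') *
            ((d * totalVariation u + ‖∫ x in cell d, u x‖) * (N * ε⁻¹)))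
          ≤ T * (B * (1 * (H * (Real.exp ((d + 1) * Λ) * δ⁻¹)) * δ') *
            ((d * (totalVariation u + ‖∫ x in cell d, u x‖)) * (N * ε⁻¹))) := by gcongr
        _ = _ := by field_simp
  · refine abs_le_mul_of_le (c := 2 * H * (V + 1)) (by positivity) (by linarith) ?_
    rw [termR2]
    have hw : IsNiceField fun x => u x - v x :=
      ⟨hu.measurable.sub hvn.measurable, fun x i => by rw [hu.periodic, hvp],
        hu.integrable.sub hvn.integrable⟩
    have hW := lintegral_sub_mollify_le hu hb hkv (r := ε') fun h hh =>
      (hη.rescale hε').2.2.2.2 h hh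
    rw [← hv] at hW
    refine (abs_interval_integral_le hT.le fun t => abs_commutator_term_le hK hkε zero_le_one hB
      (by positivity) (by positivity) (by positivity) (hφb t) (hρb t) hw hW).trans ?_
    rw [← hVd]
    -- The volume of the ball of radius δe^Λ times the sup bound He^Λδ^{-d-1} of the gradient gives
    -- e^{(d+1)Λ}/δ.
    calc _ = 2 * H * V * (T * (ε' * Real.exp ((d + 1) * Λ) / δ) * B * totalVariation u) := by
          rw [hed, mul_pow]
          field_simp
      _ ≤ _ := by
          gcongr
          linarith

/-! ### Bounded, measurable and periodic representatives -/

/-- The coordinatewise fractional part. -/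
def fractionalPart (x : Euc d) : Euc d := WithLp.toLp 2 fun i => Int.fract (x i)

lemma measurable_fractionalPart : Measurable (fractionalPart (d := d)) :=
  (PiLp.continuous_toLp 2 _).measurable.comp
    (measurable_pi_iff.2 fun i => measurable_fract.comp (measurable_coord i))

lemma isPeriodic_fractionalPart : IsPeriodic (fractionalPart (d := d)) := fun x i => by
  ext j
  by_cases h : j = i
  · subst h; simp [fractionalPart]
  · simp [fractionalPart, h]

lemma fractionalPart_of_mem_cell {x : Euc d} (hx : x ∈ cell d) : fractionalPart x = x := by
  ext i
  exact Int.fract_eq_self.2 (hx i)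

lemma ae_eq_of_ae_torus {F : Type*} {f g : Euc d → F} (hf : IsPeriodic f) (hg : IsPeriodic g)
    (h : f =ᵐ[torusMeasure d] g) : f =ᵐ[volume] g :=
  ae_of_ae_torus (p := fun x => f x = g x) (fun x i => by simp only [hf x i, hg x i]) h

lemma ae_torus_of_ae {p : Euc d → Prop} (h : ∀ᵐ x, p x) : ∀ᵐ x ∂torusMeasure d, p x :=
  ae_restrict_of_ae h

lemma ae_mem_cell : ∀ᵐ x ∂torusMeasure d, x ∈ cell d := ae_restrict_mem measurableSet_cell

/-- A Borel version on the cell is extended by composing with the fractional part, which makes it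
Borel and exactly periodic. -/
lemma exists_isNiceField {u : Euc d → Euc d} (hp : IsPeriodic u)
    (hi : Integrable u (torusMeasure d)) : ∃ u', IsNiceField u' ∧ u =ᵐ[volume] u' := by
  have hm := hi.1.stronglyMeasurable_mk.measurable
  have he : u =ᵐ[torusMeasure d] fun x => hi.1.mk u (fractionalPart x) := by
    filter_upwards [hi.1.ae_eq_mk, ae_mem_cell] with x hx hc
    rw [fractionalPart_of_mem_cell hc, hx]
  have hp' : IsPeriodic fun x => hi.1.mk u (fractionalPart x) := fun x i => by
    simp only [isPeriodic_fractionalPart x i]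
  exact ⟨_, ⟨hm.comp measurable_fractionalPart, hp', hi.congr he⟩, ae_eq_of_ae_torus hp hp' he⟩

lemma abs_clamp_le {B : ℝ} (hB : 0 ≤ B) (s : ℝ) : |max (-B) (min B s)| ≤ B :=
  abs_le.2 ⟨le_max_left _ _, max_le (by linarith) (min_le_left _ _)⟩

lemma clamp_eq_self {B s : ℝ} (h : |s| ≤ B) : max (-B) (min B s) = s := by
  rw [min_eq_right (abs_le.1 h).2, max_eq_right (abs_le.1 h).1]

lemma exists_isNiceFun {f : Euc d → ℝ} {B : ℝ} (hp : IsPeriodic f)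
    (hm : AEStronglyMeasurable f (torusMeasure d)) (hB : 0 ≤ B)
    (hb : ∀ᵐ x ∂torusMeasure d, |f x| ≤ B) : ∃ f', IsNiceFun f' B ∧ f =ᵐ[volume] f' := by
  have h1 := hm.stronglyMeasurable_mk.measurable
  have he : f =ᵐ[torusMeasure d] fun x => max (-B) (min B (hm.mk f (fractionalPart x))) := by
    filter_upwards [hm.ae_eq_mk, ae_mem_cell, hb] with x hx hc hbx
    rw [fractionalPart_of_mem_cell hc, ← hx, clamp_eq_self hbx]
  have hp' : IsPeriodic fun x => max (-B) (min B (hm.mk f (fractionalPart x))) := fun x i => by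
    simp only [isPeriodic_fractionalPart x i]
  exact ⟨_, ⟨measurable_const.max (measurable_const.min (h1.comp measurable_fractionalPart)), hp',
    fun x => abs_clamp_le hB _⟩, ae_eq_of_ae_torus hp hp' he⟩

/-- Equality almost everywhere in time of the almost everywhere classes in space. -/
def SpaceTimeEq (T : ℝ) (f g : Euc d → ℝ → ℝ) : Prop :=
  ∀ᵐ t ∂volume.restrict (Set.Icc 0 T), (fun x => f x t) =ᵐ[volume] fun x => g x t

lemma exists_isNiceDensity {f : Euc d → ℝ → ℝ} {T B : ℝ} (hf : IsBoundedOnSpaceTime T f)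
    (hB : supNormSpaceTime T f ≤ B) : ∃ f', IsNiceDensity f' B ∧ SpaceTimeEq T f f' := by
  have hB0 : 0 ≤ B := ENNReal.toReal_nonneg.trans hB
  obtain ⟨hp, hm⟩ := hf
  have h1 := hm.1.stronglyMeasurable_mk.measurable
  have hb : ∀ᵐ p ∂spaceTimeMeasure d T, |Function.uncurry f p| ≤ B := by
    filter_upwards [ae_le_eLpNormEssSup (f := Function.uncurry f) (μ := spaceTimeMeasure d T)]
      with p hpx
    refine le_trans ?_ hB
    rw [← Real.norm_eq_abs, supNormSpaceTime, eLpNorm_exponent_top, ← toReal_enorm]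
    refine ENNReal.toReal_mono ?_ hpx
    rw [← eLpNorm_exponent_top]
    exact hm.2.ne
  have hp' : ∀ t, IsPeriodic fun x => max (-B) (min B (hm.1.mk _ (fractionalPart x, t))) :=
    fun t x i => by simp only [isPeriodic_fractionalPart x i]
  refine ⟨fun x t => max (-B) (min B (hm.1.mk _ (fractionalPart x, t))), ⟨?_, hp',
    fun x t => abs_clamp_le hB0 _⟩, ?_⟩
  · exact measurable_const.max (measurable_const.min (h1.comp
      ((measurable_fractionalPart.comp measurable_fst).prodMk measurable_snd)))
  · have he : ∀ᵐ p ∂spaceTimeMeasure d T, f p.1 p.2 = hm.1.mk _ p ∧ |f p.1 p.2| ≤ B := by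
      filter_upwards [hm.1.ae_eq_mk, hb] with p h2 h3 using ⟨h2, h3⟩
    have hs := Measure.ae_ae_of_ae_prod ((Measure.measurePreserving_swap
      (μ := volume.restrict (Set.Icc 0 T)) (ν := torusMeasure d)).quasiMeasurePreserving.ae he)
    filter_upwards [hs] with t ht
    refine ae_eq_of_ae_torus (hp t) (hp' t) ?_
    filter_upwards [ht, ae_mem_cell] with x hx hc
    simp only [Prod.swap] at hx
    rw [fractionalPart_of_mem_cell hc, ← hx.1, clamp_eq_self hx.2]

lemma intervalIntegral_congr_ae_Icc {F G : ℝ → ℝ} {T : ℝ} (hT : 0 ≤ T)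
    (h : ∀ᵐ t ∂volume.restrict (Set.Icc 0 T), F t = G t) :
    ∫ t in (0 : ℝ)..T, F t = ∫ t in (0 : ℝ)..T, G t := by
  rw [intervalIntegral.integral_of_le hT, intervalIntegral.integral_of_le hT]
  exact integral_congr_ae (ae_restrict_of_ae_restrict_of_subset Set.Ioc_subset_Icc_self h)

lemma SpaceTimeEq.integral_congr {T : ℝ} {f g : Euc d → ℝ → ℝ} (h : SpaceTimeEq T f g)
    (hT : 0 ≤ T) {F : ℝ → (Euc d → ℝ) → ℝ}
    (hF : ∀ t a b, a =ᵐ[volume] b → F t a = F t b) :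
    ∫ t in (0 : ℝ)..T, F t (fun x => f x t) = ∫ t in (0 : ℝ)..T, F t (fun x => g x t) := by
  refine intervalIntegral_congr_ae_Icc hT ?_
  filter_upwards [h] with t ht using hF t _ _ ht

/-- Weak traces are assumed bounded, but not by the bound of the density. They are first represented
with some bound; the resulting solution shows that they are in fact bounded by B almost everywhere,
and the representatives are then chosen again with the bound B. -/
lemma exists_isNiceSolution {u u' : Euc d → Euc d} {T B : ℝ} {ρ : Euc d → ℝ → ℝ}
    {ρ₀ ρT : Euc d → ℝ} (h : IsWeakSolution u T ρ ρ₀ ρT) (hu : IsNiceField u')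
    (huu : u =ᵐ[volume] u') (hT : 0 < T) (hB : supNormSpaceTime T ρ ≤ B) :
    ∃ ρ' ρ₀' ρT', IsNiceSolution u' T ρ' ρ₀' ρT' B B ∧ SpaceTimeEq T ρ ρ' ∧
      ρ₀ =ᵐ[volume] ρ₀' ∧ ρT =ᵐ[volume] ρT' := by
  have hB0 : 0 ≤ B := ENNReal.toReal_nonneg.trans hB
  obtain ⟨hρ, h0, h1, hw⟩ := h
  obtain ⟨ρ', hρ', he⟩ := exists_isNiceDensity hρ hB
  have key : ∀ {A : ℝ} {a b : Euc d → ℝ}, IsNiceFun a A → IsNiceFun b A → ρ₀ =ᵐ[volume] a →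
      ρT =ᵐ[volume] b → IsNiceSolution u' T ρ' a b B A := by
    intro A a b ha hb hae hbe
    refine ⟨hρ', ha, hb, fun ψ hψ => ?_⟩
    have e0 : ∫ x in cell d, a x * ψ x 0 = ∫ x in cell d, ρ₀ x * ψ x 0 := integral_congr_ae <| by
      filter_upwards [ae_restrict_of_ae hae] with x hx
      rw [hx]
    have e1 : ∫ x in cell d, b x * ψ x T = ∫ x in cell d, ρT x * ψ x T := integral_congr_ae <| by
      filter_upwards [ae_restrict_of_ae hbe] with x hx
      rw [hx]
    rw [e0, e1, ← hw ψ hψ]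
    refine intervalIntegral_congr_ae_Icc hT.le ?_
    filter_upwards [he] with t ht
    refine integral_congr_ae ?_
    filter_upwards [ae_restrict_of_ae ht, ae_restrict_of_ae huu] with x hx hux
    rw [hx, hux]
  have hA : ∀ {f : Euc d → ℝ} {A : ℝ}, MemLp f ⊤ (torusMeasure d) → supNormTorus f ≤ A →
      ∀ᵐ x ∂torusMeasure d, |f x| ≤ A := fun hf hA => by
    filter_upwards [ae_abs_le_supNormTorus hf] with x hx using hx.trans hA
  have hA0 : 0 ≤ max (supNormTorus ρ₀) (supNormTorus ρT) :=
    (supNormTorus_nonneg _).trans (le_max_left _ _)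
  obtain ⟨a, ha, hae⟩ := exists_isNiceFun h0.1 h0.2.1 hA0 (hA h0.2 (le_max_left _ _))
  obtain ⟨b, hb, hbe⟩ := exists_isNiceFun h1.1 h1.2.1 hA0 (hA h1.2 (le_max_right _ _))
  -- Provisional solution whose only purpose is the bound on the traces.
  have hs := key ha hb hae hbe
  obtain ⟨a', ha', hae'⟩ := exists_isNiceFun h0.1 h0.2.1 hB0 <| by
    filter_upwards [ae_torus_of_ae hae, ae_torus_of_ae (hs.abs_initial_le hu hT)] with x hx hb
    rwa [hx]
  obtain ⟨b', hb', hbe'⟩ := exists_isNiceFun h1.1 h1.2.1 hB0 <| by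
    filter_upwards [ae_torus_of_ae hbe, ae_torus_of_ae (hs.abs_final_le hu hT)] with x hx hb
    rwa [hx]
  exact ⟨ρ', a', b', key ha' hb' hae' hbe', he, hae', hbe'⟩

/-! ### Invariance under almost everywhere modifications -/

lemma mollify_congr_ae {F : Type*} [NormedAddCommGroup F] [NormedSpace ℝ F] {f g : Euc d → F}
    (h : f =ᵐ[volume] g) (k : Euc d → ℝ) : mollify f k = mollify g k :=
  convolution_congr _ Filter.EventuallyEq.rfl h

lemma ae_comp_sub_smul {F : Type*} {f g : Euc d → F} (h : f =ᵐ[volume] g) (x : Euc d) {δ : ℝ}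
    (hδ : δ ≠ 0) : ∀ᵐ y, f (x - δ • y) = g (x - δ • y) :=
  (Measure.quasiMeasurePreserving_smul volume hδ).ae (ae_comp_sub_left h x)

lemma integral_cell_congr {F : Type*} [NormedAddCommGroup F] [NormedSpace ℝ F]
    {f g : Euc d → F} (h : ∀ᵐ x, f x = g x) : ∫ x in cell d, f x = ∫ x in cell d, g x :=
  integral_congr_ae (ae_restrict_of_ae h)

section Congruence

variable {η : Euc d → ℝ} {Λ δ δ' ε T : ℝ} {M : Euc d → Matrix (Fin d) (Fin d) ℝ}

lemma negSobolevNorm_congr {f g : Euc d → ℝ} (h : f =ᵐ[volume] g) :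
    negSobolevNorm f = negSobolevNorm g := by
  have : ∀ ψ : Euc d → ℝ, ∫ x in cell d, f x * ψ x = ∫ x in cell d, g x * ψ x := fun ψ =>
    integral_cell_congr <| by filter_upwards [h] with x hx; rw [hx]
  simp only [negSobolevNorm, this]

lemma variationSet_congr {u u' : Euc d → Euc d} (h : u =ᵐ[volume] u') :
    variationSet u = variationSet u' := by
  have : ∀ Ψ : Euc d → Matrix (Fin d) (Fin d) ℝ,
      ∫ x in cell d, ∑ i, ∑ j, u x j * gradient (fun y => Ψ y i j) x i =
      ∫ x in cell d, ∑ i, ∑ j, u' x j * gradient (fun y => Ψ y i j) x i := fun Ψ =>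
    integral_cell_congr <| by filter_upwards [h] with x hx; rw [hx]
  simp only [variationSet, this]

lemma IsDivFree.congr {u u' : Euc d → Euc d} (hu : IsDivFree u) (h : u =ᵐ[volume] u') :
    IsDivFree u' := fun ψ hψ => by
  rw [← hu ψ hψ]
  exact integral_cell_congr <| by filter_upwards [h] with x hx; rw [hx]

lemma SpaceTimeEq.sqNormL2_mollifySpace {f g : Euc d → ℝ → ℝ} (h : SpaceTimeEq T f g)
    (hT : 0 ≤ T) (k κ : Euc d → ℝ) :
    sqNormL2 T (mollifySpace f k) = sqNormL2 T (mollifySpace g k) ∧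
    sqNormL2 T (mollifySpace (mollifySpace f k) κ) =
      sqNormL2 T (mollifySpace (mollifySpace g k) κ) :=
  ⟨h.integral_congr hT (F := fun _ a => ∫ x in cell d, mollify a k x ^ 2)
      fun t a b hab => by rw [mollify_congr_ae hab],
    h.integral_congr hT (F := fun _ a => ∫ x in cell d, mollify (fun y => mollify a k y) κ x ^ 2)
      fun t a b hab => by rw [mollify_congr_ae hab]⟩

lemma termI1_congr {ρ ρ' φ φ' : Euc d → ℝ} (hρ : ρ =ᵐ[volume] ρ') (hφ : φ =ᵐ[volume] φ') :
    termI1 η Λ δ ε M ρ φ = termI1 η Λ δ ε M ρ' φ' :=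
  integral_cell_congr <| by
    filter_upwards [hρ, hφ] with x hx hy
    simp only [hx, hy, mollify_congr_ae hφ]

lemma termI2_congr {ρ ρ' φ φ' : Euc d → ℝ} (hρ : ρ =ᵐ[volume] ρ') (hφ : φ =ᵐ[volume] φ') :
    termI2 η Λ δ ε M ρ φ = termI2 η Λ δ ε M ρ' φ' :=
  integral_cell_congr <| by
    filter_upwards [hρ] with x hx
    simp only [hx, mollify_congr_ae hφ]

lemma localisationTerm_congr {u u' : Euc d → Euc d} {ρ ρ' f f' : Euc d → ℝ → ℝ} (hT : 0 ≤ T)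
    (hu : u =ᵐ[volume] u') (hρ : SpaceTimeEq T ρ ρ') (hf : SpaceTimeEq T f f') :
    localisationTerm η Λ δ ε T M u ρ f = localisationTerm η Λ δ ε T M u' ρ' f' := by
  rw [localisationTerm, localisationTerm]
  refine congrArg _ (intervalIntegral_congr_ae_Icc hT ?_)
  filter_upwards [hρ, hf] with t ht hft
  refine integral_cell_congr ?_
  filter_upwards [ht, hu] with x hx hux
  simp only [hx, hux, mollifySpace, mollify_congr_ae hft]

lemma SpaceTimeEq.mollifySpace {f g : Euc d → ℝ → ℝ} (h : SpaceTimeEq T f g) (k : Euc d → ℝ) :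
    SpaceTimeEq T (mollifySpace f k) (mollifySpace g k) := by
  filter_upwards [h] with t ht
  simp only [_root_.mollifySpace, mollify_congr_ae ht]
  rfl

lemma SpaceTimeEq.sub {f g f' g' : Euc d → ℝ → ℝ} (h : SpaceTimeEq T f g)
    (h' : SpaceTimeEq T f' g') :
    SpaceTimeEq T (fun x t => f x t - f' x t) (fun x t => g x t - g' x t) := by
  filter_upwards [h, h'] with t ht ht'
  filter_upwards [ht, ht'] with x hx hx'
  rw [hx, hx']

/-- Here φ is evaluated at x - δh with h as integration variable; for δ ≠ 0 this affine map pulls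
null sets back to null sets. -/
lemma termI4_congr {v : Euc d → Euc d} {ρ ρ' φ φ' : Euc d → ℝ → ℝ} (hT : 0 ≤ T) (hδ : δ ≠ 0)
    (hρ : SpaceTimeEq T ρ ρ') (hφ : SpaceTimeEq T φ φ') :
    termI4 η Λ δ ε T M v ρ φ = termI4 η Λ δ ε T M v ρ' φ' := by
  refine intervalIntegral_congr_ae_Icc hT ?_
  filter_upwards [hρ, hφ] with t ht hft
  refine integral_cell_congr ?_
  filter_upwards [ht] with x hx
  refine integral_congr_ae (Filter.Eventually.of_forall fun z => integral_congr_ae ?_)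
  filter_upwards [ae_comp_sub_smul hft x hδ] with h hh
  rw [hx, hh]

lemma termI5_congr {v : Euc d → Euc d} {ρ ρ' φ φ' : Euc d → ℝ → ℝ} (hT : 0 ≤ T) (hδ : δ ≠ 0)
    (hρ : SpaceTimeEq T ρ ρ') (hφ : SpaceTimeEq T φ φ') :
    termI5 η Λ δ ε T M v ρ φ = termI5 η Λ δ ε T M v ρ' φ' := by
  refine intervalIntegral_congr_ae_Icc hT ?_
  filter_upwards [hρ, hφ] with t ht hft
  refine integral_cell_congr ?_
  filter_upwards [ht] with x hx
  refine integral_congr_ae (Filter.Eventually.of_forall fun z => integral_congr_ae ?_)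
  filter_upwards [ae_comp_sub_smul hft x hδ] with h hh
  rw [hx, hh]

lemma termR2_congr {w w' : Euc d → Euc d} {ρ ρ' φ φ' : Euc d → ℝ → ℝ} (hT : 0 ≤ T)
    (hw : w =ᵐ[volume] w') (hρ : SpaceTimeEq T ρ ρ') (hφ : SpaceTimeEq T φ φ') :
    termR2 η Λ δ ε T M w ρ φ = termR2 η Λ δ ε T M w' ρ' φ' := by
  refine intervalIntegral_congr_ae_Icc hT ?_
  filter_upwards [hρ, hφ] with t ht hft
  refine integral_cell_congr ?_
  filter_upwards [ht, hw] with x hx hwx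
  have hv : ∀ k : Euc d → ℝ, velocityCommutator (fun y => φ y t) w k x =
      velocityCommutator (fun y => φ' y t) w' k x := fun k => integral_congr_ae <| by
    filter_upwards [ae_comp_sub_left hft x, ae_comp_sub_left hw x] with h h1 h2
    rw [h1, h2, hwx]
  simp only [hx, hv]

end Congruence

end

/-! ### From representatives to the given data -/

theorem mainTheorem3 (d : ℕ) (hd : 2 ≤ d) (η : Euc d → ℝ) (hη : IsMollifier η) :
    ∃ C : ℝ, 0 < C ∧
    ∀ (T : ℝ) (u : Euc d → Euc d) (ρ φ : Euc d → ℝ → ℝ) (ρ₀ ρT φ₀ φT : Euc d → ℝ),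
      0 < T → IsBV u → IsDivFree u →
      IsWeakSolution u T ρ ρ₀ ρT →
      φT ∈ unitBallW1Inf d →
      IsWeakSolution u T φ φ₀ φT →
      supNormSpaceTime T φ ≤ supNormTorus φT →
    ∀ Λ δ δ' ε ε' : ℝ, 0 < Λ → 0 < δ → 0 < δ' → 0 < ε → 0 < ε' → δ ≤ ε * Real.exp (-Λ) →
    ∀ (v : Euc d → Euc d) (M : Euc d → Matrix (Fin d) (Fin d) ℝ),
      v = mollify u (rescale η ε') →
      M = unitGradient (mollify v (rescale η (4 * ε))) →
    ∀ I₁ I₂ I₃' I₄' I₅' R₁ R₂ : ℝ,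
      I₁ = termI1 η Λ δ ε M ρT φT →
      I₂ = termI2 η Λ δ ε M ρ₀ φ₀ →
      I₃' = termI3 η Λ δ δ' ε T M u ρ φ →
      I₄' = termI4 η Λ δ ε T M v ρ φ →
      I₅' = termI5 η Λ δ ε T M v ρ φ →
      R₁ = termR1 η Λ δ δ' ε T M u ρ φ →
      R₂ = termR2 η Λ δ ε T M (fun x => u x - v x) ρ φ →
      (∫ x in cell d, ρT x * φT x) = I₁ + I₂ + I₃' + I₄' + I₅' + R₁ + R₂ ∧
      |I₁| ≤ C * (δ * Real.exp ((d + 1) * Λ) * supNormSpaceTime T ρ) ∧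
      |I₂| ≤ C * ((1 + Real.exp Λ / δ + 1 / ε) * negSobolevNorm ρ₀) ∧
      |I₃'| ≤ C * (T ^ (((d : ℝ) - 1) / d) * (Real.exp (d * Λ) / ε) * supNormSpaceTime T ρ
        * (totalVariation u + ‖∫ x in cell d, u x‖)
        * (sqNormL2 T (mollifySpace φ (rescale η δ'))
            - sqNormL2 T (mollifySpace (mollifySpace φ (rescale η δ'))
                (rescale η (2 * δ * Real.exp Λ)))) ^ (1 / (d : ℝ))) ∧
      |I₄'| ≤ C * (T * Real.exp (2 * Λ) * supNormSpaceTime T ρ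
        * totalVariation u ^ (1 / 2 : ℝ)
        * (gradNormL1 v - gradNormL1 (mollify v (rescale η (4 * ε)))) ^ (1 / 2 : ℝ)) ∧
      |I₅'| ≤ C * (T / Λ * supNormSpaceTime T ρ * totalVariation u) ∧
      |R₁| ≤ C * (T * (δ' * Real.exp ((d + 1) * Λ) / (ε * δ)) * supNormSpaceTime T ρ
        * (totalVariation u + ‖∫ x in cell d, u x‖)) ∧
      |R₂| ≤ C * (T * (ε' * Real.exp ((d + 1) * Λ) / δ) * supNormSpaceTime T ρ
        * totalVariation u) := by
  obtain ⟨C, hC, hmain⟩ := IsNiceSolution.exists_bounds hd hη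
  refine ⟨C, hC, ?_⟩
  intro T u ρ φ ρ₀ ρT φ₀ φT hT hu hdiv hρ hφT hφ hsup Λ δ δ' ε ε' hΛ hδ hδ' hε hε' hδε v M hv hM
    I₁ I₂ I₃' I₄' I₅' R₁ R₂ e₁ e₂ e₃ e₄ e₅ f₁ f₂
  obtain ⟨hup, hui, hub⟩ := hu
  obtain ⟨-, g, hg, hgw, hn⟩ := hφT
  -- The unit ball condition bounds ‖φT‖ + ‖∇φT‖, so each of the two is at most 1, and φ is bounded
  -- by ‖φT‖.
  have hφ1 : supNormSpaceTime T φ ≤ 1 := by linarith [supNormTorus_nonneg g]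
  have hg1 : ∀ᵐ x ∂torusMeasure d, ‖g x‖ ≤ 1 := by
    filter_upwards [ae_abs_le_supNormTorus hg] with x hx
    linarith [supNormTorus_nonneg φT]
  obtain ⟨u', hu', huu⟩ := exists_isNiceField hup hui
  obtain ⟨ρ', ρ₀', ρT', hρ', eρ, eρ₀, eρT⟩ := exists_isNiceSolution hρ hu' huu hT le_rfl
  obtain ⟨φ', φ₀', φT', hφ', eφ, eφ₀, eφT⟩ := exists_isNiceSolution hφ hu' huu hT hφ1
  have hgw' : HasWeakGradient φT' g := fun ψ hψ i => by
    rw [← hgw ψ hψ i]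
    exact integral_cell_congr <| by filter_upwards [eφT] with x hx; rw [hx]
  have hvar := variationSet_congr huu
  have hT0 := hT.le
  have eR := eφ.sub (eφ.mollifySpace (rescale η δ'))
  have ew : (fun x => u x - v x) =ᵐ[volume] fun x => u' x - v x := by
    filter_upwards [huu] with x hx
    rw [hx]
  have eTV : totalVariation u = totalVariation u' := by rw [totalVariation, hvar, totalVariation]
  have ep : ∫ x in cell d, ρT x * φT x = ∫ x in cell d, ρT' x * φT' x :=
    integral_cell_congr <| by filter_upwards [eρT, eφT] with x hx hy; rw [hx, hy]
  have eu : ∫ x in cell d, u x = ∫ x in cell d, u' x := integral_cell_congr huu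
  have eS := eφ.sqNormL2_mollifySpace hT0 (rescale η δ') (rescale η (2 * δ * Real.exp Λ))
  rw [termI1_congr eρT eφT] at e₁
  rw [termI2_congr eρ₀ eφ₀] at e₂
  rw [termI3, localisationTerm_congr hT0 huu eρ (eφ.mollifySpace _), ← termI3] at e₃
  rw [termI4_congr hT0 hδ.ne' eρ eφ] at e₄
  rw [termI5_congr hT0 hδ.ne' eρ eφ] at e₅
  rw [termR1, localisationTerm_congr hT0 huu eρ eR, ← termR1] at f₁
  rw [termR2_congr hT0 ew eρ eφ] at f₂
  -- Mollification sees only the class of u, so v and M are the same fields for the representative.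
  rw [mollify_congr_ae huu] at hv
  rw [eTV, ep, eu, eS.1, eS.2, negSobolevNorm_congr eρ₀, e₁, e₂, e₃, e₄, e₅, f₁, f₂]
  exact hmain T _ u' ρ' φ' ρ₀' ρT' φ₀' φT' g hT hu' (hvar ▸ hub) (hdiv.congr huu) hρ' hφ' hgw'
    (hg.integrable le_top) hg1 Λ δ δ' ε ε' hΛ hδ hδ' hε hε' hδε v M hv hM
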